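/- Let $n\ge 1$ and $m\ge 1$ be integers. Put $A(u)=\prod_{i<j}(u_i-u_j)$, $B(x)=\prod_{i<j}\sinh(x_i-x_j)$ and $C_m(\nu)=\prod_{k=1}^m\prod_{i<j}(\nu_i-\nu_j-k)$ for $u,x,\nu\in\mathbb C^n$, and let $$\mathcal L_m=-\sum_{i=1}^n\frac{\partial^2}{\partial x_i^2}+\sum_{i<j}\frac{2m(m+1)}{\sinh^2(x_i-x_j)} .$$ There is exactly one function $P(x,\nu)$, trigonometric polynomial in $x$ (a finite sum $\sum_{\mu\in\mathbb Z^n}c_\mu(\nu)e^{(\mu,x)}$) and polynomial in $\nu$ with leading term (homogeneous part of top degree $m\,n(n-1)/2$ in $\nu$) $B(x)^mA(\nu)^m$, such that $$\Phi^{(n)}_m(x,\nu)=\frac{P(x,\nu)}{B(x)^mC_m(\nu)}\,e^{2(\nu,x)}$$ satisfies $\mathcal L_m\Phi^{(n)}_m=-4(\nu,\nu)\Phi^{(n)}_m$. This $\Phi^{(n)}_m$ is the trigonometric Baker--Akhiezer function. Write $u_i=e^{2x_i}$ and $u_i^{a}=e^{2ax_i}$. Assume that $u_1,\dots,u_n$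 have distinct arguments and that $\operatorname{Re}(\nu_j-\nu_{j+1})>m$ for $1\le j\le n-1$. Introduce variables $t_{i,j}$, $1\le i\le j\le n-1$, set $t_{i,n}=u_i$, and put $$A_{j,j+1}=\prod_{\substack{i\le j,\ l\le j+1\\ i\le l}}(t_{i,j}-t_{l,j+1})\prod_{\substack{i\le j,\ l\le j+1\\ i>l}}(t_{l,j+1}-t_{i,j}),\qquad A_{j,j}=\prod_{1\le i<l\le j}(t_{i,j}-t_{l,j}),$$ $$\omega^*_{\kappa}=\prod_{j=1}^{n-1}A_{j,j+1}^{-\kappa-1}\prod_{j=1}^{n-1}A_{j,j}^{2+2\kappa}\prod_{1\le i\le j\le n-1}t_{i,j}^{\nu_j-\nu_{j+1}+\kappa}\,dt_{i,j},\qquad \alpha^*_m=\omega^*_{-m-1}.$$ Let $\Gamma^*$ be the contour $t_{i,j}=\tau_{i,j}t_{i,j+1}$, $\tau_{i,j}\in[0,1]$, oriented by the parameters $\tau_{i,j}$, the powers $t_{i,j}^a$ being $u_i^a$ times the power $a$ of the nonnegative real number $t_{i,j}/u_i=\tau_{i,j}\tau_{i,j+1}\cdots\tau_{i,n-1}$.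 Then $\int_{\Gamma^*}\alpha^*_m$ converges absolutely and $$\Phi^{(n)}_m=C_4^{-1}\prod_{i=1}^n u_i^{\nu_n}\;A(u)^{-m}\int_{\Gamma^*}\alpha^*_m,\qquad C_4=(-1)^{m\frac{n(n-1)}2}\prod_{i<j}\frac{\Gamma(m+1)\,\Gamma(\nu_i-\nu_j)}{\Gamma(\nu_i-\nu_j+m+1)}.$$ -/

import Mathlib

open MeasureTheory

noncomputable section

namespace TrigBA

/-! ### The trigonometric Baker-Akhiezer function of type `A_{N-1}` -/

/-- `A(u) = ∏_{i<j} (u_i - u_j)`. -/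
def vand {N : ℕ} (u : Fin N → ℂ) : ℂ :=
  ∏ i, ∏ j ∈ Finset.Ioi i, (u i - u j)

/-- `B(x) = ∏_{i<j} sinh (x_i - x_j)`. -/
def sinhVand {N : ℕ} (x : Fin N → ℂ) : ℂ :=
  ∏ i, ∏ j ∈ Finset.Ioi i, Complex.sinh (x i - x j)

/-- `C_m(ν) = ∏_{k=1}^m ∏_{i<j} (ν_i - ν_j - k)`. -/
def normC {N : ℕ} (m : ℕ) (ν : Fin N → ℂ) : ℂ :=
  ∏ k ∈ Finset.Icc 1 m, ∏ i, ∏ j ∈ Finset.Ioi i, (ν i - ν j - (k : ℂ))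

/-- Functions `P(x, ν)` that are trigonometric polynomials in `x` and ordinary polynomials in `ν`:
finite sums `∑_μ c_μ(ν) e^{μ_1 x_1 + ⋯ + μ_N x_N}` with `μ ∈ ℤ^N` and `c_μ ∈ ℂ[ν_1, …, ν_N]`. -/
abbrev TrigPoly (N : ℕ) : Type := (Fin N → ℤ) →₀ MvPolynomial (Fin N) ℂ

/-- The value `P(x, ν)`. -/
def TrigPoly.eval {N : ℕ} (P : TrigPoly N) (x ν : Fin N → ℂ) : ℂ :=
  P.sum fun μ c => MvPolynomial.eval ν c * Complex.exp (∑ i, (μ i : ℂ) * x i)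

/-- The value at `(x, ν)` of the homogeneous component of degree `d` in `ν` of `P`. -/
def TrigPoly.evalHomog {N : ℕ} (d : ℕ) (P : TrigPoly N) (x ν : Fin N → ℂ) : ℂ :=
  P.sum fun μ c => MvPolynomial.eval ν (MvPolynomial.homogeneousComponent d c) *
    Complex.exp (∑ i, (μ i : ℂ) * x i)

/-- The function `P(x, ν) / (B(x)^m C_m(ν)) · exp (2 (ν, x))` attached to `P`. -/
def baFun {N : ℕ} (m : ℕ) (P : TrigPoly N) (x ν : Fin N → ℂ) : ℂ :=
  P.eval x ν / (sinhVand x ^ m * normC m ν) * Complex.exp (2 * ∑ i, ν i * x i)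

/-- The Sutherland operator `-Δ + ∑_{i<j} 2m(m+1)/sinh²(x_i - x_j)`, where `Δ = ∑_i ∂²/∂x_i²`
is formed with the complex partial derivatives. -/
def sutherland {N : ℕ} (m : ℕ) (f : (Fin N → ℂ) → ℂ) (x : Fin N → ℂ) : ℂ :=
  -(∑ i, iteratedDeriv 2 (fun s : ℂ => f (Function.update x i s)) (x i)) +
    (∑ i, ∑ j ∈ Finset.Ioi i,
      2 * (m : ℂ) * ((m : ℂ) + 1) / Complex.sinh (x i - x j) ^ 2) * f x

/-- `P` is the numerator of the trigonometric Baker-Akhiezer function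
`Φ = P / (B^m C_m) · exp 2(ν, x)` with `N` particles and multiplicity `m`: the leading term of `P`
with respect to `ν` is `B(x)^m A(ν)^m`, and `Φ` satisfies the Schrödinger equation
`L Φ = -4 (ν, ν) Φ` for the Sutherland operator `L`, wherever `Φ` is defined. -/
structure IsBANumerator {N : ℕ} (m : ℕ) (P : TrigPoly N) : Prop where
  degree_le : ∀ μ, (P μ).totalDegree ≤ m * (N * (N - 1) / 2)
  leading : ∀ x ν : Fin N → ℂ,
    P.evalHomog (m * (N * (N - 1) / 2)) x ν = sinhVand x ^ m * vand ν ^ m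
  eigen : ∀ x ν : Fin N → ℂ, sinhVand x ≠ 0 → normC m ν ≠ 0 →
    sutherland m (fun y => baFun m P y ν) x = -4 * (∑ i, ν i * ν i) * baFun m P x ν

/-! ### The Selberg-type integral

There are `n + 1` particles. Particles `i` and levels `j` are numbered from `0` by `Fin (n + 1)`;
the points on level `j` are `t_{i,j}` with `i ≤ j`, and those on the last level are
`t_{i,n} = u_i = e^{2 x_i}`. The integration variables are `t_{i,j}` with `i ≤ j < n`.
Complex powers are formed along the contour, with the branch on the last level given by
`u_i^a = e^{2 a x_i}`; for this purpose the points are described by logarithms,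
`t_{i,j} = exp s_{i,j}`, `t_{i,j}^a = exp (a s_{i,j})`. -/

/-- Indices `(i, j)` of the integration variables: `0 ≤ i ≤ j ≤ n - 1`. -/
abbrev VarIdx (n : ℕ) : Type := {p : Fin (n + 1) × Fin n // p.1 ≤ p.2.castSucc}

/-- `A_{j,j+1}(t) = ∏_{i ≤ j, l ≤ j+1, i ≤ l} (t_{i,j} - t_{l,j+1}) ·
∏_{i ≤ j, l ≤ j+1, i > l} (t_{l,j+1} - t_{i,j})`. -/
def crossA {n : ℕ} (t : Fin (n + 1) → Fin (n + 1) → ℂ) (j : Fin n) : ℂ :=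
  ∏ i ∈ Finset.Iic j.castSucc, ∏ l ∈ Finset.Iic j.succ,
    if i ≤ l then t i j.castSucc - t l j.succ else t l j.succ - t i j.castSucc

/-- `A_{j,j}(t) = ∏_{i < l ≤ j} (t_{i,j} - t_{l,j})`, for a level `j` of integration variables. -/
def levelA {n : ℕ} (t : Fin (n + 1) → Fin (n + 1) → ℂ) (j : Fin n) : ℂ :=
  ∏ l ∈ Finset.Iic j.castSucc, ∏ i ∈ Finset.Iio l, (t i j.castSucc - t l j.castSucc)

/-- The coefficient of `∏ dt_{i,j}` in the form
`ω*_κ = ∏_j A_{j,j+1}^{-κ-1} ∏_j A_{j,j}^{2+2κ} ∏_{i≤j} t_{i,j}^{ν_j - ν_{j+1} + κ} dt_{i,j}`,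
for an integer `κ`, as a function of the logarithms `s` of the points `t`. -/
def omegaStar {n : ℕ} (κ : ℤ) (ν : Fin (n + 1) → ℂ) (s : Fin (n + 1) → Fin (n + 1) → ℂ) : ℂ :=
  (∏ j : Fin n, crossA (fun i l => Complex.exp (s i l)) j ^ (-κ - 1)) *
  (∏ j : Fin n, levelA (fun i l => Complex.exp (s i l)) j ^ (2 + 2 * κ)) *
  ∏ p : VarIdx n,
    Complex.exp ((ν p.1.2.castSucc - ν p.1.2.succ + (κ : ℂ)) * s p.1.1 p.1.2.castSucc)

/-- `α*_m = ω*_{-m-1}` (its coefficient of `∏ dt_{i,j}`). -/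
def alphaStar {n : ℕ} (m : ℕ) (ν : Fin (n + 1) → ℂ) (s : Fin (n + 1) → Fin (n + 1) → ℂ) : ℂ :=
  omegaStar (-(m : ℤ) - 1) ν s

/-- The logarithms of the points of the contour `Γ*`:
`s_{i,j} = 2 x_i + ∑_{l = j}^{n-1} log τ_{i,l}`. That `t = exp s` is the contour
`t_{i,j} = τ_{i,j} t_{i,j+1}`, `t_{i,n} = e^{2 x_i}` is shown in the two lemmas that follow. -/
def contourLog {n : ℕ} (x : Fin (n + 1) → ℂ) (τ : VarIdx n → ℝ) (i j : Fin (n + 1)) : ℂ :=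
  2 * x i + ((∑ p : VarIdx n with p.1.1 = i ∧ j ≤ p.1.2.castSucc, Real.log (τ p) : ℝ) : ℂ)

theorem exp_contourLog_last {n : ℕ} (x : Fin (n + 1) → ℂ) (τ : VarIdx n → ℝ) (i : Fin (n + 1)) :
    Complex.exp (contourLog x τ i (Fin.last n)) = Complex.exp (2 * x i) := by
  simp [contourLog]

theorem exp_contourLog_castSucc {n : ℕ} (x : Fin (n + 1) → ℂ) (τ : VarIdx n → ℝ) (p : VarIdx n)
    (hp : 0 < τ p) :
    Complex.exp (contourLog x τ p.1.1 p.1.2.castSucc) =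
      (τ p : ℂ) * Complex.exp (contourLog x τ p.1.1 p.1.2.succ) := by
  have h : (Finset.univ.filter fun q : VarIdx n => q.1.1 = p.1.1 ∧ p.1.2.castSucc ≤ q.1.2.castSucc)
      = insert p (Finset.univ.filter fun q : VarIdx n =>
          q.1.1 = p.1.1 ∧ p.1.2.succ ≤ q.1.2.castSucc) := by
    ext q
    simp only [Finset.mem_filter, Finset.mem_univ, true_and, Finset.mem_insert, Subtype.ext_iff,
      Prod.ext_iff, Fin.le_def, Fin.ext_iff, Fin.val_castSucc, Fin.val_succ]
    omega
  have hn : p ∉ (Finset.univ.filter fun q : VarIdx n =>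
      q.1.1 = p.1.1 ∧ p.1.2.succ ≤ q.1.2.castSucc) := by
    simp [Fin.le_def]
  have e : Complex.exp ((Real.log (τ p) : ℝ) : ℂ) = (τ p : ℂ) := by
    rw [← Complex.ofReal_exp, Real.exp_log hp]
  unfold contourLog
  rw [h, Finset.sum_insert hn, Complex.ofReal_add, add_left_comm, Complex.exp_add, e]

/-- The parameter cube. The faces `τ_{i,j} = 0`, where the complex powers are not defined, are
left out; they have measure zero. -/
def cube (n : ℕ) : Set (VarIdx n → ℝ) := {τ | ∀ p, τ p ∈ Set.Ioc (0 : ℝ) 1}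

/-- The form `α*_m` pulled back to the parameters `τ` of `Γ*` (its coefficient of `∏ dτ_{i,j}`).
Since `t_{i,j} = τ_{i,j} t_{i,j+1}` and `t_{i,j+1}` depends only on the `τ_{i,l}` with `l > j`,
the Jacobian matrix `∂t/∂τ` is triangular with diagonal entries `t_{i,j+1}`. -/
def alphaStarPullback {n : ℕ} (m : ℕ) (x ν : Fin (n + 1) → ℂ) (τ : VarIdx n → ℝ) : ℂ :=
  alphaStar m ν (contourLog x τ) *
    ∏ p : VarIdx n, Complex.exp (contourLog x τ p.1.1 p.1.2.succ)

/-- `C_4 = (-1)^{m N(N-1)/2} ∏_{i<j} Γ(m+1) Γ(ν_i-ν_j) / Γ(ν_i-ν_j+m+1)`. -/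
def constC4 {N : ℕ} (m : ℕ) (ν : Fin N → ℂ) : ℂ :=
  (-1) ^ (m * (N * (N - 1) / 2)) *
    ∏ i, ∏ j ∈ Finset.Ioi i,
      Complex.Gamma ((m : ℂ) + 1) * Complex.Gamma (ν i - ν j) /
        Complex.Gamma (ν i - ν j + (m : ℂ) + 1)

end TrigBA

end

noncomputable section
set_option linter.unusedSectionVars false

namespace TrigBA

/-- Laurent polynomials with exponents in `σ → ℤ`. -/
abbrev LP (σ : Type) : Type := AddMonoidAlgebra ℂ (σ → ℤ)

namespace LP
variable {σ : Type} [Fintype σ]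

/-- The linear form `μ ↦ (μ, x)`. -/
def pair (x : σ → ℂ) : (σ → ℤ) →+ ℂ where
  toFun μ := ∑ i, (μ i : ℂ) * x i
  map_zero' := by simp
  map_add' a b := by simp [add_mul, Finset.sum_add_distrib]

theorem pair_apply (x : σ → ℂ) (μ : σ → ℤ) : pair x μ = ∑ i, (μ i : ℂ) * x i := rfl

theorem pair_add_smul (x v : σ → ℂ) (s : ℂ) (μ : σ → ℤ) :
    pair (x + s • v) μ = pair x μ + s * pair v μ := by
  simp only [pair_apply, Pi.add_apply, Pi.smul_apply, smul_eq_mul, mul_add, Finset.mul_sum,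
    Finset.sum_add_distrib]
  congr 1
  exact Finset.sum_congr rfl fun i _ => by ring

/-- The character `μ ↦ e^{(μ, x)}`. -/
def char (x : σ → ℂ) : Multiplicative (σ → ℤ) →* ℂ where
  toFun μ := Complex.exp (pair x μ.toAdd)
  map_one' := by simp
  map_mul' a b := by rw [← Complex.exp_add, toAdd_mul, map_add]

/-- The value of a Laurent polynomial in `e^{x_i}`. -/
def ev (x : σ → ℂ) : LP σ →ₐ[ℂ] ℂ := AddMonoidAlgebra.lift ℂ ℂ (σ → ℤ) (char x)

@[simp] theorem ev_single (x : σ → ℂ) (μ : σ → ℤ) (c : ℂ) :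
    ev x (AddMonoidAlgebra.single μ c) = c * Complex.exp (pair x μ) := by
  simp [ev, char]

theorem ev_eq_sum (x : σ → ℂ) (D : LP σ) :
    ev x D = ∑ μ ∈ D.coeff.support, D.coeff μ * Complex.exp (pair x μ) := by
  simp [ev, AddMonoidAlgebra.lift_apply, char, Finsupp.sum]

/-- Multiplication of the coefficient at `μ` by `w μ`. -/
def diag (w : (σ → ℤ) → ℂ) : LP σ →ₗ[ℂ] LP σ where
  toFun D := .ofCoeff (
    Finsupp.onFinset D.coeff.support (fun μ => w μ * D.coeff μ)
      (fun μ h => Finsupp.mem_support_iff.2 (right_ne_zero_of_mul h)))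
  map_add' a b := by ext; simp [mul_add]
  map_smul' a b := by ext; simp [mul_left_comm]

@[simp] theorem coeff_diag (w : (σ → ℤ) → ℂ) (D : LP σ) (μ : σ → ℤ) :
    (diag w D).coeff μ = w μ * D.coeff μ := rfl

@[simp] theorem diag_single (w : (σ → ℤ) → ℂ) (μ : σ → ℤ) (c : ℂ) :
    diag w (AddMonoidAlgebra.single μ c) = AddMonoidAlgebra.single μ (w μ * c) := by
  classical
  ext κ
  simp only [coeff_diag, AddMonoidAlgebra.coeff_single, Finsupp.single_apply]
  split_ifs with h
  · rw [h]
  · simp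

theorem diag_mul_of_add (w : (σ → ℤ) →+ ℂ) (D E : LP σ) :
    diag w (D * E) = D * diag w E + E * diag w D := by
  induction D using AddMonoidAlgebra.induction_linear with
  | zero => simp
  | add a b ha hb => simp only [add_mul, map_add, ha, hb, mul_add]; ring
  | single μ c =>
    induction E using AddMonoidAlgebra.induction_linear with
    | zero => simp
    | add a b ha hb => simp only [add_mul, map_add, ha, hb, mul_add]; ring
    | single κ d =>
      simp only [AddMonoidAlgebra.single_mul_single, diag_single, map_add]
      rw [add_comm κ μ, ← AddMonoidAlgebra.single_add]
      congr 1; ring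

/-- The derivative in the direction `v`. -/
def der (v : σ → ℂ) : Derivation ℂ (LP σ) (LP σ) :=
  Derivation.mk' (diag (pair v)) fun a b => by
    simp [diag_mul_of_add]

@[simp] theorem coeff_der (v : σ → ℂ) (D : LP σ) (μ : σ → ℤ) :
    (der v D).coeff μ = pair v μ * D.coeff μ := rfl

@[simp] theorem der_single (v : σ → ℂ) (μ : σ → ℤ) (c : ℂ) :
    der v (AddMonoidAlgebra.single μ c) = AddMonoidAlgebra.single μ (pair v μ * c) :=
  diag_single _ _ _

theorem hasLineDerivAt_ev (v w : σ → ℂ) (D : LP σ) :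
    HasLineDerivAt ℂ (fun y => ev y D) (ev w (der v D)) w v := by
  unfold HasLineDerivAt
  induction D using AddMonoidAlgebra.induction_linear with
  | zero => simpa using hasDerivAt_const (0 : ℂ) (0 : ℂ)
  | add a b ha hb => simpa using ha.fun_add hb
  | single μ c =>
    simp only [ev_single, pair_add_smul, der_single]
    have h : HasDerivAt (fun s : ℂ => pair w μ + s * pair v μ) (pair v μ) 0 := by
      simpa using ((hasDerivAt_id (0 : ℂ)).mul_const (pair v μ)).const_add (pair w μ)
    have := (h.cexp).const_mul c
    simp only [zero_mul, add_zero] at this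
    exact this.congr_deriv (by ac_rfl)

theorem continuous_ev (D : LP σ) : Continuous fun y => ev y D := by
  induction D using AddMonoidAlgebra.induction_linear with
  | zero => simpa using continuous_const
  | add a b ha hb => simpa using ha.fun_add hb
  | single μ c =>
    simp only [ev_single, pair_apply]
    fun_prop

/-- The function `e^{(lam, w)} D(w) / Q(w)^M`. -/
def cl (Q : LP σ) (lam : σ → ℂ) (D : LP σ) (M : ℕ) (w : σ → ℂ) : ℂ :=
  Complex.exp (∑ a, lam a * w a) * ev w D / ev w Q ^ M

/-- The numerator of the derivative of `cl Q lam D M` in the direction `v`. -/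
def qder (Q : LP σ) (lam v : σ → ℂ) (M : ℕ) (D : LP σ) : LP σ :=
  Q * (der v D + (∑ a, lam a * v a) • D) - M * (der v Q * D)

theorem hasLineDerivAt_cl (Q : LP σ) (lam : σ → ℂ) (D : LP σ) (M : ℕ) (v w : σ → ℂ)
    (hw : ev w Q ≠ 0) :
    HasLineDerivAt ℂ (cl Q lam D M) (cl Q lam (qder Q lam v M D) (M + 1) w) w v := by
  unfold HasLineDerivAt cl
  have h1 : HasDerivAt (fun s : ℂ => ∑ a, lam a * (w + s • v) a) (∑ a, lam a * v a) 0 := by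
    refine HasDerivAt.fun_sum fun a _ => ?_
    simpa using (((hasDerivAt_id (0 : ℂ)).mul_const (v a)).const_add (w a)).const_mul (lam a)
  have hD : HasDerivAt (fun s : ℂ => ev (w + s • v) D) (ev w (der v D)) 0 :=
    hasLineDerivAt_ev v w D
  have hQ : HasDerivAt (fun s : ℂ => ev (w + s • v) Q) (ev w (der v Q)) 0 :=
    hasLineDerivAt_ev v w Q
  have := (h1.cexp.mul hD).div (hQ.pow M) (by simpa using pow_ne_zero M hw)
  refine this.congr_deriv ?_
  simp only [zero_smul, add_zero, qder, map_sub, map_mul, map_add, map_smul, map_natCast,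
    smul_eq_mul, Pi.mul_apply, Pi.pow_apply]
  rcases M with _ | M
  · simp; ring_nf
    field_simp
  · simp only [Nat.add_sub_cancel]
    field_simp
    ring

theorem cl_add (Q : LP σ) (lam : σ → ℂ) (D E : LP σ) (M : ℕ) (w : σ → ℂ) :
    cl Q lam (D + E) M w = cl Q lam D M w + cl Q lam E M w := by
  simp [cl]; ring

theorem cl_smul (Q : LP σ) (lam : σ → ℂ) (c : ℂ) (D : LP σ) (M : ℕ) (w : σ → ℂ) :
    cl Q lam (c • D) M w = c * cl Q lam D M w := by
  simp [cl]; ring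

theorem cl_mul_pow (Q : LP σ) (lam : σ → ℂ) (D : LP σ) (M r : ℕ) (w : σ → ℂ) (hw : ev w Q ≠ 0) :
    cl Q lam (Q ^ r * D) (M + r) w = cl Q lam D M w := by
  simp only [cl, map_mul, map_pow, pow_add]
  field_simp

theorem isOpen_ev_ne (Q : LP σ) : IsOpen {w : σ → ℂ | ev w Q ≠ 0} :=
  isOpen_ne_fun (continuous_ev Q) continuous_const

/-- A Laurent polynomial is determined by its values on any real translate. -/
theorem eq_zero_of_ev (x : σ → ℂ) (D : LP σ) (h : ∀ r : σ → ℝ, ev (x + fun i => (r i : ℂ)) D = 0) :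
    D = 0 := by
  classical
  let φ : (σ → ℤ) → (Multiplicative (σ → ℝ) →* ℂ) := fun μ =>
    { toFun := fun r => Complex.exp (∑ i, (μ i : ℂ) * (r.toAdd i : ℂ))
      map_one' := by simp
      map_mul' := fun a b => by
        rw [← Complex.exp_add, ← Finset.sum_add_distrib]
        congr 1
        exact Finset.sum_congr rfl fun i _ => by simp [mul_add] }
  have hφ : Function.Injective φ := by
    intro μ κ hμκ
    funext i
    have h1 := DFunLike.congr_fun hμκ (Multiplicative.ofAdd (Pi.single i 1))
    have h2 : ∀ μ : σ → ℤ, φ μ (Multiplicative.ofAdd (Pi.single i 1)) = Complex.exp (μ i : ℂ) := by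
      intro μ
      change Complex.exp (∑ j, (μ j : ℂ) * ((Pi.single i (1 : ℝ) : σ → ℝ) j : ℂ)) = _
      congr 1
      rw [Finset.sum_eq_single i] <;> simp +contextual
    rw [h2, h2] at h1
    have h3 : (Real.exp (μ i) : ℂ) = (Real.exp (κ i) : ℂ) := by push_cast; exact h1
    exact_mod_cast Real.exp_injective (Complex.ofReal_injective h3)
  have hli := (linearIndependent_monoidHom (Multiplicative (σ → ℝ)) ℂ).comp φ hφ
  rw [linearIndependent_iff'] at hli
  have key := hli D.coeff.support (fun μ => D.coeff μ * Complex.exp (pair x μ)) (by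
    funext r
    have := h r.toAdd
    rw [ev_eq_sum] at this
    simp only [Finset.sum_apply, Pi.smul_apply, Pi.zero_apply, smul_eq_mul, Function.comp]
    rw [← this]
    refine Finset.sum_congr rfl fun μ _ => ?_
    rw [mul_assoc]
    congr 1
    have : pair (x + fun i => (r.toAdd i : ℂ)) μ = pair x μ + ∑ i, (μ i : ℂ) * (r.toAdd i : ℂ) := by
      simp [pair_apply, mul_add, Finset.sum_add_distrib]
    rw [this, Complex.exp_add]
    rfl)
  ext μ
  by_cases hμ : μ ∈ D.coeff.support
  · simpa using (mul_eq_zero.1 (key μ hμ)).resolve_right (Complex.exp_ne_zero _)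
  · simpa using hμ

/-- All exponents of `D` are at most `R` in absolute value. -/
def SuppLe (R : ℕ) (D : LP σ) : Prop := ∀ μ, D.coeff μ ≠ 0 → ∀ i, |μ i| ≤ R

theorem SuppLe.mono {R R' : ℕ} {D : LP σ} (h : SuppLe R D) (hR : R ≤ R') : SuppLe R' D :=
  fun μ hμ i => (h μ hμ i).trans (by exact_mod_cast hR)

theorem SuppLe.add {R : ℕ} {D E : LP σ} (h : SuppLe R D) (h' : SuppLe R E) : SuppLe R (D + E) := by
  intro μ hμ
  by_cases h0 : D.coeff μ = 0
  · exact h' μ (by simpa [h0] using hμ)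
  · exact h μ h0

theorem SuppLe.smul {R : ℕ} {D : LP σ} (h : SuppLe R D) (c : ℂ) : SuppLe R (c • D) :=
  fun μ hμ => h μ fun h0 => hμ (by simp [h0])

theorem SuppLe.sub {R : ℕ} {D E : LP σ} (h : SuppLe R D) (h' : SuppLe R E) : SuppLe R (D - E) := by
  have := h.add (h'.smul (-1))
  rwa [neg_one_smul, ← sub_eq_add_neg] at this

theorem SuppLe.der {R : ℕ} {D : LP σ} (h : SuppLe R D) (v : σ → ℂ) : SuppLe R (der v D) :=
  fun μ hμ => h μ fun h0 => hμ (by simp [h0])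

theorem exists_of_coeff_mul_ne {D E : LP σ} {μ : σ → ℤ} (h : (D * E).coeff μ ≠ 0) :
    ∃ κ η, D.coeff κ ≠ 0 ∧ E.coeff η ≠ 0 ∧ κ + η = μ := by
  classical
  have := AddMonoidAlgebra.support_coeff_mul_subset D E (Finsupp.mem_support_iff.2 h)
  obtain ⟨κ, hκ, η, hη, e⟩ := Finset.mem_add.1 this
  exact ⟨κ, η, Finsupp.mem_support_iff.1 hκ, Finsupp.mem_support_iff.1 hη, e⟩

theorem SuppLe.mul {R R' : ℕ} {D E : LP σ} (h : SuppLe R D) (h' : SuppLe R' E) :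
    SuppLe (R + R') (D * E) := by
  intro μ hμ i
  obtain ⟨κ, η, hκ, hη, rfl⟩ := exists_of_coeff_mul_ne hμ
  push_cast
  exact (abs_add_le _ _).trans (add_le_add (h κ hκ i) (h' η hη i))

theorem suppLe_one : SuppLe 0 (1 : LP σ) := by
  intro μ hμ i
  rw [AddMonoidAlgebra.one_def] at hμ
  have : μ = 0 := by
    by_contra hne
    exact hμ (by simp [AddMonoidAlgebra.coeff_single, Ne.symm hne])
  simp [this]

theorem SuppLe.nsmul {R : ℕ} {D : LP σ} (h : SuppLe R D) (n : ℕ) : SuppLe R ((n : LP σ) * D) := by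
  have : (n : LP σ) * D = (n : ℂ) • D := by
    rw [← nsmul_eq_mul, Nat.cast_smul_eq_nsmul]
  rw [this]; exact h.smul _

theorem SuppLe.qder {R RQ : ℕ} {D Q : LP σ} (h : SuppLe R D) (hQ : SuppLe RQ Q) (lam v : σ → ℂ)
    (M : ℕ) : SuppLe (RQ + R) (qder Q lam v M D) :=
  (hQ.mul ((h.der v).add (h.smul _))).sub (((hQ.der v).mul h).nsmul M)

theorem exists_suppLe (D : LP σ) : ∃ R, SuppLe R D := by
  refine ⟨∑ μ ∈ D.coeff.support, ∑ i, (μ i).natAbs, fun μ hμ i => ?_⟩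
  rw [Int.abs_eq_natAbs]
  norm_cast
  exact (Finset.single_le_sum (f := fun i => (μ i).natAbs) (fun _ _ => Nat.zero_le _)
    (Finset.mem_univ i)).trans (Finset.single_le_sum (f := fun μ : σ → ℤ => ∑ i, (μ i).natAbs)
    (fun _ _ => Nat.zero_le _) (Finsupp.mem_support_iff.2 hμ))

end LP
end TrigBA

namespace TrigBA

/-! ### Ordered pairs -/

/-- The pairs `i < j`. -/
def prs (N : ℕ) : Finset (Fin N × Fin N) := Finset.univ.filter fun p => p.1 < p.2

theorem mem_prs {N : ℕ} {p : Fin N × Fin N} : p ∈ prs N ↔ p.1 < p.2 := by simp [prs]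

theorem prod_prs {N : ℕ} {R : Type*} [CommMonoid R] (f : Fin N → Fin N → R) :
    ∏ i, ∏ j ∈ Finset.Ioi i, f i j = ∏ p ∈ prs N, f p.1 p.2 := by
  rw [Finset.prod_sigma']
  refine Finset.prod_bij' (fun x _ => (x.1, x.2)) (fun p _ => ⟨p.1, p.2⟩) ?_ ?_ ?_ ?_ ?_ <;>
    simp [prs]

theorem sum_prs {N : ℕ} {R : Type*} [AddCommMonoid R] (f : Fin N → Fin N → R) :
    ∑ i, ∑ j ∈ Finset.Ioi i, f i j = ∑ p ∈ prs N, f p.1 p.2 := by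
  rw [Finset.sum_sigma']
  refine Finset.sum_bij' (fun x _ => (x.1, x.2)) (fun p _ => ⟨p.1, p.2⟩) ?_ ?_ ?_ ?_ ?_ <;>
    simp [prs]

theorem card_prs (N : ℕ) : (prs N).card = N * (N - 1) / 2 := by
  have h := sum_prs (N := N) (R := ℕ) fun _ _ => 1
  simp only [Finset.sum_const, smul_eq_mul, mul_one, Fin.card_Ioi] at h
  rw [← h, ← Finset.sum_range_id_mul_two N, Fin.sum_univ_eq_sum_range (fun i => N - 1 - i) N,
    Finset.sum_range_reflect (fun i => i) N, Nat.mul_div_cancel _ two_pos]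

theorem sinhVand_eq {N : ℕ} (x : Fin N → ℂ) :
    sinhVand x = ∏ p ∈ prs N, Complex.sinh (x p.1 - x p.2) :=
  prod_prs fun i j => Complex.sinh (x i - x j)

theorem sinhVand_ne {N : ℕ} {x : Fin N → ℂ} :
    sinhVand x ≠ 0 ↔ ∀ i j, i ≠ j → Complex.sinh (x i - x j) ≠ 0 := by
  rw [sinhVand_eq, Finset.prod_ne_zero_iff]
  refine ⟨fun h i j hij => ?_, fun h p hp => h _ _ (mem_prs.1 hp).ne⟩
  rcases lt_or_gt_of_ne hij with h1 | h1
  · exact h (i, j) (mem_prs.2 h1)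
  · rw [← neg_sub, Complex.sinh_neg, neg_ne_zero]
    exact h (j, i) (mem_prs.2 h1)

namespace LP
variable {σ : Type} [Fintype σ] [DecidableEq σ]

@[simp] theorem pair_single (x : σ → ℂ) (a : σ) (n : ℤ) : pair x (Pi.single a n) = n * x a := by
  rw [pair_apply, Finset.sum_eq_single a] <;> simp +contextual

@[simp] theorem pair_vec (a : σ) (μ : σ → ℤ) : pair (Pi.single a 1) μ = μ a := by
  rw [pair_apply, Finset.sum_eq_single a] <;> simp +contextual

/-- The exponent of `e^{x_a - x_b}`. -/
def rt (a b : σ) : σ → ℤ := Pi.single a 1 - Pi.single b 1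

/-- `sinh (x_a - x_b)`. -/
def S (a b : σ) : LP σ :=
  AddMonoidAlgebra.single (rt a b) (1 / 2) + AddMonoidAlgebra.single (rt b a) (-1 / 2)

/-- `cosh (x_a - x_b)`. -/
def Ch (a b : σ) : LP σ :=
  AddMonoidAlgebra.single (rt a b) (1 / 2) + AddMonoidAlgebra.single (rt b a) (1 / 2)

@[simp] theorem pair_rt (x : σ → ℂ) (a b : σ) : pair x (rt a b) = x a - x b := by
  simp [rt]

@[simp] theorem ev_S (x : σ → ℂ) (a b : σ) : ev x (S a b) = Complex.sinh (x a - x b) := by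
  simp only [S, map_add, ev_single, pair_rt, Complex.sinh, neg_sub]
  ring

@[simp] theorem ev_Ch (x : σ → ℂ) (a b : σ) : ev x (Ch a b) = Complex.cosh (x a - x b) := by
  simp only [Ch, map_add, ev_single, pair_rt, Complex.cosh, neg_sub]
  ring

theorem der_S (v : σ → ℂ) (a b : σ) : der v (S a b) = (v a - v b) • Ch a b := by
  simp only [S, Ch, map_add, der_single, pair_rt, smul_add, AddMonoidAlgebra.smul_single,
    smul_eq_mul]
  congr 2; ring

theorem S_ne_zero {a b : σ} (h : a ≠ b) : S a b ≠ 0 := by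
  intro h0
  have := congrArg (ev (Pi.single a (Complex.I * (Real.pi / 2 : ℝ)))) h0
  rw [ev_S, map_zero, Pi.single_eq_same, Pi.single_eq_of_ne h.symm, sub_zero, mul_comm,
    Complex.sinh_mul_I, ← Complex.ofReal_sin] at this
  simp at this

/-- The Laurent polynomial `B`. -/
def B (N : ℕ) : LP (Fin N) := ∏ p ∈ prs N, S p.1 p.2

@[simp] theorem ev_B {N : ℕ} (x : Fin N → ℂ) : ev x (B N) = sinhVand x := by
  simp [B, sinhVand_eq]

theorem B_ne_zero (N : ℕ) : B N ≠ 0 :=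
  Finset.prod_ne_zero_iff.2 fun _ hp => S_ne_zero (mem_prs.1 hp).ne

/-- The product of the factors of `B` other than `sinh (x_i - x_j)`. -/
def Bc {N : ℕ} (p : Fin N × Fin N) : LP (Fin N) := ∏ q ∈ (prs N).erase p, S q.1 q.2

theorem S_mul_Bc {N : ℕ} {p : Fin N × Fin N} (hp : p ∈ prs N) : S p.1 p.2 * Bc p = B N :=
  Finset.mul_prod_erase _ _ hp

/-- `B²` times the potential. -/
def Vn (N m : ℕ) : LP (Fin N) := ∑ p ∈ prs N, (2 * (m : ℂ) * (m + 1)) • Bc p ^ 2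

/-- The numerator of the image of `cl B lam D M` under the Sutherland operator. -/
def Lop {N : ℕ} (m : ℕ) (lam : Fin N → ℂ) (M : ℕ) (D : LP (Fin N)) : LP (Fin N) :=
  -(∑ l, qder (B N) lam (Pi.single l 1) (M + 1) (qder (B N) lam (Pi.single l 1) M D)) + Vn N m * D

end LP

/-- The potential of the Sutherland operator. -/
def pot {N : ℕ} (m : ℕ) (x : Fin N → ℂ) : ℂ :=
  ∑ p ∈ prs N, 2 * (m : ℂ) * ((m : ℂ) + 1) / Complex.sinh (x p.1 - x p.2) ^ 2

theorem hasDerivAt_update {N : ℕ} {f : (Fin N → ℂ) → ℂ} {f' : ℂ} {x : Fin N → ℂ} {i : Fin N}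
    (h : HasLineDerivAt ℂ f f' x (Pi.single i 1)) :
    HasDerivAt (fun s : ℂ => f (Function.update x i s)) f' (x i) := by
  unfold HasLineDerivAt at h
  have e : ∀ s : ℂ, Function.update x i s = x + (s - x i) • (Pi.single i 1 : Fin N → ℂ) := by
    intro s; ext j
    by_cases hj : j = i
    · subst hj; simp
    · simp [hj]
  simp_rw [e]
  have h2 : HasDerivAt (fun s : ℂ => s - x i) 1 (x i) := (hasDerivAt_id (x i)).sub_const _
  have h3 : HasDerivAt (fun t : ℂ => f (x + t • (Pi.single i 1 : Fin N → ℂ))) f' (x i - x i) := by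
    rwa [sub_self]
  have := HasDerivAt.comp (x i) (h := fun s : ℂ => s - x i) h3 h2
  rwa [mul_one] at this

theorem sutherland_eq {N m : ℕ} {f : (Fin N → ℂ) → ℂ} {f1 f2 : Fin N → (Fin N → ℂ) → ℂ}
    {U : Set (Fin N → ℂ)} (hU : IsOpen U)
    (h1 : ∀ y ∈ U, ∀ i, HasLineDerivAt ℂ f (f1 i y) y (Pi.single i 1))
    (h2 : ∀ y ∈ U, ∀ i, HasLineDerivAt ℂ (f1 i) (f2 i y) y (Pi.single i 1))
    {x : Fin N → ℂ} (hx : x ∈ U) :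
    sutherland m f x = -(∑ i, f2 i x) + pot m x * f x := by
  unfold sutherland pot
  rw [sum_prs fun i j => 2 * (m : ℂ) * ((m : ℂ) + 1) / Complex.sinh (x i - x j) ^ 2]
  congr 2
  refine Finset.sum_congr rfl fun i _ => ?_
  rw [iteratedDeriv_succ, iteratedDeriv_one]
  have hc : ContinuousAt (fun s : ℂ => Function.update x i s) (x i) := by fun_prop
  have hev : ∀ᶠ s in nhds (x i), Function.update x i s ∈ U :=
    hc.eventually (by simpa using hU.mem_nhds hx)
  have : deriv (fun s : ℂ => f (Function.update x i s)) =ᶠ[nhds (x i)]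
      fun s => f1 i (Function.update x i s) := by
    filter_upwards [hev] with s hs
    have := (hasDerivAt_update (h1 _ hs i)).deriv
    simpa using this
  rw [this.deriv_eq]
  exact (hasDerivAt_update (h2 x hx i)).deriv

theorem sutherland_congr {N m : ℕ} {f g : (Fin N → ℂ) → ℂ} {x : Fin N → ℂ}
    (h : f =ᶠ[nhds x] g) : sutherland m f x = sutherland m g x := by
  unfold sutherland
  rw [h.eq_of_nhds]
  congr 2
  refine Finset.sum_congr rfl fun i _ => ?_
  have hc : ContinuousAt (fun s : ℂ => Function.update x i s) (x i) := by fun_prop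
  have : (fun s : ℂ => f (Function.update x i s)) =ᶠ[nhds (x i)]
      fun s => g (Function.update x i s) :=
    hc.eventually (p := fun y => f y = g y) (by
      change ∀ᶠ y in nhds (Function.update x i (x i)), f y = g y
      rw [Function.update_eq_self]; exact h)
  exact this.iteratedDeriv_eq 2

namespace LP

theorem isOpen_sinhVand_ne (N : ℕ) : IsOpen {x : Fin N → ℂ | sinhVand x ≠ 0} := by
  simpa using isOpen_ev_ne (B N)

theorem sutherland_cl {N m : ℕ} (lam : Fin N → ℂ) (D : LP (Fin N)) (M : ℕ) {x : Fin N → ℂ}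
    (hx : sinhVand x ≠ 0) :
    sutherland m (cl (B N) lam D M) x = cl (B N) lam (Lop m lam M D) (M + 2) x := by
  rw [sutherland_eq (isOpen_sinhVand_ne N)
    (fun y hy i => hasLineDerivAt_cl (B N) lam D M (Pi.single i 1) y (by simpa using hy))
    (fun y hy i => hasLineDerivAt_cl (B N) lam _ (M + 1) (Pi.single i 1) y (by simpa using hy)) hx]
  have hS := sinhVand_ne.1 hx
  have hV : ev x (Vn N m) = pot m x * sinhVand x ^ 2 := by
    simp only [Vn, pot, map_sum, map_smul, map_pow, smul_eq_mul, Finset.sum_mul]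
    refine Finset.sum_congr rfl fun p hp => ?_
    have h1 : Complex.sinh (x p.1 - x p.2) ≠ 0 := hS _ _ (mem_prs.1 hp).ne
    have h2 : sinhVand x = Complex.sinh (x p.1 - x p.2) * ev x (Bc p) := by
      rw [← ev_B, ← S_mul_Bc hp, map_mul, ev_S]
    rw [h2]
    field_simp
  simp only [Lop, cl, map_add, map_neg, map_sum, map_mul, hV, ev_B]
  simp only [mul_add, add_div, mul_neg, neg_div, Finset.mul_sum, Finset.sum_div]
  congr 1
  field_simp
  ring

theorem Lop_add {N : ℕ} (m : ℕ) (lam : Fin N → ℂ) (M : ℕ) (D E : LP (Fin N)) :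
    Lop m lam M (D + E) = Lop m lam M D + Lop m lam M E := by
  have h : ∀ v M (D E : LP (Fin N)), qder (B N) lam v M (D + E) =
      qder (B N) lam v M D + qder (B N) lam v M E := fun v M D E => by
    simp only [qder, map_add, smul_add]; ring
  simp only [Lop, h, Finset.sum_add_distrib]; ring

theorem Lop_smul {N : ℕ} (m : ℕ) (lam : Fin N → ℂ) (M : ℕ) (c : ℂ) (D : LP (Fin N)) :
    Lop m lam M (c • D) = c • Lop m lam M D := by
  have h : ∀ v M (D : LP (Fin N)), qder (B N) lam v M (c • D) = c • qder (B N) lam v M D :=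
    fun v M D => by
      rw [qder, qder, Derivation.map_smul, smul_comm _ c, ← smul_add, mul_smul_comm, mul_smul_comm,
        mul_smul_comm, ← smul_sub]
  simp only [Lop, h, ← Finset.smul_sum, mul_smul_comm, smul_add, smul_neg]

/-- Equality of functions gives equality of numerators. -/
theorem eq_of_cl_eq {N : ℕ} {lam : Fin N → ℂ} {D E : LP (Fin N)} {M M' : ℕ}
    (h : ∀ x : Fin N → ℂ, sinhVand x ≠ 0 → cl (B N) lam D M x = cl (B N) lam E M' x) :
    B N ^ M' * D = B N ^ M * E := by
  have h1 : B N * (B N ^ M' * D - B N ^ M * E) = 0 := by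
    refine eq_zero_of_ev 0 _ fun r => ?_
    by_cases hr : sinhVand ((0 : Fin N → ℂ) + fun i => (r i : ℂ)) = 0
    · rw [map_mul, ev_B, hr, zero_mul]
    · have := h _ hr
      have he := Complex.exp_ne_zero (∑ a, lam a * ((0 : Fin N → ℂ) + fun i => (r i : ℂ)) a)
      simp only [cl, ev_B] at this
      rw [div_eq_div_iff (pow_ne_zero _ hr) (pow_ne_zero _ hr), mul_assoc, mul_assoc,
        mul_right_inj' he] at this
      simp only [map_mul, map_sub, map_pow, ev_B]
      rw [mul_comm _ (ev _ D), this]; ring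
  exact sub_eq_zero.1 ((mul_eq_zero.1 h1).resolve_left (B_ne_zero N))

/-- `e^{(lam, x)} D / B^M` is an eigenfunction of the Sutherland operator. -/
def IsEig {N : ℕ} (m : ℕ) (lam : Fin N → ℂ) (D : LP (Fin N)) (M : ℕ) (E : ℂ) : Prop :=
  Lop m lam M D = E • (B N ^ 2 * D)

theorem isEig_iff {N m : ℕ} {lam : Fin N → ℂ} {D : LP (Fin N)} {M : ℕ} {E : ℂ} :
    IsEig m lam D M E ↔ ∀ x, sinhVand x ≠ 0 →
      sutherland m (cl (B N) lam D M) x = E * cl (B N) lam D M x := by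
  have key : ∀ x, sinhVand x ≠ 0 → E * cl (B N) lam D M x =
      cl (B N) lam (E • (B N ^ 2 * D)) (M + 2) x := fun x hx => by
    rw [cl_smul, cl_mul_pow _ _ _ _ _ _ (by simpa using hx)]
  constructor
  · intro h x hx
    rw [sutherland_cl _ _ _ hx, h, key x hx]
  · intro h
    have := eq_of_cl_eq (lam := lam) (D := Lop m lam M D) (E := E • (B N ^ 2 * D)) (M := M + 2)
      (M' := M + 2) fun x hx => by rw [← sutherland_cl _ _ _ hx, h x hx, key x hx]
    exact mul_left_cancel₀ (pow_ne_zero _ (B_ne_zero N)) this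

end LP
end TrigBA

namespace TrigBA

/-! ### The kernel function identity -/

/-- `coth`, with the value `0` at `0`. -/
def coth (s : ℂ) : ℂ := Complex.cosh s / Complex.sinh s

/-- `1 / sinh²`, with the value `0` at `0`. -/
def csch2 (s : ℂ) : ℂ := 1 / Complex.sinh s ^ 2

@[simp] theorem coth_zero : coth 0 = 0 := by simp [coth]
@[simp] theorem csch2_zero : csch2 0 = 0 := by simp [csch2]
theorem coth_neg (s : ℂ) : coth (-s) = -coth s := by simp [coth, div_neg]
theorem csch2_neg (s : ℂ) : csch2 (-s) = csch2 s := by simp [csch2]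
theorem csch2_sub (s t : ℂ) : csch2 (s - t) = csch2 (t - s) := by rw [← csch2_neg, neg_sub]
theorem coth_sub (s t : ℂ) : coth (s - t) = -coth (t - s) := by rw [← coth_neg, neg_sub]

theorem coth_sq {s : ℂ} (h : Complex.sinh s ≠ 0) : coth s ^ 2 = 1 + csch2 s := by
  have := Complex.cosh_sq s
  simp only [coth, csch2]
  field_simp
  rw [this]

theorem coth_cyclic {a b c : ℂ} (h1 : Complex.sinh (a - b) ≠ 0) (h2 : Complex.sinh (b - c) ≠ 0)
    (h3 : Complex.sinh (a - c) ≠ 0) :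
    coth (a - b) * coth (a - c) + coth (b - a) * coth (b - c) + coth (c - a) * coth (c - b) = 1 := by
  rw [coth_sub b a, coth_sub c a, coth_sub c b]
  have e : a - c = (a - b) + (b - c) := by ring
  rw [e] at h3 ⊢
  simp only [coth]
  rw [Complex.sinh_add] at h3
  rw [Complex.sinh_add, Complex.cosh_add]
  field_simp
  ring

section Kernel
variable {σ : Type} [Fintype σ] [DecidableEq σ]

theorem sum_coth_sq (ε : σ → ℂ) (hε : ∀ a, ε a ^ 2 = 1) (hs : ∑ a, ε a = -1) (w : σ → ℂ)
    (hw : ∀ a b, a ≠ b → Complex.sinh (w a - w b) ≠ 0) :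
    ∑ a, ε a * (∑ b, ε b * coth (w a - w b)) ^ 2 = ∑ a, ∑ b, ε b * csch2 (w a - w b) := by
  set c : σ → σ → ℂ := fun a b => coth (w a - w b) with hc
  set h : σ → σ → ℂ := fun a b => csch2 (w a - w b) with hh
  have hcsq : ∀ a b, a ≠ b → c a b ^ 2 = 1 + h a b := fun a b hab => coth_sq (hw a b hab)
  have hanti : ∀ a b, c a b = -c b a := fun a b => coth_sub _ _
  have hsym : ∀ a b, h a b = h b a := fun a b => csch2_sub _ _
  have c0 : ∀ a, c a a = 0 := fun a => by simp [hc]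
  have h0 : ∀ a, h a a = 0 := fun a => by simp [hh]
  let d : σ → σ → ℂ := fun a b => if a = b then 1 else 0
  have pt : ∀ x y z, c x y * c x z + c y x * c y z + c z x * c z y =
      1 - d x y * d y z + d x y * h x z + d y z * h x y + d z x * h x y := by
    intro x y z
    by_cases h1 : x = y
    · subst h1
      by_cases h2 : x = z
      · subst h2; simp [d, c0, h0]
      · have h2' : z ≠ x := fun e => h2 e.symm
        simp only [d, if_pos rfl, if_neg h2, if_neg h2', c0, h0]
        linear_combination hcsq z x h2' + hsym z x
    · have h1' : y ≠ x := fun e => h1 e.symm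
      by_cases h2 : y = z
      · subst h2
        simp only [d, if_pos rfl, if_neg h1, if_neg h1', c0, h0]
        linear_combination hcsq x y h1
      · by_cases h3 : x = z
        · subst h3
          simp only [d, if_pos rfl, if_neg h1, if_neg h1', c0, h0]
          linear_combination hcsq y x h1' + hsym y x
        · have h3' : z ≠ x := fun e => h3 e.symm
          simp only [d, if_neg h1, if_neg h2, if_neg h3']
          have := coth_cyclic (hw x y h1) (hw y z h2) (hw x z h3)
          linear_combination this
  have S3 : ∀ a, ε a * (∑ b, ε b * c a b) ^ 2 =
      ∑ b, ∑ e, ε a * ε b * ε e * (c a b * c a e) := by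
    intro a
    rw [sq, Finset.sum_mul_sum, Finset.mul_sum]
    refine Finset.sum_congr rfl fun b _ => ?_
    rw [Finset.mul_sum]
    exact Finset.sum_congr rfl fun e _ => by ring
  have hT : ∑ a, ε a * (∑ b, ε b * c a b) ^ 2 =
      ∑ a, ∑ b, ∑ e, ε a * ε b * ε e * (c a b * c a e) :=
    Finset.sum_congr rfl fun a _ => S3 a
  have hT2 : ∑ a, ε a * (∑ b, ε b * c a b) ^ 2 =
      ∑ a, ∑ b, ∑ e, ε a * ε b * ε e * (c b a * c b e) := by
    rw [hT, Finset.sum_comm]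
    refine Finset.sum_congr rfl fun a _ => Finset.sum_congr rfl fun b _ =>
      Finset.sum_congr rfl fun e _ => by ring
  have hT3 : ∑ a, ε a * (∑ b, ε b * c a b) ^ 2 =
      ∑ a, ∑ b, ∑ e, ε a * ε b * ε e * (c e a * c e b) := by
    rw [hT, Finset.sum_comm]
    rw [show (∑ y, ∑ x, ∑ e, ε x * ε y * ε e * (c x y * c x e)) =
      ∑ y, ∑ e, ∑ x, ε x * ε y * ε e * (c x y * c x e) from
        Finset.sum_congr rfl fun y _ => Finset.sum_comm]
    refine Finset.sum_congr rfl fun a _ => Finset.sum_congr rfl fun b _ =>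
      Finset.sum_congr rfl fun e _ => by ring
  have hsum : 3 * ∑ a, ε a * (∑ b, ε b * c a b) ^ 2 =
      ∑ a, ∑ b, ∑ e, ε a * ε b * ε e *
        (1 - d a b * d b e + d a b * h a e + d b e * h a b + d e a * h a b) := by
    calc _ = ∑ a, ε a * (∑ b, ε b * c a b) ^ 2 + ∑ a, ε a * (∑ b, ε b * c a b) ^ 2 +
          ∑ a, ε a * (∑ b, ε b * c a b) ^ 2 := by ring
      _ = _ := by
        nth_rw 1 [hT]
        nth_rw 1 [hT2]
        rw [hT3]
        simp only [← Finset.sum_add_distrib]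
        refine Finset.sum_congr rfl fun a _ => Finset.sum_congr rfl fun b _ =>
          Finset.sum_congr rfl fun e _ => ?_
        rw [← pt]; ring
  have e1 : ∑ a, ∑ b, ∑ e, ε a * ε b * ε e = -1 := by
    simp only [← Finset.mul_sum, hs, ← Finset.sum_mul]; ring
  have e2 : ∑ a, ∑ b, ∑ e, ε a * ε b * ε e * (d a b * d b e) = -1 := by
    simp only [d, mul_ite, mul_one, mul_zero, Finset.sum_ite_eq, Finset.mem_univ, if_true]
    rw [← hs]
    exact Finset.sum_congr rfl fun a _ => by linear_combination ε a * hε a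
  have e3 : ∑ a, ∑ b, ∑ e, ε a * ε b * ε e * (d a b * h a e) = ∑ a, ∑ b, ε b * h a b := by
    refine Finset.sum_congr rfl fun a _ => ?_
    rw [Finset.sum_comm]
    refine Finset.sum_congr rfl fun b _ => ?_
    simp only [d, ite_mul, one_mul, zero_mul, mul_ite, mul_zero, Finset.sum_ite_eq,
      Finset.mem_univ, if_true]
    linear_combination ε b * h a b * hε a
  have e4 : ∑ a, ∑ b, ∑ e, ε a * ε b * ε e * (d b e * h a b) = ∑ a, ∑ b, ε b * h a b := by
    rw [Finset.sum_comm]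
    refine Finset.sum_congr rfl fun a _ => Finset.sum_congr rfl fun b _ => ?_
    simp only [d, ite_mul, one_mul, zero_mul, mul_ite, mul_zero, Finset.sum_ite_eq,
      Finset.mem_univ, if_true]
    rw [hsym a b]
    linear_combination ε b * h b a * hε a
  have e5 : ∑ a, ∑ b, ∑ e, ε a * ε b * ε e * (d e a * h a b) = ∑ a, ∑ b, ε b * h a b := by
    refine Finset.sum_congr rfl fun a _ => Finset.sum_congr rfl fun b _ => ?_
    simp only [d, ite_mul, one_mul, zero_mul, mul_ite, mul_zero, Finset.sum_ite_eq',
      Finset.mem_univ, if_true]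
    linear_combination ε b * h a b * hε a
  have : 3 * ∑ a, ε a * (∑ b, ε b * c a b) ^ 2 = 3 * ∑ a, ∑ b, ε b * h a b := by
    rw [hsum]
    simp only [mul_add, mul_sub, mul_one, Finset.sum_add_distrib, Finset.sum_sub_distrib]
    rw [e1, e2, e3, e4, e5]; ring
  exact mul_left_cancel₀ (by norm_num) this

/-- The logarithmic derivative in `w_a` of the kernel function. -/
def ell (ε : σ → ℂ) (κ p : ℂ) (a : σ) (w : σ → ℂ) : ℂ :=
  -ε a * (κ + p * ∑ b, ε b * coth (w a - w b))

/-- The derivative of `ell` in the direction `v`. -/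
def dell (ε : σ → ℂ) (p : ℂ) (a : σ) (v w : σ → ℂ) : ℂ :=
  ε a * (p * ∑ b, ε b * ((v a - v b) * csch2 (w a - w b)))

theorem sum_ell (ε : σ → ℂ) (hε : ∀ a, ε a ^ 2 = 1) (hs : ∑ a, ε a = -1) (κ p : ℂ) (w : σ → ℂ)
    (hw : ∀ a b, a ≠ b → Complex.sinh (w a - w b) ≠ 0) :
    ∑ a, ε a * (dell ε p a (Pi.single a 1) w + ell ε κ p a w ^ 2) =
      -κ ^ 2 + p * (p + 1) * ∑ a, ∑ b, ε b * csch2 (w a - w b) := by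
  have h1 : ∀ a, ε a * (dell ε p a (Pi.single a 1) w + ell ε κ p a w ^ 2) =
      p * (∑ b, ε b * csch2 (w a - w b)) + κ ^ 2 * ε a +
      2 * κ * p * (∑ b, ε a * ε b * coth (w a - w b)) +
      p ^ 2 * (ε a * (∑ b, ε b * coth (w a - w b)) ^ 2) := by
    intro a
    have e : ∑ b, ε b * (((Pi.single a 1 : σ → ℂ) a - (Pi.single a 1 : σ → ℂ) b) *
        csch2 (w a - w b)) = ∑ b, ε b * csch2 (w a - w b) := by
      refine Finset.sum_congr rfl fun b _ => ?_
      by_cases hb : b = a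
      · subst hb; simp
      · simp [hb]
    have e2 : ∑ b, ε a * ε b * coth (w a - w b) = ε a * ∑ b, ε b * coth (w a - w b) := by
      rw [Finset.mul_sum]; exact Finset.sum_congr rfl fun b _ => by ring
    rw [dell, ell, e, e2]
    linear_combination (p * (∑ b, ε b * csch2 (w a - w b)) +
      ε a * (κ + p * ∑ b, ε b * coth (w a - w b)) ^ 2) * hε a
  have h2 : ∑ a, ∑ b, ε a * ε b * coth (w a - w b) = 0 := by
    have : ∑ a, ∑ b, ε a * ε b * coth (w a - w b) = -∑ a, ∑ b, ε a * ε b * coth (w a - w b) := by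
      conv_rhs => rw [Finset.sum_comm]
      rw [← Finset.sum_neg_distrib]
      refine Finset.sum_congr rfl fun a _ => ?_
      rw [← Finset.sum_neg_distrib]
      refine Finset.sum_congr rfl fun b _ => ?_
      rw [coth_sub (w a)]; ring
    linear_combination this / 2
  simp only [h1, Finset.sum_add_distrib, ← Finset.mul_sum]
  rw [h2, sum_coth_sq ε hε hs w hw, hs]
  ring

theorem hasDerivAt_coth {s : ℂ} (h : Complex.sinh s ≠ 0) : HasDerivAt coth (-csch2 s) s := by
  have := (Complex.hasDerivAt_cosh s).div (Complex.hasDerivAt_sinh s) h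
  refine this.congr_deriv ?_
  have h2 := Complex.cosh_sq s
  simp only [csch2]
  rw [← neg_div]
  congr 1
  linear_combination -h2

theorem hasLineDerivAt_ell (ε : σ → ℂ) (κ p : ℂ) (a : σ) (v w : σ → ℂ)
    (hw : ∀ a b, a ≠ b → Complex.sinh (w a - w b) ≠ 0) :
    HasLineDerivAt ℂ (ell ε κ p a) (dell ε p a v w) w v := by
  unfold HasLineDerivAt ell
  have h : ∀ b, HasDerivAt (fun t : ℂ => coth ((w + t • v) a - (w + t • v) b))
      (-((v a - v b) * csch2 (w a - w b))) 0 := by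
    intro b
    by_cases hb : a = b
    · subst hb; simpa using hasDerivAt_const (0 : ℂ) (0 : ℂ)
    · have h1 : HasDerivAt (fun t : ℂ => (w + t • v) a - (w + t • v) b) (v a - v b) 0 := by
        simpa using (((hasDerivAt_id (0 : ℂ)).mul_const (v a)).const_add (w a)).fun_sub
          (((hasDerivAt_id (0 : ℂ)).mul_const (v b)).const_add (w b))
      have h2 : HasDerivAt coth (-csch2 (w a - w b)) ((w + (0 : ℂ) • v) a - (w + (0 : ℂ) • v) b) := by
        simpa using hasDerivAt_coth (hw a b hb)
      exact (HasDerivAt.comp (0 : ℂ) (h := fun t : ℂ => (w + t • v) a - (w + t • v) b) h2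
        h1).congr_deriv (by ring)
  have := ((HasDerivAt.fun_sum fun b (_ : b ∈ Finset.univ) => (h b).const_mul (ε b)).const_mul
    p).const_add κ |>.const_mul (-ε a)
  refine this.congr_deriv ?_
  simp only [dell, mul_neg, Finset.sum_neg_distrib]
  ring

end Kernel
end TrigBA

namespace TrigBA

section Pointwise

/-- Indices of the joint variables `(x, z)`. -/
abbrev JX (k : ℕ) : Type := Fin (k + 1) ⊕ Fin k

/-- The signs of the joint variables. -/
def eps (k : ℕ) : JX k → ℂ := Sum.elim (fun _ => -1) (fun _ => 1)

@[simp] theorem eps_inl (k : ℕ) (l : Fin (k + 1)) : eps k (Sum.inl l) = -1 := rfl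
@[simp] theorem eps_inr (k : ℕ) (i : Fin k) : eps k (Sum.inr i) = 1 := rfl

theorem eps_sq (k : ℕ) (a : JX k) : eps k a ^ 2 = 1 := by
  rcases a with a | a <;> simp [eps]

theorem sum_eps (k : ℕ) : ∑ a, eps k a = -1 := by
  simp [eps]

/-- Points with separated coordinates. -/
def Sep (k : ℕ) : Set (JX k → ℂ) := {w | ∀ a b, a ≠ b → Complex.sinh (w a - w b) ≠ 0}

/-- The direction that moves `x_l` and, for `l < k`, also `z_l`. -/
def dirv {k : ℕ} (l : Fin (k + 1)) : JX k → ℂ :=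
  Sum.elim (Pi.single l 1) (fun i => if i.castSucc = l then 1 else 0)

variable {k : ℕ}

/-- Extension of a family by zero at the last index. -/
def ext0 (f : Fin k → ℂ) : Fin (k + 1) → ℂ := Fin.snoc (α := fun _ => ℂ) f 0

@[simp] theorem ext0_castSucc (f : Fin k → ℂ) (i : Fin k) : ext0 f i.castSucc = f i := by
  simp [ext0]

@[simp] theorem ext0_last (f : Fin k → ℂ) : ext0 f (Fin.last k) = 0 := by simp [ext0]

theorem dirv_inr (l : Fin (k + 1)) (w : JX k → ℂ) (s : ℂ) :
    (w + s • dirv l) ∘ Sum.inr = w ∘ Sum.inr + s • (dirv l ∘ Sum.inr) := rfl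

theorem dirv_castSucc_inr (i : Fin k) : dirv i.castSucc ∘ Sum.inr = (Pi.single i 1 : Fin k → ℂ) := by
  ext j
  by_cases h : j = i
  · subst h; simp [dirv]
  · simp [dirv, h]

theorem dirv_last_inr : dirv (Fin.last k) ∘ Sum.inr = (0 : Fin k → ℂ) := by
  ext j
  simp [dirv]

theorem HasLineDerivAt.inr {Ψ : (Fin k → ℂ) → ℂ} {Ψ1 : Fin k → ℂ} {w : JX k → ℂ}
    (h : ∀ i, HasLineDerivAt ℂ Ψ (Ψ1 i) (w ∘ Sum.inr) (Pi.single i 1)) (l : Fin (k + 1)) :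
    HasLineDerivAt ℂ (fun w : JX k → ℂ => Ψ (w ∘ Sum.inr)) (ext0 Ψ1 l) w (dirv l) := by
  unfold HasLineDerivAt
  simp only [dirv_inr]
  refine Fin.lastCases ?_ (fun i => ?_) l
  · simpa [dirv_last_inr] using hasDerivAt_const (0 : ℂ) (Ψ (w ∘ Sum.inr))
  · rw [dirv_castSucc_inr, ext0_castSucc]; exact h i

theorem sum_dirv_mul (f : JX k → ℂ) (l : Fin (k + 1)) :
    ∑ a, dirv l a * f a = f (Sum.inl l) + ext0 (fun i => f (Sum.inr i)) l := by
  rw [Fintype.sum_sum_type]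
  congr 1
  · rw [Finset.sum_eq_single l] <;> simp +contextual [dirv]
  · refine Fin.lastCases ?_ (fun i => ?_) l
    · simp [dirv]
    · rw [Finset.sum_eq_single i] <;> simp +contextual [dirv]

variable (κ p : ℂ) (K : (JX k → ℂ) → ℂ) (Ψ : (Fin k → ℂ) → ℂ)
  (Ψ1 Ψ2 : Fin k → (Fin k → ℂ) → ℂ)

/-- The logarithmic derivative of the kernel function along `dirv l`. -/
def qv (l : Fin (k + 1)) (w : JX k → ℂ) : ℂ := ∑ a, dirv l a * ell (eps k) κ p a w

def dqv (l : Fin (k + 1)) (v w : JX k → ℂ) : ℂ := ∑ a, dirv l a * dell (eps k) p a v w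

def jF (w : JX k → ℂ) : ℂ := K w * Ψ (w ∘ Sum.inr)

def jF1 (l : Fin (k + 1)) (w : JX k → ℂ) : ℂ :=
  K w * (qv κ p l w * Ψ (w ∘ Sum.inr) + ext0 (fun i => Ψ1 i (w ∘ Sum.inr)) l)

def jF2 (l : Fin (k + 1)) (w : JX k → ℂ) : ℂ :=
  K w * (qv κ p l w * (qv κ p l w * Ψ (w ∘ Sum.inr) + ext0 (fun i => Ψ1 i (w ∘ Sum.inr)) l) +
    (dqv p l (dirv l) w * Ψ (w ∘ Sum.inr) + qv κ p l w * ext0 (fun i => Ψ1 i (w ∘ Sum.inr)) l) +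
    ext0 (fun i => Ψ2 i (w ∘ Sum.inr)) l)

def jG (i : Fin k) (w : JX k → ℂ) : ℂ :=
  K w * (dqv p i.castSucc (Pi.single (Sum.inr i) 1) w * Ψ (w ∘ Sum.inr) +
    qv κ p i.castSucc w * (ell (eps k) κ p (Sum.inr i) w * Ψ (w ∘ Sum.inr) +
      Ψ1 i (w ∘ Sum.inr)))

variable {κ p K Ψ Ψ1 Ψ2}

theorem hasLineDerivAt_qv (l : Fin (k + 1)) (v : JX k → ℂ) {w : JX k → ℂ} (hw : w ∈ Sep k) :
    HasLineDerivAt ℂ (qv κ p l) (dqv p l v w) w v := by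
  have := HasDerivAt.fun_sum fun a (_ : a ∈ Finset.univ) =>
    (hasLineDerivAt_ell (eps k) κ p a v w hw).const_mul (dirv l a)
  exact this

theorem hasLineDerivAt_jF
    (hK : ∀ w ∈ Sep k, ∀ v, HasLineDerivAt ℂ K ((∑ a, v a * ell (eps k) κ p a w) * K w) w v)
    (h1 : ∀ z, sinhVand z ≠ 0 → ∀ i, HasLineDerivAt ℂ Ψ (Ψ1 i z) z (Pi.single i 1))
    {w : JX k → ℂ} (hw : w ∈ Sep k) (l : Fin (k + 1)) :
    HasLineDerivAt ℂ (jF K Ψ) (jF1 κ p K Ψ Ψ1 l w) w (dirv l) := by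
  have hz : sinhVand (w ∘ Sum.inr) ≠ 0 :=
    sinhVand_ne.2 fun i j hij => hw _ _ fun h => hij (Sum.inr_injective h)
  have a1 : HasDerivAt _ _ _ := hK w hw (dirv l)
  have a2 : HasDerivAt _ _ _ := HasLineDerivAt.inr (h1 _ hz) l
  refine (a1.fun_mul a2).congr_deriv ?_
  simp only [zero_smul, add_zero, jF1, qv]
  ring

theorem hasLineDerivAt_jF1
    (hK : ∀ w ∈ Sep k, ∀ v, HasLineDerivAt ℂ K ((∑ a, v a * ell (eps k) κ p a w) * K w) w v)
    (h1 : ∀ z, sinhVand z ≠ 0 → ∀ i, HasLineDerivAt ℂ Ψ (Ψ1 i z) z (Pi.single i 1))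
    (h2 : ∀ z, sinhVand z ≠ 0 → ∀ i, HasLineDerivAt ℂ (Ψ1 i) (Ψ2 i z) z (Pi.single i 1))
    {w : JX k → ℂ} (hw : w ∈ Sep k) (l : Fin (k + 1)) :
    HasLineDerivAt ℂ (jF1 κ p K Ψ Ψ1 l) (jF2 κ p K Ψ Ψ1 Ψ2 l w) w (dirv l) := by
  have hz : sinhVand (w ∘ Sum.inr) ≠ 0 :=
    sinhVand_ne.2 fun i j hij => hw _ _ fun h => hij (Sum.inr_injective h)
  have a1 : HasDerivAt _ _ _ := hK w hw (dirv l)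
  have a2 : HasDerivAt _ _ _ := HasLineDerivAt.inr (h1 _ hz) l
  have a3 : HasDerivAt _ _ _ := hasLineDerivAt_qv (κ := κ) (p := p) l (dirv l) hw
  have a4 : HasLineDerivAt ℂ (fun w : JX k → ℂ => ext0 (fun i => Ψ1 i (w ∘ Sum.inr)) l)
      (ext0 (fun i => Ψ2 i (w ∘ Sum.inr)) l) w (dirv l) := by
    refine Fin.lastCases ?_ (fun i => ?_) l
    · simpa [HasLineDerivAt] using hasDerivAt_const (0 : ℂ) (0 : ℂ)
    · unfold HasLineDerivAt
      simp only [ext0_castSucc, dirv_inr, dirv_castSucc_inr]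
      exact h2 _ hz i
  have a5 : HasDerivAt _ _ _ := a4
  refine (a1.fun_mul ((a3.fun_mul a2).fun_add a5)).congr_deriv ?_
  simp only [zero_smul, add_zero, jF2, qv]
  ring

theorem hasLineDerivAt_jG
    (hK : ∀ w ∈ Sep k, ∀ v, HasLineDerivAt ℂ K ((∑ a, v a * ell (eps k) κ p a w) * K w) w v)
    (h1 : ∀ z, sinhVand z ≠ 0 → ∀ i, HasLineDerivAt ℂ Ψ (Ψ1 i z) z (Pi.single i 1))
    {w : JX k → ℂ} (hw : w ∈ Sep k) (i : Fin k) :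
    HasLineDerivAt ℂ (fun w => qv κ p i.castSucc w * jF K Ψ w) (jG κ p K Ψ Ψ1 i w) w
      (Pi.single (Sum.inr i) 1) := by
  have hz : sinhVand (w ∘ Sum.inr) ≠ 0 :=
    sinhVand_ne.2 fun i j hij => hw _ _ fun h => hij (Sum.inr_injective h)
  have a1 : HasDerivAt _ _ _ := hK w hw (Pi.single (Sum.inr i) 1)
  have e : ∀ s : ℂ, (w + s • (Pi.single (Sum.inr i) 1 : JX k → ℂ)) ∘ Sum.inr =
      w ∘ Sum.inr + s • (Pi.single i 1 : Fin k → ℂ) := by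
    intro s; ext j
    by_cases h : j = i
    · subst h; simp
    · simp [h]
  have a2 : HasDerivAt (fun s : ℂ => Ψ ((w + s • (Pi.single (Sum.inr i) 1 : JX k → ℂ)) ∘ Sum.inr))
      (Ψ1 i (w ∘ Sum.inr)) 0 := by
    simp only [e]; exact h1 _ hz i
  have a3 : HasDerivAt _ _ _ :=
    hasLineDerivAt_qv (κ := κ) (p := p) i.castSucc (Pi.single (Sum.inr i) 1) hw
  have e2 : ∑ a, (Pi.single (Sum.inr i) 1 : JX k → ℂ) a * ell (eps k) κ p a w =
      ell (eps k) κ p (Sum.inr i) w := by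
    rw [Finset.sum_eq_single (Sum.inr i)] <;> simp +contextual
  refine (a3.fun_mul (a1.fun_mul a2)).congr_deriv ?_
  simp only [zero_smul, add_zero, jG, e2]
  ring

theorem sum_ordered {N : ℕ} (f : Fin N → Fin N → ℂ) (hf : ∀ i j, f i j = f j i)
    (h0 : ∀ i, f i i = 0) : ∑ i, ∑ j, f i j = 2 * ∑ q ∈ prs N, f q.1 q.2 := by
  have e1 : ∑ i, ∑ j, f i j = ∑ q : Fin N × Fin N, f q.1 q.2 := (Fintype.sum_prod_type' f).symm
  have e2 : ∑ q ∈ Finset.univ.filter (fun q : Fin N × Fin N => ¬ q.1 < q.2), f q.1 q.2 =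
      ∑ q ∈ prs N, f q.1 q.2 := by
    rw [← Finset.sum_filter_add_sum_filter_not
      (Finset.univ.filter (fun q : Fin N × Fin N => ¬ q.1 < q.2)) (fun q => q.2 < q.1)]
    have z : ∑ q ∈ (Finset.univ.filter (fun q : Fin N × Fin N => ¬ q.1 < q.2)).filter
        (fun q => ¬ q.2 < q.1), f q.1 q.2 = 0 := by
      refine Finset.sum_eq_zero fun q hq => ?_
      simp only [Finset.mem_filter, Finset.mem_univ, true_and, not_lt] at hq
      rw [le_antisymm hq.1 hq.2, h0]
    rw [z, add_zero]
    refine Finset.sum_bij' (fun q _ => q.swap) (fun q _ => q.swap) ?_ ?_ ?_ ?_ ?_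
    · intro q hq; simp only [Finset.mem_filter] at hq; simpa [prs] using hq.2
    · intro q hq
      have := mem_prs.1 hq
      simp [this, this.le]
    · simp
    · simp
    · intro q _; exact hf _ _
  rw [e1, ← Finset.sum_filter_add_sum_filter_not _ (fun q : Fin N × Fin N => q.1 < q.2), e2]
  simp only [prs]; ring

theorem pot_eq {N : ℕ} (m : ℕ) (x : Fin N → ℂ) :
    pot m x = (m : ℂ) * (m + 1) * ∑ i, ∑ j, csch2 (x i - x j) := by
  rw [sum_ordered _ (fun i j => csch2_sub _ _) (by simp), pot, Finset.mul_sum, Finset.mul_sum]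
  exact Finset.sum_congr rfl fun q _ => by rw [csch2]; ring

theorem kernel_identity (m : ℕ) (hp : p * (p + 1) = m * (m + 1)) {w : JX k → ℂ} (hw : w ∈ Sep k) :
    -(∑ l, jF2 κ p K Ψ Ψ1 Ψ2 l w) + pot m (w ∘ Sum.inl) * jF K Ψ w + κ ^ 2 * jF K Ψ w =
      K w * (-(∑ i, Ψ2 i (w ∘ Sum.inr)) + pot m (w ∘ Sum.inr) * Ψ (w ∘ Sum.inr)) -
        ∑ i, 2 * jG κ p K Ψ Ψ1 i w := by
  have key := sum_ell (eps k) (eps_sq k) (sum_eps k) κ p w hw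
  have hH : ∑ a, ∑ b, eps k b * csch2 (w a - w b) =
      ∑ i, ∑ j, csch2 ((w ∘ Sum.inr) i - (w ∘ Sum.inr) j) -
      ∑ i, ∑ j, csch2 ((w ∘ Sum.inl) i - (w ∘ Sum.inl) j) := by
    simp only [Fintype.sum_sum_type, eps_inl, eps_inr, Function.comp,
      Finset.sum_add_distrib, neg_mul, one_mul, Finset.sum_neg_distrib]
    have : ∑ i : Fin (k + 1), ∑ j : Fin k, csch2 (w (Sum.inl i) - w (Sum.inr j)) =
        ∑ i : Fin k, ∑ j : Fin (k + 1), csch2 (w (Sum.inr i) - w (Sum.inl j)) := by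
      rw [Finset.sum_comm]
      exact Finset.sum_congr rfl fun i _ => Finset.sum_congr rfl fun j _ => csch2_sub _ _
    rw [this]; ring
  rw [hH, Fintype.sum_sum_type] at key
  rw [pot_eq, pot_eq]
  clear hH
  generalize ∑ i, ∑ j, csch2 ((w ∘ Sum.inl) i - (w ∘ Sum.inl) j) = Hx at key ⊢
  generalize ∑ i, ∑ j, csch2 ((w ∘ Sum.inr) i - (w ∘ Sum.inr) j) = Hz at key ⊢
  simp only [eps_inl, eps_inr, neg_mul, one_mul, Finset.sum_neg_distrib,
    Fin.sum_univ_castSucc, Finset.sum_add_distrib] at key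
  rw [Fin.sum_univ_castSucc]
  have hl : jF2 κ p K Ψ Ψ1 Ψ2 (Fin.last k) w = K w * Ψ (w ∘ Sum.inr) *
      (dell (eps k) p (Sum.inl (Fin.last k)) (Pi.single (Sum.inl (Fin.last k)) 1) w +
        ell (eps k) κ p (Sum.inl (Fin.last k)) w ^ 2) := by
    have : (dirv (Fin.last k) : JX k → ℂ) = Pi.single (Sum.inl (Fin.last k)) 1 := by
      ext a
      rcases a with a | a
      · by_cases h : a = Fin.last k
        · subst h; simp [dirv]
        · simp [dirv, h]
      · simp [dirv]
    simp only [jF2, ext0_last, qv, dqv, sum_dirv_mul]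
    rw [this]; ring
  have hd : ∀ i : Fin k, dell (eps k) p (Sum.inl i.castSucc) (Pi.single (Sum.inr i) 1) w =
      dell (eps k) p (Sum.inr i) (Pi.single (Sum.inl i.castSucc) 1) w := by
    intro i
    have A : ∀ (a b : JX k), a ≠ b → dell (eps k) p a (Pi.single b 1) w =
        -(p * (eps k a * eps k b * csch2 (w a - w b))) := by
      intro a b hab
      rw [dell, Finset.sum_eq_single b]
      · rw [Pi.single_eq_of_ne hab, Pi.single_eq_same]; ring
      · intro c _ hc
        rw [Pi.single_eq_of_ne hab, Pi.single_eq_of_ne hc]; ring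
      · simp
    rw [A _ _ (by simp), A _ _ (by simp), csch2_sub]; ring
  have hadd : ∀ (a : JX k) (u v : JX k → ℂ), dell (eps k) p a (u + v) w =
      dell (eps k) p a u w + dell (eps k) p a v w := by
    intro a u v
    simp only [dell, Pi.add_apply, ← mul_add, ← Finset.sum_add_distrib]
    congr 2
    exact Finset.sum_congr rfl fun b _ => by ring
  have hv : ∀ i : Fin k, (dirv i.castSucc : JX k → ℂ) =
      Pi.single (Sum.inl i.castSucc) 1 + Pi.single (Sum.inr i) 1 := by
    intro i; ext a
    rcases a with a | a
    · by_cases h : a = i.castSucc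
      · subst h; simp [dirv]
      · simp [dirv, h]
    · by_cases h : a = i
      · subst h; simp [dirv]
      · simp [dirv, h]
  have hc : ∀ i : Fin k, jF2 κ p K Ψ Ψ1 Ψ2 i.castSucc w = 2 * jG κ p K Ψ Ψ1 i w +
      K w * Ψ2 i (w ∘ Sum.inr) + K w * Ψ (w ∘ Sum.inr) *
      ((dell (eps k) p (Sum.inl i.castSucc) (Pi.single (Sum.inl i.castSucc) 1) w +
        ell (eps k) κ p (Sum.inl i.castSucc) w ^ 2) -
       (dell (eps k) p (Sum.inr i) (Pi.single (Sum.inr i) 1) w +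
        ell (eps k) κ p (Sum.inr i) w ^ 2)) := by
    intro i
    simp only [jF2, jG, qv, dqv, sum_dirv_mul, ext0_castSucc]
    rw [hv, hadd, hadd, hd]
    ring
  simp only [hc, hl, Finset.sum_add_distrib, ← Finset.mul_sum, jF, Finset.sum_sub_distrib]
  linear_combination (K w * Ψ (w ∘ Sum.inr)) * key + (K w * Ψ (w ∘ Sum.inr)) *
    (Hz - Hx) * hp

end Pointwise
end TrigBA

namespace TrigBA

/-- The open unit box. -/
def box (k : ℕ) : Set (Fin k → ℝ) := Set.univ.pi fun _ => Set.Ioo 0 1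

theorem mem_box {k : ℕ} {θ : Fin k → ℝ} : θ ∈ box k ↔ ∀ i, 0 < θ i ∧ θ i < 1 := by
  simp [box]

theorem measurableSet_box (k : ℕ) : MeasurableSet (box k) :=
  MeasurableSet.univ_pi fun _ => measurableSet_Ioo

instance (k : ℕ) : IsFiniteMeasure (volume.restrict (box k)) := by
  refine ⟨?_⟩
  rw [Measure.restrict_apply_univ, box, Real.volume_pi_Ioo]
  simp

theorem integral_box_deriv_eq_zero {k : ℕ} (i : Fin k) {h h' : (Fin k → ℝ) → ℂ}
    (hint : IntegrableOn h' (box k))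
    (hd : ∀ θ ∈ box k, HasDerivAt (fun t => h (Function.update θ i t)) (h' θ) (θ i))
    (hl : ∀ θ ∈ box k, ∃ L,
      Filter.Tendsto (fun t => h (Function.update θ i t)) (nhdsWithin 0 (Set.Ioi 0)) (nhds L) ∧
      Filter.Tendsto (fun t => h (Function.update θ i t)) (nhdsWithin 1 (Set.Iio 1)) (nhds L)) :
    ∫ θ in box k, h' θ = 0 := by
  rcases k with _ | k
  · exact i.elim0
  let e := MeasurableEquiv.piFinSuccAbove (fun _ : Fin (k + 1) => ℝ) i
  have he : MeasurePreserving e := volume_preserving_piFinSuccAbove (fun _ : Fin (k + 1) => ℝ) i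
  have hpre : e.symm ⁻¹' box (k + 1) = Set.Ioo (0 : ℝ) 1 ×ˢ box k := by
    ext ⟨t, θ⟩
    change i.insertNth (α := fun _ => ℝ) t θ ∈ box (k + 1) ↔ _
    simp only [mem_box, Set.mem_prod, Set.mem_Ioo]
    rw [Fin.forall_iff_succAbove i]
    simp
  have hes : MeasurePreserving e.symm := he.symm e
  have h1 : ∫ θ in box (k + 1), h' θ = ∫ q in Set.Ioo (0 : ℝ) 1 ×ˢ box k, h' (e.symm q) := by
    rw [← hpre, hes.setIntegral_preimage_emb e.symm.measurableEmbedding]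
  have h2 : IntegrableOn (fun q => h' (e.symm q)) (Set.Ioo (0 : ℝ) 1 ×ˢ box k)
      (volume.prod volume) := by
    rw [← hpre]
    exact (hes.integrableOn_comp_preimage e.symm.measurableEmbedding).2 hint
  have hsymm : ∀ t θ, e.symm (t, θ) = i.insertNth t θ := fun t θ => rfl
  rw [h1, Measure.volume_eq_prod, ← Measure.prod_restrict, integral_prod_symm _
    (by rwa [IntegrableOn, ← Measure.prod_restrict] at h2)]
  rw [IntegrableOn, ← Measure.prod_restrict] at h2
  refine integral_eq_zero_of_ae ?_
  filter_upwards [h2.prod_left_ae, ae_restrict_mem (measurableSet_box k)] with θ hθ hm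
  simp only [hsymm] at hθ ⊢
  have hmem : ∀ t ∈ Set.Ioo (0 : ℝ) 1, i.insertNth t θ ∈ box (k + 1) := by
    intro t ht
    rw [mem_box, Fin.forall_iff_succAbove i]
    simpa using ⟨ht, fun j => mem_box.1 hm j⟩
  have hup : ∀ s t, Function.update (i.insertNth (α := fun _ => ℝ) s θ) i t =
      i.insertNth (α := fun _ => ℝ) t θ := by
    intro s t; simp
  obtain ⟨L, hL0, hL1⟩ := hl _ (hmem (1 / 2) (by norm_num))
  simp only [hup] at hL0 hL1
  have := intervalIntegral.integral_eq_sub_of_hasDerivAt_of_tendsto (a := (0 : ℝ)) (b := 1)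
    (f := fun t => h (i.insertNth t θ)) (f' := fun t => h' (i.insertNth t θ)) one_pos
    (fun t ht => by
      have := hd _ (hmem t ht)
      simpa only [hup, Fin.insertNth_apply_same] using this)
    ((intervalIntegrable_iff_integrableOn_Ioo_of_le zero_le_one).2 hθ) hL0 hL1
  rw [intervalIntegral.integral_of_le zero_le_one, integral_Ioc_eq_integral_Ioo, sub_self] at this
  simpa using this

section Transform
variable {k : ℕ} (γ γ' : ℝ → ℂ)

/-- The joint point `(x, z)` with `z_i = x_i + γ(θ_i)`. -/
def wj (x : Fin (k + 1) → ℂ) (θ : Fin k → ℝ) : JX k → ℂ :=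
  Sum.elim x fun i => x i.castSucc + γ (θ i)

/-- The integral transform. -/
def trans (G : (JX k → ℂ) → ℂ) (x : Fin (k + 1) → ℂ) : ℂ :=
  ∫ θ in box k, G (wj γ x θ) * ∏ i, γ' (θ i)

/-- Local uniform boundedness of the integrand. -/
def Good (U : Set (Fin (k + 1) → ℂ)) (G : (JX k → ℂ) → ℂ) : Prop :=
  ∀ x₀ ∈ U, ∃ C, ∀ᶠ x in nhds x₀, ContinuousOn (fun θ => G (wj γ x θ) * ∏ i, γ' (θ i)) (box k) ∧
    ∀ θ ∈ box k, ‖G (wj γ x θ) * ∏ i, γ' (θ i)‖ ≤ C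

variable {γ γ'}

theorem wj_add (x : Fin (k + 1) → ℂ) (θ : Fin k → ℝ) (l : Fin (k + 1)) (s : ℂ) :
    wj γ (x + s • (Pi.single l 1 : Fin (k + 1) → ℂ)) θ = wj γ x θ + s • dirv l := by
  ext a
  rcases a with a | a
  · simp [wj, dirv]
  · by_cases h : a.castSucc = l
    · subst h; simp [wj, dirv]; ring
    · simp [wj, dirv, h]

theorem Good.integrableOn {U : Set (Fin (k + 1) → ℂ)} {G : (JX k → ℂ) → ℂ} (h : Good γ γ' U G)
    {x : Fin (k + 1) → ℂ} (hx : x ∈ U) :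
    IntegrableOn (fun θ => G (wj γ x θ) * ∏ i, γ' (θ i)) (box k) := by
  obtain ⟨C, hC⟩ := h x hx
  obtain ⟨hc, hb⟩ := hC.self_of_nhds
  refine (integrable_const C).mono' (hc.aestronglyMeasurable (measurableSet_box k)) ?_
  filter_upwards [ae_restrict_mem (measurableSet_box k)] with θ hθ using hb θ hθ

theorem Good.hasLineDerivAt {U : Set (Fin (k + 1) → ℂ)} (hU : IsOpen U)
    {G G1 : (JX k → ℂ) → ℂ} (h : Good γ γ' U G) (h1 : Good γ γ' U G1) {l : Fin (k + 1)}
    (hd : ∀ x ∈ U, ∀ θ ∈ box k,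
      HasLineDerivAt ℂ G (G1 (wj γ x θ)) (wj γ x θ) (dirv l))
    {x : Fin (k + 1) → ℂ} (hx : x ∈ U) :
    HasLineDerivAt ℂ (trans γ γ' G) (trans γ γ' G1 x) x (Pi.single l 1) := by
  obtain ⟨C, hC⟩ := h1 x hx
  obtain ⟨_, hC0⟩ := h x hx
  have hcont : Continuous fun s : ℂ => x + s • (Pi.single l 1 : Fin (k + 1) → ℂ) := by fun_prop
  have hev : ∀ᶠ s in nhds (0 : ℂ), (x + s • (Pi.single l 1 : Fin (k + 1) → ℂ)) ∈ U ∧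
      (∀ θ ∈ box k, ‖G1 (wj γ (x + s • Pi.single l 1) θ) * ∏ i, γ' (θ i)‖ ≤ C) ∧
      ContinuousOn (fun θ => G (wj γ (x + s • Pi.single l 1) θ) * ∏ i, γ' (θ i)) (box k) := by
    have e0 : x + (0 : ℂ) • (Pi.single l 1 : Fin (k + 1) → ℂ) = x := by simp
    have t : Filter.Tendsto (fun s : ℂ => x + s • (Pi.single l 1 : Fin (k + 1) → ℂ)) (nhds 0)
        (nhds x) := by simpa [e0] using hcont.tendsto 0
    filter_upwards [t.eventually (hU.mem_nhds hx), t.eventually hC, t.eventually hC0]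
      with s a b c using ⟨a, b.2, c.1⟩
  have := hasDerivAt_integral_of_dominated_loc_of_deriv_le (𝕜 := ℂ)
    (μ := volume.restrict (box k))
    (F := fun s θ => G (wj γ (x + s • Pi.single l 1) θ) * ∏ i, γ' (θ i))
    (F' := fun s θ => G1 (wj γ (x + s • Pi.single l 1) θ) * ∏ i, γ' (θ i)) (x₀ := 0)
    (bound := fun _ => C) hev
    (by filter_upwards [hev] with s hs using hs.2.2.aestronglyMeasurable (measurableSet_box k))
    (by simp only [zero_smul, add_zero]; exact h.integrableOn hx)
    (by simpa using (h1.integrableOn hx).aestronglyMeasurable)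
    (by
      filter_upwards [ae_restrict_mem (measurableSet_box k)] with θ hθ s hs using hs.2.1 θ hθ)
    (integrable_const C)
    (by
      filter_upwards [ae_restrict_mem (measurableSet_box k)] with θ hθ s hs
      have := hd _ hs.1 θ hθ
      unfold HasLineDerivAt at this
      have h3 : HasDerivAt (fun t : ℂ => t - s) 1 s := (hasDerivAt_id s).sub_const _
      have h4 : HasDerivAt (fun t : ℂ => G (wj γ (x + s • Pi.single l 1) θ + t • dirv l))
        (G1 (wj γ (x + s • Pi.single l 1) θ)) (s - s) := by rwa [sub_self]
      have h5 := (HasDerivAt.comp s (h := fun t : ℂ => t - s) h4 h3).mul_const (∏ i, γ' (θ i))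
      rw [mul_one] at h5
      refine h5.congr_of_eventuallyEq (Filter.Eventually.of_forall fun t => ?_)
      simp only [Function.comp, wj_add, add_assoc, ← add_smul, add_sub_cancel])
  simpa [HasLineDerivAt, trans] using this.2

theorem isOpen_sep (k : ℕ) : IsOpen (Sep k) := by
  simp only [Sep, Set.ofPred_forall]
  refine isOpen_iInter_of_finite fun a => isOpen_iInter_of_finite fun b =>
    isOpen_iInter_of_finite fun _ => isOpen_ne_fun (by fun_prop) continuous_const

theorem trans_congr {G H : (JX k → ℂ) → ℂ} {x : Fin (k + 1) → ℂ}
    (h : ∀ θ ∈ box k, G (wj γ x θ) = H (wj γ x θ)) : trans γ γ' G x = trans γ γ' H x :=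
  setIntegral_congr_fun (measurableSet_box k) fun θ hθ => by simp only [h θ hθ]

theorem Good.congr {G H : (JX k → ℂ) → ℂ} {U : Set (Fin (k + 1) → ℂ)} (hG : Good γ γ' U G)
    (hU : IsOpen U) (h : ∀ x ∈ U, ∀ θ ∈ box k, G (wj γ x θ) = H (wj γ x θ)) : Good γ γ' U H := by
  intro x₀ hx₀
  obtain ⟨C, hC⟩ := hG x₀ hx₀
  refine ⟨C, ?_⟩
  filter_upwards [hC, hU.mem_nhds hx₀] with x hx hxU
  refine ⟨hx.1.congr fun θ hθ => by simp only [h x hxU θ hθ], fun θ hθ => ?_⟩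
  rw [← h x hxU θ hθ]; exact hx.2 θ hθ

/-- The transform with the kernel `K` intertwines the Sutherland operators. -/
theorem sutherland_trans {m : ℕ} {κ p : ℂ} (hp : p * (p + 1) = m * (m + 1))
    {K : (JX k → ℂ) → ℂ} {Ψ : (Fin k → ℂ) → ℂ} {Ψ1 Ψ2 : Fin k → (Fin k → ℂ) → ℂ}
    {U : Set (Fin (k + 1) → ℂ)} (hU : IsOpen U)
    (hK : ∀ w ∈ Sep k, ∀ v, HasLineDerivAt ℂ K ((∑ a, v a * ell (eps k) κ p a w) * K w) w v)
    (h1 : ∀ z, sinhVand z ≠ 0 → ∀ i, HasLineDerivAt ℂ Ψ (Ψ1 i z) z (Pi.single i 1))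
    (h2 : ∀ z, sinhVand z ≠ 0 → ∀ i, HasLineDerivAt ℂ (Ψ1 i) (Ψ2 i z) z (Pi.single i 1))
    (hγ : ∀ t ∈ Set.Ioo (0 : ℝ) 1, HasDerivAt γ (γ' t) t)
    (hsep : ∀ x ∈ U, ∀ θ ∈ box k, wj γ x θ ∈ Sep k)
    (g0 : Good γ γ' U (jF K Ψ)) (g1 : ∀ l, Good γ γ' U (jF1 κ p K Ψ Ψ1 l))
    (g2 : ∀ l, Good γ γ' U (jF2 κ p K Ψ Ψ1 Ψ2 l)) (g3 : Good γ γ' U (jF K (sutherland m Ψ)))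
    (g4 : ∀ i, Good γ γ' U (jG κ p K Ψ Ψ1 i))
    (hl : ∀ x ∈ U, ∀ i, ∀ θ ∈ box k, ∃ L,
      Filter.Tendsto (fun t => (fun w => qv κ p i.castSucc w * jF K Ψ w)
        (wj γ x (Function.update θ i t))) (nhdsWithin 0 (Set.Ioi 0)) (nhds L) ∧
      Filter.Tendsto (fun t => (fun w => qv κ p i.castSucc w * jF K Ψ w)
        (wj γ x (Function.update θ i t))) (nhdsWithin 1 (Set.Iio 1)) (nhds L))
    {x : Fin (k + 1) → ℂ} (hx : x ∈ U) :
    sutherland m (trans γ γ' (jF K Ψ)) x =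
      trans γ γ' (jF K (sutherland m Ψ)) x - κ ^ 2 * trans γ γ' (jF K Ψ) x := by
  rw [sutherland_eq (f1 := fun l => trans γ γ' (jF1 κ p K Ψ Ψ1 l))
    (f2 := fun l => trans γ γ' (jF2 κ p K Ψ Ψ1 Ψ2 l)) hU
    (fun y hy l => g0.hasLineDerivAt hU (g1 l)
      (fun x hx θ hθ => hasLineDerivAt_jF hK h1 (hsep x hx θ hθ) l) hy)
    (fun y hy l => (g1 l).hasLineDerivAt hU (g2 l)
      (fun x hx θ hθ => hasLineDerivAt_jF1 hK h1 h2 (hsep x hx θ hθ) l) hy) hx]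
  have hG : ∀ i, trans γ γ' (jG κ p K Ψ Ψ1 i) x = 0 := by
    intro i
    refine integral_box_deriv_eq_zero i
      (h := fun θ => (fun w => qv κ p i.castSucc w * jF K Ψ w) (wj γ x θ) *
        ∏ j ∈ Finset.univ.erase i, γ' (θ j)) ((g4 i).integrableOn hx) ?_ ?_
    · intro θ hθ
      have hprod : ∀ t, ∏ j ∈ Finset.univ.erase i, γ' (Function.update θ i t j) =
          ∏ j ∈ Finset.univ.erase i, γ' (θ j) := fun t =>
        Finset.prod_congr rfl fun j hj => by rw [Function.update_of_ne (Finset.ne_of_mem_erase hj)]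
      simp only [hprod]
      have hwj : ∀ t, wj γ x (Function.update θ i t) =
          wj γ x θ + (γ t - γ (θ i)) • (Pi.single (Sum.inr i) 1 : JX k → ℂ) := by
        intro t; ext a
        rcases a with a | a
        · simp [wj]
        · by_cases h : a = i
          · subst h; simp [wj]
          · simp [wj, h]
      simp only [hwj]
      have hd : HasDerivAt _ _ _ := hasLineDerivAt_jG hK h1 (hsep x hx θ hθ) i
      have hg : HasDerivAt (fun t => γ t - γ (θ i)) (γ' (θ i)) (θ i) :=
        (hγ _ (mem_box.1 hθ i)).sub_const _
      rw [← sub_self (γ (θ i))] at hd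
      have := (HasDerivAt.comp (θ i) (h := fun t => γ t - γ (θ i)) hd hg).mul_const
        (∏ j ∈ Finset.univ.erase i, γ' (θ j))
      refine this.congr_deriv ?_
      rw [mul_assoc, Finset.mul_prod_erase Finset.univ (fun j => γ' (θ j)) (Finset.mem_univ i)]
    · intro θ hθ
      obtain ⟨L, hL0, hL1⟩ := hl x hx i θ hθ
      have hprod : ∀ t, ∏ j ∈ Finset.univ.erase i, γ' (Function.update θ i t j) =
          ∏ j ∈ Finset.univ.erase i, γ' (θ j) := fun t =>
        Finset.prod_congr rfl fun j hj => by rw [Function.update_of_ne (Finset.ne_of_mem_erase hj)]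
      simp only [hprod]
      exact ⟨_, hL0.mul_const _, hL1.mul_const _⟩
  have hint : ∀ {G : (JX k → ℂ) → ℂ}, Good γ γ' U G →
      IntegrableOn (fun θ => G (wj γ x θ) * ∏ i, γ' (θ i)) (box k) := fun h => h.integrableOn hx
  have e : -(∑ l, trans γ γ' (jF2 κ p K Ψ Ψ1 Ψ2 l) x) + pot m x * trans γ γ' (jF K Ψ) x +
      κ ^ 2 * trans γ γ' (jF K Ψ) x = trans γ γ' (jF K (sutherland m Ψ)) x -
        ∑ i, 2 * trans γ γ' (jG κ p K Ψ Ψ1 i) x := by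
    simp only [trans, ← integral_const_mul]
    rw [← integral_finsetSum _ fun l _ => hint (g2 l), ← integral_neg,
      ← integral_finsetSum _ fun i _ => (hint (g4 i)).const_mul 2,
      ← integral_add, ← integral_add, ← integral_sub]
    · refine setIntegral_congr_fun (measurableSet_box k) fun θ hθ => ?_
      have hw := hsep x hx θ hθ
      have hz : sinhVand (wj γ x θ ∘ Sum.inr) ≠ 0 :=
        sinhVand_ne.2 fun i j hij => hw _ _ fun h => hij (Sum.inr_injective h)
      have key := kernel_identity (K := K) (Ψ := Ψ) (Ψ1 := Ψ1) (Ψ2 := Ψ2) (κ := κ) m hp hw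
      have hs : jF K (sutherland m Ψ) (wj γ x θ) = K (wj γ x θ) *
          (-(∑ i, Ψ2 i (wj γ x θ ∘ Sum.inr)) +
            pot m (wj γ x θ ∘ Sum.inr) * Ψ (wj γ x θ ∘ Sum.inr)) := by
        rw [jF, sutherland_eq (LP.isOpen_sinhVand_ne k) h1 h2 hz]
      rw [← hs] at key
      have hx' : wj γ x θ ∘ Sum.inl = x := rfl
      rw [hx'] at key
      simp only [← Finset.sum_mul]
      simp only [← mul_assoc, ← Finset.sum_mul]
      linear_combination (∏ i, γ' (θ i)) * key
    · exact hint g3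
    · exact integrable_finsetSum _ fun i _ => (hint (g4 i)).const_mul 2
    · exact (integrable_finsetSum _ fun l _ => hint (g2 l)).neg.add ((hint g0).const_mul _)
    · exact (hint g0).const_mul _
    · exact (integrable_finsetSum _ fun l _ => hint (g2 l)).neg
    · exact (hint g0).const_mul _
  simp only [hG, mul_zero, Finset.sum_const_zero, sub_zero] at e
  linear_combination e

end Transform
end TrigBA

namespace TrigBA
namespace LP

section Emb
variable {σ τ : Type} [Fintype σ] [Fintype τ]

/-- The change of variables given by an additive map of exponents. -/
def emb (φ : (τ → ℤ) →+ (σ → ℤ)) : LP τ →ₐ[ℂ] LP σ :=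
  AddMonoidAlgebra.lift ℂ (LP σ) (τ → ℤ)
    { toFun := fun μ => AddMonoidAlgebra.single (φ μ.toAdd) 1
      map_one' := by simp [AddMonoidAlgebra.one_def]
      map_mul' := fun a b => by simp [AddMonoidAlgebra.single_mul_single] }

@[simp] theorem emb_single (φ : (τ → ℤ) →+ (σ → ℤ)) (μ : τ → ℤ) (c : ℂ) :
    emb φ (AddMonoidAlgebra.single μ c) = AddMonoidAlgebra.single (φ μ) c := by
  simp [emb]

theorem ev_emb {φ : (τ → ℤ) →+ (σ → ℤ)} {w : σ → ℂ} {y : τ → ℂ}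
    (h : ∀ μ, pair w (φ μ) = pair y μ) (D : LP τ) : ev w (emb φ D) = ev y D := by
  induction D using AddMonoidAlgebra.induction_linear with
  | zero => simp
  | add a b ha hb => simp [ha, hb]
  | single μ c => simp [h]

/-- The exponent map of the inclusion of the first variables. -/
def inlExp : (σ → ℤ) →+ (σ ⊕ τ → ℤ) where
  toFun μ := Sum.elim μ 0
  map_zero' := by ext a; rcases a with a | a <;> rfl
  map_add' a b := by ext i; rcases i with i | i <;> simp

/-- The exponent map of the inclusion of the last variables. -/
def inrExp : (τ → ℤ) →+ (σ ⊕ τ → ℤ) where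
  toFun μ := Sum.elim 0 μ
  map_zero' := by ext a; rcases a with a | a <;> rfl
  map_add' a b := by ext i; rcases i with i | i <;> simp

@[simp] theorem ev_inl (w : σ ⊕ τ → ℂ) (D : LP σ) : ev w (emb inlExp D) = ev (w ∘ Sum.inl) D :=
  ev_emb (fun μ => by simp [pair_apply, inlExp]) D

@[simp] theorem ev_inr (w : σ ⊕ τ → ℂ) (D : LP τ) : ev w (emb inrExp D) = ev (w ∘ Sum.inr) D :=
  ev_emb (fun μ => by simp [pair_apply, inrExp]) D

theorem exists_of_coeff_emb_ne {φ : (τ → ℤ) →+ (σ → ℤ)} {D : LP τ} {μ : σ → ℤ}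
    (h : (emb φ D).coeff μ ≠ 0) : ∃ κ, D.coeff κ ≠ 0 ∧ φ κ = μ := by
  classical
  have e : emb φ D = ∑ κ ∈ D.coeff.support, AddMonoidAlgebra.single (φ κ) (D.coeff κ) := by
    conv_lhs => rw [← AddMonoidAlgebra.sum_coeff_single D]
    simp [Finsupp.sum, map_sum]
  rw [e, AddMonoidAlgebra.coeff_sum, Finsupp.finsetSum_apply] at h
  obtain ⟨κ, hκ, h2⟩ := Finset.exists_ne_zero_of_sum_ne_zero h
  refine ⟨κ, Finsupp.mem_support_iff.1 hκ, ?_⟩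
  by_contra hne
  exact h2 (by simp [AddMonoidAlgebra.coeff_single, hne])

theorem SuppLe.inr {R : ℕ} {D : LP τ} (h : SuppLe R D) :
    SuppLe R (emb (inrExp (σ := σ)) D) := by
  intro μ hμ i
  obtain ⟨κ, hκ, rfl⟩ := exists_of_coeff_emb_ne hμ
  rcases i with i | i
  · simp [inrExp]
  · exact h κ hκ i

end Emb

theorem SuppLe.pow {σ : Type} [Fintype σ] {R : ℕ} {D : LP σ} (h : SuppLe R D) (n : ℕ) :
    SuppLe (n * R) (D ^ n) := by
  induction n with
  | zero => simpa using suppLe_one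
  | succ n ih => rw [pow_succ]; exact (ih.mul h).mono (by ring_nf; omega)

theorem SuppLe.sum {σ ι : Type} [Fintype σ] {R : ℕ} {s : Finset ι} {f : ι → LP σ}
    (h : ∀ i ∈ s, SuppLe R (f i)) : SuppLe R (∑ i ∈ s, f i) := by
  classical
  induction s using Finset.induction_on with
  | empty => intro μ hμ; simp at hμ
  | insert a s ha ih =>
    rw [Finset.sum_insert ha]
    exact (h a (Finset.mem_insert_self a s)).add
      (ih fun i hi => h i (Finset.mem_insert_of_mem hi))

theorem exists_suppLe_Lop (N m : ℕ) : ∃ R₀, ∀ (R : ℕ) (lam : Fin N → ℂ) (M : ℕ) (D : LP (Fin N)),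
    SuppLe R D → SuppLe (R₀ + R) (Lop m lam M D) := by
  obtain ⟨R1, h1⟩ := exists_suppLe (B N)
  obtain ⟨R2, h2⟩ := exists_suppLe (Vn N m)
  refine ⟨R1 + R1 + R2, fun R lam M D hD => ?_⟩
  rw [Lop, neg_add_eq_sub]
  refine SuppLe.sub ((h2.mul hD).mono (by omega)) (SuppLe.sum fun l _ => ?_)
  exact ((hD.qder h1 lam _ M).qder h1 lam _ (M + 1)).mono (by omega)

end LP
open LP

/-- A kernel function that is a quotient of Laurent polynomials. -/
structure KernelRep (k : ℕ) (p : ℂ) (K : ℂ → (JX k → ℂ) → ℂ) (Q : LP (JX k)) (R : ℕ) : Prop where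
  logd : ∀ κ, ∀ w ∈ Sep k, ∀ v, HasLineDerivAt ℂ (K κ) ((∑ a, v a * ell (eps k) κ p a w) * K κ w) w v
  sep : ∀ w ∈ Sep k, ev w Q ≠ 0
  supp : SuppLe R Q
  dvd : ∃ Q', SuppLe R Q' ∧ Q = emb inrExp (B k) * Q'
  rep0 : ∃ N n, SuppLe R N ∧ ∀ κ, ∀ w ∈ Sep k, K κ w = cl Q (fun a => -κ * eps k a) N n w
  repq : ∀ κ (i : Fin k), ∃ N n, SuppLe R N ∧ ∀ w ∈ Sep k,
    qv κ p i.castSucc w * K κ w = cl Q (fun a => -κ * eps k a) N n w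

/-- The exponents of the integrand. -/
def lamJ {k : ℕ} (κ : ℂ) (lam : Fin k → ℂ) (a : JX k) : ℂ := -κ * eps k a + Sum.elim (fun _ => (0 : ℂ)) lam a

theorem mul_cl_inr {k : ℕ} {Q Q' : LP (JX k)} (hQ : Q = emb inrExp (B k) * Q') (κ : ℂ)
    (lam : Fin k → ℂ) (N : LP (JX k)) (n : ℕ) (D : LP (Fin k)) (M : ℕ) {w : JX k → ℂ}
    (hw : ev w Q ≠ 0) :
    cl Q (fun a => -κ * eps k a) N n w * cl (B k) lam D M (w ∘ Sum.inr) =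
      cl Q (lamJ κ lam) (N * (emb inrExp D * Q' ^ M)) (n + M) w := by
  have e : ∑ a, lamJ κ lam a * w a = ∑ a, -κ * eps k a * w a + ∑ i, lam i * (w ∘ Sum.inr) i := by
    simp only [lamJ, add_mul, Finset.sum_add_distrib]
    congr 1
    rw [Fintype.sum_sum_type]; simp
  have h1 : ev w Q = ev (w ∘ Sum.inr) (B k) * ev w Q' := by rw [hQ, map_mul, ev_inr]
  have h2 := hw
  rw [h1] at h2
  have h3 := left_ne_zero_of_mul h2
  have h4 := right_ne_zero_of_mul h2
  simp only [cl, e, Complex.exp_add, map_mul, map_pow, ev_inr, h1]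
  field_simp
  ring

theorem hasLineDerivAt_unique_on_sep {k : ℕ} {f : (JX k → ℂ) → ℂ} {f' : ℂ} {v w : JX k → ℂ}
    {Q : LP (JX k)} {lam : JX k → ℂ} {N : LP (JX k)} {n : ℕ} (hw : w ∈ Sep k) (hQ : ev w Q ≠ 0)
    (hf : ∀ w ∈ Sep k, f w = cl Q lam N n w) (hd : HasLineDerivAt ℂ f f' w v) :
    f' = cl Q lam (qder Q lam v n N) (n + 1) w := by
  refine hd.unique ?_
  refine (hasLineDerivAt_cl Q lam N n v w hQ).congr_of_eventuallyEq ?_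
  filter_upwards [(isOpen_sep k).mem_nhds hw] with y hy using hf y hy

theorem cl_lineDeriv {k : ℕ} (lam : Fin k → ℂ) (D : LP (Fin k)) (M : ℕ) (z : Fin k → ℂ)
    (hz : sinhVand z ≠ 0) (i : Fin k) :
    HasLineDerivAt ℂ (cl (B k) lam D M) (cl (B k) lam (qder (B k) lam (Pi.single i 1) M D) (M + 1) z)
      z (Pi.single i 1) :=
  hasLineDerivAt_cl (B k) lam D M (Pi.single i 1) z (by simpa using hz)

/-- The intertwining property for quotients of Laurent polynomials. -/
theorem sutherland_trans_cl {k m : ℕ} {p : ℂ} {K : ℂ → (JX k → ℂ) → ℂ} {Q : LP (JX k)} {R : ℕ}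
    (hK : KernelRep k p K Q R) (hp : p * (p + 1) = m * (m + 1)) {γ γ' : ℝ → ℂ}
    (hγ : ∀ t ∈ Set.Ioo (0 : ℝ) 1, HasDerivAt γ (γ' t) t) {U : Set (Fin (k + 1) → ℂ)}
    (hU : IsOpen U) (hsep : ∀ x ∈ U, ∀ θ ∈ box k, wj γ x θ ∈ Sep k)
    (κ : ℂ) (lam : Fin k → ℂ) (D : LP (Fin k)) (M RD : ℕ) (hD : SuppLe RD D)
    (hD2 : SuppLe RD (Lop m lam M D))
    (hgood : ∀ N n, SuppLe (R + (RD + (M + 2) * R) + 2 * R) N →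
      Good γ γ' U (cl Q (lamJ κ lam) N n))
    (hl : ∀ x ∈ U, ∀ i, ∀ θ ∈ box k, ∃ L,
      Filter.Tendsto (fun t => (fun w => qv κ p i.castSucc w * jF (K κ) (cl (B k) lam D M) w)
        (wj γ x (Function.update θ i t))) (nhdsWithin 0 (Set.Ioi 0)) (nhds L) ∧
      Filter.Tendsto (fun t => (fun w => qv κ p i.castSucc w * jF (K κ) (cl (B k) lam D M) w)
        (wj γ x (Function.update θ i t))) (nhdsWithin 1 (Set.Iio 1)) (nhds L))
    {x : Fin (k + 1) → ℂ} (hx : x ∈ U) :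
    sutherland m (trans γ γ' (jF (K κ) (cl (B k) lam D M))) x =
      trans γ γ' (jF (K κ) (cl (B k) lam (Lop m lam M D) (M + 2))) x -
        κ ^ 2 * trans γ γ' (jF (K κ) (cl (B k) lam D M)) x := by
  obtain ⟨Q', hQ'R, hQ'⟩ := hK.dvd
  obtain ⟨N0, n0, hN0, hr0⟩ := hK.rep0
  have hF : ∀ (D : LP (Fin k)) (M : ℕ), ∀ w ∈ Sep k, jF (K κ) (cl (B k) lam D M) w =
      cl Q (lamJ κ lam) (N0 * (emb inrExp D * Q' ^ M)) (n0 + M) w := fun D M w hw => by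
    rw [jF, hr0 κ w hw, mul_cl_inr hQ' κ lam N0 n0 D M (hK.sep w hw)]
  have hs0 : ∀ (D : LP (Fin k)) (M' : ℕ), M' ≤ M + 2 → SuppLe RD D →
      SuppLe (R + (RD + (M + 2) * R)) (N0 * (emb inrExp D * Q' ^ M')) := fun D M' hM hD =>
    (hN0.mul (hD.inr.mul (hQ'R.pow M'))).mono (by gcongr)
  have hzw : ∀ w ∈ Sep k, sinhVand (w ∘ Sum.inr) ≠ 0 := fun w hw =>
    sinhVand_ne.2 fun i j hij => hw _ _ fun h => hij (Sum.inr_injective h)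
  have e1 : ∀ l, ∀ w ∈ Sep k, jF1 κ p (K κ) (cl (B k) lam D M) _ l w = _ := fun l w hw =>
    hasLineDerivAt_unique_on_sep hw (hK.sep w hw) (hF D M)
      (hasLineDerivAt_jF (hK.logd κ) (cl_lineDeriv lam D M) hw l)
  have e2 : ∀ l, ∀ w ∈ Sep k, jF2 κ p (K κ) (cl (B k) lam D M) _ _ l w = _ := fun l w hw =>
    hasLineDerivAt_unique_on_sep hw (hK.sep w hw) (e1 l)
      (hasLineDerivAt_jF1 (hK.logd κ) (cl_lineDeriv lam D M)
        (fun z hz i => cl_lineDeriv lam _ (M + 1) z hz i) hw l)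
  have e3 : ∀ w ∈ Sep k, jF (K κ) (sutherland m (cl (B k) lam D M)) w =
      jF (K κ) (cl (B k) lam (Lop m lam M D) (M + 2)) w := fun w hw => by
    rw [jF, jF, sutherland_cl lam D M (hzw w hw)]
  have mono1 : ∀ N : LP (JX k), SuppLe (R + (RD + (M + 2) * R)) N →
      SuppLe (R + (RD + (M + 2) * R) + 2 * R) N := fun N h => h.mono (by omega)
  have key := sutherland_trans (m := m) (κ := κ) (p := p) hp (K := K κ)
    (Ψ := cl (B k) lam D M) hU (hK.logd κ) (cl_lineDeriv lam D M)
    (fun z hz i => cl_lineDeriv lam _ (M + 1) z hz i) hγ hsep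
    ((hgood _ _ (mono1 _ (hs0 D M (by omega) hD))).congr hU
      fun x hx θ hθ => (hF D M _ (hsep x hx θ hθ)).symm)
    (fun l => (hgood _ _ (((hs0 D M (by omega) hD).qder hK.supp _ _ _).mono (by omega))).congr hU
      fun x hx θ hθ => (e1 l _ (hsep x hx θ hθ)).symm)
    (fun l => (hgood _ _ ((((hs0 D M (by omega) hD).qder hK.supp _ _ _).qder
      hK.supp _ _ _).mono (by omega))).congr hU
      fun x hx θ hθ => (e2 l _ (hsep x hx θ hθ)).symm)
    ((hgood _ _ (mono1 _ (hs0 (Lop m lam M D) (M + 2) le_rfl hD2))).congr hU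
      fun x hx θ hθ => ((e3 _ (hsep x hx θ hθ)).trans (hF _ _ _ (hsep x hx θ hθ))).symm)
    (fun i => by
      obtain ⟨Nq, nq, hNq, hq⟩ := hK.repq κ i
      have hqF : ∀ w ∈ Sep k, (fun w => qv κ p i.castSucc w * jF (K κ) (cl (B k) lam D M) w) w =
          cl Q (lamJ κ lam) (Nq * (emb inrExp D * Q' ^ M)) (nq + M) w := fun w hw => by
        simp only [jF]
        rw [← mul_assoc, hq w hw, mul_cl_inr hQ' κ lam Nq nq D M (hK.sep w hw)]
      have hs : SuppLe (R + (RD + (M + 2) * R)) (Nq * (emb inrExp D * Q' ^ M)) :=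
        (hNq.mul (hD.inr.mul (hQ'R.pow M))).mono (by gcongr; omega)
      have e4 : ∀ w ∈ Sep k, jG κ p (K κ) (cl (B k) lam D M) _ i w = _ := fun w hw =>
        hasLineDerivAt_unique_on_sep hw (hK.sep w hw) hqF
          (hasLineDerivAt_jG (hK.logd κ) (cl_lineDeriv lam D M) hw i)
      exact (hgood _ _ ((hs.qder hK.supp _ _ _).mono (by omega))).congr
        hU fun x hx θ hθ => (e4 _ (hsep x hx θ hθ)).symm)
    hl hx
  rw [key]
  congr 1
  exact trans_congr fun θ hθ => e3 _ (hsep x hx θ hθ)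

end TrigBA

namespace TrigBA
namespace LP

section
variable {σ τ : Type} [Fintype σ] [Fintype τ] [DecidableEq σ] [DecidableEq τ]

theorem S_swap (a b : σ) : S a b = -S b a := by
  simp only [S, neg_add, ← AddMonoidAlgebra.single_neg]
  rw [add_comm]
  norm_num

@[simp] theorem emb_inl_S (a b : σ) : emb (inlExp (τ := τ)) (S a b) = S (Sum.inl a) (Sum.inl b) := by
  have h : ∀ a b : σ, inlExp (τ := τ) (rt a b) = rt (Sum.inl a) (Sum.inl b) := by
    intro a b; ext i
    rcases i with i | i
    · simp [inlExp, rt, Pi.single_apply]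
    · simp [inlExp, rt]
  simp [S, h]

@[simp] theorem emb_inr_S (a b : τ) : emb (inrExp (σ := σ)) (S a b) = S (Sum.inr a) (Sum.inr b) := by
  have h : ∀ a b : τ, inrExp (σ := σ) (rt a b) = rt (Sum.inr a) (Sum.inr b) := by
    intro a b; ext i
    rcases i with i | i
    · simp [inrExp, rt]
    · simp [inrExp, rt, Pi.single_apply]
  simp [S, h]

theorem S_dvd_B {N : ℕ} {a b : Fin N} (h : a ≠ b) : S a b ∣ B N := by
  have key : ∀ {a b : Fin N}, a < b → S a b ∣ B N := fun {a b} h1 => by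
    have hm : (a, b) ∈ prs N := mem_prs.2 h1
    exact ⟨_, (S_mul_Bc hm).symm⟩
  rcases lt_or_gt_of_ne h with h1 | h1
  · exact key h1
  · rw [S_swap]
    exact (neg_dvd).2 (key h1)

end

/-- `∏ sinh (z_i - x_l)`. -/
def X (k : ℕ) : LP (JX k) := ∏ q : Fin k × Fin (k + 1), S (Sum.inr q.1) (Sum.inl q.2)

/-- `B(x)` as a function of the joint variables. -/
def Bx (k : ℕ) : LP (JX k) := emb inlExp (B (k + 1))

/-- `B(z)` as a function of the joint variables. -/
def Bz (k : ℕ) : LP (JX k) := emb inrExp (B k)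

end LP
open LP

variable {k : ℕ}

theorem ev_Bx (w : JX k → ℂ) : ev w (Bx k) = ∏ q ∈ prs (k + 1), Complex.sinh (w (Sum.inl q.1) - w (Sum.inl q.2)) := by
  simp [Bx, sinhVand_eq]

theorem ev_Bz (w : JX k → ℂ) : ev w (Bz k) = ∏ q ∈ prs k, Complex.sinh (w (Sum.inr q.1) - w (Sum.inr q.2)) := by
  simp [Bz, sinhVand_eq]

theorem ev_X (w : JX k → ℂ) : ev w (X k) = ∏ q : Fin k × Fin (k + 1), Complex.sinh (w (Sum.inr q.1) - w (Sum.inl q.2)) := by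
  simp [X]

theorem ev_Bx_ne {w : JX k → ℂ} (hw : w ∈ Sep k) : ev w (Bx k) ≠ 0 := by
  rw [ev_Bx]
  exact Finset.prod_ne_zero_iff.2 fun q hq => hw _ _ fun h => (mem_prs.1 hq).ne (Sum.inl_injective h)

theorem ev_Bz_ne {w : JX k → ℂ} (hw : w ∈ Sep k) : ev w (Bz k) ≠ 0 := by
  rw [ev_Bz]
  exact Finset.prod_ne_zero_iff.2 fun q hq => hw _ _ fun h => (mem_prs.1 hq).ne (Sum.inr_injective h)

theorem ev_X_ne {w : JX k → ℂ} (hw : w ∈ Sep k) : ev w (X k) ≠ 0 := by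
  rw [ev_X]
  exact Finset.prod_ne_zero_iff.2 fun q _ => hw _ _ (by simp)

/-- The kernel function. -/
def ker (k : ℕ) (p : ℤ) (κ : ℂ) (w : JX k → ℂ) : ℂ :=
  Complex.exp (∑ a, -κ * eps k a * w a) * (ev w (X k) / (ev w (Bx k) * ev w (Bz k))) ^ p

theorem hasLineDerivAt_log_sinh {σ : Type} {v w : σ → ℂ} {a b : σ}
    (h : Complex.sinh (w a - w b) ≠ 0) :
    HasLineDerivAt ℂ (fun w => Complex.sinh (w a - w b))
      ((v a - v b) * coth (w a - w b) * Complex.sinh (w a - w b)) w v := by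
  unfold HasLineDerivAt
  have h1 : HasDerivAt (fun t : ℂ => (w + t • v) a - (w + t • v) b) (v a - v b) 0 := by
    simpa using (((hasDerivAt_id (0 : ℂ)).mul_const (v a)).const_add (w a)).fun_sub
      (((hasDerivAt_id (0 : ℂ)).mul_const (v b)).const_add (w b))
  refine h1.csinh.congr_deriv ?_
  simp only [zero_smul, add_zero, coth]
  field_simp

theorem HasLineDerivAt.log_prod {σ ι : Type} {v w : σ → ℂ} {s : Finset ι} {f : ι → (σ → ℂ) → ℂ}
    {c : ι → ℂ} (h : ∀ i ∈ s, HasLineDerivAt ℂ (f i) (c i * f i w) w v) :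
    HasLineDerivAt ℂ (fun w => ∏ i ∈ s, f i w) ((∑ i ∈ s, c i) * ∏ i ∈ s, f i w) w v := by
  classical
  induction s using Finset.induction_on with
  | empty => simpa [HasLineDerivAt] using hasDerivAt_const (0 : ℂ) (1 : ℂ)
  | insert a s ha ih =>
    simp only [Finset.prod_insert ha, Finset.sum_insert ha]
    have h1 : HasDerivAt _ _ _ := h a (Finset.mem_insert_self a s)
    have h2 : HasDerivAt _ _ _ := ih fun i hi => h i (Finset.mem_insert_of_mem hi)
    refine (h1.fun_mul h2).congr_deriv ?_
    simp only [zero_smul, add_zero]; ring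

theorem sum_mul_ell (κ p : ℂ) (v w : JX k → ℂ) :
    ∑ a, v a * ell (eps k) κ p a w = ∑ a, -κ * eps k a * v a +
      p * (∑ q : Fin k × Fin (k + 1), (v (Sum.inr q.1) - v (Sum.inl q.2)) *
          coth (w (Sum.inr q.1) - w (Sum.inl q.2)) -
        (∑ q ∈ prs (k + 1), (v (Sum.inl q.1) - v (Sum.inl q.2)) *
          coth (w (Sum.inl q.1) - w (Sum.inl q.2)) +
         ∑ q ∈ prs k, (v (Sum.inr q.1) - v (Sum.inr q.2)) *
          coth (w (Sum.inr q.1) - w (Sum.inr q.2)))) := by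
  have e1 : ∑ a, v a * ell (eps k) κ p a w = ∑ a, -κ * eps k a * v a -
      p * ∑ a, ∑ b, eps k a * eps k b * v a * coth (w a - w b) := by
    simp only [ell, Finset.mul_sum, ← Finset.sum_sub_distrib]
    refine Finset.sum_congr rfl fun a _ => ?_
    rw [mul_left_comm, mul_add, mul_add, Finset.mul_sum, Finset.mul_sum, sub_eq_add_neg]
    congr 1
    · ring
    · rw [← Finset.sum_neg_distrib]
      exact Finset.sum_congr rfl fun b _ => by ring
  have e2 : ∀ {N : ℕ} (y u : Fin N → ℂ), ∑ i, ∑ j, u i * coth (y i - y j) =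
      ∑ q ∈ prs N, (u q.1 - u q.2) * coth (y q.1 - y q.2) := by
    intro N y u
    have h1 : ∑ i, ∑ j, (u i - u j) * coth (y i - y j) = 2 * ∑ i, ∑ j, u i * coth (y i - y j) := by
      simp only [sub_mul, Finset.sum_sub_distrib]
      have : ∑ i, ∑ j, u j * coth (y i - y j) = -∑ i, ∑ j, u i * coth (y i - y j) := by
        rw [Finset.sum_comm, ← Finset.sum_neg_distrib]
        refine Finset.sum_congr rfl fun i _ => ?_
        rw [← Finset.sum_neg_distrib]
        exact Finset.sum_congr rfl fun j _ => by rw [coth_sub]; ring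
      rw [this]; ring
    have h2 := sum_ordered (fun i j => (u i - u j) * coth (y i - y j))
      (fun i j => by rw [coth_sub]; ring) (by simp)
    rw [h1] at h2
    exact mul_left_cancel₀ two_ne_zero h2
  have e3 : ∑ i : Fin k, ∑ l : Fin (k + 1), (v (Sum.inr i) - v (Sum.inl l)) *
      coth (w (Sum.inr i) - w (Sum.inl l)) =
      ∑ i : Fin k, ∑ l : Fin (k + 1), v (Sum.inr i) * coth (w (Sum.inr i) - w (Sum.inl l)) +
      ∑ l : Fin (k + 1), ∑ i : Fin k, v (Sum.inl l) * coth (w (Sum.inl l) - w (Sum.inr i)) := by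
    rw [Finset.sum_comm (s := (Finset.univ : Finset (Fin (k + 1))))]
    simp only [← Finset.sum_add_distrib]
    refine Finset.sum_congr rfl fun i _ => Finset.sum_congr rfl fun l _ => ?_
    rw [coth_sub (w (Sum.inl l))]; ring
  rw [e1, Fintype.sum_prod_type, e3, ← e2 (fun i => w (Sum.inl i)) (fun i => v (Sum.inl i)),
    ← e2 (fun i => w (Sum.inr i)) (fun i => v (Sum.inr i))]
  simp only [Fintype.sum_sum_type, eps_inl, eps_inr, Finset.sum_add_distrib, neg_mul, one_mul,
    mul_neg, mul_one, Finset.sum_neg_distrib]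
  ring

theorem hasLineDerivAt_ker (p : ℤ) (κ : ℂ) {w : JX k → ℂ} (hw : w ∈ Sep k) (v : JX k → ℂ) :
    HasLineDerivAt ℂ (ker k p κ) ((∑ a, v a * ell (eps k) κ p a w) * ker k p κ w) w v := by
  have hX : HasDerivAt _ _ _ := HasLineDerivAt.log_prod (v := v) (w := w) (s := Finset.univ)
    fun (q : Fin k × Fin (k + 1)) _ =>
      hasLineDerivAt_log_sinh (v := v) (hw (Sum.inr q.1) (Sum.inl q.2) (by simp))
  have hBx : HasDerivAt _ _ _ := HasLineDerivAt.log_prod (v := v) (w := w) (s := prs (k + 1))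
    fun q hq => hasLineDerivAt_log_sinh (v := v) (hw (Sum.inl q.1) (Sum.inl q.2)
      fun h => (mem_prs.1 hq).ne (Sum.inl_injective h))
  have hBz : HasDerivAt _ _ _ := HasLineDerivAt.log_prod (v := v) (w := w) (s := prs k)
    fun q hq => hasLineDerivAt_log_sinh (v := v) (hw (Sum.inr q.1) (Sum.inr q.2)
      fun h => (mem_prs.1 hq).ne (Sum.inr_injective h))
  simp only [← ev_X] at hX
  simp only [← ev_Bx] at hBx
  simp only [← ev_Bz] at hBz
  have h1 : HasDerivAt (fun s : ℂ => ∑ a, -κ * eps k a * (w + s • v) a)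
      (∑ a, -κ * eps k a * v a) 0 := by
    refine HasDerivAt.fun_sum fun a _ => ?_
    simpa using (((hasDerivAt_id (0 : ℂ)).mul_const (v a)).const_add (w a)).const_mul
      (-κ * eps k a)
  have nX := ev_X_ne hw
  have nBx := ev_Bx_ne hw
  have nBz := ev_Bz_ne hw
  have h2 := hX.fun_div (hBx.fun_mul hBz) (by simpa using ⟨nBx, nBz⟩)
  have h3 := (hasDerivAt_zpow p (ev w (X k) / (ev w (Bx k) * ev w (Bz k)))
    (Or.inl (div_ne_zero nX (mul_ne_zero nBx nBz))))
  have h4 := HasDerivAt.comp (0 : ℂ) (h := fun t : ℂ => ev (w + t • v) (X k) /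
    (ev (w + t • v) (Bx k) * ev (w + t • v) (Bz k))) (by simpa using h3) h2
  refine (h1.cexp.fun_mul h4).congr_deriv ?_
  rw [sum_mul_ell]
  simp only [zero_smul, add_zero, Function.comp, ker]
  have hz : (ev w (X k) / (ev w (Bx k) * ev w (Bz k))) ^ p =
      (ev w (X k) / (ev w (Bx k) * ev w (Bz k))) ^ (p - 1) *
        (ev w (X k) / (ev w (Bx k) * ev w (Bz k))) := by
    rw [zpow_sub_one₀ (div_ne_zero nX (mul_ne_zero nBx nBz))]
    field_simp
  rw [hz]
  field_simp

theorem qv_ker (κ p : ℂ) (i : Fin k) (w : JX k → ℂ) :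
    qv κ p i.castSucc w = p * ∑ b ∈ Finset.univ.filter (fun b => b ≠ Sum.inl i.castSucc ∧ b ≠ Sum.inr i),
      eps k b * (coth (w (Sum.inl i.castSucc) - w b) - coth (w (Sum.inr i) - w b)) := by
  have h : ∑ b, eps k b * (coth (w (Sum.inl i.castSucc) - w b) - coth (w (Sum.inr i) - w b)) =
      ∑ b ∈ Finset.univ.filter (fun b => b ≠ Sum.inl i.castSucc ∧ b ≠ Sum.inr i),
      eps k b * (coth (w (Sum.inl i.castSucc) - w b) - coth (w (Sum.inr i) - w b)) := by
    rw [← Finset.sum_filter_add_sum_filter_not _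
      (fun b => b ≠ Sum.inl i.castSucc ∧ b ≠ Sum.inr i)]
    have : Finset.univ.filter (fun b : JX k => ¬(b ≠ Sum.inl i.castSucc ∧ b ≠ Sum.inr i)) =
        {Sum.inl i.castSucc, Sum.inr i} := by
      ext b; simp only [Finset.mem_filter, Finset.mem_univ, true_and, Finset.mem_insert,
        Finset.mem_singleton]; tauto
    rw [this, Finset.sum_pair (by simp)]
    simp only [eps_inl, eps_inr, sub_self, coth_zero]
    rw [coth_sub (w (Sum.inr i))]; ring
  rw [← h, qv, sum_dirv_mul, ext0_castSucc, ell, ell, eps_inl, eps_inr]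
  simp only [mul_sub, Finset.sum_sub_distrib]
  ring

end TrigBA

namespace TrigBA
open LP
variable {k : ℕ}

/-- Functions of the form `cl Q lam N n` with `N` in the ideal `I`. -/
def IsCl (Q : LP (JX k)) (lam : JX k → ℂ) (I : Ideal (LP (JX k))) (f : (JX k → ℂ) → ℂ) : Prop :=
  ∃ N ∈ I, ∃ n, ∀ w ∈ Sep k, f w = cl Q lam N n w

section IsCl
variable {Q : LP (JX k)} {lam : JX k → ℂ} {I : Ideal (LP (JX k))} {f g : (JX k → ℂ) → ℂ}

theorem IsCl.add (hQ : ∀ w ∈ Sep k, ev w Q ≠ 0) (hf : IsCl Q lam I f) (hg : IsCl Q lam I g) :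
    IsCl Q lam I fun w => f w + g w := by
  obtain ⟨N, hN, n, h⟩ := hf
  obtain ⟨N', hN', n', h'⟩ := hg
  refine ⟨Q ^ n' * N + Q ^ n * N', I.add_mem (I.mul_mem_left _ hN) (I.mul_mem_left _ hN'), n + n',
    fun w hw => ?_⟩
  beta_reduce
  rw [h w hw, h' w hw, cl_add, cl_mul_pow _ _ _ _ _ _ (hQ w hw), add_comm n n',
    cl_mul_pow _ _ _ _ _ _ (hQ w hw)]

theorem IsCl.const_mul (hf : IsCl Q lam I f) (c : ℂ) : IsCl Q lam I fun w => c * f w := by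
  obtain ⟨N, hN, n, h⟩ := hf
  refine ⟨c • N, ?_, n, fun w hw => by beta_reduce; rw [h w hw, cl_smul]⟩
  rw [Algebra.smul_def]; exact I.mul_mem_left _ hN

theorem IsCl.sum (hQ : ∀ w ∈ Sep k, ev w Q ≠ 0) {ι : Type} (s : Finset ι)
    {f : ι → (JX k → ℂ) → ℂ} (h : ∀ i ∈ s, IsCl Q lam I (f i)) :
    IsCl Q lam I fun w => ∑ i ∈ s, f i w := by
  classical
  induction s using Finset.induction_on with
  | empty => exact ⟨0, I.zero_mem, 0, fun w _ => by simp [cl]⟩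
  | insert a s ha ih =>
    simp only [Finset.sum_insert ha]
    exact (h a (Finset.mem_insert_self a s)).add hQ
      (ih fun i hi => h i (Finset.mem_insert_of_mem hi))

theorem IsCl.coth_mul_of_dvd (hQ : ∀ w ∈ Sep k, ev w Q ≠ 0) (hf : IsCl Q lam I f) {a b : JX k}
    (h : S a b ∣ Q) : IsCl Q lam I fun w => coth (w a - w b) * f w := by
  obtain ⟨N, hN, n, hf⟩ := hf
  obtain ⟨C, hC⟩ := h
  refine ⟨Ch a b * C * N, I.mul_mem_left _ hN, n + 1, fun w hw => ?_⟩
  have h1 := hQ w hw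
  have h2 : ev w Q = Complex.sinh (w a - w b) * ev w C := by rw [hC, map_mul, ev_S]
  rw [h2] at h1
  have h3 := left_ne_zero_of_mul h1
  have h4 := right_ne_zero_of_mul h1
  beta_reduce
  rw [hf w hw]
  simp only [cl, map_mul, ev_Ch, coth, h2]
  field_simp
  ring

theorem IsCl.coth_mul_of_num {a b : JX k} (hab : a ≠ b) {N C : LP (JX k)} (hN : N = S a b * C)
    (hC : C ∈ I) {n : ℕ} (hf : ∀ w ∈ Sep k, f w = cl Q lam N n w) :
    IsCl Q lam I fun w => coth (w a - w b) * f w := by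
  refine ⟨Ch a b * C, I.mul_mem_left _ hC, n, fun w hw => ?_⟩
  have h3 := hw a b hab
  beta_reduce
  rw [hf w hw, hN]
  simp only [cl, map_mul, ev_Ch, ev_S, coth]
  field_simp

theorem IsCl.swap {a b : JX k} (hf : IsCl Q lam I fun w => coth (w a - w b) * f w) :
    IsCl Q lam I fun w => coth (w b - w a) * f w := by
  have := hf.const_mul (-1)
  obtain ⟨N, hN, n, h⟩ := this
  exact ⟨N, hN, n, fun w hw => by
    beta_reduce; rw [← h w hw, coth_sub (w b)]; ring⟩

end IsCl

theorem isCl_qv {Q : LP (JX k)} {lam : JX k → ℂ} {I : Ideal (LP (JX k))}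
    (hQ : ∀ w ∈ Sep k, ev w Q ≠ 0) (κ p : ℂ) (i : Fin k) {f : (JX k → ℂ) → ℂ}
    (h : ∀ a b, a ≠ b → ¬(a = Sum.inl i.castSucc ∧ b = Sum.inr i) →
      ¬(a = Sum.inr i ∧ b = Sum.inl i.castSucc) → IsCl Q lam I fun w => coth (w a - w b) * f w) :
    IsCl Q lam I fun w => qv κ p i.castSucc w * f w := by
  have h1 := (IsCl.sum hQ (Finset.univ.filter fun b : JX k => b ≠ Sum.inl i.castSucc ∧ b ≠ Sum.inr i)
    (f := fun b w => eps k b * (coth (w (Sum.inl i.castSucc) - w b) * f w) +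
      -eps k b * (coth (w (Sum.inr i) - w b) * f w)) fun b hb => by
      have hb' := (Finset.mem_filter.1 hb).2
      exact ((h _ _ (Ne.symm hb'.1) (fun h => hb'.2 h.2) (fun h => by simpa using h.1)).const_mul _).add hQ
        ((h _ _ (Ne.symm hb'.2) (fun h => by simpa using h.1) (fun h => hb'.1 h.2)).const_mul _)).const_mul p
  obtain ⟨N, hN, n, h2⟩ := h1
  refine ⟨N, hN, n, fun w hw => ?_⟩
  beta_reduce
  rw [← h2 w hw, qv_ker, mul_assoc, Finset.sum_mul]
  congr 1
  exact Finset.sum_congr rfl fun b _ => by ring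

/-- The denominators for the kernel with positive exponent. -/
def Qst (k : ℕ) : LP (JX k) := Bz k * Bx k

/-- The denominators for the kernel with negative exponent. -/
def Qt (k : ℕ) : LP (JX k) := Bz k * (Bx k * X k)

theorem ev_Qst_ne {w : JX k → ℂ} (hw : w ∈ Sep k) : ev w (Qst k) ≠ 0 := by
  rw [Qst, map_mul]; exact mul_ne_zero (ev_Bz_ne hw) (ev_Bx_ne hw)

theorem ev_Qt_ne {w : JX k → ℂ} (hw : w ∈ Sep k) : ev w (Qt k) ≠ 0 := by
  rw [Qt, map_mul, map_mul]
  exact mul_ne_zero (ev_Bz_ne hw) (mul_ne_zero (ev_Bx_ne hw) (ev_X_ne hw))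

theorem S_inl_dvd {a b : Fin (k + 1)} (h : a ≠ b) : S (Sum.inl a) (Sum.inl b) ∣ Bx k := by
  rw [← emb_inl_S]; exact map_dvd _ (S_dvd_B h)

theorem S_inr_dvd {a b : Fin k} (h : a ≠ b) : S (Sum.inr a) (Sum.inr b) ∣ Bz k := by
  rw [← emb_inr_S]; exact map_dvd _ (S_dvd_B h)

theorem S_dvd_X (i : Fin k) (l : Fin (k + 1)) : S (Sum.inr i) (Sum.inl l) ∣ X k :=
  ⟨_, (Finset.mul_prod_erase Finset.univ
    (fun q : Fin k × Fin (k + 1) => S (Sum.inr q.1) (Sum.inl q.2)) (Finset.mem_univ (i, l))).symm⟩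

theorem S_dvd_Qt {a b : JX k} (h : a ≠ b) : S a b ∣ Qt k := by
  rcases a with a | a <;> rcases b with b | b
  · exact ((S_inl_dvd fun e => h (by rw [e])).mul_right _).mul_left _
  · rw [S_swap]; exact neg_dvd.2 (((S_dvd_X b a).mul_left _).mul_left _)
  · exact ((S_dvd_X a b).mul_left _).mul_left _
  · exact (S_inr_dvd fun e => h (by rw [e])).mul_right _

theorem ker_eq_st (m : ℕ) (κ : ℂ) {w : JX k → ℂ} (hw : w ∈ Sep k) :
    ker k m κ w = cl (Qst k) (fun a => -κ * eps k a) (X k ^ m) m w := by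
  have h1 := ev_Bx_ne hw
  have h2 := ev_Bz_ne hw
  simp only [ker, cl, Qst, map_mul, map_pow, zpow_natCast, div_pow]
  field_simp

theorem ker_eq_t (m : ℕ) (κ : ℂ) {w : JX k → ℂ} (hw : w ∈ Sep k) :
    ker k (-(m + 1 : ℕ)) κ w =
      cl (Qt k) (fun a => -κ * eps k a) ((Bx k * Bz k) ^ (2 * (m + 1))) (m + 1) w := by
  have h1 := ev_Bx_ne hw
  have h2 := ev_Bz_ne hw
  have h3 := ev_X_ne hw
  simp only [ker, cl, Qt, map_mul, map_pow, zpow_neg, zpow_natCast, div_pow]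
  field_simp
  ring

theorem isCl_qv_st {m : ℕ} (hm : 0 < m) (κ p : ℂ) (i : Fin k) :
    IsCl (Qst k) (fun a => -κ * eps k a) (Ideal.span {S (Sum.inr i) (Sum.inl i.castSucc)})
      fun w => qv κ p i.castSucc w * ker k m κ w := by
  obtain ⟨m, rfl⟩ := Nat.exists_eq_succ_of_ne_zero hm.ne'
  have hd : S (Sum.inr i) (Sum.inl i.castSucc) ∣ X k ^ (m + 1) :=
    (S_dvd_X i i.castSucc).trans (dvd_pow_self _ (by omega))
  have hK : IsCl (Qst k) (fun a => -κ * eps k a) (Ideal.span {S (Sum.inr i) (Sum.inl i.castSucc)})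
      (ker k (m + 1 : ℕ) κ) := ⟨_, Ideal.mem_span_singleton.2 hd, _, fun w hw => ker_eq_st (m + 1) κ hw⟩
  have hcross : ∀ j l, ¬(j = i ∧ l = i.castSucc) → IsCl (Qst k) (fun a => -κ * eps k a)
      (Ideal.span {S (Sum.inr i) (Sum.inl i.castSucc)})
      fun w => coth (w (Sum.inr j) - w (Sum.inl l)) * ker k (m + 1 : ℕ) κ w := by
    intro j l hjl
    have hX : X k = S (Sum.inr j) (Sum.inl l) * ∏ q ∈ Finset.univ.erase (j, l),
        S (Sum.inr q.1) (Sum.inl q.2) :=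
      (Finset.mul_prod_erase _ (fun q : Fin k × Fin (k + 1) => S (Sum.inr q.1) (Sum.inl q.2))
        (Finset.mem_univ (j, l))).symm
    have hmem : (i, i.castSucc) ∈ (Finset.univ : Finset (Fin k × Fin (k + 1))).erase (j, l) := by
      simp only [Finset.mem_erase, Finset.mem_univ, and_true, ne_eq, Prod.mk.injEq]
      exact fun h => hjl ⟨h.1.symm, h.2.symm⟩
    refine IsCl.coth_mul_of_num (by simp) (N := X k ^ (m + 1))
      (C := (∏ q ∈ Finset.univ.erase (j, l), S (Sum.inr q.1) (Sum.inl q.2)) * X k ^ m)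
      (by rw [pow_succ', ← mul_assoc, ← hX]) ?_ fun w hw => ker_eq_st (m + 1) κ hw
    refine Ideal.mul_mem_right _ _ (Ideal.mem_span_singleton.2 ?_)
    exact ⟨_, (Finset.mul_prod_erase _
      (fun q : Fin k × Fin (k + 1) => S (Sum.inr q.1) (Sum.inl q.2)) hmem).symm⟩
  refine isCl_qv (fun w hw => ev_Qst_ne hw) κ p i fun a b hab h1 h2 => ?_
  rcases a with a | a <;> rcases b with b | b
  · exact hK.coth_mul_of_dvd (fun w hw => ev_Qst_ne hw)
      ((S_inl_dvd fun e => hab (by rw [e])).mul_left _)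
  · exact (hcross b a fun h => h1 ⟨by rw [h.2], by rw [h.1]⟩).swap
  · exact hcross a b fun h => h2 ⟨by rw [h.1], by rw [h.2]⟩
  · exact hK.coth_mul_of_dvd (fun w hw => ev_Qst_ne hw)
      ((S_inr_dvd fun e => hab (by rw [e])).mul_right _)

theorem isCl_qv_t (m : ℕ) (κ p : ℂ) (i : Fin k) :
    IsCl (Qt k) (fun a => -κ * eps k a) ⊤
      fun w => qv κ p i.castSucc w * ker k (-(m + 1 : ℕ)) κ w :=
  isCl_qv (fun _ hw => ev_Qt_ne hw) κ p i fun _ _ hab _ _ =>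
    IsCl.coth_mul_of_dvd (fun _ hw => ev_Qt_ne hw)
      ⟨_, Submodule.mem_top, _, fun _ hw => ker_eq_t m κ hw⟩ (S_dvd_Qt hab)

theorem cl_indep {Q : LP (JX k)} {κ κ' : ℂ} {N : LP (JX k)} {n : ℕ} {w : JX k → ℂ}
    {p : ℤ} {i : Fin k}
    (h : qv κ p i.castSucc w * ker k p κ w = cl Q (fun a => -κ * eps k a) N n w) :
    qv κ' p i.castSucc w * ker k p κ' w = cl Q (fun a => -κ' * eps k a) N n w := by
  have e : qv κ' p i.castSucc w = qv κ p i.castSucc w := by rw [qv_ker, qv_ker]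
  have h0 := Complex.exp_ne_zero (∑ a, -κ * eps k a * w a)
  simp only [ker, cl] at h ⊢
  rw [e]
  rw [mul_left_comm, mul_div_assoc] at h
  have := mul_left_cancel₀ h0 h
  rw [mul_left_comm, this, mul_div_assoc]

/-- A kernel function, with a uniform bound for all exponents. -/
theorem exists_kernelRep {p : ℤ} {Q : LP (JX k)} {I : Fin k → Ideal (LP (JX k))}
    (hQ : ∀ w ∈ Sep k, ev w Q ≠ 0) {Q' : LP (JX k)} (hQ' : Q = Bz k * Q')
    (h0 : ∃ N n, ∀ κ, ∀ w ∈ Sep k, ker k p κ w = cl Q (fun a => -κ * eps k a) N n w)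
    (hq : ∀ i : Fin k, IsCl Q (fun a => -0 * eps k a) (I i)
      fun w => qv 0 p i.castSucc w * ker k p 0 w) :
    ∃ R, KernelRep k p (ker k p) Q R ∧ ∀ i : Fin k, ∃ N ∈ I i, ∃ n, ∀ κ, ∀ w ∈ Sep k,
      qv κ p i.castSucc w * ker k p κ w = cl Q (fun a => -κ * eps k a) N n w := by
  obtain ⟨N, n, h0⟩ := h0
  choose Nq hNq nq hq using hq
  obtain ⟨R1, h1⟩ := exists_suppLe Q
  obtain ⟨R2, h2⟩ := exists_suppLe Q'
  obtain ⟨R3, h3⟩ := exists_suppLe N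
  choose Rq h4 using fun i => exists_suppLe (Nq i)
  refine ⟨R1 + R2 + R3 + ∑ i, Rq i, ⟨fun κ w hw v => hasLineDerivAt_ker p κ hw v, hQ,
    h1.mono (by omega), ⟨Q', h2.mono (by omega), hQ'⟩, ⟨N, n, h3.mono (by omega), h0⟩,
    fun κ i => ⟨Nq i, nq i, (h4 i).mono ?_, fun w hw => ?_⟩⟩,
    fun i => ⟨Nq i, hNq i, nq i, fun κ w hw => ?_⟩⟩
  · have := Finset.single_le_sum (f := Rq) (fun _ _ => Nat.zero_le _) (Finset.mem_univ i)
    omega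
  · exact cl_indep (hq i w hw)
  · exact cl_indep (hq i w hw)

end TrigBA

namespace TrigBA
open LP

/-! ### Integrals over small circles -/

theorem sinh_ne_zero_of_norm {s : ℂ} (h0 : s ≠ 0) (h : ‖s‖ ≤ 1) : Complex.sinh s ≠ 0 := by
  intro hs
  have e : Complex.exp s = Complex.exp (-s) := by
    rw [Complex.sinh, div_eq_zero_iff] at hs
    exact sub_eq_zero.1 (hs.resolve_right two_ne_zero)
  obtain ⟨n, hn⟩ := Complex.exp_eq_exp_iff_exists_int.1 e
  have h2 : s = n * (Real.pi * Complex.I) := by linear_combination hn / 2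
  have h3 : ‖s‖ = |(n : ℝ)| * Real.pi := by
    rw [h2]; simp [abs_of_pos Real.pi_pos]
  have hn0 : n ≠ 0 := by rintro rfl; exact h0 (by simpa using h2)
  have h4 : (1 : ℝ) ≤ |(n : ℝ)| := by exact_mod_cast Int.one_le_abs hn0
  have := Real.pi_gt_three
  nlinarith

theorem circle_integral_div_sinh {ε : ℝ} (hε : 0 < ε) (hε1 : ε ≤ 1) {h h' : ℂ → ℂ}
    (hd : ∀ s ∈ Metric.closedBall (0 : ℂ) ε, HasDerivAt h (h' s) s) :
    (∮ s in C(0, ε), h s / Complex.sinh s) = 2 * Real.pi * Complex.I * h 0 := by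
  have hne : ∀ s ∈ Metric.closedBall (0 : ℂ) ε, dslope Complex.sinh 0 s ≠ 0 := by
    intro s hs
    by_cases h0 : s = 0
    · subst h0; simp [dslope_same]
    · rw [dslope_of_ne _ h0, slope_def_field]
      refine div_ne_zero ?_ (by simpa using h0)
      rw [Complex.sinh_zero, sub_zero]
      exact sinh_ne_zero_of_norm h0 (by
        rw [Metric.mem_closedBall, dist_zero_right] at hs; linarith)
  have hcont : ContinuousOn (dslope Complex.sinh 0) (Metric.closedBall (0 : ℂ) ε) := by
    rw [continuousOn_dslope (Metric.closedBall_mem_nhds 0 hε)]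
    exact ⟨Complex.continuous_sinh.continuousOn, (Complex.differentiable_sinh 0)⟩
  have key := Complex.circleIntegral_sub_inv_smul_of_differentiable_on_off_countable
    (s := {0}) (c := (0 : ℂ)) (w := 0) (R := ε) (f := fun s => h s / dslope Complex.sinh 0 s)
    (Set.countable_singleton 0) (Metric.mem_ball_self hε)
    (ContinuousOn.div (fun s hs => (hd s hs).continuousAt.continuousWithinAt) hcont hne)
    (fun s hs => by
      have h0 : s ≠ 0 := by simpa using hs.2
      refine ((hd s (Metric.ball_subset_closedBall hs.1)).differentiableAt).div ?_
        (hne s (Metric.ball_subset_closedBall hs.1))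
      rw [differentiableAt_dslope_of_ne h0]
      exact Complex.differentiable_sinh s)
  have h00 : dslope Complex.sinh 0 0 = 1 := by simp [dslope_same]
  rw [h00, div_one, smul_eq_mul] at key
  rw [← key]
  refine circleIntegral.integral_congr hε.le fun s hs => ?_
  have h0 : s ≠ 0 := by
    rintro rfl; simp at hs; exact hε.ne hs
  have h1 : Complex.sinh s ≠ 0 := sinh_ne_zero_of_norm h0 (by
    rw [mem_sphere_zero_iff_norm] at hs; linarith)
  simp only [dslope_of_ne _ h0, slope_def_field, Complex.sinh_zero, sub_zero, smul_eq_mul]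
  field_simp

/-- Integrals against powers of `1 / sinh` by repeated integration by parts. -/
theorem circle_integral_div_sinh_pow {ε : ℝ} (hε : 0 < ε) (hε1 : ε ≤ 1) (m : ℕ) {h : ℕ → ℂ → ℂ}
    (hd : ∀ j, ∀ s ∈ Metric.closedBall (0 : ℂ) ε,
      HasDerivAt (h j) (h (j + 1) s - ((m : ℂ) - 1 - 2 * j) * h j s) s) :
    (∮ s in C(0, ε), h 0 s / Complex.sinh s ^ (m + 1)) =
      2 * Real.pi * Complex.I / m.factorial * h m 0 := by
  have hsn : ∀ s ∈ Metric.sphere (0 : ℂ) ε, Complex.sinh s ≠ 0 := by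
    intro s hs
    rw [mem_sphere_zero_iff_norm] at hs
    refine sinh_ne_zero_of_norm ?_ (by linarith)
    rintro rfl; simp at hs; exact hε.ne hs
  have hcont : ∀ j, ContinuousOn (h j) (Metric.sphere (0 : ℂ) ε) := fun j s hs =>
    (hd j s (Metric.sphere_subset_closedBall hs)).continuousAt.continuousWithinAt
  have step : ∀ j r : ℕ, j + (r + 1) = m →
      ((r : ℂ) + 1) * (∮ s in C(0, ε), Complex.exp (-(j : ℂ) * s) * h j s / Complex.sinh s ^ (r + 2)) =
      ∮ s in C(0, ε), Complex.exp (-((j + 1 : ℕ) : ℂ) * s) * h (j + 1) s /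
        Complex.sinh s ^ (r + 1) := by
    intro j r hjr
    have h0 := circleIntegral.integral_eq_zero_of_hasDerivWithinAt' (c := (0 : ℂ)) (R := ε)
      (f := fun s => Complex.exp (-((j + 1 : ℕ) : ℂ) * s) * h j s / Complex.sinh s ^ (r + 1))
      (f' := fun s => Complex.exp (-((j + 1 : ℕ) : ℂ) * s) * h (j + 1) s / Complex.sinh s ^ (r + 1) -
        ((r : ℂ) + 1) * (Complex.exp (-(j : ℂ) * s) * h j s / Complex.sinh s ^ (r + 2)))
      (fun s hs => by
        rw [abs_of_pos hε] at hs
        have hs0 := hsn s hs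
        have e1 : HasDerivAt (fun s : ℂ => Complex.exp (-((j + 1 : ℕ) : ℂ) * s))
            (Complex.exp (-((j + 1 : ℕ) : ℂ) * s) * -((j + 1 : ℕ) : ℂ)) s := by
          simpa using ((hasDerivAt_id s).const_mul (-((j + 1 : ℕ) : ℂ))).cexp
        have e2 := (e1.fun_mul (hd j s (Metric.sphere_subset_closedBall hs))).fun_div
          ((Complex.hasDerivAt_sinh s).fun_pow (r + 1)) (pow_ne_zero _ hs0)
        refine (e2.congr_deriv ?_).hasDerivWithinAt
        have e3 : Complex.exp (-(j : ℂ) * s) =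
            Complex.exp (-((j + 1 : ℕ) : ℂ) * s) * (Complex.cosh s + Complex.sinh s) := by
          rw [Complex.cosh_add_sinh, ← Complex.exp_add]; congr 1; push_cast; ring
        have e4 : (m : ℂ) = j + (r + 1) := by rw [← hjr]; push_cast; ring
        rw [e3, e4]
        simp only [Nat.add_sub_cancel]
        field_simp
        push_cast
        ring)
    rw [circleIntegral.integral_sub] at h0
    · rw [sub_eq_zero] at h0
      rw [h0]
      exact (circleIntegral.integral_const_mul _ _ _ _).symm
    · refine ContinuousOn.circleIntegrable hε.le ?_
      exact ((by fun_prop : Continuous fun s : ℂ => Complex.exp (-((j + 1 : ℕ) : ℂ) * s)).continuousOn.mul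
        (hcont _)).div (by fun_prop) fun s hs => pow_ne_zero _ (hsn s hs)
    · refine ContinuousOn.circleIntegrable hε.le ?_
      exact continuousOn_const.mul
        (((by fun_prop : Continuous fun s : ℂ => Complex.exp (-(j : ℂ) * s)).continuousOn.mul
        (hcont _)).div (by fun_prop) fun s hs => pow_ne_zero _ (hsn s hs))
  have all : ∀ j, j ≤ m → (∮ s in C(0, ε), h 0 s / Complex.sinh s ^ (m + 1)) =
      ((m - j).factorial : ℂ) / m.factorial *
        ∮ s in C(0, ε), Complex.exp (-(j : ℂ) * s) * h j s / Complex.sinh s ^ (m - j + 1) := by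
    intro j
    induction j with
    | zero =>
      intro _
      have : (m.factorial : ℂ) ≠ 0 := by exact_mod_cast m.factorial_ne_zero
      simp [this]
    | succ j ih =>
      intro hj
      obtain ⟨r, hr⟩ : ∃ r, m = j + (r + 1) := ⟨m - j - 1, by omega⟩
      rw [ih (by omega)]
      have e1 : m - j = r + 1 := by omega
      have e2 : m - (j + 1) = r := by omega
      rw [e1, e2, ← step j r hr.symm, Nat.factorial_succ]
      push_cast; ring
  rw [all m le_rfl]
  simp only [Nat.sub_self, zero_add, pow_one, Nat.factorial_zero, Nat.cast_one]
  rw [circle_integral_div_sinh hε hε1 (h := fun s => Complex.exp (-(m : ℂ) * s) * h m s)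
    (h' := fun s => Complex.exp (-(m : ℂ) * s) * -(m : ℂ) * h m s + Complex.exp (-(m : ℂ) * s) *
      (h (m + 1) s - ((m : ℂ) - 1 - 2 * m) * h m s))]
  · simp; ring
  · intro s hs
    have e1 : HasDerivAt (fun s : ℂ => Complex.exp (-(m : ℂ) * s))
        (Complex.exp (-(m : ℂ) * s) * -(m : ℂ)) s := by
      simpa using ((hasDerivAt_id s).const_mul (-(m : ℂ))).cexp
    exact e1.fun_mul (hd m s hs)

end TrigBA

namespace TrigBA
open LP
variable {k : ℕ}

/-- The circle of radius `ε`. -/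
def gT (ε t : ℝ) : ℂ := circleMap 0 ε (2 * Real.pi * t)

/-- The derivative of `gT`. -/
def gT' (ε t : ℝ) : ℂ := 2 * Real.pi * (circleMap 0 ε (2 * Real.pi * t) * Complex.I)

theorem hasDerivAt_gT (ε t : ℝ) : HasDerivAt (gT ε) (gT' ε t) t := by
  have h1 : HasDerivAt (fun t : ℝ => 2 * Real.pi * t) (2 * Real.pi) t := by
    simpa using (hasDerivAt_id t).const_mul (2 * Real.pi)
  have := (hasDerivAt_circleMap 0 ε (2 * Real.pi * t)).scomp t h1
  refine this.congr_deriv ?_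
  simp [gT']

theorem continuous_gT (ε : ℝ) : Continuous (gT ε) := by unfold gT; fun_prop
theorem continuous_gT' (ε : ℝ) : Continuous (gT' ε) := by unfold gT'; fun_prop

theorem norm_gT {ε : ℝ} (hε : 0 < ε) (t : ℝ) : ‖gT ε t‖ = ε := by
  simp [gT, abs_of_pos hε]

theorem gT_ne {ε : ℝ} (hε : 0 < ε) (t : ℝ) : gT ε t ≠ 0 := by
  rw [← norm_pos_iff, norm_gT hε]; exact hε

theorem integral_gT (ε : ℝ) (f : ℂ → ℂ) :
    ∫ t in Set.Ioo (0 : ℝ) 1, f (gT ε t) * gT' ε t = ∮ s in C(0, ε), f s := by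
  rw [← integral_Ioc_eq_integral_Ioo, ← intervalIntegral.integral_of_le zero_le_one, circleIntegral]
  have := intervalIntegral.smul_integral_comp_mul_left (a := 0) (b := 1)
    (fun θ => deriv (circleMap 0 ε) θ • f (circleMap 0 ε θ)) (2 * Real.pi)
  rw [mul_zero, mul_one] at this
  rw [← this, ← intervalIntegral.integral_smul]
  refine intervalIntegral.integral_congr fun t _ => ?_
  simp only [gT, gT', deriv_circleMap, smul_eq_mul, Complex.real_smul]
  push_cast; ring

/-- Small circles around the coordinates of `x` do not meet near `x₀`. -/
structure Small (x₀ : Fin (k + 1) → ℂ) (ε : ℝ) : Prop where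
  pos : 0 < ε
  le : ε ≤ 1
  sep : ∀ i l, i ≠ l → ∀ u : ℂ, ‖u‖ < 4 * ε → Complex.sinh (x₀ i - x₀ l + u) ≠ 0

theorem exists_small {x₀ : Fin (k + 1) → ℂ} (h : sinhVand x₀ ≠ 0) : ∃ ε, Small x₀ ε := by
  have h1 : ∀ i l, i ≠ l → ∀ᶠ u in nhds (0 : ℂ), Complex.sinh (x₀ i - x₀ l + u) ≠ 0 := by
    intro i l hil
    have : ContinuousAt (fun u : ℂ => Complex.sinh (x₀ i - x₀ l + u)) 0 := by fun_prop
    exact this.eventually_ne (by simpa using sinhVand_ne.1 h i l hil)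
  have h2 : ∀ᶠ u in nhds (0 : ℂ), ∀ i l, i ≠ l → Complex.sinh (x₀ i - x₀ l + u) ≠ 0 := by
    simp only [Filter.eventually_all]
    exact h1
  obtain ⟨r, hr, hr2⟩ := Metric.eventually_nhds_iff.1 h2
  refine ⟨min (r / 4) 1, by positivity, min_le_right _ _, fun i l hil u hu => hr2 ?_ i l hil⟩
  rw [dist_zero_right]
  have := min_le_left (r / 4) 1
  linarith

/-- The neighbourhood on which the circles of radius `ε` may be used. -/
def nbh (x₀ : Fin (k + 1) → ℂ) (ε : ℝ) : Set (Fin (k + 1) → ℂ) :=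
  {x | ∀ i, ‖x i - x₀ i‖ < ε}

theorem isOpen_nbh (x₀ : Fin (k + 1) → ℂ) (ε : ℝ) : IsOpen (nbh x₀ ε) := by
  simp only [nbh, Set.ofPred_forall]
  exact isOpen_iInter_of_finite fun i => isOpen_lt (by fun_prop) continuous_const

theorem Small.mem {x₀ : Fin (k + 1) → ℂ} {ε : ℝ} (h : Small x₀ ε) : x₀ ∈ nbh x₀ ε := fun i => by
  simpa using h.pos

theorem Small.ne {x₀ : Fin (k + 1) → ℂ} {ε : ℝ} (h : Small x₀ ε) {x : Fin (k + 1) → ℂ}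
    (hx : x ∈ nbh x₀ ε) {i l : Fin (k + 1)} (hil : i ≠ l) {u : ℂ} (hu : ‖u‖ ≤ 2 * ε) :
    Complex.sinh (x i - x l + u) ≠ 0 := by
  have e : x i - x l + u = x₀ i - x₀ l + ((x i - x₀ i) - (x l - x₀ l) + u) := by ring
  rw [e]
  refine h.sep i l hil _ ?_
  have h1 := hx i
  have h2 := hx l
  calc _ ≤ ‖(x i - x₀ i) - (x l - x₀ l)‖ + ‖u‖ := norm_add_le _ _
    _ ≤ ‖x i - x₀ i‖ + ‖x l - x₀ l‖ + ‖u‖ := by gcongr; exact norm_sub_le _ _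
    _ < 4 * ε := by linarith

theorem Small.wj_mem {x₀ : Fin (k + 1) → ℂ} {ε : ℝ} (h : Small x₀ ε) {x : Fin (k + 1) → ℂ}
    (hx : x ∈ nbh x₀ ε) (θ : Fin k → ℝ) : wj (gT ε) x θ ∈ Sep k := by
  have n := fun t => norm_gT h.pos t
  have key : ∀ (i : Fin k) (l : Fin (k + 1)),
      Complex.sinh (x i.castSucc + gT ε (θ i) - x l) ≠ 0 := by
    intro i l
    by_cases hil : i.castSucc = l
    · subst hil
      rw [add_sub_cancel_left]
      exact sinh_ne_zero_of_norm (gT_ne h.pos _) (by rw [n]; exact h.le)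
    · rw [add_sub_right_comm]
      exact h.ne hx hil (by rw [n]; linarith [h.pos])
  intro a b hab
  rcases a with a | a <;> rcases b with b | b
  · simpa [wj] using h.ne hx (u := 0) (fun e => hab (by rw [e])) (by simpa using h.pos.le)
  · have := key b a
    simp only [wj, Sum.elim_inl, Sum.elim_inr]
    rwa [← neg_sub, Complex.sinh_neg, neg_ne_zero]
  · exact key a b
  · have e : wj (gT ε) x θ (Sum.inr a) - wj (gT ε) x θ (Sum.inr b) =
        x a.castSucc - x b.castSucc + (gT ε (θ a) - gT ε (θ b)) := by simp [wj]; ring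
    rw [e]
    refine h.ne hx (fun e => hab (by rw [Fin.castSucc_injective _ e])) ?_
    calc _ ≤ ‖gT ε (θ a)‖ + ‖gT ε (θ b)‖ := norm_sub_le _ _
      _ = 2 * ε := by rw [n, n]; ring

theorem continuous_wj {γ : ℝ → ℂ} (hγ : Continuous γ) :
    Continuous fun q : (Fin (k + 1) → ℂ) × (Fin k → ℝ) => wj γ q.1 q.2 := by
  refine continuous_pi fun a => ?_
  rcases a with a | a
  · simp only [wj, Sum.elim_inl]; fun_prop
  · simp only [wj, Sum.elim_inr]; fun_prop

theorem continuousAt_cl {σ : Type} [Fintype σ] {Q : LP σ} {lam : σ → ℂ} {N : LP σ} {n : ℕ}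
    {w : σ → ℂ} (hw : ev w Q ≠ 0) : ContinuousAt (cl Q lam N n) w := by
  unfold cl
  have h1 := (continuous_ev N).continuousAt (x := w)
  have h2 := (continuous_ev Q).continuousAt (x := w)
  have h3 : ContinuousAt (fun w : σ → ℂ => Complex.exp (∑ a, lam a * w a)) w :=
    (by fun_prop : Continuous fun w : σ → ℂ => Complex.exp (∑ a, lam a * w a)).continuousAt
  exact (h3.mul h1).div (h2.pow n) (pow_ne_zero _ hw)

theorem Small.good {x₀ : Fin (k + 1) → ℂ} {ε : ℝ} (h : Small x₀ ε) {Q : LP (JX k)}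
    (hQ : ∀ w ∈ Sep k, ev w Q ≠ 0) (lam : JX k → ℂ) (N : LP (JX k)) (n : ℕ) :
    Good (gT ε) (gT' ε) (nbh x₀ ε) (cl Q lam N n) := by
  intro x₁ hx₁
  obtain ⟨r, hr, hrU⟩ := Metric.nhds_basis_closedBall.mem_iff.1 ((isOpen_nbh x₀ ε).mem_nhds hx₁)
  have hprod : Continuous fun q : (Fin (k + 1) → ℂ) × (Fin k → ℝ) => ∏ i, gT' ε (q.2 i) :=
    continuous_finsetProd _ fun i _ => (continuous_gT' ε).comp (by fun_prop)
  have hc : ContinuousOn (fun q : (Fin (k + 1) → ℂ) × (Fin k → ℝ) =>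
      cl Q lam N n (wj (gT ε) q.1 q.2) * ∏ i, gT' ε (q.2 i))
      (Metric.closedBall x₁ r ×ˢ Set.univ.pi fun _ => Set.Icc 0 1) := by
    intro q hq
    have h1 := h.wj_mem (hrU hq.1) q.2
    have h2 : ContinuousAt (fun q : (Fin (k + 1) → ℂ) × (Fin k → ℝ) =>
        cl Q lam N n (wj (gT ε) q.1 q.2)) q :=
      ContinuousAt.comp (g := cl Q lam N n) (continuousAt_cl (hQ _ h1))
        (continuous_wj (continuous_gT ε)).continuousAt
    exact (h2.mul hprod.continuousAt).continuousWithinAt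
  have hK : IsCompact (Metric.closedBall x₁ r ×ˢ Set.univ.pi fun _ : Fin k => Set.Icc (0 : ℝ) 1) :=
    (isCompact_closedBall x₁ r).prod (isCompact_univ_pi fun _ => isCompact_Icc)
  obtain ⟨C, hC⟩ := hK.exists_bound_of_continuousOn hc
  have hsub : ∀ θ ∈ box k, θ ∈ Set.univ.pi fun _ : Fin k => Set.Icc (0 : ℝ) 1 := fun θ hθ i _ =>
    ⟨(mem_box.1 hθ i).1.le, (mem_box.1 hθ i).2.le⟩
  refine ⟨C, ?_⟩
  filter_upwards [Metric.closedBall_mem_nhds x₁ hr] with x hx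
  refine ⟨?_, fun θ hθ => hC (x, θ) ⟨hx, hsub θ hθ⟩⟩
  exact hc.comp (f := fun θ => (x, θ)) (by fun_prop) fun θ hθ => ⟨hx, hsub θ hθ⟩

theorem gT_zero_one (ε : ℝ) : gT ε 0 = gT ε 1 := by
  simp [gT, circleMap]

theorem Small.limits {x₀ : Fin (k + 1) → ℂ} {ε : ℝ} (h : Small x₀ ε) {Q : LP (JX k)}
    (hQ : ∀ w ∈ Sep k, ev w Q ≠ 0) {lam : JX k → ℂ} {N : LP (JX k)} {n : ℕ}
    {f : (JX k → ℂ) → ℂ} (hf : ∀ w ∈ Sep k, f w = cl Q lam N n w) {x : Fin (k + 1) → ℂ}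
    (hx : x ∈ nbh x₀ ε) (i : Fin k) (θ : Fin k → ℝ) : ∃ L,
      Filter.Tendsto (fun t => f (wj (gT ε) x (Function.update θ i t)))
        (nhdsWithin 0 (Set.Ioi 0)) (nhds L) ∧
      Filter.Tendsto (fun t => f (wj (gT ε) x (Function.update θ i t)))
        (nhdsWithin 1 (Set.Iio 1)) (nhds L) := by
  have e : (fun t => f (wj (gT ε) x (Function.update θ i t))) =
      fun t => cl Q lam N n (wj (gT ε) x (Function.update θ i t)) := by
    funext t; exact hf _ (h.wj_mem hx _)
  have hc : Continuous fun t => cl Q lam N n (wj (gT ε) x (Function.update θ i t)) := by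
    rw [continuous_iff_continuousAt]
    intro t
    have h2 : Continuous fun t : ℝ => wj (gT ε) x (Function.update θ i t) :=
      (continuous_wj (continuous_gT ε)).comp
        (f := fun t : ℝ => (x, Function.update θ i t)) (by fun_prop)
    exact ContinuousAt.comp (g := cl Q lam N n) (continuousAt_cl (hQ _ (h.wj_mem hx _)))
      h2.continuousAt
  have e2 : wj (gT ε) x (Function.update θ i 0) = wj (gT ε) x (Function.update θ i 1) := by
    ext a
    rcases a with a | a
    · rfl
    · by_cases ha : a = i
      · subst ha; simp [wj, gT_zero_one]
      · simp [wj, ha]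
  rw [e]
  refine ⟨_, (hc.tendsto 0).mono_left nhdsWithin_le_nhds, ?_⟩
  rw [e2]
  exact (hc.tendsto 1).mono_left nhdsWithin_le_nhds

/-- The residue transform of an eigenfunction is an eigenfunction. -/
theorem Small.eig {m : ℕ} {x₀ : Fin (k + 1) → ℂ} {ε : ℝ} (h : Small x₀ ε) (κ : ℂ)
    {lam : Fin k → ℂ} {D : LP (Fin k)} {M : ℕ} {E : ℂ} (hD : IsEig m lam D M E)
    {x : Fin (k + 1) → ℂ} (hx : x ∈ nbh x₀ ε) :
    sutherland m (trans (gT ε) (gT' ε) (jF (ker k (-(m + 1 : ℕ)) κ) (cl (B k) lam D M))) x =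
      (E - κ ^ 2) * trans (gT ε) (gT' ε) (jF (ker k (-(m + 1 : ℕ)) κ) (cl (B k) lam D M)) x := by
  obtain ⟨R, hK, hq⟩ := exists_kernelRep (p := -(m + 1 : ℕ)) (I := fun _ => ⊤)
    (fun w hw => ev_Qt_ne hw) (Q' := Bx k * X k) rfl ⟨_, _, fun κ w hw => ker_eq_t m κ hw⟩
    (fun i => isCl_qv_t m 0 _ i)
  obtain ⟨R1, hR1⟩ := exists_suppLe D
  obtain ⟨R2, hR2⟩ := exists_suppLe (Lop m lam M D)
  rw [sutherland_trans_cl (m := m) hK (by push_cast; ring) (fun t _ => hasDerivAt_gT ε t)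
    (isOpen_nbh x₀ ε) (fun x hx θ _ => h.wj_mem hx θ) κ lam D M (R1 + R2) (hR1.mono (by omega))
    (hR2.mono (by omega)) (fun N n _ => h.good hK.sep _ N n) ?_ hx]
  · have : trans (gT ε) (gT' ε) (jF (ker k (-(m + 1 : ℕ)) κ) (cl (B k) lam (Lop m lam M D) (M + 2))) x =
        E * trans (gT ε) (gT' ε) (jF (ker k (-(m + 1 : ℕ)) κ) (cl (B k) lam D M)) x := by
      rw [trans, trans, ← integral_const_mul]
      refine setIntegral_congr_fun (measurableSet_box k) fun θ hθ => ?_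
      have hw := h.wj_mem hx θ
      have hz : ev (wj (gT ε) x θ ∘ Sum.inr) (B k) ≠ 0 := by
        rw [ev_B]
        exact sinhVand_ne.2 fun i j hij => hw _ _ fun h => hij (Sum.inr_injective h)
      simp only [jF]
      rw [show Lop m lam M D = E • (B k ^ 2 * D) from hD, cl_smul, cl_mul_pow _ _ _ _ _ _ hz]
      ring
    rw [this]; ring
  · intro x hx i θ _
    obtain ⟨N, _, n, hN⟩ := hq i
    obtain ⟨Q', _, hQ'⟩ := hK.dvd
    refine h.limits (f := fun w => qv κ ((-(m + 1 : ℕ) : ℤ) : ℂ) i.castSucc w *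
      jF (ker k (-(m + 1 : ℕ)) κ) (cl (B k) lam D M) w) hK.sep (Q := Qt k) (lam := lamJ κ lam) (N := N * (emb inrExp D * Q' ^ M))
      (n := n + M) (fun w hw => ?_) hx i θ
    simp only [jF]
    rw [← mul_assoc, hN κ w hw, mul_cl_inr hQ' κ lam N n D M (hK.sep w hw)]

end TrigBA

namespace TrigBA
open LP

/-! ### Families depending polynomially on the spectral parameter -/

section PolyFam
variable {N : ℕ} {V W : Type} [CommRing V] [Algebra ℂ V] [CommRing W] [Algebra ℂ W]

/-- The monomial `∏ ν_i^{α_i}`. -/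
def mon (α : Fin N → ℕ) (ν : Fin N → ℂ) : ℂ := ∏ i, ν i ^ α i

/-- Families spanned by monomials whose degrees satisfy `p`. -/
def MS (N : ℕ) (V : Type) [CommRing V] [Algebra ℂ V] (p : ℕ → Prop) :
    Submodule ℂ ((Fin N → ℂ) → V) :=
  Submodule.span ℂ {f | ∃ α v, p (∑ i, α i) ∧ f = fun ν => mon α ν • v}

variable {p q r : ℕ → Prop} {f g : (Fin N → ℂ) → V}

theorem mon_smul_mem {α : Fin N → ℕ} (h : p (∑ i, α i)) (v : V) :
    (fun ν => mon α ν • v) ∈ MS N V p := Submodule.subset_span ⟨α, v, h, rfl⟩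

theorem MS_mono (h : ∀ a, p a → q a) (hf : f ∈ MS N V p) : f ∈ MS N V q := by
  refine Submodule.span_mono ?_ hf
  rintro _ ⟨α, v, hp, rfl⟩
  exact ⟨α, v, h _ hp, rfl⟩

theorem const_mem (h : p 0) (v : V) : (fun _ => v) ∈ MS N V p := by
  have := mon_smul_mem (N := N) (α := 0) (p := p) (by simpa using h) v
  convert this using 1
  ext; simp [mon]

theorem mul_mem_MS (h : ∀ a b, p a → q b → r (a + b)) (hf : f ∈ MS N V p) (hg : g ∈ MS N V q) :
    (fun ν => f ν * g ν) ∈ MS N V r := by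
  induction hf using Submodule.span_induction with
  | mem f hf =>
    obtain ⟨α, v, hα, rfl⟩ := hf
    induction hg using Submodule.span_induction with
    | mem g hg =>
      obtain ⟨β, w, hβ, rfl⟩ := hg
      have := mon_smul_mem (α := α + β) (p := r)
        (by simpa [Finset.sum_add_distrib] using h _ _ hα hβ) (v * w)
      convert this using 2 with ν
      simp only [mon, Pi.add_apply, pow_add, Finset.prod_mul_distrib, smul_mul_smul_comm]
    | zero => convert (MS N V r).zero_mem using 1; ext; simp
    | add g g' _ _ h1 h2 => convert (MS N V r).add_mem h1 h2 using 1; ext; simp [mul_add]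
    | smul c g _ h1 => convert (MS N V r).smul_mem c h1 using 1; ext; simp
  | zero => convert (MS N V r).zero_mem using 1; ext; simp
  | add f f' _ _ h1 h2 => convert (MS N V r).add_mem h1 h2 using 1; ext; simp [add_mul]
  | smul c f _ h1 => convert (MS N V r).smul_mem c h1 using 1; ext; simp

theorem map_mem_MS (ψ : V →ₗ[ℂ] W) (hf : f ∈ MS N V p) : (fun ν => ψ (f ν)) ∈ MS N W p := by
  induction hf using Submodule.span_induction with
  | mem f hf =>
    obtain ⟨α, v, hα, rfl⟩ := hf
    simpa using mon_smul_mem hα (ψ v)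
  | zero => convert (MS N W p).zero_mem using 1; ext; simp
  | add f f' _ _ h1 h2 => convert (MS N W p).add_mem h1 h2 using 1; ext; simp
  | smul c f _ h1 => convert (MS N W p).smul_mem c h1 using 1; ext; simp

theorem castSucc_mem_MS (hf : f ∈ MS N V p) :
    (fun ν : Fin (N + 1) → ℂ => f (ν ∘ Fin.castSucc)) ∈ MS (N + 1) V p := by
  induction hf using Submodule.span_induction with
  | mem f hf =>
    obtain ⟨α, v, hα, rfl⟩ := hf
    have := mon_smul_mem (α := (Fin.snoc (α := fun _ => ℕ) α 0 : Fin (N + 1) → ℕ)) (p := p)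
      (by simpa [Fin.sum_univ_castSucc] using hα) v
    convert this using 2 with ν
    simp [mon, Fin.prod_univ_castSucc]
  | zero => exact (MS (N + 1) V p).zero_mem
  | add f f' _ _ h1 h2 => exact (MS (N + 1) V p).add_mem h1 h2
  | smul c f _ h1 => exact (MS (N + 1) V p).smul_mem c h1

theorem coord_mem_MS (h : p 1) (i : Fin N) (v : V) : (fun ν => ν i • v) ∈ MS N V p := by
  have := mon_smul_mem (α := (Pi.single i 1 : Fin N → ℕ)) (p := p) (by simpa using h) v
  convert this using 2 with ν
  rw [mon, Finset.prod_eq_single i] <;> simp +contextual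

/-- Families of degree at most `d` with leading part `L`. -/
def PolyFam (d : ℕ) (f L : (Fin N → ℂ) → V) : Prop :=
  f - L ∈ MS N V (· < d) ∧ L ∈ MS N V (· = d)

variable {d e : ℕ} {L L' : (Fin N → ℂ) → V}

theorem PolyFam.mem (h : PolyFam d f L) : f ∈ MS N V (· ≤ d) := by
  have := (MS N V (· ≤ d)).add_mem (MS_mono (fun a ha => le_of_lt ha) h.1)
    (MS_mono (fun a ha => le_of_eq ha) h.2)
  simpa using this

theorem PolyFam.mul (h : PolyFam d f L) (h' : PolyFam e g L') :
    PolyFam (d + e) (fun ν => f ν * g ν) (fun ν => L ν * L' ν) := by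
  refine ⟨?_, mul_mem_MS (fun a b ha hb => by subst ha hb; rfl) h.2 h'.2⟩
  have h1 := mul_mem_MS (r := (· < d + e)) (fun a b (ha : a < d) (hb : b ≤ e) => by show a + b < d + e; omega) h.1 h'.mem
  have h2 := mul_mem_MS (r := (· < d + e)) (fun a b (ha : a = d) (hb : b < e) => by show a + b < d + e; omega) h.2 h'.1
  have := (MS N V (· < d + e)).add_mem h1 h2
  convert this using 1
  ext ν
  simp only [Pi.sub_apply, Pi.add_apply]; ring

theorem PolyFam.add (h : PolyFam d f L) (h' : PolyFam d g L') :
    PolyFam d (fun ν => f ν + g ν) (fun ν => L ν + L' ν) := by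
  refine ⟨?_, (MS N V _).add_mem h.2 h'.2⟩
  have := (MS N V (· < d)).add_mem h.1 h'.1
  convert this using 1
  ext ν
  simp only [Pi.sub_apply, Pi.add_apply]; ring

theorem PolyFam.zero : PolyFam (N := N) (V := V) d (fun _ => 0) (fun _ => 0) :=
  ⟨by convert (MS N V (· < d)).zero_mem using 1; ext; simp, (MS N V _).zero_mem⟩

theorem PolyFam.sum {ι : Type} (s : Finset ι) {f L : ι → (Fin N → ℂ) → V}
    (h : ∀ i ∈ s, PolyFam d (f i) (L i)) :
    PolyFam d (fun ν => ∑ i ∈ s, f i ν) (fun ν => ∑ i ∈ s, L i ν) := by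
  classical
  induction s using Finset.induction_on with
  | empty => simpa using PolyFam.zero
  | insert a s ha ih =>
    simp only [Finset.sum_insert ha]
    exact (h a (Finset.mem_insert_self a s)).add (ih fun i hi => h i (Finset.mem_insert_of_mem hi))

theorem PolyFam.const (v : V) : PolyFam (N := N) 0 (fun _ => v) (fun _ => v) :=
  ⟨by convert (MS N V (· < 0)).zero_mem using 1; ext; simp, const_mem (p := (· = 0)) rfl v⟩

theorem PolyFam.prod {ι : Type} (s : Finset ι) {f L : ι → (Fin N → ℂ) → V}
    (h : ∀ i ∈ s, PolyFam d (f i) (L i)) :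
    PolyFam (s.card * d) (fun ν => ∏ i ∈ s, f i ν) (fun ν => ∏ i ∈ s, L i ν) := by
  classical
  induction s using Finset.induction_on with
  | empty => simpa using PolyFam.const (N := N) (1 : V)
  | insert a s ha ih =>
    simp only [Finset.prod_insert ha]
    have h1 := h a (Finset.mem_insert_self a s)
    have h2 := ih fun i hi => h i (Finset.mem_insert_of_mem hi)
    have h3 : (insert a s).card * d = d + s.card * d := by
      rw [Finset.card_insert_of_notMem ha]; ring
    rw [h3]
    exact PolyFam.mul h1 h2

theorem PolyFam.map (ψ : V →ₗ[ℂ] W) (h : PolyFam d f L) :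
    PolyFam d (fun ν => ψ (f ν)) (fun ν => ψ (L ν)) := by
  refine ⟨?_, map_mem_MS ψ h.2⟩
  convert map_mem_MS ψ h.1 using 1
  ext ν; simp

theorem PolyFam.castSucc (h : PolyFam d f L) :
    PolyFam d (fun ν : Fin (N + 1) → ℂ => f (ν ∘ Fin.castSucc)) (fun ν => L (ν ∘ Fin.castSucc)) :=
  by
    have h1 := castSucc_mem_MS h.1
    have h2 := castSucc_mem_MS h.2
    refine ⟨?_, h2⟩
    convert h1 using 1
    rfl

theorem PolyFam.lin (c c' : ℂ) (i j : Fin N) (v : V) :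
    PolyFam 1 (fun ν => (c * (ν i - ν j) + c') • v) (fun ν => (c * (ν i - ν j)) • v) := by
  constructor
  · convert const_mem (N := N) (p := (· < 1)) zero_lt_one (c' • v) using 1
    ext ν; simp [add_smul]
  · have h1 := (MS N V (· = 1)).smul_mem c (coord_mem_MS (p := (· = 1)) rfl i v)
    have h2 := (MS N V (· = 1)).smul_mem c (coord_mem_MS (p := (· = 1)) rfl j v)
    convert (MS N V (· = 1)).sub_mem h1 h2 using 1
    ext ν; simp [mul_sub, sub_smul, smul_smul]

theorem PolyFam.lower (h : PolyFam d f L) (hde : d < e) : PolyFam e f (fun _ => 0) :=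
  ⟨by
    convert MS_mono (q := (· < e)) (fun a ha => lt_of_le_of_lt ha hde) h.mem using 1
    ext; simp, (MS N V _).zero_mem⟩

theorem MS_eval {h : (Fin N → ℂ) → ℂ} (hh : h ∈ MS N ℂ p) :
    ∃ P : MvPolynomial (Fin N) ℂ, (∀ ν, h ν = MvPolynomial.eval ν P) ∧
      ∀ α ∈ P.support, p (∑ i, α i) := by
  classical
  induction hh using Submodule.span_induction with
  | mem f hf =>
    obtain ⟨α, v, hα, rfl⟩ := hf
    refine ⟨MvPolynomial.monomial (Finsupp.equivFunOnFinite.symm α) v, fun ν => ?_, fun β hβ => ?_⟩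
    · simp [MvPolynomial.eval_monomial, mon, Finsupp.prod_fintype, mul_comm]
    · have := MvPolynomial.support_monomial_subset hβ
      rw [Finset.mem_singleton] at this
      subst this; simpa using hα
  | zero => exact ⟨0, by simp, by simp⟩
  | add f f' _ _ h1 h2 =>
    obtain ⟨P, hP, hP2⟩ := h1
    obtain ⟨P', hP', hP2'⟩ := h2
    refine ⟨P + P', fun ν => by simp [hP, hP'], fun α hα => ?_⟩
    rcases Finset.mem_union.1 (MvPolynomial.support_add hα) with h | h
    · exact hP2 _ h
    · exact hP2' _ h
  | smul c f _ h1 =>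
    obtain ⟨P, hP, hP2⟩ := h1
    exact ⟨c • P, fun ν => by simp [hP, MvPolynomial.smul_eval], fun α hα =>
      hP2 _ (MvPolynomial.support_smul hα)⟩

theorem MS_finite {f : (Fin N → ℂ) → LP (Fin N)} (hf : f ∈ MS N (LP (Fin N)) p) :
    ∃ s : Finset (Fin N → ℤ), ∀ ν μ, (f ν).coeff μ ≠ 0 → μ ∈ s := by
  classical
  induction hf using Submodule.span_induction with
  | mem f hf =>
    obtain ⟨α, v, hα, rfl⟩ := hf
    refine ⟨v.coeff.support, fun ν μ hμ => ?_⟩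
    rw [Finsupp.mem_support_iff]
    intro h0; exact hμ (by simp [h0])
  | zero => exact ⟨∅, by simp⟩
  | add f f' _ _ h1 h2 =>
    obtain ⟨s, hs⟩ := h1
    obtain ⟨s', hs'⟩ := h2
    refine ⟨s ∪ s', fun ν μ hμ => ?_⟩
    by_cases h0 : (f ν).coeff μ = 0
    · exact Finset.mem_union_right _ (hs' ν μ (by simpa [h0] using hμ))
    · exact Finset.mem_union_left _ (hs ν μ h0)
  | smul c f _ h1 =>
    obtain ⟨s, hs⟩ := h1
    exact ⟨s, fun ν μ hμ => hs ν μ fun h0 => hμ (by simp [h0])⟩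

/-- The coefficient at `μ` as a linear map. -/
def LP.coeffL {σ : Type} (μ : σ → ℤ) : LP σ →ₗ[ℂ] ℂ where
  toFun D := D.coeff μ
  map_add' := by simp
  map_smul' := by simp

end PolyFam
end TrigBA

namespace TrigBA
open LP
variable {k : ℕ}

theorem integral_box_prod (f : Fin k → ℝ → ℂ) :
    ∫ θ in box k, ∏ i, f i (θ i) = ∏ i, ∫ t in Set.Ioo (0 : ℝ) 1, f i t := by
  rw [box, volume_pi, Measure.restrict_pi_pi]
  exact integral_fintype_prod_eq_prod f

namespace LP

/-- `∏_{l ≠ i} sinh (x_i - x_l)`. -/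
def Pn {N : ℕ} (i : Fin N) : LP (Fin N) := ∏ l ∈ Finset.univ.erase i, S i l

/-- The numerators of the successive derivatives in the residue at `x_i`. -/
def Dr {N : ℕ} (i : Fin N) (m : ℕ) (b : ℂ) : ℕ → LP (Fin N)
  | 0 => 1
  | j + 1 => qder (Pn i) (Pi.single i b) (Pi.single i 1) (m + 1 + j) (Dr i m b j) +
      ((m : ℂ) - 1 - 2 * j) • (Pn i * Dr i m b j)

theorem ev_Pn {N : ℕ} (i : Fin N) (x : Fin N → ℂ) :
    ev x (Pn i) = ∏ l ∈ Finset.univ.erase i, Complex.sinh (x i - x l) := by simp [Pn]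

end LP

theorem Small.circle {x₀ : Fin (k + 1) → ℂ} {ε : ℝ} (h : Small x₀ ε) {x : Fin (k + 1) → ℂ}
    (hx : x ∈ nbh x₀ ε) (i : Fin (k + 1)) (m : ℕ) (b : ℂ) :
    (∮ s in C(0, ε), Complex.exp (b * (x i + s)) / ∏ l, Complex.sinh (x i + s - x l) ^ (m + 1)) =
      2 * Real.pi * Complex.I / m.factorial *
        cl (Pn i) (Pi.single i b) (Dr i m b m) (2 * m + 1) x := by
  have hne : ∀ s ∈ Metric.closedBall (0 : ℂ) ε,
      ev (x + s • (Pi.single i 1 : Fin (k + 1) → ℂ)) (Pn i) ≠ 0 := by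
    intro s hs
    rw [ev_Pn]
    refine Finset.prod_ne_zero_iff.2 fun l hl => ?_
    have hl : l ≠ i := (Finset.mem_erase.1 hl).1
    have := h.ne hx hl.symm (u := s) (by
      rw [mem_closedBall_zero_iff] at hs; linarith [h.pos])
    simpa [hl, add_sub_right_comm] using this
  have key := circle_integral_div_sinh_pow h.pos h.le m
    (h := fun j s => cl (Pn i) (Pi.single i b) (Dr i m b j) (m + 1 + j)
      (x + s • (Pi.single i 1 : Fin (k + 1) → ℂ))) (by
    intro j s hs
    have h1 := hasLineDerivAt_cl (Pn i) (Pi.single i b) (Dr i m b j) (m + 1 + j)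
      (Pi.single i 1) (x + s • (Pi.single i 1 : Fin (k + 1) → ℂ)) (hne s hs)
    have h2 : HasDerivAt (fun t : ℂ => cl (Pn i) (Pi.single i b) (Dr i m b j) (m + 1 + j)
        (x + s • Pi.single i 1 + t • (Pi.single i 1 : Fin (k + 1) → ℂ)))
        (cl (Pn i) (Pi.single i b) (qder (Pn i) (Pi.single i b) (Pi.single i 1) (m + 1 + j)
          (Dr i m b j)) (m + 1 + j + 1) (x + s • (Pi.single i 1 : Fin (k + 1) → ℂ))) (s - s) := by
      rw [sub_self]; exact h1
    have h3 := HasDerivAt.comp_sub_const s s h2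
    have e : ∀ t : ℂ, x + s • Pi.single i 1 + (t - s) • (Pi.single i 1 : Fin (k + 1) → ℂ) =
        x + t • Pi.single i 1 := by
      intro t; rw [add_assoc, ← add_smul]; congr 2; ring
    simp only [e] at h3
    refine h3.congr_deriv ?_
    rw [← add_assoc, Dr, cl_add, cl_smul]
    have h4 := cl_mul_pow (Pn i) (Pi.single i b) (Dr i m b j) (m + 1 + j) 1 _ (hne s hs)
    rw [pow_one] at h4
    rw [h4]; ring)
  have e0 : x + (0 : ℂ) • (Pi.single i 1 : Fin (k + 1) → ℂ) = x := by simp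
  rw [e0, show m + 1 + m = 2 * m + 1 by ring] at key
  rw [← key]
  refine circleIntegral.integral_congr h.pos.le fun s hs => ?_
  have h5 : ∑ a, (Pi.single i b : Fin (k + 1) → ℂ) a *
      (x + s • (Pi.single i 1 : Fin (k + 1) → ℂ)) a = b * (x i + s) := by
    rw [Finset.sum_eq_single i] <;> simp +contextual
  have h6 : ev (x + s • (Pi.single i 1 : Fin (k + 1) → ℂ)) (Pn i) =
      ∏ l ∈ Finset.univ.erase i, Complex.sinh (x i + s - x l) := by
    rw [ev_Pn]
    refine Finset.prod_congr rfl fun l hl => ?_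
    simp [(Finset.mem_erase.1 hl).1]
  simp only [cl, Dr, h5, h6, map_one, mul_one, add_zero]
  rw [Finset.prod_pow, ← Finset.mul_prod_erase Finset.univ _ (Finset.mem_univ i), mul_pow,
    add_sub_cancel_left, div_div, mul_comm (Complex.sinh s ^ _)]

namespace LP

theorem Pn_dvd {N : ℕ} (i : Fin N) : Pn i ∣ B N := by
  have hinj : Set.InjOn (fun l : Fin N => if i < l then (i, l) else (l, i))
      (Finset.univ.erase i : Finset (Fin N)) := by
    intro l hl l' hl' h
    simp only [Finset.coe_erase, Finset.coe_univ, Set.mem_sdiff, Set.mem_univ,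
      Set.mem_singleton_iff, true_and] at hl hl'
    dsimp only at h
    split_ifs at h with h1 h2 h2
    · exact (Prod.ext_iff.1 h).2
    · exact absurd (Prod.ext_iff.1 h).1 (Ne.symm hl')
    · exact absurd (Prod.ext_iff.1 h).1 hl
    · exact (Prod.ext_iff.1 h).1
  classical
  have h1 : ∏ q ∈ (Finset.univ.erase i).image (fun l : Fin N => if i < l then (i, l) else (l, i)),
      S q.1 q.2 ∣ B N := by
    refine Finset.prod_dvd_prod_of_subset _ _ _ fun q hq => ?_
    obtain ⟨l, hl, rfl⟩ := Finset.mem_image.1 hq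
    have hl : l ≠ i := (Finset.mem_erase.1 hl).1
    rw [mem_prs]
    split_ifs with h
    · exact h
    · exact lt_of_le_of_ne (not_lt.1 h) hl
  rw [Finset.prod_image hinj] at h1
  refine dvd_trans ?_ h1
  refine Finset.prod_dvd_prod_of_dvd _ _ fun l hl => ?_
  split_ifs with h
  · exact dvd_rfl
  · rw [S_swap]; exact neg_dvd.2 dvd_rfl

/-- The cofactor of `Pn i` in `B`. -/
def Cn {N : ℕ} (i : Fin N) : LP (Fin N) := (Pn_dvd i).choose

theorem Pn_mul_Cn {N : ℕ} (i : Fin N) : Pn i * Cn i = B N := (Pn_dvd i).choose_spec.symm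

/-- Extension of exponents by zero at the last index. -/
def sncExp : (Fin k → ℤ) →+ (Fin (k + 1) → ℤ) where
  toFun μ := Fin.snoc (α := fun _ => ℤ) μ 0
  map_zero' := by
    ext a; refine Fin.lastCases ?_ (fun i => ?_) a <;> simp
  map_add' μ κ := by
    ext a; refine Fin.lastCases ?_ (fun i => ?_) a <;> simp

/-- The summand of the numerator of the transform. -/
def Tsum (m : ℕ) (c : Fin k → ℂ) (μ : Fin k → ℤ) : LP (Fin (k + 1)) :=
  B (k + 1) ^ (m + 1) * (AddMonoidAlgebra.single (sncExp μ) 1 *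
    ∏ i : Fin k, (Cn i.castSucc ^ (2 * m + 1) * Dr i.castSucc m (c i + μ i) m))

/-- The numerator of the transform. -/
def Tnum (m : ℕ) (s : Finset (Fin k → ℤ)) (κ : ℂ) (lam : Fin k → ℂ) (P : LP (Fin k)) :
    LP (Fin (k + 1)) :=
  ∑ μ ∈ s, (B k * P).coeff μ • Tsum m (fun i => lam i - κ) μ

end LP

theorem ev_eq_sum_of_subset {σ : Type} [Fintype σ] (x : σ → ℂ) (D : LP σ) {s : Finset (σ → ℤ)}
    (hs : ∀ μ, D.coeff μ ≠ 0 → μ ∈ s) :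
    ev x D = ∑ μ ∈ s, D.coeff μ * Complex.exp (pair x μ) := by
  rw [ev_eq_sum]
  refine Finset.sum_subset (fun μ hμ => hs μ (Finsupp.mem_support_iff.1 hμ)) fun μ _ hμ => ?_
  rw [Finsupp.notMem_support_iff.1 hμ, zero_mul]

theorem prod_cl {N : ℕ} {ι : Type} (s : Finset ι) (Q C D : ι → LP (Fin N)) (Q₀ : LP (Fin N))
    (h : ∀ i ∈ s, Q i * C i = Q₀) (lam : ι → Fin N → ℂ) (M : ℕ) {x : Fin N → ℂ}
    (hx : ev x Q₀ ≠ 0) :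
    ∏ i ∈ s, cl (Q i) (lam i) (D i) M x =
      cl Q₀ (fun a => ∑ i ∈ s, lam i a) (∏ i ∈ s, (C i ^ M * D i)) (M * s.card) x := by
  have h1 : ∀ i ∈ s, cl (Q i) (lam i) (D i) M x = cl Q₀ (lam i) (C i ^ M * D i) M x := by
    intro i hi
    have h2 : ev x Q₀ = ev x (Q i) * ev x (C i) := by rw [← h i hi, map_mul]
    have h3 : ev x (C i) ≠ 0 := fun h0 => hx (by rw [h2, h0, mul_zero])
    have h4 : ev x (Q i) ≠ 0 := fun h0 => hx (by rw [h2, h0, zero_mul])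
    simp only [cl, h2, map_mul, map_pow]
    field_simp
    ring
  rw [Finset.prod_congr rfl h1]
  simp only [cl, Finset.prod_div_distrib, Finset.prod_mul_distrib, ← Complex.exp_sum, map_prod,
    map_mul, Finset.prod_const, pow_mul, Finset.sum_mul]
  rw [Finset.sum_comm]

theorem Small.trans_eq {m : ℕ} {x₀ : Fin (k + 1) → ℂ} {ε : ℝ} (h : Small x₀ ε) (κ : ℂ)
    (lam : Fin k → ℂ) (P : LP (Fin k)) {s : Finset (Fin k → ℤ)}
    (hs : ∀ μ, (B k * P).coeff μ ≠ 0 → μ ∈ s)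
    {x : Fin (k + 1) → ℂ} (hx : x ∈ nbh x₀ ε) :
    trans (gT ε) (gT' ε) (jF (ker k (-(m + 1 : ℕ)) κ) (cl (B k) lam P m)) x =
      (2 * Real.pi * Complex.I / m.factorial) ^ k *
        cl (B (k + 1)) (Fin.snoc (α := fun _ => ℂ) lam κ) (Tnum m s κ lam P) ((2 * m + 1) * k) x := by
  have hBx : ev x (B (k + 1)) ≠ 0 := by
    rw [ev_B, sinhVand_ne]
    intro i l hil
    simpa using h.ne hx hil (u := 0) (by simpa using h.pos.le)
  set A : ℂ := Complex.exp (κ * ∑ l, x l) * ev x (B (k + 1)) ^ (m + 1) with hA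
  let f : (Fin k → ℤ) → Fin k → ℝ → ℂ := fun μ i t =>
    Complex.exp ((lam i - κ + μ i) * (x i.castSucc + gT ε t)) /
      (∏ l, Complex.sinh (x i.castSucc + gT ε t - x l) ^ (m + 1)) * gT' ε t
  have e1 : ∀ θ, jF (ker k (-(m + 1 : ℕ)) κ) (cl (B k) lam P m) (wj (gT ε) x θ) *
      ∏ i, gT' ε (θ i) = ∑ μ ∈ s, A * (B k * P).coeff μ * ∏ i, f μ i (θ i) := by
    intro θ
    have hw := h.wj_mem hx θ
    set w := wj (gT ε) x θ with hwdef
    have hz : ev w (Bz k) = ev (w ∘ Sum.inr) (B k) := ev_inr w _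
    have hxx : ev w (Bx k) = ev x (B (k + 1)) := ev_inl w _
    have hX : ev w (X k) = ∏ i, ∏ l, Complex.sinh (x i.castSucc + gT ε (θ i) - x l) := by
      rw [ev_X, Fintype.prod_prod_type]; rfl
    have hX0 := ev_X_ne hw
    have hz0 := ev_Bz_ne hw
    have step1 : jF (ker k (-(m + 1 : ℕ)) κ) (cl (B k) lam P m) w =
        A * (Complex.exp (∑ i, (lam i - κ) * w (Sum.inr i)) * ev (w ∘ Sum.inr) (B k * P)) /
          ev w (X k) ^ (m + 1) := by
      have e : Complex.exp (∑ a, -κ * eps k a * w a) * Complex.exp (∑ i, lam i * w (Sum.inr i)) =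
          Complex.exp (κ * ∑ l, x l) * Complex.exp (∑ i, (lam i - κ) * w (Sum.inr i)) := by
        rw [← Complex.exp_add, ← Complex.exp_add]
        congr 1
        rw [Fintype.sum_sum_type]
        simp only [eps_inl, eps_inr, sub_mul, Finset.sum_sub_distrib, Finset.mul_sum]
        simp [hwdef, wj]; ring
      rw [hz] at hz0
      simp only [jF, ker, cl, Function.comp_apply, zpow_neg, zpow_natCast, hz, hxx, map_mul, hA]
      generalize Complex.exp (∑ a, -κ * eps k a * w a) = E1 at e ⊢
      generalize Complex.exp (∑ i, lam i * w (Sum.inr i)) = E2 at e ⊢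
      generalize Complex.exp (κ * ∑ l, x l) = E3 at e ⊢
      generalize Complex.exp (∑ i, (lam i - κ) * w (Sum.inr i)) = E4 at e ⊢
      calc _ = E1 * E2 * (ev x (B (k + 1)) ^ (m + 1) *
            (ev (w ∘ Sum.inr) (B k) * ev (w ∘ Sum.inr) P) / ev w (X k) ^ (m + 1)) := by
            rw [div_pow, mul_pow, inv_div, pow_succ (ev (w ∘ Sum.inr) (B k))]
            field_simp
        _ = _ := by rw [e]; ring
    rw [step1, ev_eq_sum_of_subset _ _ hs, Finset.mul_sum, Finset.mul_sum, Finset.sum_div,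
      Finset.sum_mul]
    refine Finset.sum_congr rfl fun μ _ => ?_
    have e2 : ∏ i, f μ i (θ i) = Complex.exp (∑ i, (lam i - κ) * w (Sum.inr i)) *
        Complex.exp (pair (w ∘ Sum.inr) μ) / ev w (X k) ^ (m + 1) * ∏ i, gT' ε (θ i) := by
      simp only [f, Finset.prod_mul_distrib, Finset.prod_div_distrib, ← Complex.exp_sum, hX,
        ← Complex.exp_add, ← Finset.prod_pow, pair_apply, ← Finset.sum_add_distrib]
      congr 4
      ext i
      simp [hwdef, wj]; ring
    rw [e2]; ring
  have e3 : ∀ μ i, ∫ t in Set.Ioo (0 : ℝ) 1, f μ i t = 2 * Real.pi * Complex.I / m.factorial *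
      cl (Pn i.castSucc) (Pi.single i.castSucc (lam i - κ + μ i))
        (Dr i.castSucc m (lam i - κ + μ i) m) (2 * m + 1) x := fun μ i => by
    rw [← h.circle hx]
    exact integral_gT ε fun s => Complex.exp ((lam i - κ + μ i) * (x i.castSucc + s)) /
      ∏ l, Complex.sinh (x i.castSucc + s - x l) ^ (m + 1)
  have hint : ∀ μ ∈ s, Integrable (fun θ : Fin k → ℝ =>
      A * (B k * P).coeff μ * ∏ i, f μ i (θ i)) (volume.restrict (box k)) := by
    intro μ _
    have hc : Continuous fun θ : Fin k → ℝ => A * (B k * P).coeff μ * ∏ i, f μ i (θ i) := by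
      refine continuous_const.mul (continuous_finsetProd _ fun i _ => ?_)
      have h1 : Continuous fun θ : Fin k → ℝ => gT ε (θ i) :=
        (continuous_gT ε).comp (continuous_apply i)
      have h2 : Continuous fun θ : Fin k → ℝ => gT' ε (θ i) :=
        (continuous_gT' ε).comp (continuous_apply i)
      refine Continuous.mul (Continuous.div (by fun_prop) (by fun_prop) fun θ => ?_) h2
      refine Finset.prod_ne_zero_iff.2 fun l _ => pow_ne_zero _ ?_
      exact h.wj_mem hx θ (Sum.inr i) (Sum.inl l) (by simp)
    refine (hc.integrableOn_Icc (a := 0) (b := 1)).mono_set fun θ hθ => ?_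
    rw [mem_box] at hθ
    exact ⟨fun i => (hθ i).1.le, fun i => (hθ i).2.le⟩
  rw [trans, setIntegral_congr_fun (measurableSet_box k) (fun θ _ => e1 θ), integral_finsetSum _ hint]
  rw [Tnum]
  have hsum : ∀ (t : Finset (Fin k → ℤ)) (lam' : Fin (k + 1) → ℂ) (F : (Fin k → ℤ) → LP (Fin (k + 1)))
      (M : ℕ), cl (B (k + 1)) lam' (∑ μ ∈ t, F μ) M x = ∑ μ ∈ t, cl (B (k + 1)) lam' (F μ) M x := by
    intro t lam' F M
    simp only [cl, map_sum, Finset.mul_sum, Finset.sum_div]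
  rw [hsum, Finset.mul_sum]
  refine Finset.sum_congr rfl fun μ _ => ?_
  rw [integral_const_mul, integral_box_prod, cl_smul]
  simp only [e3]
  rw [Finset.prod_mul_distrib, Finset.prod_const, Finset.card_univ, Fintype.card_fin,
    prod_cl Finset.univ (fun i : Fin k => Pn i.castSucc) (fun i => Cn i.castSucc) _ (B (k + 1))
      (fun i _ => Pn_mul_Cn _) _ _ hBx, Finset.card_univ, Fintype.card_fin]
  have e4 : ∀ a, ∑ i : Fin k, (Pi.single i.castSucc (lam i - κ + μ i) : Fin (k + 1) → ℂ) a =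
      ext0 (fun i => lam i - κ + μ i) a := by
    intro a
    refine Fin.lastCases ?_ (fun j => ?_) a
    · simp
    · rw [ext0_castSucc, Finset.sum_eq_single j]
      · simp
      · intro i _ hij
        rw [Pi.single_eq_of_ne]
        exact fun e => hij (Fin.castSucc_injective _ e).symm
      · simp
  simp only [cl, e4, Tsum, map_mul, map_pow, ev_single, one_mul, hA]
  have e5 : Complex.exp (κ * ∑ l, x l) *
      Complex.exp (∑ a, ext0 (fun i => lam i - κ + (μ i : ℂ)) a * x a) =
      Complex.exp (∑ a, (Fin.snoc (α := fun _ => ℂ) lam κ : Fin (k + 1) → ℂ) a * x a) *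
        Complex.exp (pair x (sncExp μ)) := by
    rw [← Complex.exp_add, ← Complex.exp_add]
    congr 1
    simp only [Fin.sum_univ_castSucc, pair_apply, ext0_castSucc, ext0_last, Fin.snoc_castSucc,
      Fin.snoc_last, sncExp, AddMonoidHom.coe_mk, ZeroHom.coe_mk, Finset.mul_sum, mul_add,
      add_mul, sub_mul, Finset.sum_add_distrib, Finset.sum_sub_distrib]
    simp; ring
  linear_combination (ev x (B (k + 1)) ^ (m + 1) * (B k * P).coeff μ *
    ((2 * Real.pi * Complex.I / m.factorial) ^ k * (ev x (∏ i : Fin k, (Cn i.castSucc ^ (2 * m + 1) *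
      Dr i.castSucc m (lam i - κ + μ i) m)) / ev x (B (k + 1)) ^ ((2 * m + 1) * k)))) * e5

end TrigBA

namespace TrigBA
namespace LP
variable {σ : Type} [Fintype σ] [DecidableEq σ]

/-- The exponent map of the substitution `x_a = x_b`. -/
def mrgExp (a b : σ) : (σ → ℤ) →+ (σ → ℤ) where
  toFun μ := μ - μ a • (Pi.single a 1 : σ → ℤ) + μ a • (Pi.single b 1 : σ → ℤ)
  map_zero' := by simp
  map_add' μ κ := by
    simp only [Pi.add_apply, add_smul]; abel

/-- The substitution `x_a = x_b + c`. -/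
def mrg (a b : σ) (c : ℂ) : LP σ →ₐ[ℂ] LP σ :=
  AddMonoidAlgebra.lift ℂ (LP σ) (σ → ℤ)
    { toFun := fun μ => AddMonoidAlgebra.single (mrgExp a b μ.toAdd) (Complex.exp (μ.toAdd a * c))
      map_one' := by simp [AddMonoidAlgebra.one_def]
      map_mul' := fun μ κ => by
        simp [AddMonoidAlgebra.single_mul_single, add_mul, Complex.exp_add] }

theorem mrg_single (a b : σ) (c : ℂ) (μ : σ → ℤ) (d : ℂ) :
    mrg a b c (AddMonoidAlgebra.single μ d) =
      AddMonoidAlgebra.single (mrgExp a b μ) (d * Complex.exp (μ a * c)) := by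
  simp [mrg]

theorem ev_mrg (a b : σ) (c : ℂ) (x : σ → ℂ) (D : LP σ) :
    ev x (mrg a b c D) = ev (Function.update x a (x b + c)) D := by
  induction D using AddMonoidAlgebra.induction_linear with
  | zero => simp
  | add f g hf hg => simp [hf, hg]
  | single μ d =>
    rw [mrg_single, ev_single, ev_single, mul_assoc, ← Complex.exp_add]
    congr 2
    have e : Function.update x a (x b + c) = x + (x b + c - x a) • (Pi.single a 1 : σ → ℂ) := by
      ext i
      by_cases hi : i = a
      · subst hi; simp
      · simp [hi]
    rw [e, pair_add_smul]
    have h1 : ∀ y : σ → ℂ, ∀ j : σ, ∀ n : ℤ, pair y (n • Pi.single j 1) = n * y j := fun y j n => by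
      rw [pair_apply, Finset.sum_eq_single j] <;> simp +contextual
    have h2 : pair (Pi.single a 1 : σ → ℂ) μ = μ a := by
      rw [pair_apply, Finset.sum_eq_single a] <;> simp +contextual
    simp only [mrgExp, AddMonoidHom.coe_mk, ZeroHom.coe_mk, map_add, map_sub, h1, h2]
    ring

theorem dvd_single_sub (a b : σ) (c : ℂ) (n : ℤ) :
    (AddMonoidAlgebra.single (Pi.single a 1) 1 -
      AddMonoidAlgebra.single (Pi.single b 1) (Complex.exp c) : LP σ) ∣
    AddMonoidAlgebra.single (n • Pi.single a 1) 1 -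
      AddMonoidAlgebra.single (n • Pi.single b 1) (Complex.exp (n * c)) := by
  have h : ∀ n : ℕ, (AddMonoidAlgebra.single (Pi.single a 1) 1 -
      AddMonoidAlgebra.single (Pi.single b 1) (Complex.exp c) : LP σ) ∣
    AddMonoidAlgebra.single (n • Pi.single a 1) 1 -
      AddMonoidAlgebra.single (n • Pi.single b 1) (Complex.exp (n * c)) := by
    intro n
    have := sub_dvd_pow_sub_pow (AddMonoidAlgebra.single (Pi.single a 1) 1 : LP σ)
      (AddMonoidAlgebra.single (Pi.single b 1) (Complex.exp c)) n
    rwa [AddMonoidAlgebra.single_pow, AddMonoidAlgebra.single_pow, one_pow, ← Complex.exp_nat_mul]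
      at this
  obtain ⟨k, rfl | rfl⟩ := n.eq_nat_or_neg
  · simpa using h k
  · refine ((h k).mul_right (-AddMonoidAlgebra.single (-(k • Pi.single a 1 + k • Pi.single b 1))
      (Complex.exp (-(k * c))))).trans (dvd_of_eq ?_)
    rw [mul_neg, sub_mul, AddMonoidAlgebra.single_mul_single, AddMonoidAlgebra.single_mul_single,
      ← Complex.exp_add]
    simp only [neg_sub, one_mul, neg_smul, natCast_zsmul, Int.cast_neg, Int.cast_natCast, neg_mul,
      add_neg_cancel, Complex.exp_zero]
    congr 2 <;> abel

theorem dvd_sub_mrg (a b : σ) (c : ℂ) (D : LP σ) :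
    (AddMonoidAlgebra.single (Pi.single a 1) 1 -
      AddMonoidAlgebra.single (Pi.single b 1) (Complex.exp c) : LP σ) ∣ D - mrg a b c D := by
  induction D using AddMonoidAlgebra.induction_linear with
  | zero => simp
  | add f g hf hg =>
    rw [map_add, add_sub_add_comm]; exact dvd_add hf hg
  | single μ d =>
    refine ((dvd_single_sub a b c (μ a)).mul_right
      (AddMonoidAlgebra.single (μ - μ a • Pi.single a 1) d)).trans (dvd_of_eq ?_)
    rw [mrg_single, sub_mul, AddMonoidAlgebra.single_mul_single,
      AddMonoidAlgebra.single_mul_single, mrgExp]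
    congr 2
    · abel
    · simp
    · simp [add_comm]
    · ring

theorem exists_S_eq (a b : σ) : ∃ U : LP σ, IsUnit U ∧
    S a b = U * ((AddMonoidAlgebra.single (Pi.single a 1) 1 -
      AddMonoidAlgebra.single (Pi.single b 1) (Complex.exp 0)) *
    (AddMonoidAlgebra.single (Pi.single a 1) 1 -
      AddMonoidAlgebra.single (Pi.single b 1) (Complex.exp (Real.pi * Complex.I)))) := by
  refine ⟨AddMonoidAlgebra.single (-(Pi.single a 1 + Pi.single b 1)) (1 / 2), ?_, ?_⟩
  · refine IsUnit.of_mul_eq_one (AddMonoidAlgebra.single (Pi.single a 1 + Pi.single b 1) 2) ?_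
    rw [AddMonoidAlgebra.single_mul_single, AddMonoidAlgebra.one_def]
    simp
  · rw [Complex.exp_pi_mul_I, Complex.exp_zero, AddMonoidAlgebra.single_neg, sub_neg_eq_add,
      mul_comm (_ - _), ← sq_sub_sq, mul_sub, AddMonoidAlgebra.single_pow, AddMonoidAlgebra.single_pow,
      AddMonoidAlgebra.single_mul_single, AddMonoidAlgebra.single_mul_single, S, rt, rt,
      sub_eq_add_neg (AddMonoidAlgebra.single _ _), ← AddMonoidAlgebra.single_neg]
    congr 2
    · rw [two_smul]; abel
    · norm_num
    · rw [two_smul]; abel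
    · norm_num

theorem mrg_S (a b : σ) (hab : a ≠ b) (c : ℂ) (hc : c = 0 ∨ c = Real.pi * Complex.I) :
    mrg a b c (S a b) = 0 := by
  refine eq_zero_of_ev 0 _ fun r => ?_
  rw [ev_mrg, ev_S, Function.update_self, Function.update_of_ne hab.symm, add_sub_cancel_left]
  rcases hc with rfl | rfl
  · simp
  · rw [Complex.sinh_mul_I]; simp

theorem S_dvd_of_mrg {a b : σ} (hab : a ≠ b) {D : LP σ} (h0 : mrg a b 0 D = 0)
    (h1 : mrg a b (Real.pi * Complex.I) D = 0) : S a b ∣ D := by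
  obtain ⟨U, hU, hS⟩ := exists_S_eq a b
  rw [hS, hU.mul_left_dvd]
  have e0 := dvd_sub_mrg a b 0 D
  rw [h0, sub_zero] at e0
  obtain ⟨D1, rfl⟩ := e0
  refine mul_dvd_mul_left _ ?_
  have e1 := dvd_sub_mrg a b (Real.pi * Complex.I) D1
  rw [map_mul, mul_eq_zero] at h1
  rcases h1 with h1 | h1
  · exfalso
    have := congrArg (ev (0 : σ → ℂ)) h1
    rw [ev_mrg, map_sub, ev_single, ev_single] at this
    simp [pair_single, Function.update_of_ne (Ne.symm hab)] at this
    norm_num at this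
  · rwa [h1, sub_zero] at e1

theorem sinh_ne_zero_of_re {z : ℂ} (h : z.re ≠ 0) : Complex.sinh z ≠ 0 := by
  intro hs
  have e : Complex.exp z = Complex.exp (-z) := by
    rw [Complex.sinh, div_eq_zero_iff] at hs
    exact sub_eq_zero.1 (hs.resolve_right two_ne_zero)
  have := congrArg norm e
  rw [Complex.norm_exp, Complex.norm_exp, Real.exp_eq_exp, Complex.neg_re] at this
  exact h (by linarith)

theorem mrg_S_ne {N : ℕ} {p q : Fin N × Fin N} (hp : p ∈ prs N) (hq : q ∈ prs N) (hpq : q ≠ p)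
    {c : ℂ} (hc : c.re = 0) : mrg p.1 p.2 c (S q.1 q.2) ≠ 0 := by
  obtain ⟨a, b⟩ := p
  obtain ⟨i, j⟩ := q
  rw [mem_prs] at hp hq
  dsimp only at hp hq ⊢
  intro h0
  have h1 := congrArg (ev (fun i : Fin N => ((i : ℕ) : ℂ))) h0
  rw [ev_mrg, ev_S, map_zero] at h1
  have hupd : ∀ l : Fin N, (Function.update (fun i : Fin N => ((i : ℕ) : ℂ)) a (((b : ℕ) : ℂ) + c) l).re =
      if l = a then ((b : ℕ) : ℝ) else ((l : ℕ) : ℝ) := fun l => by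
    by_cases hl : l = a
    · subst hl; simp [hc]
    · simp [hl]
  refine sinh_ne_zero_of_re ?_ h1
  rw [Complex.sub_re, hupd, hupd, sub_ne_zero]
  split_ifs with h2 h3 h3
  · exact absurd (h2.trans h3.symm) hq.ne
  · intro e
    have e' : b = j := Fin.ext (by exact_mod_cast e)
    exact hpq (by rw [h2, e'])
  · intro e
    have e' : i = b := Fin.ext (by exact_mod_cast e)
    subst e' h3
    exact absurd hp (not_lt.2 hq.le)
  · intro e
    exact hq.ne (Fin.ext (by exact_mod_cast e))

theorem mrg_prod_ne {N : ℕ} {p : Fin N × Fin N} (hp : p ∈ prs N) {t : Finset (Fin N × Fin N)}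
    (ht : t ⊆ (prs N).erase p) {c : ℂ} (hc : c.re = 0) :
    mrg p.1 p.2 c (∏ q ∈ t, S q.1 q.2) ≠ 0 := by
  rw [map_prod]
  refine Finset.prod_ne_zero_iff.2 fun q hq => ?_
  obtain ⟨h1, h2⟩ := Finset.mem_erase.1 (ht hq)
  exact mrg_S_ne hp h2 h1 hc

theorem S_dvd_of_mul {N : ℕ} {p : Fin N × Fin N} (hp : p ∈ prs N) {F D : LP (Fin N)}
    (hF : ∀ c : ℂ, c.re = 0 → mrg p.1 p.2 c F ≠ 0) (h : S p.1 p.2 ∣ F * D) : S p.1 p.2 ∣ D := by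
  have hne : p.1 ≠ p.2 := (mem_prs.1 hp).ne
  have key : ∀ c : ℂ, c.re = 0 → (c = 0 ∨ c = Real.pi * Complex.I) → mrg p.1 p.2 c D = 0 := by
    intro c hc hc'
    obtain ⟨G, hG⟩ := h
    have := congrArg (mrg p.1 p.2 c) hG
    rw [map_mul, map_mul, mrg_S _ _ hne c hc', zero_mul, mul_eq_zero] at this
    exact this.resolve_left (hF c hc)
  exact S_dvd_of_mrg hne (key 0 rfl (Or.inl rfl)) (key _ (by simp) (Or.inr rfl))

theorem B_dvd {N : ℕ} {D : LP (Fin N)} (h : ∀ p ∈ prs N, S p.1 p.2 ∣ D) : B N ∣ D := by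
  classical
  suffices H : ∀ t ⊆ prs N, ∏ q ∈ t, S q.1 q.2 ∣ D from H _ subset_rfl
  intro t
  induction t using Finset.induction_on with
  | empty => simp
  | insert p t hpt ih =>
    intro ht
    have hp := ht (Finset.mem_insert_self p t)
    obtain ⟨E, rfl⟩ := ih fun q hq => ht (Finset.mem_insert_of_mem hq)
    rw [Finset.prod_insert hpt, mul_comm]
    refine mul_dvd_mul_left _ (S_dvd_of_mul hp (F := ∏ q ∈ t, S q.1 q.2) (fun c hc => ?_) (h p hp))
    exact mrg_prod_ne hp (fun q hq => Finset.mem_erase.2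
      ⟨fun e => hpt (e ▸ hq), ht (Finset.mem_insert_of_mem hq)⟩) hc

theorem Ch_sq (a b : σ) : Ch a b ^ 2 = 1 + S a b ^ 2 := by
  refine sub_eq_zero.1 (eq_zero_of_ev 0 _ fun r => ?_)
  simp only [map_sub, map_add, map_pow, map_one, ev_S, ev_Ch, Complex.cosh_sq]
  ring

end LP
open LP

theorem Vn_eq {N m : ℕ} {p : Fin N × Fin N} (hp : p ∈ prs N) :
    ∃ G, Vn N m = (2 * (m : ℂ) * (m + 1)) • Bc p ^ 2 + S p.1 p.2 * G := by
  have h : S p.1 p.2 ∣ ∑ q ∈ (prs N).erase p, (2 * (m : ℂ) * (m + 1)) • Bc q ^ 2 := by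
    refine Finset.dvd_sum fun q hq => ?_
    have hpq : p ∈ (prs N).erase q := Finset.mem_erase.2 ⟨(Finset.mem_erase.1 hq).1.symm, hp⟩
    have hC : S p.1 p.2 ∣ Bc q := by
      unfold Bc
      exact Finset.dvd_prod_of_mem (fun r : Fin N × Fin N => S r.1 r.2) hpq
    rw [Algebra.smul_def]
    exact (dvd_pow hC two_ne_zero).mul_left _
  obtain ⟨G, hG⟩ := h
  exact ⟨G, by rw [Vn, ← Finset.add_sum_erase _ _ hp, hG]⟩

theorem IsEig.mrg_eq_zero {N m M : ℕ} (hM : m < M) {lam : Fin N → ℂ} {D : LP (Fin N)} {E : ℂ}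
    (h : Lop m lam M D = E • (B N ^ 2 * D)) {p : Fin N × Fin N} (hp : p ∈ prs N) {c : ℂ}
    (hc : c = 0 ∨ c = Real.pi * Complex.I) : mrg p.1 p.2 c D = 0 := by
  have hB := S_mul_Bc hp
  have hne : p.1 ≠ p.2 := (mem_prs.1 hp).ne
  have hc0 : c.re = 0 := by rcases hc with rfl | rfl <;> simp
  have hS0 := mrg_S _ _ hne c hc
  have hBc : mrg p.1 p.2 c (Bc p) ≠ 0 := mrg_prod_ne hp subset_rfl hc0
  have hCh : mrg p.1 p.2 c (Ch p.1 p.2) ^ 2 = 1 := by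
    rw [← map_pow, Ch_sq, map_add, map_pow, hS0]; simp
  have hV : mrg p.1 p.2 c (Vn N m) = (2 * (m : ℂ) * (m + 1)) • mrg p.1 p.2 c (Bc p) ^ 2 := by
    obtain ⟨G, hG⟩ := Vn_eq (m := m) hp
    rw [hG, map_add, map_smul, map_pow, map_mul, hS0, zero_mul, add_zero]
  generalize mrg p.1 p.2 c = π at *
  have hB0 : π (B N) = 0 := by rw [← hB, map_mul, hS0, zero_mul]
  have hd : ∀ v, π (der v (B N)) = (v p.1 - v p.2) • (π (Ch p.1 p.2) * π (Bc p)) := fun v => by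
    rw [← hB, Derivation.leibniz, der_S, map_add, smul_eq_mul, smul_eq_mul, map_mul, map_mul, hS0,
      zero_mul, zero_add, mul_comm, map_smul, smul_mul_assoc]
  have e2 : ∀ v M F, π (qder (B N) lam v M F) = -(M : LP (Fin N)) * (π (der v (B N)) * π F) :=
    fun v M F => by
      rw [qder, map_sub, map_mul, hB0, map_mul, map_mul, map_natCast]; ring
  have hq : ∀ v, π (qder (B N) lam v (M + 1) (qder (B N) lam v M D)) =
      (v p.1 - v p.2) ^ 2 • (((M + 1 : ℕ) : LP (Fin N)) * M * (π (Bc p) ^ 2 * π D)) := fun v => by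
    rw [e2, e2, hd]
    simp only [Algebra.smul_def, map_pow]
    linear_combination (((M + 1 : ℕ) : LP (Fin N)) * M * (π (Bc p) ^ 2 * π D) *
      (algebraMap ℂ (LP (Fin N)) (v p.1 - v p.2)) ^ 2) * hCh
  have h1 := congrArg π h
  rw [Lop, map_add, map_neg, map_sum, map_mul, hV, map_smul, map_mul, map_pow, hB0] at h1
  simp only [hq] at h1
  have hs : ∑ l : Fin N, ((Pi.single l 1 : Fin N → ℂ) p.1 - (Pi.single l 1 : Fin N → ℂ) p.2) ^ 2 = 2 := by
    have : ∀ l : Fin N, ((Pi.single l 1 : Fin N → ℂ) p.1 - (Pi.single l 1 : Fin N → ℂ) p.2) ^ 2 =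
        (if l = p.1 then 1 else 0) + if l = p.2 then 1 else 0 := fun l => by
      by_cases h1 : l = p.1
      · subst h1; simp [hne, hne.symm]
      · by_cases h2 : l = p.2
        · subst h2; simp [hne, hne.symm]
        · simp [h1, h2, Ne.symm h1, Ne.symm h2]
    simp only [this, Finset.sum_add_distrib, Finset.sum_ite_eq', Finset.mem_univ, if_true]
    norm_num
  rw [← Finset.sum_smul, hs] at h1
  have h2 : ((2 * ((m : ℂ) * (m + 1) - M * (M + 1)) : ℂ)) • (π (Bc p) ^ 2 * π D) = 0 := by
    have e : ((2 * ((m : ℂ) * (m + 1) - M * (M + 1)) : ℂ)) • (π (Bc p) ^ 2 * π D) =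
        -((2 : ℂ) • (((M + 1 : ℕ) : LP (Fin N)) * M * (π (Bc p) ^ 2 * π D))) +
          (2 * (m : ℂ) * (m + 1)) • π (Bc p) ^ 2 * π D := by
      simp only [Algebra.smul_def, map_mul, map_sub, map_add, map_natCast, map_one, map_ofNat]
      push_cast
      ring
    rw [e, h1]; simp
  have hcc : (2 * ((m : ℂ) * (m + 1) - M * (M + 1))) ≠ 0 := by
    refine mul_ne_zero two_ne_zero (sub_ne_zero.2 ?_)
    have : m * (m + 1) < M * (M + 1) := by nlinarith
    exact_mod_cast this.ne
  exact (mul_eq_zero.1 ((smul_eq_zero.1 h2).resolve_left hcc)).resolve_left (pow_ne_zero _ hBc)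

theorem IsEig.B_dvd {N m M : ℕ} (hM : m < M) {lam : Fin N → ℂ} {D : LP (Fin N)} {E : ℂ}
    (h : IsEig m lam D M E) : B N ∣ D := LP.B_dvd fun _ hp =>
  S_dvd_of_mrg (mem_prs.1 hp).ne (IsEig.mrg_eq_zero hM h hp (Or.inl rfl))
    (IsEig.mrg_eq_zero hM h hp (Or.inr rfl))

theorem IsEig.of_mul {N m M r : ℕ} {lam : Fin N → ℂ} {D : LP (Fin N)} {E : ℂ} :
    IsEig m lam (B N ^ r * D) (M + r) E ↔ IsEig m lam D M E := by
  have key : ∀ x, sinhVand x ≠ 0 → cl (B N) lam (B N ^ r * D) (M + r) x = cl (B N) lam D M x :=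
    fun x hx => cl_mul_pow _ _ _ _ _ _ (by simpa using hx)
  rw [isEig_iff, isEig_iff]
  refine forall_congr' fun x => forall_congr' fun hx => ?_
  rw [key x hx, sutherland_congr (Filter.eventuallyEq_of_mem
    ((isOpen_sinhVand_ne N).mem_nhds hx) key)]

theorem IsEig.pow_dvd {N m : ℕ} {lam : Fin N → ℂ} {E : ℂ} (r : ℕ) {D : LP (Fin N)}
    (h : IsEig m lam D (m + r) E) : ∃ D', D = B N ^ r * D' ∧ IsEig m lam D' m E := by
  induction r generalizing D with
  | zero => exact ⟨D, by simp, h⟩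
  | succ r ih =>
    obtain ⟨D1, rfl⟩ := IsEig.B_dvd (by omega) h
    have h1 : IsEig m lam D1 (m + r) E := by
      rw [← IsEig.of_mul (r := 1), pow_one]; exact h
    obtain ⟨D', rfl, hD'⟩ := ih h1
    exact ⟨D', by ring, hD'⟩

end TrigBA

namespace TrigBA
open LP
variable {k : ℕ}

theorem prod_prs_succ {R : Type*} [CommMonoid R] (f : Fin (k + 1) × Fin (k + 1) → R) :
    ∏ p ∈ prs (k + 1), f p = (∏ p ∈ prs k, f (p.1.castSucc, p.2.castSucc)) *
      ∏ i : Fin k, f (i.castSucc, Fin.last k) := by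
  rw [prs, prs, Finset.prod_filter, Finset.prod_filter, Fintype.prod_prod_type,
    Fintype.prod_prod_type, Fin.prod_univ_castSucc]
  have h : ∀ j : Fin (k + 1), ¬ Fin.last k < j := fun j => not_lt.2 (Fin.le_last j)
  simp only [Fin.prod_univ_castSucc, Fin.castSucc_lt_castSucc_iff, Fin.castSucc_lt_last, if_true,
    h, if_false, Finset.prod_const_one, mul_one, Finset.prod_mul_distrib]

theorem card_prs_succ (k : ℕ) : (prs (k + 1)).card = (prs k).card + k := by
  have := prod_prs_succ (k := k) (R := Multiplicative ℕ) fun _ => Multiplicative.ofAdd 1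
  simp only [Finset.prod_const, ← ofAdd_nsmul, ← ofAdd_add, EmbeddingLike.apply_eq_iff_eq,
    smul_eq_mul, mul_one, Finset.card_univ, Fintype.card_fin] at this
  exact this

theorem vand_eq {N : ℕ} (u : Fin N → ℂ) : vand u = ∏ p ∈ prs N, (u p.1 - u p.2) :=
  prod_prs fun i j => u i - u j

theorem vand_succ (ν : Fin (k + 1) → ℂ) : vand ν =
    vand (ν ∘ Fin.castSucc) * ∏ i : Fin k, (ν i.castSucc - ν (Fin.last k)) := by
  rw [vand_eq, vand_eq, prod_prs_succ]; rfl

namespace LP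

theorem emb_snc_S (a b : Fin k) : emb sncExp (S a b) = S a.castSucc b.castSucc := by
  have h : ∀ a b : Fin k, sncExp (rt a b) = rt a.castSucc b.castSucc := by
    intro a b
    ext i
    refine Fin.lastCases ?_ (fun j => ?_) i
    · simp [sncExp, rt]
    · simp [sncExp, rt, Pi.single_apply]
  simp [S, h]

theorem B_succ (k : ℕ) : B (k + 1) = emb sncExp (B k) * ∏ i : Fin k, S i.castSucc (Fin.last k) := by
  rw [B, prod_prs_succ, B, map_prod]
  simp only [emb_snc_S]

theorem prod_Pn (k : ℕ) : ∃ σ : ℂ, σ ≠ 0 ∧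
    ∏ i : Fin k, Pn i.castSucc = σ • (emb sncExp (B k) * B (k + 1)) := by
  have h1 : ∀ i : Fin k, Pn i.castSucc =
      (∏ l ∈ Finset.univ.erase i, emb sncExp (S i l)) * S i.castSucc (Fin.last k) := by
    intro i
    have e : (Finset.univ.erase i.castSucc : Finset (Fin (k + 1))) =
        insert (Fin.last k) ((Finset.univ.erase i).map Fin.castSuccEmb) := by
      ext l
      refine Fin.lastCases ?_ (fun j => ?_) l
      · simp [Fin.ext_iff]; omega
      · simp [Fin.ext_iff]; omega
    rw [Pn, e, Finset.prod_insert (by simp), Finset.prod_map, mul_comm]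
    simp [emb_snc_S]
  have h2 : ∃ σ : ℂ, σ ≠ 0 ∧ ∏ i : Fin k, ∏ l ∈ Finset.univ.erase i, S i l = σ • (B k * B k) := by
    refine ⟨(-1) ^ (prs k).card, by simp, ?_⟩
    have e1 : ∀ i : Fin k, (Finset.univ.erase i : Finset (Fin k)) = Finset.Ioi i ∪ Finset.Iio i := by
      intro i; ext l; simp [lt_or_lt_iff_ne, eq_comm]
    have e2 : ∀ i : Fin k, ∏ l ∈ Finset.univ.erase i, S i l =
        (∏ l ∈ Finset.Ioi i, S i l) * ∏ l ∈ Finset.Iio i, S i l := fun i => by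
      rw [e1, Finset.prod_union]
      rw [Finset.disjoint_left]; intro l h h'
      exact absurd (Finset.mem_Ioi.1 h) (not_lt.2 (Finset.mem_Iio.1 h').le)
    have e3 : ∏ i : Fin k, ∏ l ∈ Finset.Iio i, S i l = ∏ p ∈ prs k, S p.2 p.1 := by
      rw [← prod_prs fun i j => S j i]
      rw [Finset.prod_sigma', Finset.prod_sigma']
      refine Finset.prod_bij' (fun x _ => ⟨x.2, x.1⟩) (fun x _ => ⟨x.2, x.1⟩) ?_ ?_ ?_ ?_ ?_ <;> simp
    rw [Finset.prod_congr rfl fun i _ => e2 i, Finset.prod_mul_distrib, prod_prs fun i j => S i j, e3]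
    have e4 : ∏ p ∈ prs k, S p.2 p.1 = ((-1 : ℂ) ^ (prs k).card) • B k := by
      have : ∀ p : Fin k × Fin k, S p.2 p.1 = (-1 : ℂ) • S p.1 p.2 := fun p => by
        rw [S_swap]; simp
      simp only [this]
      rw [Finset.prod_smul, Finset.prod_const]; rfl
    rw [e4, mul_smul_comm]; rfl
  obtain ⟨σ, hσ, h2⟩ := h2
  refine ⟨σ, hσ, ?_⟩
  rw [Finset.prod_congr rfl fun i _ => h1 i, Finset.prod_mul_distrib, B_succ]
  simp only [← map_prod]
  rw [h2, map_smul, map_mul, smul_mul_assoc, mul_assoc]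

/-- The part of the recursion for `Dr` that does not involve the spectral parameter. -/
def drL {N : ℕ} (i : Fin N) (m j : ℕ) : LP (Fin N) →ₗ[ℂ] LP (Fin N) :=
  LinearMap.mulLeft ℂ (Pn i) ∘ₗ (der (Pi.single i 1)).toLinearMap -
    LinearMap.mulLeft ℂ (((m + 1 + j : ℕ) : LP (Fin N)) * der (Pi.single i 1) (Pn i)) +
    ((m : ℂ) - 1 - 2 * j) • LinearMap.mulLeft ℂ (Pn i)

theorem Dr_succ {N : ℕ} (i : Fin N) (m j : ℕ) (b : ℂ) :
    Dr i m b (j + 1) = (b • 1) * (Pn i * Dr i m b j) + drL i m j (Dr i m b j) := by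
  have h : ∑ a, (Pi.single i b : Fin N → ℂ) a * (Pi.single i 1 : Fin N → ℂ) a = b := by
    rw [Finset.sum_eq_single i] <;> simp +contextual
  rw [Dr, qder, h]
  simp only [drL, LinearMap.add_apply, LinearMap.sub_apply, LinearMap.comp_apply,
    LinearMap.mulLeft_apply, LinearMap.smul_apply]
  simp only [Derivation.coeFn_coe]
  rw [mul_add, mul_smul_comm, smul_one_mul]
  ring

theorem polyFam_Dr {N n : ℕ} (i : Fin n) (m : ℕ) {β L : (Fin N → ℂ) → ℂ}
    (h : PolyFam 1 (fun ν => β ν • (1 : LP (Fin n))) (fun ν => L ν • 1)) (j : ℕ) :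
    PolyFam j (fun ν => Dr i m (β ν) j) (fun ν => (L ν • Pn i) ^ j) := by
  induction j with
  | zero => simpa [Dr] using PolyFam.const (N := N) (1 : LP (Fin n))
  | succ j ih =>
    simp only [Dr_succ]
    have h1 := h.mul (ih.map (LinearMap.mulLeft ℂ (Pn i)))
    have h2 := (ih.map (drL i m j)).lower (Nat.lt_succ_self j)
    rw [add_comm 1 j] at h1
    have h3 := h1.add h2
    simp only [LinearMap.mulLeft_apply, add_zero] at h3
    convert h3 using 2 with ν
    rw [pow_succ', smul_one_mul, smul_mul_assoc]

theorem sum_coeff_emb {s : Finset (Fin k → ℤ)} {D : LP (Fin k)}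
    (hs : ∀ μ, D.coeff μ ≠ 0 → μ ∈ s) :
    ∑ μ ∈ s, D.coeff μ • (AddMonoidAlgebra.single (sncExp μ) 1 : LP (Fin (k + 1))) = emb sncExp D := by
  have h1 : D = ∑ μ ∈ s, AddMonoidAlgebra.single μ (D.coeff μ) := by
    rw [← Finset.sum_subset (s₁ := D.coeff.support) (fun μ h => hs μ (Finsupp.mem_support_iff.1 h))]
    · exact (AddMonoidAlgebra.sum_coeff_single D).symm
    · intro μ _ hμ
      rw [Finsupp.notMem_support_iff.1 hμ]; simp
  conv_rhs => rw [h1]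
  rw [map_sum]
  simp

theorem coeffL_apply {σ : Type} (μ : σ → ℤ) (D : LP σ) : coeffL μ D = D.coeff μ := rfl

theorem polyFam_Tnum (hk : 0 < k) (m : ℕ) {P : (Fin k → ℂ) → LP (Fin k)}
    (hP : PolyFam (m * (prs k).card) P fun ν => vand ν ^ m • B k ^ m) :
    ∃ (s : Finset (Fin k → ℤ)) (c : ℂ), c ≠ 0 ∧ (∀ ν μ, (B k * P ν).coeff μ ≠ 0 → μ ∈ s) ∧
      PolyFam (m * (prs (k + 1)).card)
        (fun ν : Fin (k + 1) → ℂ => Tnum m s (2 * ν (Fin.last k)) (fun i => 2 * ν i.castSucc)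
          (P (ν ∘ Fin.castSucc)))
        fun ν => (c * vand ν ^ m) • B (k + 1) ^ ((2 * m + 1) * k) := by
  classical
  have h1 := hP.map (LinearMap.mulLeft ℂ (B k))
  simp only [LinearMap.mulLeft_apply] at h1
  obtain ⟨s₀, hs₀⟩ := MS_finite h1.mem
  set s := s₀ ∪ (B k ^ (m + 1)).coeff.support with hsdef
  obtain ⟨σ, hσ, hPn⟩ := prod_Pn k
  refine ⟨s, (2 ^ m) ^ k * (σ⁻¹) ^ (m + 1), mul_ne_zero (pow_ne_zero _ (pow_ne_zero _ two_ne_zero)) (pow_ne_zero _ (inv_ne_zero hσ)), fun ν μ h =>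
    Finset.mem_union_left _ (hs₀ ν μ h), ?_⟩
  have hDr : ∀ μ : Fin k → ℤ, ∀ i : Fin k, PolyFam m
      (fun ν : Fin (k + 1) → ℂ => Cn i.castSucc ^ (2 * m + 1) *
        Dr i.castSucc m (2 * ν i.castSucc - 2 * ν (Fin.last k) + μ i) m)
      (fun ν => Cn i.castSucc ^ (2 * m + 1) *
        ((2 * (ν i.castSucc - ν (Fin.last k))) • Pn i.castSucc) ^ m) := fun μ i => by
    have := polyFam_Dr i.castSucc m (PolyFam.lin 2 (μ i) i.castSucc (Fin.last k) 1) m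
    have := this.map (LinearMap.mulLeft ℂ (Cn i.castSucc ^ (2 * m + 1)))
    simpa only [mul_sub, LinearMap.mulLeft_apply] using this
  have hT : ∀ μ : Fin k → ℤ, PolyFam (k * m)
      (fun ν : Fin (k + 1) → ℂ => Tsum m (fun i => 2 * ν i.castSucc - 2 * ν (Fin.last k)) μ)
      (fun ν => B (k + 1) ^ (m + 1) * (AddMonoidAlgebra.single (sncExp μ) 1 *
        ∏ i : Fin k, Cn i.castSucc ^ (2 * m + 1) *
          ((2 * (ν i.castSucc - ν (Fin.last k))) • Pn i.castSucc) ^ m)) := fun μ => by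
    have := PolyFam.prod Finset.univ fun i _ => hDr μ i
    rw [Finset.card_univ, Fintype.card_fin] at this
    exact (this.map (LinearMap.mulLeft ℂ (AddMonoidAlgebra.single (sncExp μ) 1))).map
      (LinearMap.mulLeft ℂ (B (k + 1) ^ (m + 1)))
  have hc : ∀ μ : Fin k → ℤ, PolyFam (m * (prs k).card)
      (fun ν : Fin (k + 1) → ℂ => algebraMap ℂ (LP (Fin (k + 1)))
        ((B k * P (ν ∘ Fin.castSucc)).coeff μ)) _ := fun μ =>
    (h1.castSucc.map (coeffL μ)).map (Algebra.linearMap ℂ (LP (Fin (k + 1))))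
  have hsum := PolyFam.sum s fun μ _ => (hc μ).mul (hT μ)
  rw [show m * (prs (k + 1)).card = m * (prs k).card + k * m by rw [card_prs_succ]; ring]
  have ef : (fun ν : Fin (k + 1) → ℂ => Tnum m s (2 * ν (Fin.last k)) (fun i => 2 * ν i.castSucc)
      (P (ν ∘ Fin.castSucc))) = fun ν : Fin (k + 1) → ℂ => ∑ μ ∈ s, algebraMap ℂ (LP (Fin (k + 1)))
        ((B k * P (ν ∘ Fin.castSucc)).coeff μ) *
        Tsum m (fun i => 2 * ν i.castSucc - 2 * ν (Fin.last k)) μ := by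
    ext1 ν
    simp only [Tnum, Algebra.smul_def]
  rw [ef]
  convert hsum using 2 with ν
  have e0 : ∏ i : Fin k, Cn i.castSucc ^ (2 * m + 1) *
      ((2 * (ν i.castSucc - ν (Fin.last k))) • Pn i.castSucc) ^ m =
      ((2 ^ m) ^ k * (∏ i : Fin k, (ν i.castSucc - ν (Fin.last k))) ^ m) •
        ((∏ i : Fin k, Cn i.castSucc) ^ (m + 1) * B (k + 1) ^ (m * k)) := by
    have : ∀ i : Fin k, Cn i.castSucc ^ (2 * m + 1) *
      ((2 * (ν i.castSucc - ν (Fin.last k))) • Pn i.castSucc) ^ m =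
      (2 ^ m * (ν i.castSucc - ν (Fin.last k)) ^ m) • (Cn i.castSucc ^ (m + 1) * B (k + 1) ^ m) := by
      intro i
      rw [smul_pow, mul_smul_comm, mul_pow, ← Pn_mul_Cn i.castSucc]
      congr 1; ring
    simp only [this]
    rw [Finset.prod_smul, Finset.prod_mul_distrib, Finset.prod_mul_distrib, Finset.prod_const,
      Finset.prod_const, Finset.prod_pow, Finset.prod_pow, Finset.card_univ, Fintype.card_fin,
      ← pow_mul (B (k + 1))]
  have e1 : emb sncExp (B k) * ∏ i : Fin k, Cn i.castSucc = σ⁻¹ • B (k + 1) ^ (k - 1) := by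
    have : B (k + 1) * (emb sncExp (B k) * ∏ i : Fin k, Cn i.castSucc) =
        B (k + 1) * (σ⁻¹ • B (k + 1) ^ (k - 1)) := by
      rw [mul_smul_comm, ← pow_succ', Nat.sub_add_cancel hk]
      have h2 : ∏ i : Fin k, (Pn i.castSucc * Cn i.castSucc) = B (k + 1) ^ k := by
        simp [Pn_mul_Cn]
      rw [← h2, Finset.prod_mul_distrib, hPn, smul_mul_assoc, smul_smul, inv_mul_cancel₀ hσ, one_smul]
      ring
    exact mul_left_cancel₀ (B_ne_zero _) this
  simp only [e0, coeffL_apply, Algebra.linearMap_apply, ← Algebra.smul_def]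
  have e2 : ∀ μ, (B k * vand (ν ∘ Fin.castSucc) ^ m • B k ^ m).coeff μ =
      vand (ν ∘ Fin.castSucc) ^ m * (B k ^ (m + 1)).coeff μ := fun μ => by
    rw [mul_smul_comm, ← pow_succ']; rfl
  set G := ((2 ^ m) ^ k * (∏ i : Fin k, (ν i.castSucc - ν (Fin.last k))) ^ m) •
        ((∏ i : Fin k, Cn i.castSucc) ^ (m + 1) * B (k + 1) ^ (m * k)) with hG
  have e3 : ∑ μ ∈ s, (B k * vand (ν ∘ Fin.castSucc) ^ m • B k ^ m).coeff μ •
      (B (k + 1) ^ (m + 1) * (AddMonoidAlgebra.single (sncExp μ) 1 * G)) =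
      vand (ν ∘ Fin.castSucc) ^ m • (B (k + 1) ^ (m + 1) * (emb sncExp (B k ^ (m + 1)) * G)) := by
    rw [← sum_coeff_emb (s := s) (fun μ hμ => Finset.mem_union_right _ (Finsupp.mem_support_iff.2 hμ)),
      Finset.sum_mul, Finset.mul_sum, Finset.smul_sum]
    refine Finset.sum_congr rfl fun μ _ => ?_
    rw [e2, mul_smul, smul_mul_assoc, mul_smul_comm (_ : ℂ) (B (k + 1) ^ (m + 1))]
  rw [e3, hG, map_pow, vand_succ]
  have e4 : B (k + 1) ^ (m + 1) * (emb sncExp (B k) ^ (m + 1) *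
      ((∏ i : Fin k, Cn i.castSucc) ^ (m + 1) * B (k + 1) ^ (m * k))) =
      (σ⁻¹ ^ (m + 1)) • B (k + 1) ^ ((2 * m + 1) * k) := by
    rw [← mul_assoc (emb sncExp (B k) ^ (m + 1)), ← mul_pow, e1, smul_pow, smul_mul_assoc,
      mul_smul_comm, ← pow_mul, ← pow_add, ← pow_add]
    congr 2
    obtain ⟨j, rfl⟩ := Nat.exists_eq_succ_of_ne_zero hk.ne'
    simp only [Nat.succ_eq_add_one, Nat.add_sub_cancel]; ring
  rw [mul_smul_comm, mul_smul_comm, e4, smul_smul, smul_smul]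
  congr 1; ring

end LP

theorem isEig_Tnum {m : ℕ} {s : Finset (Fin k → ℤ)} {κ E : ℂ} {lam : Fin k → ℂ} {P : LP (Fin k)}
    (hs : ∀ μ, (B k * P).coeff μ ≠ 0 → μ ∈ s) (h : IsEig m lam P m E) :
    IsEig m (Fin.snoc (α := fun _ => ℂ) lam κ : Fin (k + 1) → ℂ) (Tnum m s κ lam P)
      ((2 * m + 1) * k) (E - κ ^ 2) := by
  rw [isEig_iff]
  intro x hx
  obtain ⟨ε, hε⟩ := exists_small hx
  have h1 := hε.eig κ h hε.mem
  have h2 := fun y (hy : y ∈ nbh x ε) => hε.trans_eq (m := m) κ lam P hs hy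
  set C : ℂ := (2 * Real.pi * Complex.I / m.factorial) ^ k with hC
  have hC0 : C ≠ 0 := by
    rw [hC]
    exact pow_ne_zero _ (div_ne_zero Complex.two_pi_I_ne_zero (by exact_mod_cast m.factorial_ne_zero))
  rw [sutherland_congr (Filter.eventuallyEq_of_mem ((isOpen_nbh x ε).mem_nhds hε.mem) h2),
    h2 x hε.mem] at h1
  rw [show (fun y => C * cl (B (k + 1)) (Fin.snoc (α := fun _ => ℂ) lam κ) (Tnum m s κ lam P)
    ((2 * m + 1) * k) y) = cl (B (k + 1)) (Fin.snoc (α := fun _ => ℂ) lam κ)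
      (C • Tnum m s κ lam P) ((2 * m + 1) * k) from funext fun y => (cl_smul _ _ _ _ _ _).symm,
    sutherland_cl _ _ _ hx, Lop_smul, cl_smul] at h1
  rw [sutherland_cl _ _ _ hx]
  exact mul_left_cancel₀ hC0 (by rw [h1]; ring)

end TrigBA

namespace TrigBA
namespace LP

/-! ### Leading exponents -/

section Lead
variable {σ τ : Type} [Fintype σ] [Fintype τ]

/-- All exponents of `D` have weight at most that of `κ`, and the coefficient at `κ` is `c`. -/
def Lead (w : (σ → ℤ) →+ ℝ) (D : LP σ) (κ : σ → ℤ) (c : ℂ) : Prop :=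
  D.coeff κ = c ∧ ∀ μ, D.coeff μ ≠ 0 → w μ ≤ w κ

variable {w : (σ → ℤ) →+ ℝ} {D E : LP σ} {κ κ' : σ → ℤ} {c c' : ℂ}

theorem Lead.add (h : Lead w D κ c) (h' : Lead w E κ c') : Lead w (D + E) κ (c + c') := by
  refine ⟨by simp [h.1, h'.1], fun μ hμ => ?_⟩
  by_cases h0 : D.coeff μ = 0
  · exact h'.2 μ (by simpa [h0] using hμ)
  · exact h.2 μ h0

theorem Lead.smul (h : Lead w D κ c) (a : ℂ) : Lead w (a • D) κ (a * c) :=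
  ⟨by simp [h.1], fun _ hμ => h.2 _ fun h0 => hμ (by simp [h0])⟩

theorem Lead.sub (h : Lead w D κ c) (h' : Lead w E κ c') : Lead w (D - E) κ (c - c') := by
  have := h.add (h'.smul (-1))
  simpa [sub_eq_add_neg] using this

theorem Lead.zero : Lead w (0 : LP σ) κ 0 := ⟨rfl, fun _ hμ => absurd rfl hμ⟩

theorem Lead.sum {ι : Type} (s : Finset ι) {D : ι → LP σ} {c : ι → ℂ}
    (h : ∀ i ∈ s, Lead w (D i) κ (c i)) : Lead w (∑ i ∈ s, D i) κ (∑ i ∈ s, c i) := by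
  classical
  induction s using Finset.induction_on with
  | empty => simpa using Lead.zero
  | insert a s ha ih =>
    rw [Finset.sum_insert ha, Finset.sum_insert ha]
    exact (h a (Finset.mem_insert_self a s)).add (ih fun i hi => h i (Finset.mem_insert_of_mem hi))

theorem Lead.der (h : Lead w D κ c) (v : σ → ℂ) : Lead w (der v D) κ (pair v κ * c) :=
  ⟨by simp [h.1], fun μ hμ => h.2 μ fun h0 => hμ (by simp [h0])⟩

theorem Lead.mul (hw : Function.Injective w) (h : Lead w D κ c) (h' : Lead w E κ' c') :
    Lead w (D * E) (κ + κ') (c * c') := by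
  constructor
  · rw [← h.1, ← h'.1]
    refine AddMonoidAlgebra.coeff_mul_add_of_uniqueAdd fun a b ha hb hab => ?_
    have h1 := h.2 a (Finsupp.mem_support_iff.1 ha)
    have h2 := h'.2 b (Finsupp.mem_support_iff.1 hb)
    have h3 := congrArg w hab
    rw [map_add, map_add] at h3
    exact ⟨hw (by linarith), hw (by linarith)⟩
  · intro μ hμ
    obtain ⟨a, b, ha, hb, rfl⟩ := exists_of_coeff_mul_ne hμ
    rw [map_add, map_add]
    exact add_le_add (h.2 a ha) (h'.2 b hb)

theorem Lead.of_lt (h : Lead w D κ c) (hlt : w κ < w κ') : Lead w D κ' 0 :=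
  ⟨by
    by_contra h0
    exact absurd (h.2 κ' h0) (not_le.2 hlt), fun μ hμ => (h.2 μ hμ).trans hlt.le⟩

theorem Lead.one : Lead w (1 : LP σ) 0 1 := by
  classical
  refine ⟨by simp [AddMonoidAlgebra.one_def], fun μ hμ => ?_⟩
  rw [AddMonoidAlgebra.one_def, AddMonoidAlgebra.coeff_single, Finsupp.single_apply] at hμ
  split_ifs at hμ with h0
  · rw [← h0]
  · exact absurd rfl hμ

theorem Lead.single (κ : σ → ℤ) (c : ℂ) : Lead w (AddMonoidAlgebra.single κ c : LP σ) κ c := by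
  classical
  refine ⟨by simp, fun μ hμ => ?_⟩
  rw [AddMonoidAlgebra.coeff_single, Finsupp.single_apply] at hμ
  split_ifs at hμ with h0
  · rw [← h0]
  · exact absurd rfl hμ

theorem Lead.prod (hw : Function.Injective w) {ι : Type} (s : Finset ι) {D : ι → LP σ} {c : ι → ℂ}
    {κ : ι → σ → ℤ} (h : ∀ i ∈ s, Lead w (D i) (κ i) (c i)) :
    Lead w (∏ i ∈ s, D i) (∑ i ∈ s, κ i) (∏ i ∈ s, c i) := by
  classical
  induction s using Finset.induction_on with
  | empty => simpa using Lead.one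
  | insert a s ha ih =>
    rw [Finset.prod_insert ha, Finset.prod_insert ha, Finset.sum_insert ha]
    exact (h a (Finset.mem_insert_self a s)).mul hw
      (ih fun i hi => h i (Finset.mem_insert_of_mem hi))

theorem Lead.pow (hw : Function.Injective w) (h : Lead w D κ c) (n : ℕ) :
    Lead w (D ^ n) (n • κ) (c ^ n) := by
  have := Lead.prod hw (Finset.range n) fun _ _ => h
  simpa using this

theorem exists_lead (hD : D ≠ 0) : ∃ κ c, c ≠ 0 ∧ Lead w D κ c := by
  have hs : D.coeff.support.Nonempty := by
    rw [Finsupp.support_nonempty_iff]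
    intro h0; exact hD (by ext; simp [h0])
  obtain ⟨κ, hκ, hmax⟩ := Finset.exists_max_image _ w hs
  exact ⟨κ, _, Finsupp.mem_support_iff.1 hκ, rfl, fun μ hμ => hmax μ (Finsupp.mem_support_iff.2 hμ)⟩

theorem Lead.eq (hw : Function.Injective w) (h : Lead w D κ c) (h' : Lead w D κ' c')
    (hc : c ≠ 0) (hc' : c' ≠ 0) : κ = κ' :=
  hw (le_antisymm (h'.2 κ (by rwa [h.1])) (h.2 κ' (by rwa [h'.1])))

theorem Lead.of_mul (hw : Function.Injective w) (h : Lead w D κ c) (hc : c ≠ 0)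
    (h' : Lead w (D * E) (κ + κ') c') : Lead w E κ' (c' / c) := by
  have hb : ∀ μ, E.coeff μ ≠ 0 → w μ ≤ w κ' := by
    by_cases hE : E = 0
    · subst hE; exact fun μ hμ => absurd rfl hμ
    · obtain ⟨κ1, c1, hc1, h1⟩ := exists_lead (w := w) hE
      have h2 := h'.2 (κ + κ1) (by rw [(h.mul hw h1).1]; exact mul_ne_zero hc hc1)
      rw [map_add, map_add] at h2
      exact fun μ hμ => (h1.2 μ hμ).trans (by linarith)
  have h3 : Lead w E κ' (E.coeff κ') := ⟨rfl, hb⟩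
  have h4 := (h.mul hw h3).1.symm.trans h'.1
  rwa [eq_div_of_mul_eq hc ((mul_comm _ _).trans h4)] at h3

theorem coeff_emb {φ : (τ → ℤ) →+ (σ → ℤ)} (hφ : Function.Injective φ) (D : LP τ) (μ : τ → ℤ) :
    (emb φ D).coeff (φ μ) = D.coeff μ := by
  classical
  induction D using AddMonoidAlgebra.induction_linear with
  | zero => simp
  | add f g hf hg => simp [hf, hg]
  | single κ c =>
    simp only [emb_single, AddMonoidAlgebra.coeff_single, Finsupp.single_apply, hφ.eq_iff]

theorem Lead.emb {φ : (τ → ℤ) →+ (σ → ℤ)} {v : (τ → ℤ) →+ ℝ} (hφ : Function.Injective φ)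
    (hv : ∀ μ, w (φ μ) = v μ) {D : LP τ} {κ : τ → ℤ} (h : Lead v D κ c) :
    Lead w (emb φ D) (φ κ) c := by
  refine ⟨by rw [coeff_emb hφ, h.1], fun μ hμ => ?_⟩
  obtain ⟨κ1, h1, rfl⟩ := exists_of_coeff_emb_ne hμ
  rw [hv, hv]; exact h.2 κ1 h1

end Lead

/-! ### A generic weight -/

theorem exists_transcendental : ∃ t : ℝ, 0 < t ∧ t < 1 ∧ Transcendental ℤ t := by
  by_contra! h
  have h1 : Set.Ioo (0 : ℝ) 1 ⊆ {x : ℝ | IsAlgebraic ℤ x} := fun t ht => by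
    by_contra h0
    exact h t ht.1 ht.2 h0
  have h2 := ((Algebraic.countable ℤ ℝ).mono h1).le_aleph0
  rw [Cardinal.mk_Ioo_real zero_lt_one] at h2
  exact absurd h2 (not_le.2 Cardinal.aleph0_lt_continuum)

/-- A transcendental number between `0` and `1`. -/
def tt : ℝ := exists_transcendental.choose

theorem tt_pos : 0 < tt := exists_transcendental.choose_spec.1
theorem tt_lt_one : tt < 1 := exists_transcendental.choose_spec.2.1
theorem tt_transcendental : Transcendental ℤ tt := exists_transcendental.choose_spec.2.2

/-- A weight on exponents that separates them and decreases along the coordinates, multiplied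
by `ε`. -/
def wt (ε : ℤ) (N : ℕ) : (Fin N → ℤ) →+ ℝ where
  toFun μ := ε * ∑ i, (μ i : ℝ) * tt ^ (i : ℕ)
  map_zero' := by simp
  map_add' μ κ := by simp [add_mul, Finset.sum_add_distrib, mul_add]

theorem wt_injective {ε : ℤ} (hε : ε ≠ 0) (N : ℕ) : Function.Injective (wt ε N) := by
  rw [injective_iff_map_eq_zero]
  intro μ hμ
  have h1 : ∑ i, (μ i : ℝ) * tt ^ (i : ℕ) = 0 :=
    (mul_eq_zero.1 hμ).resolve_left (by exact_mod_cast hε)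
  set p : Polynomial ℤ := ∑ i : Fin N, Polynomial.monomial (i : ℕ) (μ i) with hp
  have h2 : Polynomial.aeval tt p = 0 := by
    rw [hp, map_sum, ← h1]
    simp [Polynomial.aeval_monomial]
  have h3 : p = 0 := (transcendental_iff.1 tt_transcendental) p h2
  ext i
  have h4 := congrArg (fun q => Polynomial.coeff q (i : ℕ)) h3
  simpa [hp, Polynomial.finsetSum_coeff, Polynomial.coeff_monomial, Fin.val_inj] using h4

theorem wt_rt (ε : ℤ) {N : ℕ} (a b : Fin N) :
    wt ε N (rt a b) = ε * (tt ^ (a : ℕ) - tt ^ (b : ℕ)) := by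
  simp [wt, rt, sub_mul, Finset.sum_sub_distrib, Pi.single_apply]

theorem wt_snc (ε : ℤ) {k : ℕ} (μ : Fin k → ℤ) : wt ε (k + 1) (sncExp μ) = wt ε k μ := by
  simp [wt, sncExp, Fin.sum_univ_castSucc]

/-- The sign of `l - i`. -/
def sg {N : ℕ} (i l : Fin N) : ℤ := if i < l then 1 else -1

theorem lead_S {ε : ℤ} (hε : ε = 1 ∨ ε = -1) {N : ℕ} {i l : Fin N} (hil : i ≠ l) :
    Lead (wt ε N) (S i l) (ε • sg i l • rt i l) (((ε * sg i l : ℤ) : ℂ) / 2) := by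
  have hsw : rt l i = -rt i l := by simp [rt]
  have h1 : ((ε * sg i l : ℤ) : ℝ) * (ε * (tt ^ (i : ℕ) - tt ^ (l : ℕ))) > 0 := by
    have hlt : ∀ {a b : ℕ}, a < b → tt ^ b < tt ^ a := fun h =>
      pow_lt_pow_right_of_lt_one₀ tt_pos tt_lt_one h
    have h2 : ((ε : ℤ) : ℝ) * ε = 1 := by rcases hε with rfl | rfl <;> norm_num
    have h3 : (sg i l : ℝ) * (tt ^ (i : ℕ) - tt ^ (l : ℕ)) > 0 := by
      unfold sg
      split_ifs with h
      · have := hlt h; push_cast; linarith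
      · have := hlt (lt_of_le_of_ne (not_lt.1 h) (Fin.val_ne_of_ne (Ne.symm hil))); push_cast; linarith
    push_cast
    nlinarith
  have h4 : ε * sg i l = 1 ∨ ε * sg i l = -1 := by
    unfold sg
    rcases hε with rfl | rfl <;> split_ifs <;> simp
  rw [smul_smul]
  rcases h4 with h4 | h4 <;> rw [h4] at h1 ⊢
  · have := (Lead.single (w := wt ε N) (rt i l) (1 / 2)).add
      ((Lead.single (w := wt ε N) (rt l i) (-1 / 2)).of_lt (κ' := rt i l) (by
        rw [hsw, map_neg, wt_rt]; push_cast at h1; linarith))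
    simpa [S] using this
  · have := ((Lead.single (w := wt ε N) (rt i l) (1 / 2)).of_lt (κ' := rt l i) (by
        rw [hsw, map_neg, wt_rt]; push_cast at h1; linarith)).add
      (Lead.single (w := wt ε N) (rt l i) (-1 / 2))
    simpa [S, hsw] using this

/-- The sum of the differences `e_i - e_j` with `i < j`. -/
def rho (N : ℕ) : Fin N → ℤ := ∑ p ∈ prs N, rt p.1 p.2

theorem lead_B {ε : ℤ} (hε : ε = 1 ∨ ε = -1) (N : ℕ) :
    Lead (wt ε N) (B N) (ε • rho N) (((ε : ℂ) / 2) ^ (prs N).card) := by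
  have hε0 : ε ≠ 0 := by rcases hε with rfl | rfl <;> simp
  have := Lead.prod (wt_injective hε0 N) (prs N) fun p hp => lead_S hε (mem_prs.1 hp).ne
  rw [B, rho, Finset.smul_sum, ← Finset.prod_const]
  have h1 : ∀ p ∈ prs N, sg p.1 p.2 = 1 := fun p hp => if_pos (mem_prs.1 hp)
  convert this using 1
  · exact Finset.sum_congr rfl fun p hp => by rw [h1 p hp, one_smul]
  · exact Finset.prod_congr rfl fun p hp => by rw [h1 p hp, mul_one]

/-- The exponent of `Pn i`. -/
def rhoAt {N : ℕ} (i : Fin N) : Fin N → ℤ := ∑ l ∈ Finset.univ.erase i, sg i l • rt i l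

theorem sum_sg {N : ℕ} (i : Fin N) : ∑ l ∈ Finset.univ.erase i, sg i l = N - 1 - 2 * i := by
  classical
  have e1 : (Finset.univ.erase i : Finset (Fin N)) = Finset.Ioi i ∪ Finset.Iio i := by
    ext l; simp [lt_or_lt_iff_ne, eq_comm]
  rw [e1, Finset.sum_union (by
    rw [Finset.disjoint_left]; intro l h h'
    exact absurd (Finset.mem_Ioi.1 h) (not_lt.2 (Finset.mem_Iio.1 h').le))]
  rw [Finset.sum_congr rfl fun l hl => show sg i l = 1 from if_pos (Finset.mem_Ioi.1 hl),
    Finset.sum_congr (s₁ := Finset.Iio i) rfl fun l hl => show sg i l = -1 from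
      if_neg (not_lt.2 (Finset.mem_Iio.1 hl).le)]
  simp only [Finset.sum_const, Fin.card_Ioi, Fin.card_Iio]
  have := i.2
  simp; omega

theorem rhoAt_self {N : ℕ} (i : Fin N) : rhoAt i i = N - 1 - 2 * i := by
  rw [← sum_sg, rhoAt, Finset.sum_apply]
  refine Finset.sum_congr rfl fun l hl => ?_
  simp [rt, (Finset.mem_erase.1 hl).1]

theorem rho_apply {N : ℕ} (i : Fin N) : rho N i = N - 1 - 2 * i := by
  have h1 : rho N = ∑ j, ∑ l ∈ Finset.Ioi j, rt j l := (sum_prs fun j l => rt j l).symm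
  have h2 : ∀ j : Fin N, (∑ l ∈ Finset.Ioi j, (Pi.single l 1 : Fin N → ℤ) i) =
      if j < i then 1 else 0 := fun j => by
    simp [Pi.single_apply]
  have h3 : ∀ j : Fin N, (∑ l ∈ Finset.Ioi j, (Pi.single j 1 : Fin N → ℤ) i) =
      if i = j then ((N : ℤ) - 1 - j) else 0 := fun j => by
    rw [Finset.sum_const, Fin.card_Ioi, Pi.single_apply]
    have := j.2
    split_ifs <;> simp; omega
  rw [h1, Finset.sum_apply]
  simp only [Finset.sum_apply, rt, Pi.sub_apply, Finset.sum_sub_distrib, h2, h3]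
  rw [Finset.sum_ite_eq, if_pos (Finset.mem_univ i), Finset.sum_boole]
  have : (Finset.univ.filter fun j : Fin N => j < i) = Finset.Iio i := by ext; simp
  rw [this, Fin.card_Iio]; ring

theorem lead_Pn {ε : ℤ} (hε : ε = 1 ∨ ε = -1) {N : ℕ} (i : Fin N) :
    ∃ q : ℂ, q ≠ 0 ∧ Lead (wt ε N) (Pn i) (ε • rhoAt i) q := by
  have hε0 : ε ≠ 0 := by rcases hε with rfl | rfl <;> simp
  refine ⟨∏ l ∈ Finset.univ.erase i, ((ε * sg i l : ℤ) : ℂ) / 2, ?_, ?_⟩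
  rotate_left
  · rw [Pn, rhoAt, Finset.smul_sum]
    exact Lead.prod (wt_injective hε0 N) _ fun l hl => lead_S hε (Finset.mem_erase.1 hl).1.symm
  · refine Finset.prod_ne_zero_iff.2 fun l _ => div_ne_zero ?_ two_ne_zero
    refine Int.cast_ne_zero.2 (mul_ne_zero hε0 ?_)
    unfold sg; split_ifs <;> simp

theorem pair_single_one {N : ℕ} (i : Fin N) (κ : Fin N → ℤ) :
    pair (Pi.single i 1 : Fin N → ℂ) κ = κ i := by
  rw [pair_apply, Finset.sum_eq_single i] <;> simp +contextual

theorem lead_Dr {ε : ℤ} (hε : ε = 1 ∨ ε = -1) {N : ℕ} (i : Fin N) (m : ℕ) {q : ℂ}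
    (hq : Lead (wt ε N) (Pn i) (ε • rhoAt i) q) (b : ℂ) (j : ℕ) :
    Lead (wt ε N) (Dr i m b j) (j • ε • rhoAt i)
      (q ^ j * ∏ t ∈ Finset.range j, (b - ε * (m + 1) * ((N : ℂ) - 1 - 2 * i) + (m - 1 - 2 * t))) := by
  have hε0 : ε ≠ 0 := by rcases hε with rfl | rfl <;> simp
  have hw := wt_injective hε0 N
  induction j with
  | zero => simpa [Dr] using Lead.one
  | succ j ih =>
    have h1 := (hq.mul hw ih).smul b
    have h2 := hq.mul hw (ih.der (Pi.single i 1))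
    have h3 := ((hq.der (Pi.single i 1)).mul hw ih).smul ((m + 1 + j : ℕ) : ℂ)
    have h4 := (hq.mul hw ih).smul ((m : ℂ) - 1 - 2 * j)
    have h5 := h1.add ((h2.sub h3).add h4)
    have hr : ((rhoAt i i : ℤ) : ℂ) = (N : ℂ) - 1 - 2 * i := by rw [rhoAt_self]; push_cast; ring
    rw [Dr_succ]
    convert h5 using 1
    · simp only [drL, LinearMap.add_apply, LinearMap.sub_apply, LinearMap.comp_apply,
        LinearMap.mulLeft_apply, LinearMap.smul_apply]
      simp only [Derivation.coeFn_coe, Algebra.smul_def, map_natCast]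
      ring
    · rw [succ_nsmul, add_comm]
    · rw [pair_single_one, pair_single_one, Finset.prod_range_succ, pow_succ]
      simp only [Pi.smul_apply, smul_eq_mul, nsmul_eq_mul]
      push_cast
      rw [hr]
      ring

variable {k : ℕ}

/-- The product of the factors `ν_i - ν_j - ε t` for `i < j` and `1 ≤ t ≤ m`. -/
def lc (m : ℕ) (ε : ℤ) {N : ℕ} (ν : Fin N → ℂ) : ℂ :=
  ∏ p ∈ prs N, ∏ t ∈ Finset.range m, (ν p.1 - ν p.2 - ε * (t + 1))

theorem lc_succ (m : ℕ) (ε : ℤ) (ν : Fin (k + 1) → ℂ) : lc m ε ν =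
    lc m ε (ν ∘ Fin.castSucc) *
      ∏ i : Fin k, ∏ t ∈ Finset.range m, (ν i.castSucc - ν (Fin.last k) - ε * (t + 1)) := by
  rw [lc, lc, prod_prs_succ]; rfl

theorem sncExp_injective : Function.Injective (sncExp (k := k)) := by
  intro μ κ h
  ext i
  simpa [sncExp] using congrFun h i.castSucc

theorem rho_succ : rho (k + 1) + sncExp (rho k) = ∑ i : Fin k, rhoAt i.castSucc := by
  have h1 : (1 : ℤ) = 1 ∨ (1 : ℤ) = -1 := Or.inl rfl
  have hw := wt_injective one_ne_zero (k + 1)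
  choose q hq hP using fun i : Fin (k + 1) => lead_Pn h1 i
  obtain ⟨σ, hσ, hPn⟩ := prod_Pn k
  have h2 := Lead.prod hw Finset.univ fun i _ => hP (Fin.castSucc i)
  have h3 := (((lead_B h1 k).emb (φ := sncExp) (sncExp_injective) (wt_snc 1)).mul hw
    (lead_B h1 (k + 1))).smul σ
  rw [hPn] at h2
  have := h3.eq hw h2 (mul_ne_zero hσ (mul_ne_zero (pow_ne_zero _ (by simp)) (pow_ne_zero _ (by simp))))
    (Finset.prod_ne_zero_iff.2 fun i _ => hq _)
  simpa [add_comm] using this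

theorem lead_Tnum {ε : ℤ} (hε : ε = 1 ∨ ε = -1) (m k : ℕ) : ∃ c : ℂ, c ≠ 0 ∧
    ∀ (s : Finset (Fin k → ℤ)) (ν : Fin (k + 1) → ℂ) (P : LP (Fin k)) (p : ℂ),
      (∀ μ, (B k * P).coeff μ ≠ 0 → μ ∈ s) → Lead (wt ε k) P (m • ε • rho k) p →
      Lead (wt ε (k + 1)) (Tnum m s (2 * ν (Fin.last k)) (fun i => 2 * ν i.castSucc) P)
        (((2 * m + 1) * k) • ε • rho (k + 1))
        (c * (p * ∏ i : Fin k, ∏ t ∈ Finset.range m, (ν i.castSucc - ν (Fin.last k) - ε * (t + 1)))) := by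
  classical
  have hε0 : ε ≠ 0 := by rcases hε with rfl | rfl <;> simp
  have hw := wt_injective hε0 (k + 1)
  choose q hq hP using fun i : Fin (k + 1) => lead_Pn hε i
  set b : ℂ := ((ε : ℂ) / 2) ^ (prs (k + 1)).card with hb
  set b' : ℂ := ((ε : ℂ) / 2) ^ (prs k).card with hb'
  have hεc : (ε : ℂ) / 2 ≠ 0 := div_ne_zero (by exact_mod_cast hε0) two_ne_zero
  have hC : ∀ i : Fin (k + 1), Lead (wt ε (k + 1)) (Cn i) (ε • (rho (k + 1) - rhoAt i)) (b / q i) :=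
    fun i => (hP i).of_mul hw (hq i) (by
      rw [Pn_mul_Cn, ← smul_add, add_sub_cancel]; exact lead_B hε (k + 1))
  refine ⟨b ^ (m + 1) * b' * ∏ i : Fin k, ((b / q i.castSucc) ^ (2 * m + 1) * q i.castSucc ^ m * 2 ^ m), ?_, ?_⟩
  · have hb0 : b ≠ 0 := pow_ne_zero _ hεc
    refine mul_ne_zero (mul_ne_zero (pow_ne_zero _ hb0) (pow_ne_zero _ hεc))
      (Finset.prod_ne_zero_iff.2 fun i _ => ?_)
    exact mul_ne_zero (mul_ne_zero (pow_ne_zero _ (div_ne_zero hb0 (hq _))) (pow_ne_zero _ (hq _)))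
      (pow_ne_zero _ two_ne_zero)
  intro s ν P p hs hPl
  have hBP := (lead_B hε k).mul (wt_injective hε0 k) hPl
  set μ0 := ε • rho k + m • ε • rho k with hμ0
  set K0 : Fin (k + 1) → ℤ := (m + 1) • ε • rho (k + 1) + ∑ i : Fin k,
    ((2 * m + 1) • ε • (rho (k + 1) - rhoAt i.castSucc) + m • ε • rhoAt i.castSucc) with hK0
  let R : (Fin k → ℤ) → ℂ := fun μ => b ^ (m + 1) * ∏ i : Fin k, ((b / q i.castSucc) ^ (2 * m + 1) *
    (q i.castSucc ^ m * ∏ t ∈ Finset.range m, (2 * ν i.castSucc - 2 * ν (Fin.last k) + μ i -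
      ε * (m + 1) * (((k + 1 : ℕ) : ℂ) - 1 - 2 * (i.castSucc : ℕ)) + (m - 1 - 2 * t))))
  have hT : ∀ μ, Lead (wt ε (k + 1)) (Tsum m (fun i => 2 * ν i.castSucc - 2 * ν (Fin.last k)) μ)
      (sncExp μ + K0) (R μ) := fun μ => by
    have := ((lead_B hε (k + 1)).pow hw (m + 1)).mul hw ((Lead.single (sncExp μ) 1).mul hw
      (Lead.prod hw Finset.univ fun i _ => ((hC (Fin.castSucc i)).pow hw (2 * m + 1)).mul hw
        (lead_Dr hε i.castSucc m (hP _) (2 * ν i.castSucc - 2 * ν (Fin.last k) + μ i) m)))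
    rw [one_mul] at this
    have e : sncExp μ + K0 = (m + 1) • ε • rho (k + 1) + (sncExp μ + ∑ i : Fin k,
        ((2 * m + 1) • ε • (rho (k + 1) - rhoAt i.castSucc) + m • ε • rhoAt i.castSucc)) := by
      rw [hK0]; abel
    rw [e]
    exact this
  have hsum := Lead.sum s (D := fun μ => (B k * P).coeff μ •
      Tsum m (fun i => 2 * ν i.castSucc - 2 * ν (Fin.last k)) μ) (κ := sncExp μ0 + K0)
      (c := fun μ => if μ = μ0 then (B k * P).coeff μ0 * R μ0 else 0) (w := wt ε (k + 1)) (fun μ _ => by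
    split_ifs with h
    · rw [h]; exact (hT μ0).smul _
    · by_cases h0 : (B k * P).coeff μ = 0
      · rw [h0, zero_smul]; exact Lead.zero
      · have h2 := ((hT μ).smul ((B k * P).coeff μ)).of_lt (κ' := sncExp μ0 + K0) (by
          rw [map_add (wt ε (k + 1)) (sncExp μ) K0, map_add (wt ε (k + 1)) (sncExp μ0) K0, wt_snc,
            wt_snc]
          have h3 := lt_of_le_of_ne (hBP.2 μ h0) (fun e => h (wt_injective hε0 k e))
          linarith)
        exact h2)
  have hval : (∑ μ ∈ s, if μ = μ0 then (B k * P).coeff μ0 * R μ0 else 0) = b' * p * R μ0 := by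
    rw [Finset.sum_ite_eq', hBP.1]
    split_ifs with h
    · rfl
    · by_contra h0
      exact h (hs μ0 (by rw [hBP.1]; exact left_ne_zero_of_mul (Ne.symm h0)))
  have hexp : sncExp μ0 + K0 = ((2 * m + 1) * k) • ε • rho (k + 1) := by
    have h1 : sncExp μ0 = ((m : ℤ) + 1) • ε • sncExp (rho k) := by
      rw [hμ0, map_add, map_nsmul, map_zsmul, add_smul, one_smul, natCast_zsmul]; abel
    have h2 : K0 = ((m : ℤ) + 1) • ε • rho (k + 1) + (2 * (m : ℤ) + 1) • ε • ((k : ℤ) • rho (k + 1)) -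
        ((m : ℤ) + 1) • ε • ∑ i : Fin k, rhoAt i.castSucc := by
      rw [hK0]
      simp only [smul_sub, Finset.sum_add_distrib, Finset.sum_sub_distrib, ← Finset.smul_sum,
        Finset.sum_const, Finset.card_univ, Fintype.card_fin]
      module
    rw [h1, h2, ← rho_succ]
    module
  have hR : b' * p * R μ0 = (b ^ (m + 1) * b' * ∏ i : Fin k, ((b / q i.castSucc) ^ (2 * m + 1) *
      q i.castSucc ^ m * 2 ^ m)) * (p * ∏ i : Fin k, ∏ t ∈ Finset.range m,
        (ν i.castSucc - ν (Fin.last k) - ε * (t + 1))) := by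
    have h1 : ∀ i : Fin k, ∏ t ∈ Finset.range m, (2 * ν i.castSucc - 2 * ν (Fin.last k) + μ0 i -
        ε * (m + 1) * (((k + 1 : ℕ) : ℂ) - 1 - 2 * (i.castSucc : ℕ)) + ((m : ℂ) - 1 - 2 * t)) =
        2 ^ m * ∏ t ∈ Finset.range m, (ν i.castSucc - ν (Fin.last k) - ε * (t + 1)) := by
      intro i
      have h2 : ((μ0 i : ℤ) : ℂ) = ε * (m + 1) * ((k : ℂ) - 1 - 2 * (i : ℕ)) := by
        simp only [hμ0, ← natCast_zsmul, Pi.add_apply, Pi.smul_apply, smul_eq_mul, rho_apply]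
        push_cast; ring
      rw [h2]
      conv_rhs => rw [← Finset.card_range m, ← Finset.prod_const, Finset.card_range,
        ← Finset.prod_mul_distrib]
      rcases hε with rfl | rfl
      · refine Finset.prod_congr rfl fun t _ => ?_
        simp; ring
      · rw [← Finset.prod_range_reflect (fun t => 2 * (ν i.castSucc - ν (Fin.last k) - ((-1 : ℤ) : ℂ) * (t + 1)))]
        refine Finset.prod_congr rfl fun t ht => ?_
        rw [Nat.sub_sub, Nat.cast_sub (by have := Finset.mem_range.1 ht; omega)]
        simp; ring
    simp only [R, h1, Finset.prod_mul_distrib]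
    ring
  rw [hval, hexp, hR] at hsum
  exact hsum

end LP
open LP

/-- The numerators of the Baker-Akhiezer function. -/
theorem exists_family (m n : ℕ) : ∃ P : (Fin (n + 1) → ℂ) → LP (Fin (n + 1)),
    PolyFam (m * (prs (n + 1)).card) P (fun ν => vand ν ^ m • B (n + 1) ^ m) ∧
    (∀ ν, IsEig m (fun i => 2 * ν i) (P ν) m (-4 * ∑ i, ν i * ν i)) ∧
    ∀ ε : ℤ, ε = 1 ∨ ε = -1 → ∃ c : ℂ, c ≠ 0 ∧ ∀ ν,
      Lead (wt ε (n + 1)) (P ν) (m • ε • rho (n + 1)) (c * lc m ε ν) := by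
  induction n with
  | zero =>
    have h0 : prs 1 = ∅ := by decide
    have hB : B 1 = 1 := by rw [B, h0]; simp
    refine ⟨fun _ => 1, ?_, fun ν => ?_, fun ε _ => ⟨1, one_ne_zero, fun ν => ?_⟩⟩
    · rw [h0]
      simpa [vand_eq, h0, hB] using PolyFam.const (N := 1) (1 : LP (Fin 1))
    · simp [IsEig, Lop, qder, hB, Vn, h0, Algebra.smul_def]
      ring_nf
    · simpa [rho, h0, LP.lc] using Lead.one
  | succ n ih =>
    obtain ⟨P, hP, hE, hL⟩ := ih
    obtain ⟨s, c, hc, hs, hT⟩ := polyFam_Tnum (Nat.succ_pos n) m hP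
    have hr : (2 * m + 1) * (n + 1) = m + (m + 1 + (2 * m + 1) * n) := by ring
    set r := m + 1 + (2 * m + 1) * n with hrdef
    rw [hr] at hT
    have hinj : Function.Injective (LinearMap.mulLeft ℂ (B (n + 1 + 1) ^ r)) := fun a b h =>
      mul_left_cancel₀ (pow_ne_zero r (B_ne_zero _)) h
    obtain ⟨ψ, hψ⟩ := LinearMap.exists_leftInverse_of_injective _ (LinearMap.ker_eq_bot.2 hinj)
    have hψ' : ∀ D, ψ (B (n + 1 + 1) ^ r * D) = D := fun D => LinearMap.congr_fun hψ D
    have hdiv : ∀ ν : Fin (n + 1 + 1) → ℂ, ∃ D,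
        Tnum m s (2 * ν (Fin.last (n + 1))) (fun i => 2 * ν i.castSucc) (P (ν ∘ Fin.castSucc)) =
          B (n + 1 + 1) ^ r * D ∧ IsEig m (fun i => 2 * ν i) D m (-4 * ∑ i, ν i * ν i) := by
      intro ν
      have h1 := isEig_Tnum (κ := 2 * ν (Fin.last (n + 1))) (hs (ν ∘ Fin.castSucc))
        (hE (ν ∘ Fin.castSucc))
      rw [hr] at h1
      obtain ⟨D, hD, hD'⟩ := IsEig.pow_dvd _ h1
      simp only [Function.comp_apply] at hD hD'
      have e1 : (Fin.snoc (α := fun _ => ℂ) (fun i : Fin (n + 1) => 2 * ν i.castSucc)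
          (2 * ν (Fin.last (n + 1))) : Fin (n + 1 + 1) → ℂ) = fun i => 2 * ν i := by
        ext i; refine Fin.lastCases ?_ (fun j => ?_) i <;> simp
      have e2 : -4 * ∑ i : Fin (n + 1), ν i.castSucc * ν i.castSucc - (2 * ν (Fin.last (n + 1))) ^ 2 =
          -4 * ∑ i, ν i * ν i := by
        rw [Fin.sum_univ_castSucc (n := n + 1)]; ring
      rw [e1, e2] at hD'
      exact ⟨D, hD, hD'⟩
    refine ⟨fun ν => c⁻¹ • ψ (Tnum m s (2 * ν (Fin.last (n + 1))) (fun i => 2 * ν i.castSucc)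
      (P (ν ∘ Fin.castSucc))), ?_, fun ν => ?_, fun ε hε => ?_⟩
    · have := (hT.map ψ).map (c⁻¹ • LinearMap.id)
      convert this using 2 with ν
      · rfl
      rw [map_smul, pow_add, mul_comm (B _ ^ m), hψ', LinearMap.smul_apply, LinearMap.id_apply,
        smul_smul, ← mul_assoc, inv_mul_cancel₀ hc, one_mul]
    · obtain ⟨D, hD, hD'⟩ := hdiv ν
      simp only [hD, hψ']
      unfold IsEig at hD' ⊢
      rw [Lop_smul, hD', mul_smul_comm, smul_comm]
    · obtain ⟨a, ha, hLP⟩ := hL ε hε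
      obtain ⟨a', ha', hTn⟩ := lead_Tnum hε m (n + 1)
      have hε0 : ε ≠ 0 := by rcases hε with rfl | rfl <;> simp
      have hw := wt_injective hε0 (n + 1 + 1)
      set b : ℂ := ((ε : ℂ) / 2) ^ (prs (n + 1 + 1)).card with hb
      have hb0 : b ≠ 0 := pow_ne_zero _ (div_ne_zero (by exact_mod_cast hε0) two_ne_zero)
      refine ⟨c⁻¹ * (a' * a / b ^ r), mul_ne_zero (inv_ne_zero hc)
        (div_ne_zero (mul_ne_zero ha' ha) (pow_ne_zero _ hb0)), fun ν => ?_⟩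
      have h1 := hTn s ν _ _ (hs (ν ∘ Fin.castSucc)) (hLP (ν ∘ Fin.castSucc))
      obtain ⟨D, hD, -⟩ := hdiv ν
      simp only [hD, hψ'] at h1 ⊢
      rw [hr, add_comm m r, add_smul] at h1
      have h2 := (((lead_B hε (n + 1 + 1)).pow hw r).of_mul hw (pow_ne_zero _ hb0) h1).smul c⁻¹
      convert h2 using 1
      rw [lc_succ]; ring

end TrigBA

namespace TrigBA
open LP

/-! ### Leading coefficients of eigenfunctions -/

namespace LP
variable {N : ℕ}

theorem lead_qder {lam v : Fin N → ℂ} {M : ℕ} {D : LP (Fin N)} {κ : Fin N → ℤ} {c b : ℂ}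
    (hB : Lead (wt 1 N) (B N) (rho N) b) (h : Lead (wt 1 N) D κ c) :
    Lead (wt 1 N) (qder (B N) lam v M D) (rho N + κ)
      (b * (pair v κ + (∑ a, lam a * v a) - M * pair v (rho N)) * c) := by
  have hw := wt_injective one_ne_zero N
  have h1 := hB.mul hw ((h.der v).add (h.smul (∑ a, lam a * v a)))
  have h2 := ((hB.der v).mul hw h).smul (M : ℂ)
  convert h1.sub h2 using 1
  · simp [qder, Algebra.smul_def]
  · ring

theorem lead_Vn (m : ℕ) : Lead (wt 1 N) (Vn N m) (2 • rho N) 0 := by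
  have hw := wt_injective one_ne_zero N
  rw [Vn, ← Finset.sum_const_zero (s := prs N)]
  refine Lead.sum _ fun p hp => ?_
  have hS := lead_S (Or.inl rfl) (mem_prs.1 hp).ne (ε := 1)
  have hsg : sg p.1 p.2 = 1 := if_pos (mem_prs.1 hp)
  rw [hsg, one_smul, one_smul] at hS
  have hc : (((1 * 1 : ℤ) : ℂ) / 2) ≠ 0 := by norm_num
  have hBc : Lead (wt 1 N) (Bc p) (rho N - rt p.1 p.2) _ := hS.of_mul hw hc (by
    rw [S_mul_Bc hp, add_sub_cancel]
    have := lead_B (Or.inl rfl) N (ε := 1)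
    rwa [one_smul] at this)
  have h2 := (hBc.pow hw 2).smul (2 * (m : ℂ) * (m + 1))
  refine h2.of_lt ?_
  have h3 : wt 1 N (rt p.1 p.2) > 0 := by
    rw [wt_rt]
    have := pow_lt_pow_right_of_lt_one₀ tt_pos tt_lt_one (mem_prs.1 hp)
    push_cast
    have h4 : tt ^ (p.2 : ℕ) < tt ^ (p.1 : ℕ) := this
    linarith
  rw [map_nsmul, map_nsmul, map_sub]
  simp only [nsmul_eq_mul]
  push_cast
  linarith

theorem lead_Lop {lam : Fin N → ℂ} {m M : ℕ} {D : LP (Fin N)} {κ : Fin N → ℤ} {c b : ℂ}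
    (hB : Lead (wt 1 N) (B N) (rho N) b) (h : Lead (wt 1 N) D κ c) :
    Lead (wt 1 N) (Lop m lam M D) (2 • rho N + κ)
      (-b ^ 2 * (∑ l, (κ l + lam l - M * rho N l) ^ 2) * c) := by
  have hw := wt_injective one_ne_zero N
  have h1 : ∀ l : Fin N, Lead (wt 1 N) (qder (B N) lam (Pi.single l 1) (M + 1)
      (qder (B N) lam (Pi.single l 1) M D)) (2 • rho N + κ)
      (b ^ 2 * (κ l + lam l - M * rho N l) ^ 2 * c) := fun l => by
    have := lead_qder (lam := lam) (v := Pi.single l 1) (M := M + 1) hB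
      (lead_qder (lam := lam) (v := Pi.single l 1) (M := M) hB h)
    convert this using 1
    · rw [two_nsmul, add_assoc]
    · have e : ∑ a, lam a * (Pi.single l 1 : Fin N → ℂ) a = lam l := by
        rw [Finset.sum_eq_single l] <;> simp +contextual
      rw [map_add, pair_single_one, pair_single_one, e]
      push_cast; ring
  have h2 := ((Lead.sum Finset.univ fun l _ => h1 l).smul (-1)).add ((lead_Vn m).mul hw h)
  convert h2 using 1
  · simp [Lop]
  · rw [Finset.mul_sum, Finset.sum_mul, zero_mul, add_zero, Finset.mul_sum]
    exact Finset.sum_congr rfl fun l _ => by ring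

/-- Spectral parameters for which an eigenfunction has only one possible leading exponent. -/
def Gen (ν : Fin N → ℂ) : Prop :=
  ∀ κ : Fin N → ℤ, κ ≠ 0 → 4 * (∑ i, ν i * κ i) + ∑ i, (κ i : ℂ) ^ 2 ≠ 0

theorem eq_zero_of_isEig {m M : ℕ} {ν : Fin N → ℂ} (hν : Gen ν) {F : LP (Fin N)}
    (h : IsEig m (fun i => 2 * ν i) F M (-4 * ∑ i, ν i * ν i))
    (h0 : F.coeff (M • rho N) = 0) : F = 0 := by
  by_contra hF
  have hw := wt_injective one_ne_zero N
  obtain ⟨κ, c, hc, hl⟩ := exists_lead (w := wt 1 N) hF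
  have hB := lead_B (Or.inl rfl) N (ε := 1)
  rw [one_smul] at hB
  set b : ℂ := (((1 : ℤ) : ℂ) / 2) ^ (prs N).card with hb
  have hb0 : b ≠ 0 := pow_ne_zero _ (by norm_num)
  have h1 := lead_Lop (lam := fun i => 2 * ν i) (m := m) (M := M) hB hl
  rw [show Lop m (fun i => 2 * ν i) M F = _ from h] at h1
  have h2 := ((hB.pow hw 2).mul hw hl).smul (-4 * ∑ i, ν i * ν i)
  have h3 := h1.1.symm.trans h2.1
  have h4 : ∑ l, ((κ l : ℂ) + 2 * ν l - M * rho N l) ^ 2 = 4 * ∑ i, ν i * ν i := by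
    have : b ^ 2 * c ≠ 0 := mul_ne_zero (pow_ne_zero _ hb0) hc
    apply mul_left_cancel₀ this
    linear_combination -h3
  have hκ : κ - M • rho N ≠ 0 := fun e => hc (by rw [← hl.1, sub_eq_zero.1 e, h0])
  refine hν _ hκ ?_
  have e : ∀ i, (((κ - M • rho N) i : ℤ) : ℂ) = κ i - M * rho N i := fun i => by
    rw [← natCast_zsmul]; simp
  simp only [e]
  rw [Finset.mul_sum, ← Finset.sum_add_distrib]
  rw [Finset.mul_sum, ← sub_eq_zero, ← Finset.sum_sub_distrib] at h4
  rw [← h4]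
  exact Finset.sum_congr rfl fun i _ => by ring

theorem isEig_sub_smul {m M : ℕ} {lam : Fin N → ℂ} {E a b : ℂ} {F G : LP (Fin N)}
    (hF : IsEig m lam F M E) (hG : IsEig m lam G M E) : IsEig m lam (a • F - b • G) M E := by
  unfold IsEig at *
  rw [sub_eq_add_neg, ← neg_smul, Lop_add, Lop_smul, Lop_smul, hF, hG, mul_add, mul_smul_comm,
    mul_smul_comm, smul_add, smul_comm a, smul_comm (-b)]

/-- Two eigenfunctions with the same generic spectral parameter are proportional. -/
theorem isEig_proportional {m M : ℕ} {ν : Fin N → ℂ} (hν : Gen ν) {F G : LP (Fin N)}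
    (hF : IsEig m (fun i => 2 * ν i) F M (-4 * ∑ i, ν i * ν i))
    (hG : IsEig m (fun i => 2 * ν i) G M (-4 * ∑ i, ν i * ν i)) :
    G.coeff (M • rho N) • F = F.coeff (M • rho N) • G :=
  sub_eq_zero.1 (eq_zero_of_isEig hν (isEig_sub_smul hF hG) (by simp [mul_comm]))

theorem countable_not_gen (η : Fin N → ℂ) (ξ : Fin N → ℂ) : {s : ℂ | ¬ Gen (fun i => ξ i + s * η i)}.Countable ∨
    ∃ κ : Fin N → ℤ, κ ≠ 0 ∧ ∑ i, η i * κ i = 0 ∧ 4 * (∑ i, ξ i * κ i) + ∑ i, (κ i : ℂ) ^ 2 = 0 := by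
  by_contra! h
  refine h.1 ?_
  have : {s : ℂ | ¬ Gen (fun i => ξ i + s * η i)} ⊆ ⋃ κ : Fin N → ℤ,
      {s | κ ≠ 0 ∧ 4 * (∑ i, (ξ i + s * η i) * κ i) + ∑ i, (κ i : ℂ) ^ 2 = 0} := by
    intro s hs
    simp only [Gen, Set.mem_ofPred_eq, not_forall, not_not] at hs
    obtain ⟨κ, h1, h2⟩ := hs
    exact Set.mem_iUnion.2 ⟨κ, h1, h2⟩
  refine (Set.countable_iUnion fun κ => Set.Subsingleton.countable ?_).mono this
  rintro s ⟨hκ, hs⟩ s' ⟨-, hs'⟩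
  have e : ∀ s : ℂ, ∑ i, (ξ i + s * η i) * κ i = ∑ i, ξ i * κ i + s * ∑ i, η i * κ i := fun s => by
    rw [Finset.mul_sum, ← Finset.sum_add_distrib]
    exact Finset.sum_congr rfl fun i _ => by ring
  rw [e] at hs hs'
  by_cases h0 : ∑ i, η i * κ i = 0
  · rw [h0, mul_zero, add_zero] at hs
    exact absurd hs (h.2 κ hκ h0)
  · have : (s - s') * ∑ i, η i * κ i = 0 := by linear_combination (hs - hs') / 4
    exact sub_eq_zero.1 ((mul_eq_zero.1 this).resolve_right h0)

theorem countable_not_gen_line (η : Fin N → ℂ) : {s : ℂ | ¬ Gen (fun i => s * η i)}.Countable := by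
  rcases countable_not_gen η 0 with h | ⟨κ, hκ, -, h⟩
  · simpa using h
  · exfalso
    simp only [Pi.zero_apply, zero_mul, Finset.sum_const_zero, mul_zero, zero_add] at h
    have h1 : ∑ i, (κ i) ^ 2 = 0 := by exact_mod_cast h
    rw [Finset.sum_eq_zero_iff_of_nonneg fun i _ => sq_nonneg _] at h1
    exact hκ (funext fun i => by simpa using h1 i (Finset.mem_univ i))

end LP

/-! ### Trigonometric polynomials with polynomial coefficients -/

namespace TrigPoly
variable {N : ℕ}

/-- The Laurent polynomial at a fixed spectral parameter. -/
def toLP (T : TrigPoly N) (ν : Fin N → ℂ) : LP (Fin N) :=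
  .ofCoeff (Finsupp.mapRange (MvPolynomial.eval ν) (map_zero _) T)

@[simp] theorem coeff_toLP (T : TrigPoly N) (ν : Fin N → ℂ) (μ : Fin N → ℤ) :
    (T.toLP ν).coeff μ = MvPolynomial.eval ν (T μ) := rfl

theorem toLP_sub (T T' : TrigPoly N) (ν : Fin N → ℂ) :
    TrigPoly.toLP (T - T') ν = T.toLP ν - T'.toLP ν := by
  ext μ; simp

theorem ev_toLP (T : TrigPoly N) (x ν : Fin N → ℂ) : ev x (T.toLP ν) = T.eval x ν := by
  classical
  rw [ev_eq_sum_of_subset (s := T.support)]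
  · rfl
  · intro μ hμ
    rw [Finsupp.mem_support_iff]
    intro h0; exact hμ (by simp [h0])

theorem baFun_eq (m : ℕ) (T : TrigPoly N) (x ν : Fin N → ℂ) :
    baFun m T x ν = (normC m ν)⁻¹ * cl (B N) (fun i => 2 * ν i) (T.toLP ν) m x := by
  have e : ∑ i, 2 * ν i * x i = 2 * ∑ i, ν i * x i := by
    rw [Finset.mul_sum]; exact Finset.sum_congr rfl fun i _ => by ring
  rw [baFun, cl, ev_toLP, ev_B, e]
  field_simp

theorem isEig_iff_eigen {m : ℕ} {T : TrigPoly N} {ν : Fin N → ℂ} (hν : normC m ν ≠ 0) :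
    IsEig m (fun i => 2 * ν i) (T.toLP ν) m (-4 * ∑ i, ν i * ν i) ↔
      ∀ x, sinhVand x ≠ 0 →
        sutherland m (fun y => baFun m T y ν) x = -4 * (∑ i, ν i * ν i) * baFun m T x ν := by
  rw [isEig_iff]
  refine forall_congr' fun x => forall_congr' fun hx => ?_
  have e : (fun y => baFun m T y ν) =
      cl (B N) (fun i => 2 * ν i) ((normC m ν)⁻¹ • T.toLP ν) m := by
    ext y; rw [baFun_eq, cl_smul]
  rw [e, baFun_eq, sutherland_cl _ _ _ hx, sutherland_cl _ _ _ hx, Lop_smul, cl_smul]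
  constructor
  · intro h; rw [h]; ring
  · intro h
    exact mul_left_cancel₀ (inv_ne_zero hν) (by rw [h]; ring)

end TrigPoly

end TrigBA

namespace TrigBA
open LP
variable {N : ℕ}

/-! ### Restriction to lines through the origin -/

/-- The restriction of a polynomial to the line through `η`. -/
def lineP (η : Fin N → ℂ) : MvPolynomial (Fin N) ℂ →ₐ[ℂ] Polynomial ℂ :=
  MvPolynomial.aeval fun i => Polynomial.C (η i) * Polynomial.X

theorem eval_lineP (η : Fin N → ℂ) (s : ℂ) (p : MvPolynomial (Fin N) ℂ) :
    (lineP η p).eval s = MvPolynomial.eval (fun i => s * η i) p := by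
  induction p using MvPolynomial.induction_on with
  | C a => simp [lineP]
  | add p q hp hq => simp [hp, hq]
  | mul_X p i hp => simp [hp]; simp [lineP]; ring_nf; simp

theorem coeff_lineP (η : Fin N → ℂ) (p : MvPolynomial (Fin N) ℂ) (n : ℕ) :
    (lineP η p).coeff n = MvPolynomial.eval η (MvPolynomial.homogeneousComponent n p) := by
  classical
  induction p using MvPolynomial.induction_on' with
  | add p q hp hq => simp [hp, hq]
  | monomial α c =>
    have h1 : lineP η (MvPolynomial.monomial α c) =
        Polynomial.C (MvPolynomial.eval η (MvPolynomial.monomial α c)) * Polynomial.X ^ α.degree := by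
      simp only [lineP, MvPolynomial.aeval_monomial, MvPolynomial.eval_monomial, mul_pow,
        Finsupp.prod_mul, map_mul, Finsupp.degree_eq_sum, Finsupp.prod_fintype, pow_zero,
        implies_true, Finset.prod_pow_eq_pow_sum, map_prod, map_pow, Polynomial.algebraMap_eq]
      ring
    rw [h1, MvPolynomial.homogeneousComponent_of_mem
      (MvPolynomial.isHomogeneous_monomial c (rfl : α.degree = α.degree)),
      Polynomial.coeff_C_mul, Polynomial.coeff_X_pow]
    split_ifs <;> simp_all

theorem lineP_eq_of_degree {η : Fin N → ℂ} {p : MvPolynomial (Fin N) ℂ} {d : ℕ}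
    (h : p.totalDegree ≤ d) (h0 : MvPolynomial.homogeneousComponent d p = 0) :
    (lineP η p).degree < d := by
  rw [Polynomial.degree_lt_iff_coeff_zero]
  intro n hn
  rw [coeff_lineP]
  rcases hn.eq_or_lt with rfl | hn
  · rw [h0, map_zero]
  · rw [MvPolynomial.homogeneousComponent_eq_zero _ _ (lt_of_le_of_lt h hn), map_zero]

/-! ### Polynomial families and trigonometric polynomials -/

theorem exists_trigPoly {d : ℕ} {f L : (Fin N → ℂ) → LP (Fin N)} (h : PolyFam d f L) :
    ∃ T : TrigPoly N, (∀ ν, T.toLP ν = f ν) ∧ (∀ μ, (T μ).totalDegree ≤ d) ∧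
      ∀ μ ν, MvPolynomial.eval ν (MvPolynomial.homogeneousComponent d (T μ)) = (L ν).coeff μ := by
  classical
  choose q1 hq1 hs1 using fun μ => MS_eval (map_mem_MS (coeffL μ) h.1)
  choose q2 hq2 hs2 using fun μ => MS_eval (map_mem_MS (coeffL μ) h.2)
  obtain ⟨s1, hs1'⟩ := MS_finite h.mem
  obtain ⟨s2, hs2'⟩ := MS_finite h.2
  have hfin : ∀ μ, q1 μ + q2 μ ≠ 0 → μ ∈ s1 := fun μ hμ => by
    by_contra h0
    refine hμ (MvPolynomial.funext fun ν => ?_)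
    rw [map_add, ← hq1, ← hq2, map_zero]
    have : (f ν).coeff μ = 0 := by
      by_contra h1; exact h0 (hs1' ν μ h1)
    simp [coeffL_apply, this]
  refine ⟨Finsupp.onFinset s1 (fun μ => q1 μ + q2 μ) hfin, fun ν => ?_, fun μ => ?_, fun μ ν => ?_⟩
  · ext μ
    rw [TrigPoly.coeff_toLP, Finsupp.onFinset_apply, map_add, ← hq1, ← hq2]
    simp [coeffL_apply]
  · rw [Finsupp.onFinset_apply]
    refine (MvPolynomial.totalDegree_add _ _).trans (max_le ?_ ?_)
    · refine Finset.sup_le fun α hα => ?_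
      rw [Finsupp.sum_fintype _ _ (fun _ => rfl)]
      exact (hs1 μ α hα).le
    · refine Finset.sup_le fun α hα => ?_
      rw [Finsupp.sum_fintype _ _ (fun _ => rfl)]
      exact (hs2 μ α hα).le
  · rw [Finsupp.onFinset_apply, map_add, MvPolynomial.homogeneousComponent_eq_zero',
      zero_add, MvPolynomial.homogeneousComponent_eq_self, ← hq2]
    · rfl
    · intro α hα
      have := hs2 μ α (MvPolynomial.mem_support_iff.2 hα)
      rw [← Finsupp.degree_eq_sum, Finsupp.degree_eq_weight_one] at this
      exact this
    · intro α hα e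
      have := hs1 μ α hα
      rw [← Finsupp.degree_eq_sum, e] at this
      exact lt_irrefl _ this

/-! ### Coprimality of the extreme coefficients on a line -/

/-- The restriction of `lc` to a line. -/
def lcP (m : ℕ) (ε : ℤ) (η : Fin N → ℂ) : Polynomial ℂ :=
  ∏ p ∈ prs N, ∏ t ∈ Finset.range m,
    (Polynomial.C (η p.1 - η p.2) * Polynomial.X + Polynomial.C (-(ε * ((t : ℂ) + 1))))

theorem eval_lcP (m : ℕ) (ε : ℤ) (η : Fin N → ℂ) (s : ℂ) :
    (lcP m ε η).eval s = lc m ε fun i => s * η i := by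
  simp only [lcP, lc, Polynomial.eval_prod, Polynomial.eval_add, Polynomial.eval_mul,
    Polynomial.eval_C, Polynomial.eval_X]
  exact Finset.prod_congr rfl fun p _ => Finset.prod_congr rfl fun t _ => by ring

theorem degree_lcP {m : ℕ} {ε : ℤ} {η : Fin N → ℂ} (h : ∀ i j, i < j → η i ≠ η j) :
    (lcP m ε η).degree = ((m * (prs N).card : ℕ) : WithBot ℕ) := by
  rw [lcP, Polynomial.degree_prod]
  simp_rw [Polynomial.degree_prod]
  rw [Finset.sum_congr rfl fun p hp => Finset.sum_congr rfl fun t _ =>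
    Polynomial.degree_linear (sub_ne_zero.2 (h _ _ (mem_prs.1 hp)))]
  simp [mul_comm]

theorem leadingCoeff_lcP (m : ℕ) (ε : ℤ) {η : Fin N → ℂ} (h : ∀ i j, i < j → η i ≠ η j) :
    (lcP m ε η).leadingCoeff = vand η ^ m := by
  rw [lcP, Polynomial.leadingCoeff_prod, vand_eq, ← Finset.prod_pow]
  refine Finset.prod_congr rfl fun p hp => ?_
  rw [Polynomial.leadingCoeff_prod, Finset.prod_congr rfl fun t _ =>
    Polynomial.leadingCoeff_linear (sub_ne_zero.2 (h _ _ (mem_prs.1 hp)))]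
  simp

theorem isCoprime_lcP (m : ℕ) {η : Fin N → ℝ} (h : ∀ i j, i < j → η j < η i) :
    IsCoprime (lcP m 1 fun i => (η i : ℂ)) (lcP m (-1) fun i => (η i : ℂ)) := by
  refine IsCoprime.prod_left fun p hp => IsCoprime.prod_left fun t _ =>
    IsCoprime.prod_right fun p' hp' => IsCoprime.prod_right fun t' _ => ?_
  set a : ℝ := η p.1 - η p.2 with ha
  set a' : ℝ := η p'.1 - η p'.2 with ha'
  have h1 : 0 < a := sub_pos.2 (h _ _ (mem_prs.1 hp))
  have h1' : 0 < a' := sub_pos.2 (h _ _ (mem_prs.1 hp'))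
  have h2 : a' * ((t : ℝ) + 1) + a * ((t' : ℝ) + 1) ≠ 0 := by positivity
  set c : ℂ := a' * ((t : ℂ) + 1) + a * ((t' : ℂ) + 1) with hc
  have h3 : c ≠ 0 := by rw [hc]; exact_mod_cast h2
  have e : (η p.1 : ℂ) - η p.2 = a := by rw [ha]; push_cast; rfl
  have e' : (η p'.1 : ℂ) - η p'.2 = a' := by rw [ha']; push_cast; rfl
  refine ⟨Polynomial.C (-a' / c), Polynomial.C (a / c), ?_⟩
  rw [e, e']
  have e1 : -(a' : ℂ) / c * a + a / c * a' = 0 := by ring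
  have e2 : -(a' : ℂ) / c * -(((1 : ℤ) : ℂ) * ((t : ℂ) + 1)) +
      a / c * -(((-1 : ℤ) : ℂ) * ((t' : ℂ) + 1)) = 1 := by
    push_cast
    field_simp
    rw [hc]
  calc _ = Polynomial.C (-(a' : ℂ) / c * a + a / c * a') * Polynomial.X +
      Polynomial.C (-(a' : ℂ) / c * -(((1 : ℤ) : ℂ) * ((t : ℂ) + 1)) +
        a / c * -(((-1 : ℤ) : ℂ) * ((t' : ℂ) + 1))) := by
        simp only [Polynomial.C_add, Polynomial.C_mul]; ring
    _ = 1 := by rw [e1, e2]; simp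

theorem normC_eq (m : ℕ) (ν : Fin N → ℂ) : normC m ν = lc m 1 ν := by
  have h : ∀ k : ℕ, ∏ i, ∏ j ∈ Finset.Ioi i, (ν i - ν j - (k : ℂ)) =
      ∏ p ∈ prs N, (ν p.1 - ν p.2 - (k : ℂ)) := fun k => prod_prs fun i j => ν i - ν j - (k : ℂ)
  simp only [normC, lc, h]
  rw [Finset.prod_comm]
  refine Finset.prod_congr rfl fun p _ => ?_
  have h1 := Finset.prod_Ico_add' (fun t : ℕ => ν p.1 - ν p.2 - (t : ℂ)) 0 m 1
  have h2 : Finset.Icc 1 m = Finset.Ico (0 + 1) (m + 1) := by ext; simp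
  rw [Finset.range_eq_Ico, h2, ← h1]
  refine Finset.prod_congr rfl fun t _ => ?_
  push_cast; ring

theorem infinite_good {η : Fin N → ℂ} {p : Polynomial ℂ} (hp : p ≠ 0) :
    {s : ℂ | Gen (fun i => s * η i) ∧ p.eval s ≠ 0}.Infinite := by
  intro hf
  have h1 := (countable_not_gen_line η).union ((p.rootSet_finite ℂ).countable.union hf.countable)
  refine not_countable_complex (h1.mono fun s _ => ?_)
  by_cases h : Gen fun i => s * η i
  · by_cases h' : p.eval s = 0
    · exact Or.inr (Or.inl (by rw [Polynomial.mem_rootSet]; exact ⟨hp, by simpa using h'⟩))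
    · exact Or.inr (Or.inr ⟨h, h'⟩)
  · exact Or.inl h

theorem TrigPoly.eq_zero_of_isEig {m : ℕ} {T₀ T : TrigPoly N} {c₁ c₂ : ℂ} (hc₁ : c₁ ≠ 0) (hc₂ : c₂ ≠ 0)
    (h₀ : ∀ ν, IsEig m (fun i => 2 * ν i) (T₀.toLP ν) m (-4 * ∑ i, ν i * ν i))
    (h₁ : ∀ ν, MvPolynomial.eval ν (T₀ (m • rho N)) = c₁ * lc m 1 ν)
    (h₂ : ∀ ν, MvPolynomial.eval ν (T₀ (-(m • rho N))) = c₂ * lc m (-1) ν)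
    (hd : ∀ μ, (T μ).totalDegree ≤ m * (prs N).card)
    (hh : ∀ μ, MvPolynomial.homogeneousComponent (m * (prs N).card) (T μ) = 0)
    (he : ∀ ν, normC m ν ≠ 0 →
      IsEig m (fun i => 2 * ν i) (T.toLP ν) m (-4 * ∑ i, ν i * ν i)) : T = 0 := by
  have key : ∀ η : Fin N → ℝ, (∀ i j, i < j → η j < η i) → ∀ μ,
      MvPolynomial.eval (fun i => (η i : ℂ)) (T μ) = 0 := by
    intro η hη μ
    set η' : Fin N → ℂ := fun i => (η i : ℂ) with hη'
    have hne : ∀ i j, i < j → η' i ≠ η' j := fun i j hij e =>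
      (hη i j hij).ne (Complex.ofReal_injective e.symm)
    have hdeg := degree_lcP (m := m) (ε := 1) hne
    have hp0 : lcP m 1 η' ≠ 0 := fun e => by
      rw [e, Polynomial.degree_zero] at hdeg
      exact WithBot.bot_ne_coe hdeg
    have hinf := infinite_good (η := η') hp0
    have hprop : ∀ s ∈ {s : ℂ | Gen (fun i => s * η' i) ∧ (lcP m 1 η').eval s ≠ 0}, ∀ μ,
        c₁ * (lcP m 1 η').eval s * (lineP η' (T μ)).eval s =
          (lineP η' (T (m • rho N))).eval s * MvPolynomial.eval (fun i => s * η' i) (T₀ μ) := by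
      rintro s ⟨hg, hs⟩ μ
      rw [eval_lcP] at hs ⊢
      have h := isEig_proportional hg (he _ (by rw [normC_eq]; exact hs)) (h₀ _)
      have h' := congrArg (fun D : LP (Fin N) => D.coeff μ) h
      simp only [TrigPoly.coeff_toLP, h₁, AddMonoidAlgebra.coeff_smul, Finsupp.smul_apply,
        smul_eq_mul] at h'
      rw [eval_lineP, eval_lineP]
      exact h'
    have h3 : Polynomial.C c₁ * lcP m 1 η' * lineP η' (T (-(m • rho N))) =
        lineP η' (T (m • rho N)) * (Polynomial.C c₂ * lcP m (-1) η') := by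
      refine Polynomial.eq_of_infinite_eval_eq _ _ (hinf.mono fun s hs => ?_)
      have := hprop s hs (-(m • rho N))
      rw [h₂, ← eval_lcP] at this
      simpa using this
    have h4 : lineP η' (T (m • rho N)) = 0 := by
      refine Polynomial.eq_zero_of_dvd_of_degree_lt (p := lcP m 1 η') ?_ ?_
      · have h5 : lcP m 1 η' ∣ lcP m (-1) η' * lineP η' (T (m • rho N)) := by
          refine ⟨Polynomial.C (c₂⁻¹ * c₁) * lineP η' (T (-(m • rho N))), ?_⟩
          have e : Polynomial.C c₂⁻¹ * Polynomial.C c₂ = 1 := by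
            rw [← Polynomial.C_mul, inv_mul_cancel₀ hc₂, Polynomial.C_1]
          rw [Polynomial.C_mul]
          linear_combination (-Polynomial.C c₂⁻¹) * h3 -
            (lcP m (-1) η' * lineP η' (T (m • rho N))) * e
        exact (isCoprime_lcP m hη).dvd_of_dvd_mul_left h5
      · rw [hdeg]; exact lineP_eq_of_degree (hd _) (hh _)
    have h5 : lcP m 1 η' * lineP η' (T μ) = 0 := by
      refine Polynomial.eq_of_infinite_eval_eq _ _ (hinf.mono fun s hs => ?_)
      have := hprop s hs μ
      rw [h4, Polynomial.eval_zero, zero_mul, mul_assoc] at this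
      simpa using (mul_eq_zero.1 this).resolve_left hc₁
    have h6 := (mul_eq_zero.1 h5).resolve_left hp0
    have h7 := eval_lineP η' 1 (T μ)
    rw [h6] at h7
    simpa using h7.symm
  ext1 μ
  refine MvPolynomial.funext_set (fun i : Fin N => (fun r : ℝ => (r : ℂ)) ''
    Set.Ioo (-2 * (i : ℝ)) (-2 * (i : ℝ) + 1)) (fun i => ?_) fun x hx => ?_
  · exact (Set.Ioo_infinite (by linarith)).image Complex.ofReal_injective.injOn
  · choose η hη hηx using fun i => hx i (Set.mem_univ i)
    have e : x = fun i => (η i : ℂ) := funext fun i => (hηx i).symm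
    rw [e, key η fun i j hij => ?_]
    · simp
    · have h1 := (hη i).1
      have h2 := (hη j).2
      have h3 : (i : ℝ) + 1 ≤ j := by exact_mod_cast hij
      linarith

end TrigBA

namespace TrigBA
open LP
variable {N : ℕ}

theorem vand_ne_zero {ν : Fin N → ℂ} : vand ν ≠ 0 ↔ ∀ i j, i < j → ν i ≠ ν j := by
  rw [vand_eq, Finset.prod_ne_zero_iff]
  exact ⟨fun h i j hij => sub_ne_zero.1 (h (i, j) (mem_prs.2 hij)),
    fun h p hp => sub_ne_zero.2 (h _ _ (mem_prs.1 hp))⟩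

theorem exists_trigBA (m n : ℕ) : ∃ T : TrigPoly (n + 1), IsBANumerator m T ∧
    (∀ ν, IsEig m (fun i => 2 * ν i) (T.toLP ν) m (-4 * ∑ i, ν i * ν i)) ∧
    (∀ ν, Lead (wt 1 (n + 1)) (T.toLP ν) (m • rho (n + 1))
      (((1 / 2 : ℂ) ^ (prs (n + 1)).card) ^ m * normC m ν)) ∧
    ∃ c : ℂ, c ≠ 0 ∧ ∀ ν, MvPolynomial.eval ν (T (-(m • rho (n + 1)))) = c * lc m (-1) ν := by
  obtain ⟨P, hP, hE, hL⟩ := exists_family m n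
  obtain ⟨T, hT, hd, hh⟩ := exists_trigPoly hP
  obtain ⟨c₁, hc₁, h₁⟩ := hL 1 (Or.inl rfl)
  obtain ⟨c₂, hc₂, h₂⟩ := hL (-1) (Or.inr rfl)
  simp only [one_smul] at h₁
  simp only [neg_smul, one_smul, smul_neg] at h₂
  have hb := lead_B (Or.inl rfl) (n + 1) (ε := 1)
  rw [one_smul] at hb
  have hw := wt_injective one_ne_zero (n + 1)
  have hev1 : ∀ ν, MvPolynomial.eval ν (T (m • rho (n + 1))) = c₁ * lc m 1 ν := fun ν => by
    rw [← TrigPoly.coeff_toLP, hT, (h₁ ν).1]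
  have hev2 : ∀ ν, MvPolynomial.eval ν (T (-(m • rho (n + 1)))) = c₂ * lc m (-1) ν := fun ν => by
    rw [← TrigPoly.coeff_toLP, hT, (h₂ ν).1]
  have hc : c₁ = ((1 / 2 : ℂ) ^ (prs (n + 1)).card) ^ m := by
    set η : Fin (n + 1) → ℂ := fun i => (i : ℕ) with hη
    have hne : ∀ i j, i < j → η i ≠ η j := fun i j hij e =>
      hij.ne (Fin.ext (by exact_mod_cast (show ((i : ℕ) : ℂ) = (j : ℕ) from e)))
    have e1 : lineP η (T (m • rho (n + 1))) = Polynomial.C c₁ * lcP m 1 η := by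
      refine Polynomial.funext fun s => ?_
      rw [eval_lineP, hev1, Polynomial.eval_mul, Polynomial.eval_C, eval_lcP]
    have e2 := coeff_lineP η (T (m • rho (n + 1))) (m * (prs (n + 1)).card)
    rw [hh, e1, Polynomial.coeff_C_mul] at e2
    have e3 : (lcP m 1 η).coeff (m * (prs (n + 1)).card) = vand η ^ m := by
      rw [← leadingCoeff_lcP m 1 hne, Polynomial.leadingCoeff,
        Polynomial.natDegree_eq_of_degree_eq_some (degree_lcP hne)]
    rw [e3] at e2
    have e4 := ((hb.pow hw m).smul (vand η ^ m)).1
    rw [e4, mul_comm] at e2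
    have := mul_left_cancel₀ (pow_ne_zero m (vand_ne_zero.2 hne)) e2
    rw [this]; norm_num
  have hE' : ∀ ν, IsEig m (fun i => 2 * ν i) (T.toLP ν) m (-4 * ∑ i, ν i * ν i) := fun ν => by
    rw [hT]; exact hE ν
  refine ⟨T, ⟨?_, ?_, ?_⟩, hE', fun ν => ?_, c₂, hc₂, hev2⟩
  · rw [← card_prs]; exact hd
  · intro x ν
    rw [← card_prs]
    classical
    have e : ev x (vand ν ^ m • B (n + 1) ^ m) = sinhVand x ^ m * vand ν ^ m := by
      rw [map_smul, map_pow, ev_B, smul_eq_mul, mul_comm]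
    rw [← e, ev_eq_sum_of_subset (s := T.support)]
    · simp only [TrigPoly.evalHomog, Finsupp.sum, hh]; rfl
    · intro μ hμ
      rw [Finsupp.mem_support_iff]
      intro h0
      rw [← hh, h0] at hμ
      simp at hμ
  · intro x ν hx hν
    exact (TrigPoly.isEig_iff_eigen hν).1 (hE' ν) x hx
  · rw [hT, normC_eq, ← hc]; exact h₁ ν

theorem existsUnique_trigBA (m n : ℕ) : ∃! P : TrigPoly (n + 1), IsBANumerator m P := by
  obtain ⟨T₀, hT₀, hE, hl, c₂, hc₂, h₂⟩ := exists_trigBA m n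
  refine ⟨T₀, hT₀, fun T hT => ?_⟩
  rw [← sub_eq_zero]
  refine TrigPoly.eq_zero_of_isEig (m := m) (T₀ := T₀)
    (c₁ := ((1 / 2 : ℂ) ^ (prs (n + 1)).card) ^ m) (pow_ne_zero _ (pow_ne_zero _ (by norm_num))) hc₂ hE (fun ν => ?_) h₂
    (fun μ => ?_) (fun μ => ?_) fun ν hν => ?_
  · rw [← TrigPoly.coeff_toLP, (hl ν).1, normC_eq]
  · rw [card_prs, Finsupp.sub_apply]
    exact (MvPolynomial.totalDegree_sub _ _).trans (max_le (hT.degree_le μ) (hT₀.degree_le μ))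
  · refine MvPolynomial.funext fun ν => ?_
    rw [card_prs, Finsupp.sub_apply, map_sub, map_sub, map_zero]
    set d := m * ((n + 1) * (n + 1 - 1) / 2) with hd
    have key : ∀ T : TrigPoly (n + 1), IsBANumerator m T → ∀ x,
        ev x (.ofCoeff (Finsupp.mapRange (fun p => MvPolynomial.eval ν
          (MvPolynomial.homogeneousComponent d p)) (by simp) T)) =
          sinhVand x ^ m * vand ν ^ m := fun T hT x => by
      classical
      rw [← hT.leading x ν, ev_eq_sum_of_subset (s := T.support)]
      · rfl
      · intro μ hμ
        rw [Finsupp.mem_support_iff]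
        intro h0; exact hμ (by simp [h0])
    have h1 := eq_zero_of_ev 0 ((.ofCoeff (Finsupp.mapRange (fun p => MvPolynomial.eval ν
          (MvPolynomial.homogeneousComponent d p)) (by simp) T) : LP (Fin (n + 1))) -
        .ofCoeff (Finsupp.mapRange (fun p => MvPolynomial.eval ν
          (MvPolynomial.homogeneousComponent d p)) (by simp) T₀)) fun r => by
      rw [map_sub, key T hT, key T₀ hT₀, sub_self]
    exact congrArg (fun D : LP (Fin (n + 1)) => D.coeff μ) h1
  · rw [TrigPoly.toLP_sub]
    have := isEig_sub_smul (a := 1) (b := 1)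
      ((TrigPoly.isEig_iff_eigen hν).2 fun x hx => hT.eigen x ν hx hν) (hE ν)
    simpa using this

end TrigBA

namespace TrigBA
namespace LP
variable {N : ℕ}

/-! ### The constant term pairing -/

/-- The point `x₀ + 2πiθ` of a torus. -/
def tor (x₀ : Fin N → ℂ) (θ : Fin N → ℝ) : Fin N → ℂ :=
  fun i => x₀ i + 2 * Real.pi * Complex.I * θ i

theorem continuous_tor (x₀ : Fin N → ℂ) : Continuous (tor x₀) := by
  unfold tor; fun_prop

/-- The mean value of `G / B^M` over a torus. -/
def ct (x₀ : Fin N → ℂ) (G : LP (Fin N)) (M : ℕ) : ℂ :=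
  ∫ θ in box N, cl (B N) 0 G M (tor x₀ θ)

theorem pair_tor (x₀ : Fin N → ℂ) (θ : Fin N → ℝ) (μ : Fin N → ℤ) :
    pair (tor x₀ θ) μ = pair x₀ μ + ∑ i, 2 * Real.pi * Complex.I * (μ i : ℂ) * θ i := by
  simp only [pair_apply, tor, mul_add, Finset.sum_add_distrib]
  congr 1
  exact Finset.sum_congr rfl fun i _ => by ring

section
variable {x₀ : Fin N → ℂ} (hx : ∀ θ, sinhVand (tor x₀ θ) ≠ 0)
include hx

theorem continuous_cl_tor (G : LP (Fin N)) (M : ℕ) :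
    Continuous fun θ => cl (B N) 0 G M (tor x₀ θ) := by
  unfold cl
  have h1 := (continuous_ev G).comp (continuous_tor x₀)
  have h2 := (continuous_ev (B N)).comp (continuous_tor x₀)
  simp only [Pi.zero_apply, zero_mul, Finset.sum_const_zero, Complex.exp_zero, one_mul]
  exact h1.div (h2.pow M) fun θ => pow_ne_zero _ (by simpa using hx θ)

theorem integrableOn_cl_tor (G : LP (Fin N)) (M : ℕ) :
    IntegrableOn (fun θ => cl (B N) 0 G M (tor x₀ θ)) (box N) :=
  ((continuous_cl_tor hx G M).continuousOn.integrableOn_Icc (a := 0) (b := 1)).mono_set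
    fun θ hθ => ⟨fun i => (mem_box.1 hθ i).1.le, fun i => (mem_box.1 hθ i).2.le⟩

theorem ct_add (G H : LP (Fin N)) (M : ℕ) : ct x₀ (G + H) M = ct x₀ G M + ct x₀ H M := by
  simp only [ct, cl_add]
  exact integral_add (integrableOn_cl_tor hx G M) (integrableOn_cl_tor hx H M)

theorem ct_smul (c : ℂ) (G : LP (Fin N)) (M : ℕ) : ct x₀ (c • G) M = c * ct x₀ G M := by
  simp only [ct, cl_smul]
  exact integral_const_mul _ _

theorem ct_sum {ι : Type} (s : Finset ι) (G : ι → LP (Fin N)) (M : ℕ) :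
    ct x₀ (∑ i ∈ s, G i) M = ∑ i ∈ s, ct x₀ (G i) M := by
  classical
  induction s using Finset.induction_on with
  | empty => simp [ct, cl]
  | insert a s ha ih => rw [Finset.sum_insert ha, Finset.sum_insert ha, ct_add hx, ih]

theorem ct_mul_pow (G : LP (Fin N)) (M r : ℕ) : ct x₀ (B N ^ r * G) (M + r) = ct x₀ G M := by
  unfold ct
  congr 1
  ext θ
  exact cl_mul_pow _ _ _ _ _ _ (by simpa using hx θ)

theorem ct_qder (G : LP (Fin N)) (M : ℕ) (i : Fin N) :
    ct x₀ (qder (B N) 0 (Pi.single i 1) M G) (M + 1) = 0 := by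
  have hI : (2 * Real.pi * Complex.I : ℂ) ≠ 0 := by simp [Real.pi_ne_zero]
  apply (mul_eq_zero.1 _).resolve_left hI
  rw [ct, ← integral_const_mul]
  have hup : ∀ (θ : Fin N → ℝ) (t : ℝ), tor x₀ (Function.update θ i t) = tor x₀ θ +
      (2 * Real.pi * Complex.I * ((t - θ i : ℝ) : ℂ)) • (Pi.single i 1 : Fin N → ℂ) := by
    intro θ t
    ext j
    rcases eq_or_ne j i with rfl | hj
    · simp [tor]; ring
    · simp [tor, hj]
  refine integral_box_deriv_eq_zero i (h := fun θ => cl (B N) 0 G M (tor x₀ θ))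
    ((integrableOn_cl_tor hx _ _).const_mul _) (fun θ _ => ?_) fun θ _ => ?_
  · simp only [hup]
    have h1 := hasLineDerivAt_cl (B N) 0 G M (Pi.single i 1) (tor x₀ θ) (by simpa using hx θ)
    unfold HasLineDerivAt at h1
    have h2 : HasDerivAt (fun t : ℝ => 2 * Real.pi * Complex.I * ((t - θ i : ℝ) : ℂ))
        (2 * Real.pi * Complex.I) (θ i) := by
      have := ((hasDerivAt_id (θ i)).sub_const (θ i)).ofReal_comp.const_mul
        (2 * Real.pi * Complex.I : ℂ)
      simpa using this
    have h3 := HasDerivAt.comp (θ i) (h₂ := fun s : ℂ => cl (B N) 0 G M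
      (tor x₀ θ + s • (Pi.single i 1 : Fin N → ℂ))) (by simpa using h1) h2
    exact h3.congr_deriv (by ring)
  · have hc : Continuous fun t => cl (B N) 0 G M (tor x₀ (Function.update θ i t)) :=
      (continuous_cl_tor hx G M).comp (continuous_const.update i continuous_id)
    have e : cl (B N) 0 G M (tor x₀ (Function.update θ i 1)) =
        cl (B N) 0 G M (tor x₀ (Function.update θ i 0)) := by
      have key : ∀ D : LP (Fin N), ev (tor x₀ (Function.update θ i 1)) D =
          ev (tor x₀ (Function.update θ i 0)) D := fun D => by
        rw [ev_eq_sum, ev_eq_sum]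
        refine Finset.sum_congr rfl fun μ _ => ?_
        congr 1
        rw [Complex.exp_eq_exp_iff_exists_int]
        refine ⟨μ i, ?_⟩
        rw [hup, hup, pair_add_smul, pair_add_smul, pair_single_one]
        push_cast; ring
      simp only [cl, key, Pi.zero_apply, zero_mul, Finset.sum_const_zero]
    exact ⟨_, (hc.tendsto 0).mono_left nhdsWithin_le_nhds,
      e ▸ (hc.tendsto 1).mono_left nhdsWithin_le_nhds⟩

theorem Lop_mul_sub (m : ℕ) (lam : Fin N → ℂ) (M M' : ℕ) (D D' : LP (Fin N)) :
    Lop m lam M D * D' - D * Lop m (-lam) M' D' =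
      ∑ i, (-1 : ℂ) • qder (B N) 0 (Pi.single i 1) (M + M' + 1)
        (qder (B N) lam (Pi.single i 1) M D * D' - D * qder (B N) (-lam) (Pi.single i 1) M' D') := by
  have e : Lop m lam M D * D' - D * Lop m (-lam) M' D' = ∑ i, (-1 : ℂ) •
      (qder (B N) lam (Pi.single i 1) (M + 1) (qder (B N) lam (Pi.single i 1) M D) * D' -
      D * qder (B N) (-lam) (Pi.single i 1) (M' + 1) (qder (B N) (-lam) (Pi.single i 1) M' D')) := by
    simp only [neg_smul, one_smul, Finset.sum_neg_distrib, Finset.sum_sub_distrib,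
      ← Finset.sum_mul, ← Finset.mul_sum, Lop]
    ring
  rw [e]
  refine Finset.sum_congr rfl fun i _ => ?_
  congr 1
  simp only [qder, Pi.neg_apply, Pi.zero_apply, zero_mul, neg_mul, Finset.sum_neg_distrib,
    Finset.sum_const_zero, Derivation.leibniz, map_sub, map_add, map_neg, smul_eq_mul, Derivation.map_natCast, Algebra.smul_def, Nat.cast_add,
    Nat.cast_one]
  have h0 : ∀ c : ℂ, der (Pi.single i 1 : Fin N → ℂ) (algebraMap ℂ (LP (Fin N)) c) = 0 :=
    fun c => Derivation.map_algebraMap _ c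
  simp only [h0, map_zero]
  ring

theorem ct_Lop (m : ℕ) (lam : Fin N → ℂ) (M M' : ℕ) (D D' : LP (Fin N)) :
    ct x₀ (Lop m lam M D * D') (M + M' + 2) = ct x₀ (D * Lop m (-lam) M' D') (M + M' + 2) := by
  have h := congrArg (fun G => ct x₀ G (M + M' + 2)) (Lop_mul_sub hx m lam M M' D D')
  simp only [sub_eq_add_neg (Lop m lam M D * D'), ← neg_one_smul ℂ (D * Lop m (-lam) M' D'),
    ct_add hx, ct_smul hx, ct_sum hx, ct_qder hx, mul_zero, Finset.sum_const_zero] at h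
  linear_combination h

theorem ct_zero_right (G : LP (Fin N)) : ct x₀ G 0 = G.coeff 0 := by
  classical
  induction G using AddMonoidAlgebra.induction_linear with
  | zero => simp [ct, cl]
  | add a b ha hb => rw [ct_add hx, ha, hb]; rfl
  | single μ c =>
    have e : ∀ θ, cl (B N) 0 (AddMonoidAlgebra.single μ c) 0 (tor x₀ θ) =
        c * Complex.exp (pair x₀ μ) *
          ∏ i, Complex.exp (2 * Real.pi * Complex.I * (μ i : ℂ) * θ i) := fun θ => by
      simp only [cl, Pi.zero_apply, zero_mul, Finset.sum_const_zero, Complex.exp_zero, one_mul,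
        pow_zero, div_one, ev_single, pair_tor, Complex.exp_add, Complex.exp_sum, mul_assoc]
    simp only [ct, e]
    rw [integral_const_mul, integral_box_prod fun i t =>
      Complex.exp (2 * Real.pi * Complex.I * (μ i : ℂ) * t)]
    have h1 : ∀ i, ∫ t in Set.Ioo (0 : ℝ) 1, Complex.exp (2 * Real.pi * Complex.I * (μ i : ℂ) * t) =
        if μ i = 0 then 1 else 0 := fun i => by
      rw [← integral_Ioc_eq_integral_Ioo, ← intervalIntegral.integral_of_le zero_le_one]
      split_ifs with h
      · simp [h]
      · rw [integral_exp_mul_complex (by simp [Real.pi_ne_zero, h])]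
        have : Complex.exp (2 * Real.pi * Complex.I * (μ i : ℂ)) = 1 := by
          rw [mul_comm]; exact Complex.exp_int_mul_two_pi_mul_I _
        simp [this]
    simp only [h1, AddMonoidAlgebra.coeff_single, Finsupp.single_apply]
    by_cases h0 : μ = 0
    · subst h0; simp
    · obtain ⟨i, hi⟩ := Function.ne_iff.1 h0
      rw [Finset.prod_eq_zero (Finset.mem_univ i) (if_neg hi), mul_zero, if_neg h0]

end

/-- Repeated application of the Sutherland operator, shifted by the entries of a list. -/
def Lfac (m : ℕ) (lam : Fin N → ℂ) (M : ℕ) : List ℂ → LP (Fin N) → LP (Fin N)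
  | [], D => D
  | e :: es, D => Lop m lam (M + 2 * es.length) (Lfac m lam M es D) +
      e • (B N ^ 2 * Lfac m lam M es D)

theorem ct_Lfac {x₀ : Fin N → ℂ} (hx : ∀ θ, sinhVand (tor x₀ θ) ≠ 0) {m M M' : ℕ} {E : ℂ}
    {lam : Fin N → ℂ} (D : LP (Fin N)) {D' : LP (Fin N)} (h : IsEig m (-lam) D' M' E)
    (es : List ℂ) : ct x₀ (Lfac m lam M es D * D') (M + 2 * es.length + M') =
      (es.map fun e => E + e).prod * ct x₀ (D * D') (M + M') := by
  induction es with
  | nil => simp [Lfac]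
  | cons e es ih =>
    set F := Lfac m lam M es D
    have e1 : M + 2 * (e :: es).length + M' = M + 2 * es.length + M' + 2 := by
      simp only [List.length_cons]; ring
    rw [e1, Lfac, add_mul, ct_add hx, ct_Lop hx, h, mul_smul_comm, smul_mul_assoc, ct_smul hx,
      ct_smul hx, mul_left_comm, mul_assoc, ct_mul_pow hx, ih, List.map_cons, List.prod_cons]
    ring

theorem lead_Lfac {m M : ℕ} {lam : Fin N → ℂ} {D : LP (Fin N)} {c b : ℂ}
    (hB : Lead (wt 1 N) (B N) (rho N) b) (h : Lead (wt 1 N) D (M • rho N) c) (es : List ℂ) :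
    Lead (wt 1 N) (Lfac m lam M es D) ((M + 2 * es.length) • rho N)
      ((es.map fun e => b ^ 2 * (e - ∑ i, lam i ^ 2)).prod * c) := by
  have hw := wt_injective one_ne_zero N
  induction es with
  | nil => simpa [Lfac] using h
  | cons e es ih =>
    have h1 := (lead_Lop (lam := lam) (m := m) (M := M + 2 * es.length) hB ih).add
      (((hB.pow hw 2).mul hw ih).smul e)
    convert h1 using 1
    · rfl
    · rw [← add_smul]; congr 1; simp; ring
    · have e1 : ∀ l, ((((M + 2 * es.length) • rho N) l : ℤ) : ℂ) + lam l -
          ((M + 2 * es.length : ℕ) : ℂ) * rho N l = lam l := fun l => by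
        rw [← natCast_zsmul]; simp
      simp only [e1, List.map_cons, List.prod_cons]
      ring

/-- A decreasing real direction, along which the weight measures growth. -/
def ray (r : ℝ) : Fin N → ℂ := fun i => ((r * tt ^ (i : ℕ) : ℝ) : ℂ)

theorem sinhVand_tor_ray {r : ℝ} (hr : 0 < r) (θ : Fin N → ℝ) : sinhVand (tor (ray r) θ) ≠ 0 := by
  refine sinhVand_ne.2 fun i j hij => sinh_ne_zero_of_re ?_
  have : ∀ i, (tor (ray r) θ i).re = r * tt ^ (i : ℕ) := fun i => by
    simp [tor, ray, -Complex.ofReal_pow, -Complex.ofReal_mul]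
  rw [Complex.sub_re, this, this, ← mul_sub]
  refine mul_ne_zero hr.ne' (sub_ne_zero.2 fun h => hij (Fin.ext ?_))
  exact (pow_right_strictAnti₀ tt_pos tt_lt_one).injective h

theorem re_pair_ray (r : ℝ) (μ : Fin N → ℤ) : (pair (ray r) μ).re = r * wt 1 N μ := by
  simp only [pair_apply, ray, wt, AddMonoidHom.coe_mk, ZeroHom.coe_mk, Complex.re_sum,
    Int.cast_one, one_mul, Finset.mul_sum]
  refine Finset.sum_congr rfl fun i _ => ?_
  rw [← Complex.ofReal_intCast, ← Complex.ofReal_mul, Complex.ofReal_re]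
  ring

theorem Lead.eventually_near {G : LP (Fin N)} {κ : Fin N → ℤ} {c : ℂ} (h : Lead (wt 1 N) G κ c)
    {ε : ℝ} (hε : 0 < ε) : ∀ᶠ r : ℝ in Filter.atTop, ∀ θ,
      ‖ev (tor (ray r) θ) G * Complex.exp (-pair (tor (ray r) θ) κ) - c‖ < ε := by
  classical
  have hw := wt_injective one_ne_zero N
  have h1 : Filter.Tendsto (fun r : ℝ => ∑ μ ∈ G.coeff.support.erase κ,
      ‖G.coeff μ‖ * Real.exp (r * (wt 1 N μ - wt 1 N κ))) Filter.atTop (nhds 0) := by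
    rw [← Finset.sum_const_zero (s := G.coeff.support.erase κ)]
    refine tendsto_finsetSum _ fun μ hμ => ?_
    rw [← mul_zero ‖G.coeff μ‖]
    refine Filter.Tendsto.const_mul _ (Real.tendsto_exp_atBot.comp ?_)
    rw [Finset.mem_erase, Finsupp.mem_support_iff] at hμ
    exact Filter.tendsto_id.atTop_mul_const_of_neg
      (sub_neg.2 ((h.2 μ hμ.2).lt_of_ne fun e => hμ.1 (hw e)))
  filter_upwards [h1.eventually (gt_mem_nhds hε)] with r hr θ
  refine lt_of_le_of_lt ?_ hr
  set x := tor (ray r) θ with hx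
  have hre : ∀ μ, (pair x μ).re = r * wt 1 N μ := fun μ => by
    have : ∀ i : Fin N, (2 * Real.pi * Complex.I * (μ i : ℂ) * θ i : ℂ) =
        ((2 * Real.pi * μ i * θ i : ℝ) : ℂ) * Complex.I := fun i => by push_cast; ring
    rw [hx, pair_tor, Complex.add_re, re_pair_ray, Complex.re_sum]
    simp only [this, Complex.re_ofReal_mul, Complex.I_re, mul_zero, Finset.sum_const_zero, add_zero]
  have h2 : ev x G * Complex.exp (-pair x κ) - c =
      ∑ μ ∈ G.coeff.support.erase κ, G.coeff μ * Complex.exp (pair x μ - pair x κ) := by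
    rw [ev_eq_sum_of_subset (s := insert κ (G.coeff.support.erase κ))]
    · rw [Finset.sum_insert (Finset.notMem_erase _ _), add_mul, mul_assoc, ← Complex.exp_add,
        add_neg_cancel, Complex.exp_zero, mul_one, h.1, add_sub_cancel_left, Finset.sum_mul]
      exact Finset.sum_congr rfl fun μ _ => by rw [mul_assoc, ← Complex.exp_add, sub_eq_add_neg]
    · intro μ hμ
      by_cases e : μ = κ
      · exact e ▸ Finset.mem_insert_self _ _
      · exact Finset.mem_insert_of_mem (Finset.mem_erase.2 ⟨e, Finsupp.mem_support_iff.2 hμ⟩)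
  rw [h2]
  refine (norm_sum_le _ _).trans_eq (Finset.sum_congr rfl fun μ _ => ?_)
  rw [norm_mul, Complex.norm_exp, Complex.sub_re, hre, hre, mul_sub]

theorem tendsto_ct {G : LP (Fin N)} {c b : ℂ} {M : ℕ} (hB : Lead (wt 1 N) (B N) (rho N) b)
    (hb : b ≠ 0) (h : Lead (wt 1 N) G (M • rho N) c) :
    Filter.Tendsto (fun r : ℝ => ct (ray r) G M) Filter.atTop (nhds (c / b ^ M)) := by
  have e0 : c / b ^ M = ∫ _ in box N, c / b ^ M := by
    rw [setIntegral_const]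
    simp [box, Measure.real, Real.volume_pi_Ioo]
  have key : ∀ r θ, cl (B N) 0 G M (tor (ray r) θ) =
      (ev (tor (ray r) θ) G * Complex.exp (-pair (tor (ray r) θ) (M • rho N))) /
      (ev (tor (ray r) θ) (B N) * Complex.exp (-pair (tor (ray r) θ) (rho N))) ^ M := fun r θ => by
    rw [mul_pow, ← Complex.exp_nat_mul, map_nsmul, nsmul_eq_mul, mul_neg,
      mul_div_mul_right _ _ (Complex.exp_ne_zero _)]
    simp [cl]
  have hbp : 0 < ‖b‖ := norm_pos_iff.2 hb
  rw [e0]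
  unfold ct
  simp only [key]
  refine tendsto_integral_filter_of_dominated_convergence
    (fun _ => (‖c‖ + 1) / (‖b‖ / 2) ^ M) ?_ ?_ (integrable_const _) ?_
  · filter_upwards [Filter.eventually_gt_atTop 0] with r hr
    refine ((integrableOn_cl_tor (sinhVand_tor_ray hr) G M).1).congr
      (Filter.Eventually.of_forall fun θ => key r θ)
  · filter_upwards [h.eventually_near one_pos, hB.eventually_near (half_pos hbp)] with r h1 h2
    refine Filter.Eventually.of_forall fun θ => ?_
    rw [norm_div, norm_pow]
    have h3 := norm_sub_norm_le (ev (tor (ray r) θ) G *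
      Complex.exp (-pair (tor (ray r) θ) (M • rho N))) c
    have h4 := norm_sub_norm_le b (ev (tor (ray r) θ) (B N) *
      Complex.exp (-pair (tor (ray r) θ) (rho N)))
    rw [norm_sub_rev] at h4
    have h5 := h1 θ
    have h6 := h2 θ
    gcongr <;> linarith
  · refine Filter.Eventually.of_forall fun θ => ?_
    refine Filter.Tendsto.div ?_ (Filter.Tendsto.pow ?_ M) (pow_ne_zero _ hb)
    · rw [Metric.tendsto_nhds]
      intro ε hε
      filter_upwards [h.eventually_near hε] with r hr
      rw [dist_eq_norm]; exact hr θ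
    · rw [Metric.tendsto_nhds]
      intro ε hε
      filter_upwards [hB.eventually_near hε] with r hr
      rw [dist_eq_norm]; exact hr θ

end LP
open LP

/-- The numerator of `e^{-m(ρ, x)} B(x)^m`. -/
def seed (m N : ℕ) : LP (Fin N) := AddMonoidAlgebra.single (-(m • rho N)) 1 * B N ^ m

theorem lead_seed (m N : ℕ) : Lead (wt 1 N) (seed m N) (0 • rho N) (((1 / 2 : ℂ) ^ (prs N).card) ^ m) := by
  have hw := wt_injective one_ne_zero N
  have hB := lead_B (Or.inl rfl) N (ε := 1)
  rw [one_smul] at hB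
  have := (Lead.single (w := wt 1 N) (-(m • rho N)) 1).mul hw (hB.pow hw m)
  convert this using 1
  · rfl
  · rw [neg_add_cancel, zero_smul]
  · norm_num

/-- The eigenvalue shift attached to an exponent. -/
def shift {N : ℕ} (ν : Fin N → ℂ) (κ : Fin N → ℤ) : ℂ := ∑ i, (2 * ν i + κ i) ^ 2

/-- A finite product of shifted Sutherland operators kills `e^{(2ν - mρ, x)} B(x)^m`. -/
theorem Lfac_seed_eq_zero {N m : ℕ} {T : TrigPoly N}
    (hE : ∀ ν, IsEig m (fun i => 2 * ν i) (T.toLP ν) m (-4 * ∑ i, ν i * ν i))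
    (hl : ∀ ν, Lead (wt 1 N) (T.toLP ν) (m • rho N)
      (((1 / 2 : ℂ) ^ (prs N).card) ^ m * normC m ν)) {ν : Fin N → ℂ}
    (hν : ∀ κ : Fin N → ℤ, normC m (fun i => -ν i - κ i / 2) ≠ 0) (es : List ℂ)
    (hes : ∀ κ : Fin N → ℤ, T (m • rho N + κ) ≠ 0 → shift ν κ ∈ es) :
    Lfac m (fun i => 2 * ν i) 0 es (seed m N) = 0 := by
  by_contra hF
  have hw := wt_injective one_ne_zero N
  set F := Lfac m (fun i => 2 * ν i) 0 es (seed m N)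
  obtain ⟨κ', c, hc, hlF⟩ := exists_lead (w := wt 1 N) hF
  set M := 2 * es.length
  obtain ⟨κ, rfl⟩ : ∃ κ, κ' = κ + M • rho N := ⟨κ' - M • rho N, by abel⟩
  set ν' : Fin N → ℂ := fun i => -ν i - κ i / 2 with hν'
  set P := T.toLP ν'
  set D' : LP (Fin N) := AddMonoidAlgebra.single (-κ) 1 * P with hD'
  have hB := lead_B (Or.inl rfl) N (ε := 1)
  rw [one_smul] at hB
  have hEe : -4 * ∑ i, ν' i * ν' i = -shift ν κ := by
    rw [shift, Finset.mul_sum, ← Finset.sum_neg_distrib]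
    exact Finset.sum_congr rfl fun i _ => by simp only [hν']; ring
  have hE' : IsEig m (-fun i => 2 * ν i) D' m (-shift ν κ) := by
    rw [isEig_iff]
    have h1 := isEig_iff.1 (hE ν')
    have e : cl (B N) (-fun i => 2 * ν i) D' m = cl (B N) (fun i => 2 * ν' i) P m := by
      ext x
      simp only [cl, hD', map_mul, ev_single, one_mul]
      rw [← mul_assoc, ← Complex.exp_add]
      congr 3
      rw [pair_apply, ← Finset.sum_add_distrib]
      refine Finset.sum_congr rfl fun i _ => ?_
      simp only [hν', Pi.neg_apply]; push_cast; ring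
    rw [e, ← hEe]; exact h1
  have hz : ∀ r : ℝ, 0 < r → ct (ray r) (F * D') (M + m) = 0 := by
    intro r hr
    have hx := sinhVand_tor_ray (N := N) hr
    have h1 := ct_Lfac hx (M := 0) (seed m N) hE' es
    rw [zero_add] at h1
    rw [h1]
    by_cases hT : T (m • rho N + κ) = 0
    · have e : seed m N * D' = B N ^ m * (AddMonoidAlgebra.single (-(m • rho N + κ)) 1 * P) := by
        have : (AddMonoidAlgebra.single (-(m • rho N + κ)) 1 : LP (Fin N)) =
            AddMonoidAlgebra.single (-(m • rho N)) 1 * AddMonoidAlgebra.single (-κ) 1 := by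
          rw [AddMonoidAlgebra.single_mul_single, mul_one]; congr 1; abel
        rw [seed, hD', this]; ring
      have h2 := ct_mul_pow hx (AddMonoidAlgebra.single (-(m • rho N + κ)) 1 * P) 0 m
      rw [e, h2, ct_zero_right hx]
      have h3 : (AddMonoidAlgebra.single (-(m • rho N + κ)) (1 : ℂ) * P).coeff
          (-(m • rho N + κ) + (m • rho N + κ)) = P.coeff (m • rho N + κ) := by
        rw [AddMonoidAlgebra.coeff_single_mul_add, one_mul]
      rw [neg_add_cancel] at h3
      rw [h3, TrigPoly.coeff_toLP, hT, map_zero, mul_zero]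
    · rw [List.prod_eq_zero, zero_mul]
      exact List.mem_map.2 ⟨_, hes κ hT, neg_add_cancel _⟩
  have h5 := hlF.mul hw ((Lead.single (w := wt 1 N) (-κ) 1).mul hw (hl ν'))
  rw [show κ + M • rho N + (-κ + m • rho N) = (M + m) • rho N by rw [add_smul]; abel] at h5
  have h6 := tendsto_ct hB (pow_ne_zero _ (by norm_num)) h5
  have h7 : Filter.Tendsto (fun r : ℝ => ct (ray r) (F * D') (M + m)) Filter.atTop (nhds 0) :=
    tendsto_const_nhds.congr' (by
      filter_upwards [Filter.eventually_gt_atTop 0] with r hr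
      rw [hz r hr])
  have h8 := tendsto_nhds_unique h6 h7
  rw [div_eq_zero_iff] at h8
  have hh : ((1 / 2 : ℂ) ^ (prs N).card) ^ m ≠ 0 := pow_ne_zero _ (pow_ne_zero _ (by norm_num))
  exact mul_ne_zero hc (mul_ne_zero one_ne_zero (mul_ne_zero hh (hν κ)))
    (h8.resolve_right (pow_ne_zero _ (pow_ne_zero _ (by norm_num))))

/-- The eigenfunction is obtained from `e^{(2ν - mρ, x)} B(x)^m` by a product of shifted Sutherland
operators, whose length does not depend on the spectral parameter. -/
theorem exists_Lfac_seed {N m : ℕ} {T : TrigPoly N}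
    (hE : ∀ ν, IsEig m (fun i => 2 * ν i) (T.toLP ν) m (-4 * ∑ i, ν i * ν i))
    (hl : ∀ ν, Lead (wt 1 N) (T.toLP ν) (m • rho N)
      (((1 / 2 : ℂ) ^ (prs N).card) ^ m * normC m ν)) :
    ∃ L : ℕ, ∀ ν : Fin N → ℂ, Gen ν → (∀ κ : Fin N → ℤ, normC m (fun i => -ν i - κ i / 2) ≠ 0) →
      ∃ es : List ℂ, es.length = L ∧
        (∀ e ∈ es, e - ∑ i, (2 * ν i) ^ 2 ≠ 0) ∧
        IsEig m (fun i => 2 * ν i) (Lfac m (fun i => 2 * ν i) 0 es (seed m N)) (2 * L)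
          (-4 * ∑ i, ν i * ν i) := by
  classical
  refine ⟨(T.support.erase (m • rho N)).toList.length, fun ν hν hν' =>
    ⟨(T.support.erase (m • rho N)).toList.map fun μ => shift ν (μ - m • rho N), by simp,
      fun e he => ?_, ?_⟩⟩
  · obtain ⟨μ, hμ, rfl⟩ := List.mem_map.1 he
    rw [Finset.mem_toList, Finset.mem_erase] at hμ
    have := hν _ (sub_ne_zero.2 hμ.1)
    rw [shift, ← Finset.sum_sub_distrib]
    rw [Finset.mul_sum, ← Finset.sum_add_distrib] at this
    convert this using 1
    exact Finset.sum_congr rfl fun i _ => by simp; ring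
  · have h := Lfac_seed_eq_zero hE hl hν' (shift ν 0 :: (T.support.erase (m • rho N)).toList.map
      fun μ => shift ν (μ - m • rho N)) fun κ hκ => by
        by_cases h0 : κ = 0
        · subst h0; exact List.mem_cons_self
        · refine List.mem_cons_of_mem _ (List.mem_map.2 ⟨m • rho N + κ, ?_, by
            rw [add_sub_cancel_left]⟩)
          rw [Finset.mem_toList, Finset.mem_erase, Finsupp.mem_support_iff]
          exact ⟨fun e => h0 (by simpa using e), hκ⟩
    rw [Lfac, List.length_map] at h
    rw [IsEig, ← sub_eq_zero, ← h, zero_add, sub_eq_add_neg, ← neg_smul]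
    congr 3
    rw [shift, Finset.mul_sum, ← Finset.sum_neg_distrib]
    exact Finset.sum_congr rfl fun i _ => by simp; ring

end TrigBA

namespace TrigBA
open LP
variable {k : ℕ}

/-! ### The ray contours -/

/-- Half the logarithm. -/
def gS (t : ℝ) : ℂ := ((Real.log t / 2 : ℝ) : ℂ)

/-- The derivative of `gS`. -/
def gS' (t : ℝ) : ℂ := ((1 / (2 * t) : ℝ) : ℂ)

theorem hasDerivAt_gS {t : ℝ} (ht : 0 < t) : HasDerivAt gS (gS' t) t := by
  have := ((Real.hasDerivAt_log ht.ne').div_const 2).ofReal_comp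
  exact this.congr_deriv (by simp only [gS']; congr 1; field_simp)

/-- Points with pairwise distinct arguments of `e^{2 x_i}`. -/
def Spr (N : ℕ) : Set (Fin N → ℂ) := {x | ∀ i l, i ≠ l → Real.sin (x i - x l).im ≠ 0}

theorem isOpen_spr (N : ℕ) : IsOpen (Spr N) := by
  simp only [Spr, Set.ofPred_forall]
  refine isOpen_iInter_of_finite fun i => isOpen_iInter_of_finite fun l =>
    isOpen_iInter_of_finite fun _ => isOpen_ne_fun ?_ continuous_const
  fun_prop

theorem norm_sinh_sq (z : ℂ) :
    ‖Complex.sinh z‖ ^ 2 = Real.sinh z.re ^ 2 + Real.sin z.im ^ 2 := by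
  rw [← Complex.normSq_eq_norm_sq, Complex.normSq_apply]
  have e : Complex.sinh z = ((Real.sinh z.re * Real.cos z.im : ℝ) : ℂ) +
      ((Real.cosh z.re * Real.sin z.im : ℝ) : ℂ) * Complex.I := by
    conv_lhs => rw [← Complex.re_add_im z, Complex.sinh_add, Complex.sinh_mul_I, Complex.cosh_mul_I]
    push_cast; ring
  have hre : (Complex.sinh z).re = Real.sinh z.re * Real.cos z.im := by
    rw [e, Complex.add_re, Complex.ofReal_re, Complex.re_ofReal_mul]; simp
  have him : (Complex.sinh z).im = Real.cosh z.re * Real.sin z.im := by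
    rw [e, Complex.add_im, Complex.ofReal_im, Complex.im_ofReal_mul]; simp
  rw [hre, him]
  have h1 := Real.cosh_sq z.re
  have h2 := Real.sin_sq_add_cos_sq z.im
  linear_combination Real.sinh z.re ^ 2 * h2 + Real.sin z.im ^ 2 * h1

theorem abs_sin_le_norm_sinh (z : ℂ) : |Real.sin z.im| ≤ ‖Complex.sinh z‖ := by
  apply abs_le_of_sq_le_sq' _ (norm_nonneg _) |>.2
  rw [norm_sinh_sq, sq_abs]
  nlinarith [sq_nonneg (Real.sinh z.re)]

theorem wj_gS_sub (x : Fin (k + 1) → ℂ) (θ : Fin k → ℝ) (i : Fin k) (l : Fin (k + 1)) :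
    (wj gS x θ (Sum.inr i) - wj gS x θ (Sum.inl l)).im = (x i.castSucc - x l).im := by
  simp [wj, gS, -Complex.ofReal_div]

theorem wj_gS_sub_inr (x : Fin (k + 1) → ℂ) (θ : Fin k → ℝ) (i l : Fin k) :
    (wj gS x θ (Sum.inr i) - wj gS x θ (Sum.inr l)).im = (x i.castSucc - x l.castSucc).im := by
  simp [wj, gS, -Complex.ofReal_div]

theorem sinh_sub_ne_swap {a b : ℂ} (h : Complex.sinh (a - b) ≠ 0) : Complex.sinh (b - a) ≠ 0 := by
  rw [← neg_sub, Complex.sinh_neg]; exact neg_ne_zero.2 h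

theorem wj_gS_mem_sep {x : Fin (k + 1) → ℂ} (hx : x ∈ Spr (k + 1)) {θ : Fin k → ℝ}
    (hθ : θ ∈ box k) : wj gS x θ ∈ Sep k := by
  have h0 : ∀ z : ℂ, Real.sin z.im ≠ 0 → Complex.sinh z ≠ 0 := fun z hz h => by
    have := abs_sin_le_norm_sinh z
    rw [h, norm_zero] at this
    exact hz (abs_nonpos_iff.1 this)
  have h1 : ∀ i l, Complex.sinh (wj gS x θ (Sum.inr i) - wj gS x θ (Sum.inl l)) ≠ 0 := by
    intro i l
    by_cases h : i.castSucc = l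
    · subst h
      refine sinh_ne_zero_of_re ?_
      have := Real.log_neg (mem_box.1 hθ i).1 (mem_box.1 hθ i).2
      simp [wj, gS, -Complex.ofReal_div, this.ne]
    · exact h0 _ (by rw [wj_gS_sub]; exact hx _ _ h)
  intro a b hab
  rcases a with a | a <;> rcases b with b | b
  · exact h0 _ (hx a b fun e => hab (by rw [e]))
  · exact sinh_sub_ne_swap (h1 b a)
  · exact h1 a b
  · refine h0 _ ?_
    rw [wj_gS_sub_inr]
    exact hx _ _ fun e => hab (by rw [Fin.castSucc_injective k e])

/-- A lower bound for the denominators. -/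
def lowQ (k : ℕ) (x : Fin (k + 1) → ℂ) : ℝ :=
  (∏ q ∈ prs k, |Real.sin (x q.1.castSucc - x q.2.castSucc).im|) *
    ∏ q ∈ prs (k + 1), |Real.sin (x q.1 - x q.2).im|

theorem continuous_lowQ : Continuous (lowQ k) := by unfold lowQ; fun_prop

theorem lowQ_pos {x : Fin (k + 1) → ℂ} (hx : x ∈ Spr (k + 1)) : 0 < lowQ k x := by
  refine mul_pos (Finset.prod_pos fun q hq => ?_) (Finset.prod_pos fun q hq => ?_)
  · exact abs_pos.2 (hx _ _ fun e => (mem_prs.1 hq).ne (Fin.castSucc_injective k e))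
  · exact abs_pos.2 (hx _ _ (mem_prs.1 hq).ne)

theorem lowQ_le (x : Fin (k + 1) → ℂ) (θ : Fin k → ℝ) : lowQ k x ≤ ‖ev (wj gS x θ) (Qst k)‖ := by
  rw [Qst, map_mul, ev_Bz, ev_Bx, norm_mul, norm_prod, norm_prod]
  refine mul_le_mul (Finset.prod_le_prod (fun _ _ => abs_nonneg _) fun q _ => ?_)
    (Finset.prod_le_prod (fun _ _ => abs_nonneg _) fun q _ => ?_)
    (Finset.prod_nonneg fun _ _ => abs_nonneg _) (Finset.prod_nonneg fun _ _ => norm_nonneg _)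
  · rw [← wj_gS_sub_inr x θ]; exact abs_sin_le_norm_sinh _
  · exact abs_sin_le_norm_sinh _

/-- The limit point of the contour. -/
def wj0 (x : Fin (k + 1) → ℂ) : JX k → ℂ := Sum.elim x fun i => x i.castSucc

theorem exp_pair_wj (a : JX k → ℂ) (x : Fin (k + 1) → ℂ) (θ : Fin k → ℝ) :
    Complex.exp (∑ b, a b * wj gS x θ b) = Complex.exp (∑ b, a b * wj0 x b) *
      ∏ i, Complex.exp (a (Sum.inr i) * gS (θ i)) := by
  rw [← Complex.exp_sum, ← Complex.exp_add]
  congr 1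
  simp only [Fintype.sum_sum_type, wj, wj0, Sum.elim_inl, Sum.elim_inr, mul_add,
    Finset.sum_add_distrib, add_assoc]

theorem exp_mul_ev (lam : JX k → ℂ) (N : LP (JX k)) (w : JX k → ℂ) :
    Complex.exp (∑ a, lam a * w a) * ev w N =
      ∑ μ ∈ N.coeff.support, N.coeff μ * Complex.exp (∑ b, (lam b + μ b) * w b) := by
  rw [ev_eq_sum, Finset.mul_sum]
  refine Finset.sum_congr rfl fun μ _ => ?_
  rw [mul_left_comm, ← Complex.exp_add, pair_apply, ← Finset.sum_add_distrib]
  simp only [add_mul]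

theorem continuousAt_wj_gS (x : Fin (k + 1) → ℂ) {θ : Fin k → ℝ} (hθ : ∀ i, 0 < θ i) :
    ContinuousAt (wj gS x) θ := by
  refine continuousAt_pi.2 fun a => ?_
  rcases a with a | a
  · exact continuousAt_const
  · have h1 : ContinuousAt gS (θ a) := (hasDerivAt_gS (hθ a)).continuousAt
    exact continuousAt_const.add
      (ContinuousAt.comp (f := fun p : Fin k → ℝ => p a) h1 (continuous_apply a).continuousAt)

/-- A bound for the integrand. -/
def bndS (lam : JX k → ℂ) (N : LP (JX k)) (n : ℕ) (x : Fin (k + 1) → ℂ) : ℝ :=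
  (∑ μ ∈ N.coeff.support, ‖N.coeff μ‖ * ‖Complex.exp (∑ b, (lam b + μ b) * wj0 x b)‖) / lowQ k x ^ n

theorem norm_exp_gS {a : ℂ} {t : ℝ} (s : ℝ) (ht : 0 < t) (h : 2 * s ≤ a.re) (ht1 : t ≤ 1) :
    ‖Complex.exp (a * gS t)‖ ≤ t ^ s := by
  rw [Complex.norm_exp, gS, Complex.re_mul_ofReal, Real.rpow_def_of_pos ht, Real.exp_le_exp]
  have := Real.log_nonpos ht.le ht1
  nlinarith

theorem norm_cl_wj_le {x : Fin (k + 1) → ℂ} (hx : x ∈ Spr (k + 1)) {θ : Fin k → ℝ}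
    (hθ : θ ∈ box k) {lam : JX k → ℂ} {N : LP (JX k)} {R : ℕ} (hN : SuppLe R N)
    (hlam : ∀ i, R + 2 ≤ (lam (Sum.inr i)).re) (n : ℕ) :
    ‖cl (Qst k) lam N n (wj gS x θ)‖ ≤ bndS lam N n x * ∏ i, θ i := by
  have h1 := lowQ_pos hx
  rw [cl, exp_mul_ev, norm_div, norm_pow, bndS, div_mul_eq_mul_div]
  have h2 : ‖∑ μ ∈ N.coeff.support, N.coeff μ *
      Complex.exp (∑ b, (lam b + μ b) * wj gS x θ b)‖ ≤
      (∑ μ ∈ N.coeff.support, ‖N.coeff μ‖ * ‖Complex.exp (∑ b, (lam b + μ b) * wj0 x b)‖) *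
        ∏ i, θ i := by
    rw [Finset.sum_mul]
    refine (norm_sum_le _ _).trans (Finset.sum_le_sum fun μ hμ => ?_)
    rw [norm_mul, exp_pair_wj, norm_mul, norm_prod, mul_assoc]
    gcongr with i
    have h3 := mem_box.1 hθ i
    have h4 := (abs_le.1 (hN μ (Finsupp.mem_support_iff.1 hμ) (Sum.inr i))).1
    have h5 : -(R : ℝ) ≤ (μ (Sum.inr i) : ℝ) := by exact_mod_cast h4
    refine (norm_exp_gS 1 h3.1 ?_ h3.2.le).trans_eq (Real.rpow_one _)
    rw [Complex.add_re, Complex.intCast_re]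
    have := hlam i
    linarith
  have h3 : 0 ≤ ∏ i, θ i := Finset.prod_nonneg fun i _ => (mem_box.1 hθ i).1.le
  gcongr
  exact lowQ_le x θ

theorem continuousAt_bndS (lam : JX k → ℂ) (N : LP (JX k)) (n : ℕ) {x : Fin (k + 1) → ℂ}
    (hx : x ∈ Spr (k + 1)) : ContinuousAt (bndS lam N n) x := by
  refine ContinuousAt.div ?_ (continuous_lowQ.continuousAt.pow n) (pow_ne_zero _ (lowQ_pos hx).ne')
  have : Continuous (wj0 (k := k)) := by
    refine continuous_pi fun a => ?_
    rcases a with a | a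
    · exact continuous_apply a
    · exact continuous_apply a.castSucc
  fun_prop

theorem good_gS {lam : JX k → ℂ} {N : LP (JX k)} {R : ℕ} (hN : SuppLe R N)
    (hlam : ∀ i, R + 2 ≤ (lam (Sum.inr i)).re) (n : ℕ) :
    Good gS gS' (Spr (k + 1)) (cl (Qst k) lam N n) := by
  intro x₀ hx₀
  refine ⟨bndS lam N n x₀ + 1, ?_⟩
  filter_upwards [(isOpen_spr (k + 1)).mem_nhds hx₀,
    (continuousAt_bndS lam N n hx₀).eventually_lt_const (lt_add_one _)] with x hx hb
  refine ⟨fun θ hθ => ContinuousAt.continuousWithinAt ?_, fun θ hθ => ?_⟩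
  · have h0 : ∀ i, 0 < θ i := fun i => (mem_box.1 hθ i).1
    have h1 := continuousAt_wj_gS x h0
    have h2 : ev (wj gS x θ) (Qst k) ≠ 0 := ev_Qst_ne (wj_gS_mem_sep hx hθ)
    refine ContinuousAt.mul (ContinuousAt.comp (g := cl (Qst k) lam N n) (continuousAt_cl h2) h1)
      (tendsto_finsetProd _ fun i _ => ?_)
    have h3 : ContinuousAt gS' (θ i) := by
      refine Complex.continuous_ofReal.continuousAt.comp ?_
      exact continuousAt_const.div (by fun_prop) (by have := h0 i; positivity)
    exact ContinuousAt.comp (f := fun p : Fin k → ℝ => p i) h3 (continuous_apply i).continuousAt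
  · rw [norm_mul]
    have h1 := norm_cl_wj_le hx hθ hN hlam n
    have hb0 : 0 ≤ bndS lam N n x := div_nonneg (Finset.sum_nonneg fun _ _ => by positivity)
      (pow_nonneg (lowQ_pos hx).le _)
    have h2 : (∏ i, θ i) * ‖∏ i, gS' (θ i)‖ ≤ 1 := by
      rw [norm_prod, ← Finset.prod_mul_distrib]
      refine Finset.prod_le_one (fun i _ => mul_nonneg (mem_box.1 hθ i).1.le (norm_nonneg _))
        fun i _ => ?_
      have := (mem_box.1 hθ i).1
      rw [gS', Complex.norm_real, Real.norm_of_nonneg (by positivity)]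
      field_simp; norm_num
    calc _ ≤ bndS lam N n x * (∏ i, θ i) * ‖∏ i, gS' (θ i)‖ := by gcongr
      _ = bndS lam N n x * ((∏ i, θ i) * ‖∏ i, gS' (θ i)‖) := by ring
      _ ≤ bndS lam N n x * 1 := by gcongr
      _ ≤ _ := by linarith

theorem update_mem_box {θ : Fin k → ℝ} (hθ : θ ∈ box k) (i : Fin k) {t : ℝ}
    (ht : t ∈ Set.Ioo (0 : ℝ) 1) : Function.update θ i t ∈ box k := by
  rw [mem_box]
  intro j
  by_cases h : j = i
  · subst h; simpa using ht
  · simpa [h] using mem_box.1 hθ j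

theorem tendsto_cl_zero {x : Fin (k + 1) → ℂ} (hx : x ∈ Spr (k + 1)) {θ : Fin k → ℝ}
    (hθ : θ ∈ box k) {lam : JX k → ℂ} {N : LP (JX k)} {R : ℕ} (hN : SuppLe R N)
    (hlam : ∀ i, R + 2 ≤ (lam (Sum.inr i)).re) (n : ℕ) (i : Fin k) :
    Filter.Tendsto (fun t => cl (Qst k) lam N n (wj gS x (Function.update θ i t)))
      (nhdsWithin 0 (Set.Ioi 0)) (nhds 0) := by
  have h1 : Filter.Tendsto (fun t => bndS lam N n x * ∏ j, Function.update θ i t j)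
      (nhdsWithin 0 (Set.Ioi 0)) (nhds 0) := by
    have hc : Continuous fun t => bndS lam N n x * ∏ j, Function.update θ i t j := by fun_prop
    have := (hc.tendsto 0).mono_left (nhdsWithin_le_nhds (s := Set.Ioi 0))
    rwa [Finset.prod_eq_zero (Finset.mem_univ i) (by simp), mul_zero] at this
  refine squeeze_zero_norm' ?_ h1
  filter_upwards [Ioo_mem_nhdsGT one_pos] with t ht
  exact norm_cl_wj_le hx (update_mem_box hθ i ht) hN hlam n

theorem tendsto_cl_one {x : Fin (k + 1) → ℂ} (hx : x ∈ Spr (k + 1)) {θ : Fin k → ℝ}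
    (hθ : θ ∈ box k) (lam : JX k → ℂ) {N : LP (JX k)} (n : ℕ) (i : Fin k)
    (hN : S (Sum.inr i) (Sum.inl i.castSucc) ∣ N) :
    Filter.Tendsto (fun t => cl (Qst k) lam N n (wj gS x (Function.update θ i t)))
      (nhdsWithin 1 (Set.Iio 1)) (nhds 0) := by
  have h0 : ∀ j, 0 < Function.update θ i 1 j := fun j => by
    by_cases h : j = i
    · subst h; simp
    · simpa [h] using (mem_box.1 hθ j).1
  have h1 : ContinuousAt (fun t => wj gS x (Function.update θ i t)) 1 :=
    ContinuousAt.comp (g := wj gS x) (continuousAt_wj_gS x h0)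
      (continuous_const.update i continuous_id).continuousAt
  have h2 : ev (wj gS x (Function.update θ i 1)) (Qst k) ≠ 0 := by
    rw [← norm_pos_iff]; exact (lowQ_pos hx).trans_le (lowQ_le _ _)
  have h3 := ContinuousAt.comp (g := cl (Qst k) lam N n)
    (f := fun t => wj gS x (Function.update θ i t)) (continuousAt_cl h2) h1
  have h4 : cl (Qst k) lam N n (wj gS x (Function.update θ i 1)) = 0 := by
    obtain ⟨C, rfl⟩ := hN
    have : ev (wj gS x (Function.update θ i 1)) (S (Sum.inr i) (Sum.inl i.castSucc)) = 0 := by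
      rw [ev_S]; simp [wj, gS]
    rw [cl, map_mul, this]; simp
  have h5 : Filter.Tendsto _ _ _ := h3
  simp only [Function.comp, h4] at h5
  exact h5.mono_left nhdsWithin_le_nhds

/-- The intertwining property for the ray contours. -/
theorem exists_intertwine_gS (k : ℕ) {m : ℕ} (hm : 0 < m) : ∃ R : ℕ, ∀ (κ : ℂ) (lam : Fin k → ℂ)
    (D : LP (Fin k)) (M RD : ℕ), SuppLe RD D →
    (∀ i, ((R + (RD + (M + 2) * R) + 2 * R : ℕ) : ℝ) + 2 ≤ (lam i - κ).re) →
    Good gS gS' (Spr (k + 1)) (jF (ker k m κ) (cl (B k) lam D M)) ∧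
    (SuppLe RD (Lop m lam M D) →
    ∀ x ∈ Spr (k + 1), sutherland m (trans gS gS' (jF (ker k m κ) (cl (B k) lam D M))) x =
      trans gS gS' (jF (ker k m κ) (cl (B k) lam (Lop m lam M D) (M + 2))) x -
        κ ^ 2 * trans gS gS' (jF (ker k m κ) (cl (B k) lam D M)) x) := by
  obtain ⟨R, hK, hq⟩ := exists_kernelRep (k := k) (p := m) (Q := Qst k)
    (I := fun i => Ideal.span {S (Sum.inr i) (Sum.inl i.castSucc)})
    (fun w hw => ev_Qst_ne hw) (Q' := Bx k) rfl ⟨_, _, fun κ w hw => ker_eq_st m κ hw⟩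
    (fun i => isCl_qv_st hm 0 _ i)
  refine ⟨R, fun κ lam D M RD hD hlam => ?_⟩
  have hlamJ : ∀ i : Fin k, lamJ κ lam (Sum.inr i) = lam i - κ := fun i => by
    simp [lamJ]; ring
  obtain ⟨Q', hQ'R, hQ'⟩ := hK.dvd
  have hle : ((R + (RD + M * R) : ℕ) : ℝ) ≤ (R + (RD + (M + 2) * R) + 2 * R : ℕ) := by
    rw [Nat.cast_le]
    have : M * R ≤ (M + 2) * R := by gcongr; omega
    omega
  refine ⟨?_, fun hD2 x hx => ?_⟩
  · obtain ⟨N, n, hN, hrep⟩ := hK.rep0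
    have hs : SuppLe (R + (RD + M * R)) (N * (emb inrExp D * Q' ^ M)) :=
      hN.mul (hD.inr.mul (hQ'R.pow M))
    refine (good_gS (lam := lamJ κ lam) hs (fun i => ?_) (n + M)).congr (isOpen_spr (k + 1))
      fun x hx θ hθ => ?_
    · rw [hlamJ]; linarith [hlam i]
    · have hw := wj_gS_mem_sep hx hθ
      simp only [jF]
      rw [hrep κ _ hw, mul_cl_inr hQ' κ lam N n D M (hK.sep _ hw)]
  refine sutherland_trans_cl hK (by push_cast; ring) (fun t ht => hasDerivAt_gS ht.1)
    (isOpen_spr (k + 1)) (fun x hx θ hθ => wj_gS_mem_sep hx hθ) κ lam D M RD hD hD2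
    (fun N n hN => good_gS hN (fun i => by rw [hlamJ]; exact hlam i) n) (fun x hx i θ hθ => ?_) hx
  refine ⟨0, ?_, ?_⟩
  · obtain ⟨N, n, hN, hrep⟩ := hK.repq κ i
    have hs : SuppLe (R + (RD + M * R)) (N * (emb inrExp D * Q' ^ M)) :=
      hN.mul (hD.inr.mul (hQ'R.pow M))
    refine (tendsto_cl_zero hx hθ (lam := lamJ κ lam) hs (fun i => ?_) (n + M) i).congr' ?_
    · rw [hlamJ]
      linarith [hlam i]
    · filter_upwards [Ioo_mem_nhdsGT one_pos] with t ht
      have hw := wj_gS_mem_sep hx (update_mem_box hθ i ht)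
      simp only [jF]
      refine Eq.trans ?_ (mul_assoc _ _ _)
      rw [hrep _ hw, mul_cl_inr hQ' κ lam N n D M (hK.sep _ hw)]
  · obtain ⟨N, hN, n, hrep⟩ := hq i
    rw [Ideal.mem_span_singleton] at hN
    refine (tendsto_cl_one hx hθ (lamJ κ lam) (n + M) i (N := N * (emb inrExp D * Q' ^ M))
      (hN.mul_right _)).congr' ?_
    filter_upwards [Ioo_mem_nhdsLT zero_lt_one] with t ht
    have hw := wj_gS_mem_sep hx (update_mem_box hθ i ht)
    simp only [jF]
    refine Eq.trans ?_ (mul_assoc _ _ _)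
    rw [hrep κ _ hw, mul_cl_inr hQ' κ lam N n D M (hK.sep _ hw)]

end TrigBA

namespace TrigBA
open LP
variable {k : ℕ}

/-! ### The transform of the seed function -/

/-- Identification of `z_i` with `x_i` on exponents. -/
def mergeExp (k : ℕ) : (JX k → ℤ) →+ (Fin (k + 1) → ℤ) where
  toFun μ := fun l => μ (Sum.inl l) + Fin.snoc (α := fun _ => ℤ) (fun i => μ (Sum.inr i)) 0 l
  map_zero' := by ext l; refine Fin.lastCases ?_ (fun i => ?_) l <;> simp
  map_add' μ κ := by ext l; refine Fin.lastCases ?_ (fun i => ?_) l <;> simp; ring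

@[simp] theorem mergeExp_castSucc (μ : JX k → ℤ) (i : Fin k) :
    mergeExp k μ i.castSucc = μ (Sum.inl i.castSucc) + μ (Sum.inr i) := by simp [mergeExp]

@[simp] theorem mergeExp_last (μ : JX k → ℤ) :
    mergeExp k μ (Fin.last k) = μ (Sum.inl (Fin.last k)) := by simp [mergeExp]

theorem pair_mergeExp (x : Fin (k + 1) → ℂ) (μ : JX k → ℤ) :
    pair x (mergeExp k μ) = pair (wj0 x) μ := by
  rw [pair_apply, pair_apply, Fin.sum_univ_castSucc, Fintype.sum_sum_type, Fin.sum_univ_castSucc]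
  simp only [mergeExp_castSucc, mergeExp_last, wj0, Sum.elim_inl, Sum.elim_inr, Int.cast_add,
    add_mul, Finset.sum_add_distrib]
  ring

/-- The result of integrating a Laurent polynomial along the ray contours. -/
def Theta (a : Fin k → ℂ) (G : LP (JX k)) : LP (Fin (k + 1)) :=
  emb (mergeExp k) (diag (fun μ => ∏ i, (a i + μ (Sum.inr i))⁻¹) G)

theorem Theta_add (a : Fin k → ℂ) (G H : LP (JX k)) : Theta a (G + H) = Theta a G + Theta a H := by
  simp [Theta]

theorem exp_gS_mul {t : ℝ} (ht : 0 < t) (a : ℂ) :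
    Complex.exp (a * gS t) * gS' t = 1 / 2 * (t : ℂ) ^ (a / 2 - 1) := by
  have h0 : (t : ℂ) ≠ 0 := by exact_mod_cast ht.ne'
  rw [Complex.cpow_sub _ _ h0, Complex.cpow_one, Complex.cpow_def_of_ne_zero h0, gS, gS',
    ← Complex.ofReal_log ht.le]
  have : a * ((Real.log t / 2 : ℝ) : ℂ) = (Real.log t : ℂ) * (a / 2) := by push_cast; ring
  rw [this]; push_cast; field_simp

theorem integral_exp_gS {a : ℂ} (ha : 0 < a.re) :
    IntegrableOn (fun t => Complex.exp (a * gS t) * gS' t) (Set.Ioo 0 1) ∧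
    ∫ t in Set.Ioo (0 : ℝ) 1, Complex.exp (a * gS t) * gS' t = a⁻¹ := by
  have hr : -1 < (a / 2 - 1).re := by simp; exact ha
  have e : Set.EqOn (fun t : ℝ => 1 / 2 * (t : ℂ) ^ (a / 2 - 1))
      (fun t => Complex.exp (a * gS t) * gS' t) (Set.Ioo 0 1) := fun t ht => (exp_gS_mul ht.1 a).symm
  constructor
  · refine IntegrableOn.congr_fun ?_ e measurableSet_Ioo
    exact ((intervalIntegrable_iff_integrableOn_Ioo_of_le zero_le_one).1
      (intervalIntegral.intervalIntegrable_cpow' hr)).const_mul _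
  · rw [← setIntegral_congr_fun measurableSet_Ioo e, integral_const_mul, ← integral_Ioc_eq_integral_Ioo,
      ← intervalIntegral.integral_of_le zero_le_one, integral_cpow (Or.inl hr)]
    have ha0 : a ≠ 0 := fun h => by simp [h] at ha
    rw [sub_add_cancel, Complex.ofReal_one, Complex.one_cpow, Complex.ofReal_zero,
      Complex.zero_cpow (by simpa using ha0)]
    field_simp; simp

theorem integral_exp_mul_ev {lam : JX k → ℂ} {G : LP (JX k)}
    (h : ∀ μ, G.coeff μ ≠ 0 → ∀ i, 0 < (lam (Sum.inr i) + μ (Sum.inr i)).re)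
    (x : Fin (k + 1) → ℂ) :
    ∫ θ in box k, Complex.exp (∑ a, lam a * wj gS x θ a) * ev (wj gS x θ) G * ∏ i, gS' (θ i) =
      Complex.exp (∑ a, lam a * wj0 x a) * ev x (Theta (fun i => lam (Sum.inr i)) G) := by
  have e : ∀ θ, Complex.exp (∑ a, lam a * wj gS x θ a) * ev (wj gS x θ) G * ∏ i, gS' (θ i) =
      ∑ μ ∈ G.coeff.support, G.coeff μ * Complex.exp (∑ b, (lam b + μ b) * wj0 x b) *
        ∏ i, (Complex.exp ((lam (Sum.inr i) + μ (Sum.inr i)) * gS (θ i)) * gS' (θ i)) := fun θ => by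
    rw [exp_mul_ev, Finset.sum_mul]
    refine Finset.sum_congr rfl fun μ _ => ?_
    rw [exp_pair_wj, Finset.prod_mul_distrib]; ring
  simp only [e]
  rw [integral_finsetSum]
  · rw [Theta, ev_emb (pair_mergeExp x), ev_eq_sum_of_subset (s := G.coeff.support), Finset.mul_sum]
    · refine Finset.sum_congr rfl fun μ hμ => ?_
      rw [integral_const_mul, integral_box_prod fun i t =>
        Complex.exp ((lam (Sum.inr i) + μ (Sum.inr i)) * gS t) * gS' t]
      rw [Finset.prod_congr rfl fun i _ =>
        (integral_exp_gS (h μ (Finsupp.mem_support_iff.1 hμ) i)).2]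
      have : Complex.exp (∑ b, (lam b + μ b) * wj0 x b) =
          Complex.exp (∑ a, lam a * wj0 x a) * Complex.exp (pair (wj0 x) μ) := by
        rw [← Complex.exp_add, pair_apply, ← Finset.sum_add_distrib]
        simp only [add_mul]
      rw [this, coeff_diag]; ring
    · intro μ hμ
      rw [Finsupp.mem_support_iff]
      intro h0; exact hμ (by simp [h0])
  · intro μ hμ
    refine Integrable.const_mul ?_ _
    rw [box, volume_pi, Measure.restrict_pi_pi]
    exact Integrable.fintype_prod (f := fun i t =>
      Complex.exp ((lam (Sum.inr i) + μ (Sum.inr i)) * gS t) * gS' t) fun i =>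
      (integral_exp_gS (h μ (Finsupp.mem_support_iff.1 hμ) i)).1

/-- The integral over one ray. -/
theorem integral_exp_sinh_gS (m : ℕ) (a : ℂ) :
    ∫ t in Set.Ioo (0 : ℝ) 1, Complex.exp ((a + m) * gS t) * Complex.sinh (gS t) ^ m * gS' t =
      (-1) ^ m * (1 / 2) ^ (m + 1) * Complex.betaIntegral (a / 2) (m + 1) := by
  rw [Complex.betaIntegral, intervalIntegral.integral_of_le zero_le_one,
    integral_Ioc_eq_integral_Ioo, ← integral_const_mul]
  refine setIntegral_congr_fun measurableSet_Ioo fun t ht => ?_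
  beta_reduce
  have h1 : Complex.exp (gS t) * Complex.sinh (gS t) = ((t : ℂ) - 1) / 2 := by
    have h2 : Complex.exp (gS t) * Complex.exp (gS t) = t := by
      rw [← Complex.exp_add, gS, ← Complex.ofReal_add, add_halves, ← Complex.ofReal_exp,
        Real.exp_log ht.1]
    have h3 : Complex.exp (gS t) * Complex.exp (-gS t) = 1 := by
      rw [← Complex.exp_add, add_neg_cancel, Complex.exp_zero]
    rw [Complex.sinh]
    linear_combination h2 / 2 - h3 / 2
  rw [add_mul, Complex.exp_add, Complex.exp_nat_mul, mul_assoc (Complex.exp (a * gS t)), ← mul_pow,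
    h1, mul_right_comm, exp_gS_mul ht.1, add_sub_cancel_right, Complex.cpow_natCast,
    show ((t : ℂ) - 1) / 2 = (-1) * (1 / 2) * (1 - t) by ring, mul_pow, mul_pow, pow_succ]
  ring

/-- A strictly leading term. -/
def SLead {σ : Type} [Fintype σ] (w : (σ → ℤ) →+ ℝ) (G : LP σ) (μ : σ → ℤ) (c : ℂ) : Prop :=
  ∃ G', G = AddMonoidAlgebra.single μ c + G' ∧ ∀ κ, G'.coeff κ ≠ 0 → w κ < w μ

section SLead
variable {σ : Type} [Fintype σ] {w : (σ → ℤ) →+ ℝ}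

theorem SLead.single (μ : σ → ℤ) (c : ℂ) : SLead w (AddMonoidAlgebra.single μ c : LP σ) μ c :=
  ⟨0, by simp, fun κ h => absurd rfl h⟩

theorem SLead.mul {G H : LP σ} {μ κ : σ → ℤ} {c d : ℂ} (hG : SLead w G μ c) (hH : SLead w H κ d) :
    SLead w (G * H) (μ + κ) (c * d) := by
  classical
  obtain ⟨G', rfl, hG⟩ := hG
  obtain ⟨H', rfl, hH⟩ := hH
  have hs : ∀ (μ : σ → ℤ) (c : ℂ) κ, (AddMonoidAlgebra.single μ c : LP σ).coeff κ ≠ 0 → κ = μ :=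
    fun μ c κ h => by
      by_contra hne
      exact h (by simp [AddMonoidAlgebra.coeff_single, Ne.symm hne])
  refine ⟨AddMonoidAlgebra.single μ c * H' + (G' * AddMonoidAlgebra.single κ d + G' * H'),
    by rw [← AddMonoidAlgebra.single_mul_single]; ring, fun η hη => ?_⟩
  have h3 : ∀ {A B C : LP σ}, (A + (B + C)).coeff η ≠ 0 →
      A.coeff η ≠ 0 ∨ B.coeff η ≠ 0 ∨ C.coeff η ≠ 0 := by
    intro A B C h
    by_contra! h'
    exact h (by simp [h'.1, h'.2.1, h'.2.2])
  rw [map_add]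
  rcases h3 hη with h | h | h <;> obtain ⟨a, b, ha, hb, rfl⟩ := exists_of_coeff_mul_ne h <;>
    rw [map_add]
  · rw [hs _ _ _ ha]; linarith [hH b hb]
  · rw [hs _ _ _ hb]; linarith [hG a ha]
  · linarith [hG a ha, hH b hb]

theorem SLead.prod {ι : Type} (s : Finset ι) {D : ι → LP σ} {c : ι → ℂ}
    {κ : ι → σ → ℤ} (h : ∀ i ∈ s, SLead w (D i) (κ i) (c i)) :
    SLead w (∏ i ∈ s, D i) (∑ i ∈ s, κ i) (∏ i ∈ s, c i) := by
  classical
  induction s using Finset.induction_on with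
  | empty => simpa [AddMonoidAlgebra.one_def] using SLead.single (w := w) 0 1
  | insert a s ha ih =>
    rw [Finset.prod_insert ha, Finset.prod_insert ha, Finset.sum_insert ha]
    exact (h a (Finset.mem_insert_self a s)).mul (ih fun i hi => h i (Finset.mem_insert_of_mem hi))

theorem SLead.pow {G : LP σ} {μ : σ → ℤ} {c : ℂ} (h : SLead w G μ c) (n : ℕ) :
    SLead w (G ^ n) (n • μ) (c ^ n) := by
  simpa using SLead.prod (Finset.range n) fun _ _ => h

end SLead

/-- The weight on joint exponents. -/
def wtJ (k : ℕ) : (JX k → ℤ) →+ ℝ := (wt 1 (k + 1)).comp (mergeExp k)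

theorem mergeExp_rt (i : Fin k) (l : Fin (k + 1)) :
    mergeExp k (rt (Sum.inr i) (Sum.inl l)) = rt i.castSucc l := by
  ext j
  refine Fin.lastCases ?_ (fun j => ?_) j
  · simp [rt, Pi.single_apply, (Fin.castSucc_lt_last i).ne']
  · simp [rt, Pi.single_apply]; ring

theorem sLead_S {i : Fin k} {l : Fin (k + 1)} (h : i.castSucc ≠ l) :
    SLead (wtJ k) (S (Sum.inr i) (Sum.inl l)) (sg i.castSucc l • rt (Sum.inr i) (Sum.inl l))
      ((sg i.castSucc l : ℂ) / 2) := by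
  have hsw : rt (Sum.inl l) (Sum.inr i) = -rt (Sum.inr i : JX k) (Sum.inl l) := by simp [rt]
  have hw : wtJ k (rt (Sum.inr i) (Sum.inl l)) = tt ^ (i : ℕ) - tt ^ (l : ℕ) := by
    rw [wtJ, AddMonoidHom.comp_apply, mergeExp_rt, wt_rt]; simp
  have hlt : ∀ {a b : ℕ}, a < b → tt ^ b < tt ^ a := fun h =>
    pow_lt_pow_right_of_lt_one₀ tt_pos tt_lt_one h
  have hs : ∀ (μ : JX k → ℤ) (c : ℂ) κ, (AddMonoidAlgebra.single μ c : LP (JX k)).coeff κ ≠ 0 →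
      κ = μ := fun μ c κ h => by
    classical
    by_contra hne
    exact h (by simp [AddMonoidAlgebra.coeff_single, Ne.symm hne])
  unfold sg
  split_ifs with h1
  · refine ⟨AddMonoidAlgebra.single (rt (Sum.inl l) (Sum.inr i)) (-1 / 2), by simp [S], fun κ hκ => ?_⟩
    rw [hs _ _ _ hκ, hsw, map_neg, one_smul, hw]
    linarith [hlt (show (i : ℕ) < l from h1)]
  · refine ⟨AddMonoidAlgebra.single (rt (Sum.inr i) (Sum.inl l)) (1 / 2), ?_, fun κ hκ => ?_⟩
    · simp [S, hsw, add_comm]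
    · rw [hs _ _ _ hκ, map_zsmul, hw]
      have : (l : ℕ) < i := lt_of_le_of_ne (not_lt.1 h1) (Fin.val_ne_of_ne (Ne.symm h))
      have := hlt this
      simp only [neg_smul, one_smul]
      linarith

end TrigBA

namespace TrigBA
open LP
variable {k : ℕ}

/-- The diagonal factors of the kernel. -/
def Xd (k : ℕ) : LP (JX k) := ∏ i : Fin k, S (Sum.inr i) (Sum.inl i.castSucc)

/-- The remaining factors of the kernel. -/
def Xo (k : ℕ) : LP (JX k) :=
  ∏ i : Fin k, ∏ l ∈ Finset.univ.erase i.castSucc, S (Sum.inr i) (Sum.inl l)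

theorem X_eq (k : ℕ) : X k = Xd k * Xo k := by
  rw [X, Xd, Xo, ← Finset.prod_mul_distrib, Fintype.prod_prod_type]
  exact Finset.prod_congr rfl fun i _ => (Finset.mul_prod_erase _ _ (Finset.mem_univ _)).symm

/-- The leading exponent of the integrand. -/
def topExp (m k : ℕ) : JX k → ℤ :=
  m • (∑ i : Fin k, ∑ l ∈ Finset.univ.erase i.castSucc,
    sg i.castSucc l • rt (Sum.inr i) (Sum.inl l)) + inrExp (-(m • rho k))

/-- The leading coefficient of the integrand. -/
def topCoeff (m k : ℕ) : ℂ :=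
  (∏ i : Fin k, ∏ l ∈ Finset.univ.erase i.castSucc, (sg i.castSucc l : ℂ) / 2) ^ m

theorem topExp_inr (m k : ℕ) (i : Fin k) : topExp m k (Sum.inr i) = m := by
  have h1 : ∀ j : Fin k, (∑ l ∈ Finset.univ.erase j.castSucc,
      sg j.castSucc l • rt (Sum.inr j : JX k) (Sum.inl l)) (Sum.inr i) =
      if j = i then ∑ l ∈ Finset.univ.erase i.castSucc, sg i.castSucc l else 0 := by
    intro j
    rw [Finset.sum_apply]
    split_ifs with h
    · subst h
      exact Finset.sum_congr rfl fun l _ => by simp [rt]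
    · exact Finset.sum_eq_zero fun l _ => by simp [rt, Pi.single_apply, Ne.symm h]
  have h2 : (∑ j : Fin k, ∑ l ∈ Finset.univ.erase j.castSucc,
      sg j.castSucc l • rt (Sum.inr j : JX k) (Sum.inl l)) (Sum.inr i) = k - 2 * i := by
    rw [Finset.sum_apply]
    simp only [h1, Finset.sum_ite_eq', Finset.mem_univ, if_true, sum_sg]
    push_cast; simp
  rw [topExp, Pi.add_apply, ← natCast_zsmul, Pi.smul_apply, h2]
  simp only [inrExp, AddMonoidHom.coe_mk, ZeroHom.coe_mk, Sum.elim_inr, Pi.neg_apply]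
  rw [← natCast_zsmul, Pi.smul_apply, rho_apply]
  simp only [smul_eq_mul]; ring

theorem topExp_inl (m k : ℕ) (l : Fin (k + 1)) :
    topExp m k (Sum.inl l) = m * ∑ i : Fin k, if i.castSucc = l then 0 else sg l i.castSucc := by
  have h1 : ∀ i : Fin k, (∑ l ∈ Finset.univ.erase i.castSucc,
      sg i.castSucc l • rt (Sum.inr i : JX k) (Sum.inl l)) (Sum.inl l) =
      if i.castSucc = l then 0 else sg l i.castSucc := by
    intro i
    rw [Finset.sum_apply]
    have : ∀ j, (sg i.castSucc j • rt (Sum.inr i : JX k) (Sum.inl j)) (Sum.inl l) =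
        if l = j then -sg i.castSucc j else 0 := fun j => by
      simp only [rt, Pi.smul_apply, Pi.sub_apply, Pi.single_apply, reduceCtorEq, if_false,
        Sum.inl.injEq]
      split_ifs <;> simp
    simp only [this, Finset.sum_ite_eq, Finset.mem_erase, Finset.mem_univ, and_true]
    by_cases h : i.castSucc = l
    · simp [h]
    · rw [if_neg h, if_pos (Ne.symm h)]
      unfold sg
      rcases lt_or_gt_of_ne h with h' | h' <;> simp [h', not_lt.2 h'.le]
  rw [topExp, Pi.add_apply, ← natCast_zsmul, Pi.smul_apply, Finset.sum_apply]
  simp only [h1, inrExp, AddMonoidHom.coe_mk, ZeroHom.coe_mk, Sum.elim_inl, Pi.zero_apply, add_zero,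
    smul_eq_mul]

theorem mergeExp_topExp (m k : ℕ) : mergeExp k (topExp m k) = m • rho (k + 1) := by
  have hs : ∀ l : Fin (k + 1), (∑ i : Fin k, if i.castSucc = l then 0 else sg l i.castSucc) +
      (if Fin.last k = l then 0 else sg l (Fin.last k)) = k - 2 * l := fun l => by
    have := sum_sg l
    rw [← Fin.sum_univ_castSucc (f := fun i => if i = l then 0 else sg l i)]
    rw [← Finset.sum_erase (a := l) _ (by simp)]
    rw [Finset.sum_congr rfl fun i hi => if_neg (Finset.ne_of_mem_erase hi), this]
    push_cast; ring
  ext l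
  rw [← natCast_zsmul, Pi.smul_apply, rho_apply, smul_eq_mul]
  refine Fin.lastCases ?_ (fun i => ?_) l
  · have := hs (Fin.last k)
    rw [if_pos rfl, add_zero] at this
    rw [mergeExp_last, topExp_inl, this]
    push_cast; ring
  · have := hs i.castSucc
    rw [if_neg (Fin.castSucc_lt_last i).ne', sg, if_pos (Fin.castSucc_lt_last i)] at this
    rw [mergeExp_castSucc, topExp_inl, topExp_inr, eq_sub_of_add_eq this]
    push_cast; simp; ring

theorem mergeExp_Xd_pow {m : ℕ} {μ : JX k → ℤ} (h : (Xd k ^ m).coeff μ ≠ 0) : mergeExp k μ = 0 := by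
  classical
  have hS : ∀ (i : Fin k) κ, (S (Sum.inr i) (Sum.inl i.castSucc) : LP (JX k)).coeff κ ≠ 0 →
      mergeExp k κ = 0 := by
    intro i κ hκ
    have h0 : mergeExp k (rt (Sum.inr i) (Sum.inl i.castSucc)) = 0 := by rw [mergeExp_rt]; simp [rt]
    have hsw : rt (Sum.inl i.castSucc) (Sum.inr i) = -rt (Sum.inr i : JX k) (Sum.inl i.castSucc) := by
      simp [rt]
    by_contra hne
    refine hκ ?_
    have h1 : rt (Sum.inr i) (Sum.inl i.castSucc) ≠ κ := fun e => hne (e ▸ h0)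
    have h2 : rt (Sum.inl i.castSucc) (Sum.inr i) ≠ κ := fun e => hne (by
      rw [← e, hsw, map_neg, h0, neg_zero])
    simp [S, AddMonoidAlgebra.coeff_single, h1, h2]
  have hone : ∀ κ, (1 : LP (JX k)).coeff κ ≠ 0 → mergeExp k κ = 0 := fun κ hκ => by
    by_contra hne
    refine hκ ?_
    rw [AddMonoidAlgebra.one_def]
    have : (0 : JX k → ℤ) ≠ κ := fun e => hne (by rw [← e, map_zero])
    simp [AddMonoidAlgebra.coeff_single, this]
  have hmul : ∀ A B : LP (JX k), (∀ κ, A.coeff κ ≠ 0 → mergeExp k κ = 0) →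
      (∀ κ, B.coeff κ ≠ 0 → mergeExp k κ = 0) → ∀ κ, (A * B).coeff κ ≠ 0 → mergeExp k κ = 0 := by
    intro A B hA hB κ hκ
    obtain ⟨a, b, ha, hb, rfl⟩ := exists_of_coeff_mul_ne hκ
    rw [map_add, hA a ha, hB b hb, add_zero]
  have hprod : ∀ κ, (Xd k).coeff κ ≠ 0 → mergeExp k κ = 0 :=
    Finset.prod_induction _ (fun A : LP (JX k) => ∀ κ, A.coeff κ ≠ 0 → mergeExp k κ = 0) hmul hone
      fun i _ => hS i
  have hpow : ∀ n, ∀ κ, (Xd k ^ n).coeff κ ≠ 0 → mergeExp k κ = 0 := fun n => by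
    induction n with
    | zero => simpa using hone
    | succ n ih => rw [pow_succ]; exact hmul _ _ ih hprod
  exact hpow m μ h

theorem Lead.of_single {σ : Type} [Fintype σ] {w : (σ → ℤ) →+ ℝ} {G : LP σ} {κ : σ → ℤ} {c : ℂ}
    (h : ∀ μ, G.coeff μ ≠ 0 → w μ < w κ) : Lead w (AddMonoidAlgebra.single κ c + G) κ c := by
  refine ⟨?_, fun μ hμ => ?_⟩
  · have : G.coeff κ = 0 := by
      by_contra h0; exact lt_irrefl _ (h κ h0)
    simp [this]
  · by_cases h0 : G.coeff μ = 0
    · have : (AddMonoidAlgebra.single κ c : LP σ).coeff μ ≠ 0 := by simpa [h0] using hμ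
      exact (Lead.single κ c).2 μ this
    · exact (h μ h0).le

theorem Theta_Xd_single {m R : ℕ} (c : ℂ) (μ : JX k → ℤ) (hμ : ∀ i, μ (Sum.inr i) = m)
    (hR : SuppLe R (Xd k ^ m * AddMonoidAlgebra.single μ c)) {a : Fin k → ℂ}
    (ha : ∀ i, (R : ℝ) < (a i).re) :
    Theta a (Xd k ^ m * AddMonoidAlgebra.single μ c) =
      AddMonoidAlgebra.single (mergeExp k μ) (c * ∏ i,
        ((-1) ^ m * (1 / 2) ^ (m + 1) * Complex.betaIntegral (a i / 2) (m + 1))) := by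
  rw [← sub_eq_zero]
  refine eq_zero_of_ev 0 _ fun r => ?_
  set x : Fin (k + 1) → ℂ := 0 + fun i => (r i : ℂ)
  have h1 := integral_exp_mul_ev (lam := Sum.elim (fun _ => 0) a)
    (G := Xd k ^ m * AddMonoidAlgebra.single μ c) (fun κ hκ i => by
      have h4 := (abs_le.1 (hR κ hκ (Sum.inr i))).1
      have h5 : -(R : ℝ) ≤ (κ (Sum.inr i) : ℝ) := by exact_mod_cast h4
      rw [Sum.elim_inr, Complex.add_re, Complex.intCast_re]
      linarith [ha i]) x
  have h2 : ∀ θ, Complex.exp (∑ b, (Sum.elim (fun _ => 0) a : JX k → ℂ) b * wj gS x θ b) *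
      ev (wj gS x θ) (Xd k ^ m * AddMonoidAlgebra.single μ c) * ∏ i, gS' (θ i) =
      Complex.exp (∑ b, (Sum.elim (fun _ => 0) a : JX k → ℂ) b * wj0 x b) *
        (c * Complex.exp (pair (wj0 x) μ)) *
        ∏ i, (Complex.exp ((a i + m) * gS (θ i)) * Complex.sinh (gS (θ i)) ^ m * gS' (θ i)) := by
    intro θ
    have e1 : ev (wj gS x θ) (Xd k) = ∏ i, Complex.sinh (gS (θ i)) := by
      simp [Xd, map_prod, ev_S, wj]
    have e2 : Complex.exp (∑ b, (Sum.elim (fun _ => 0) a : JX k → ℂ) b * wj gS x θ b) *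
        Complex.exp (pair (wj gS x θ) μ) =
        Complex.exp (∑ b, (Sum.elim (fun _ => 0) a : JX k → ℂ) b * wj0 x b) *
        Complex.exp (pair (wj0 x) μ) * ∏ i, Complex.exp ((a i + m) * gS (θ i)) := by
      have := exp_pair_wj (fun b => (Sum.elim (fun _ => 0) a : JX k → ℂ) b + μ b) x θ
      simp only [add_mul, Finset.sum_add_distrib, Complex.exp_add, ← pair_apply, Sum.elim_inr, hμ,
        Int.cast_natCast] at this
      simp only [add_mul, Complex.exp_add]
      exact this
    rw [map_mul, map_pow, ev_single, e1]
    simp only [Finset.prod_mul_distrib, Finset.prod_pow]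
    linear_combination c * (∏ i, Complex.sinh (gS (θ i))) ^ m * (∏ i, gS' (θ i)) * e2
  simp only [h2] at h1
  rw [integral_const_mul, integral_box_prod fun i t =>
    Complex.exp ((a i + m) * gS t) * Complex.sinh (gS t) ^ m * gS' t, mul_assoc] at h1
  simp only [integral_exp_sinh_gS] at h1
  have h3 := mul_left_cancel₀ (Complex.exp_ne_zero _) h1
  rw [map_sub, ev_single, pair_mergeExp, sub_eq_zero]
  simp only [Sum.elim_inr] at h3
  rw [← h3]; ring

theorem lamJ_inr (κ : ℂ) (lam : Fin k → ℂ) (i : Fin k) : lamJ κ lam (Sum.inr i) = lam i - κ := by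
  simp [lamJ]; ring

theorem sum_lamJ_wj0 (κ : ℂ) (lam : Fin k → ℂ) (x : Fin (k + 1) → ℂ) :
    ∑ a, lamJ κ lam a * wj0 x a = ∑ l, (Fin.snoc (α := fun _ => ℂ) lam κ : Fin (k + 1) → ℂ) l * x l := by
  rw [Fintype.sum_sum_type, Fin.sum_univ_castSucc, Fin.sum_univ_castSucc]
  simp only [lamJ_inr, wj0, Sum.elim_inl, Sum.elim_inr, Fin.snoc_castSucc, Fin.snoc_last]
  simp only [lamJ, eps_inl, Sum.elim_inl, sub_mul, Finset.sum_sub_distrib]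
  simp; ring

/-- The transform of the seed function and its leading coefficient. -/
theorem exists_trans_seed (m k : ℕ) : ∃ R : ℕ, ∀ (κ : ℂ) (lam : Fin k → ℂ),
    (∀ i, (R : ℝ) < (lam i - κ).re) → ∃ D : LP (Fin (k + 1)),
      (∀ x ∈ Spr (k + 1), trans gS gS' (jF (ker k m κ) (cl (B k) lam (seed m k) 0)) x =
        cl (B (k + 1)) (Fin.snoc (α := fun _ => ℂ) lam κ : Fin (k + 1) → ℂ) D m x) ∧
      Lead (wt 1 (k + 1)) D (m • rho (k + 1)) (topCoeff m k * ∏ i,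
        ((-1) ^ m * (1 / 2) ^ (m + 1) * Complex.betaIntegral ((lam i - κ) / 2) (m + 1))) := by
  have hXo : SLead (wtJ k) (Xo k) (∑ i : Fin k, ∑ l ∈ Finset.univ.erase i.castSucc,
      sg i.castSucc l • rt (Sum.inr i) (Sum.inl l))
      (∏ i : Fin k, ∏ l ∈ Finset.univ.erase i.castSucc, (sg i.castSucc l : ℂ) / 2) := by
    unfold Xo
    exact SLead.prod _ fun i _ => SLead.prod _ fun l hl =>
      sLead_S (Ne.symm (Finset.ne_of_mem_erase hl))
  have hX := (hXo.pow m).mul (SLead.single (inrExp (-(m • rho k))) 1)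
  rw [mul_one, ← topCoeff, ← topExp] at hX
  obtain ⟨U', hU', hlt⟩ := hX
  obtain ⟨G, hG⟩ : ∃ G, G = Xd k ^ m * (Xo k ^ m *
    AddMonoidAlgebra.single (inrExp (-(m • rho k))) 1) := ⟨_, rfl⟩
  obtain ⟨R1, h1⟩ := exists_suppLe G
  obtain ⟨R2, h2⟩ := exists_suppLe (Xd k ^ m * AddMonoidAlgebra.single (topExp m k) (topCoeff m k))
  refine ⟨R1 + R2, fun κ lam hlam => ⟨Theta (fun i => lam i - κ) G, fun x hx => ?_, ?_⟩⟩
  · have h3 := integral_exp_mul_ev (lam := lamJ κ lam) (G := G) (fun μ hμ i => by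
      have h4 := (abs_le.1 (h1 μ hμ (Sum.inr i))).1
      have h5 : -(R1 : ℝ) ≤ (μ (Sum.inr i) : ℝ) := by exact_mod_cast h4
      rw [lamJ_inr, Complex.add_re, Complex.intCast_re]
      have := hlam i
      push_cast at this
      have h6 : (0 : ℝ) ≤ R2 := Nat.cast_nonneg _
      linarith) x
    simp only [lamJ_inr, sum_lamJ_wj0] at h3
    rw [cl, ← h3, div_eq_mul_inv, mul_comm, ← integral_const_mul, trans]
    refine setIntegral_congr_fun (measurableSet_box k) fun θ hθ => ?_
    have hw := wj_gS_mem_sep hx hθ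
    have hz := ev_Bz_ne hw
    have hz' := ev_Bx_ne hw
    have hx' : wj gS x θ ∘ Sum.inl = x := rfl
    rw [Bz, ev_inr] at hz
    rw [Bx, ev_inl, hx'] at hz'
    have e1 : Complex.exp (∑ a, lamJ κ lam a * wj gS x θ a) =
        Complex.exp (∑ a, -κ * eps k a * wj gS x θ a) *
        Complex.exp (∑ a, lam a * (wj gS x θ ∘ Sum.inr) a) := by
      rw [← Complex.exp_add]
      congr 1
      simp only [lamJ, add_mul, Finset.sum_add_distrib]
      congr 1
      rw [Fintype.sum_sum_type]; simp
    have e2 : ∀ c, ev (wj gS x θ) (AddMonoidAlgebra.single (inrExp (-(m • rho k))) c) =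
        c * Complex.exp (pair (wj gS x θ ∘ Sum.inr) (-(m • rho k))) := fun c => by
      rw [ev_single]; simp [pair_apply, inrExp]
    simp only [jF, ker_eq_st m κ hw, cl, seed, pow_zero, div_one, map_mul, map_pow, ev_single, hG, Qst,
      Bz, Bx, ev_inr, ev_inl, hx', X_eq, e1, e2]
    field_simp
    ring
  · have h3 : Theta (fun i => lam i - κ) G = AddMonoidAlgebra.single (m • rho (k + 1)) (topCoeff m k *
        ∏ i, ((-1) ^ m * (1 / 2) ^ (m + 1) * Complex.betaIntegral ((lam i - κ) / 2) (m + 1))) +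
        Theta (fun i => lam i - κ) (Xd k ^ m * U') := by
      rw [hG, hU', mul_add, Theta_add, Theta_Xd_single _ _ (topExp_inr m k) h2 fun i => ?_,
        mergeExp_topExp]
      have := hlam i
      push_cast at this
      have h6 : (0 : ℝ) ≤ R1 := Nat.cast_nonneg _
      linarith
    rw [h3]
    refine Lead.of_single fun μ hμ => ?_
    rw [Theta] at hμ
    obtain ⟨κ', h4, rfl⟩ := exists_of_coeff_emb_ne hμ
    have h5 : (Xd k ^ m * U').coeff κ' ≠ 0 := fun h0 => h4 (by rw [coeff_diag, h0, mul_zero])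
    obtain ⟨a, b, ha, hb, rfl⟩ := exists_of_coeff_mul_ne h5
    have := hlt b hb
    rw [wtJ, AddMonoidHom.comp_apply, AddMonoidHom.comp_apply, mergeExp_topExp] at this
    rwa [map_add, mergeExp_Xd_pow ha, zero_add]

end TrigBA

namespace TrigBA
open LP
variable {k : ℕ}

/-! ### The transform of the eigenfunction -/

theorem sinhVand_ne_of_spr {N : ℕ} {x : Fin N → ℂ} (hx : x ∈ Spr N) : sinhVand x ≠ 0 :=
  sinhVand_ne.2 fun i j hij h => by
    have := abs_sin_le_norm_sinh (x i - x j)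
    rw [h, norm_zero] at this
    exact hx i j hij (abs_nonpos_iff.1 this)

theorem exists_mem_spr (N : ℕ) : ∃ x, x ∈ Spr N := by
  refine ⟨fun i => (i : ℕ) * Complex.I, fun i l hil => ?_⟩
  rw [Real.sin_ne_zero_iff]
  intro n h
  have e : ((i : ℕ) * Complex.I - (l : ℕ) * Complex.I : ℂ).im = (i : ℕ) - ((l : ℕ) : ℝ) := by simp
  rw [e] at h
  by_cases hn : n = 0
  · subst hn
    rw [Int.cast_zero, zero_mul, eq_comm, sub_eq_zero] at h
    exact hil (Fin.ext (by exact_mod_cast h))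
  · refine (irrational_pi.intCast_mul hn) ⟨(i : ℕ) - (l : ℕ), ?_⟩
    push_cast; exact h.symm

theorem eq_of_cl_eq_spr {N : ℕ} {lam : Fin N → ℂ} {D E : LP (Fin N)} {M : ℕ}
    (h : ∀ x ∈ Spr N, cl (B N) lam D M x = cl (B N) lam E M x) : D = E := by
  obtain ⟨x₀, hx₀⟩ := exists_mem_spr N
  rw [← sub_eq_zero]
  refine eq_zero_of_ev x₀ _ fun r => ?_
  have hx : (x₀ + fun i => (r i : ℂ)) ∈ Spr N := fun i l hil => by
    simpa using hx₀ i l hil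
  have h1 := h _ hx
  have h2 : ev (x₀ + fun i => (r i : ℂ)) (B N) ^ M ≠ 0 :=
    pow_ne_zero _ (by simpa using sinhVand_ne_of_spr hx)
  have he := Complex.exp_ne_zero (∑ a, lam a * (x₀ + fun i => (r i : ℂ)) a)
  simp only [cl, div_left_inj' h2] at h1
  rw [map_sub, mul_left_cancel₀ he h1, sub_self]

theorem isEig_of_spr {N m M : ℕ} {lam : Fin N → ℂ} {D : LP (Fin N)} {E : ℂ}
    (h : ∀ x ∈ Spr N, sutherland m (cl (B N) lam D M) x = E * cl (B N) lam D M x) :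
    IsEig m lam D M E :=
  eq_of_cl_eq_spr (lam := lam) (M := M + 2) fun x hx => by
    have hs := sinhVand_ne_of_spr hx
    rw [← sutherland_cl lam D M hs, h x hx, cl_smul, cl_mul_pow _ _ _ _ _ _ (by simpa using hs)]

theorem exists_suppLe_Lfac (m k : ℕ) : ∃ R : ℕ, ∀ (lam : Fin k → ℂ) (es : List ℂ),
    SuppLe ((es.length + 1) * R) (Lfac m lam 0 es (seed m k)) ∧
    SuppLe ((es.length + 2) * R) (Lop m lam (2 * es.length) (Lfac m lam 0 es (seed m k))) := by
  obtain ⟨R0, h0⟩ := exists_suppLe_Lop k m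
  obtain ⟨R1, h1⟩ := exists_suppLe (seed m k)
  obtain ⟨R2, h2⟩ := exists_suppLe (B k ^ 2)
  have key : ∀ (lam : Fin k → ℂ) (es : List ℂ),
      SuppLe ((es.length + 1) * (R0 + R1 + R2)) (Lfac m lam 0 es (seed m k)) := by
    intro lam es
    induction es with
    | nil => exact h1.mono (by simp; omega)
    | cons e es ih =>
      rw [Lfac]
      refine SuppLe.add ((h0 _ lam _ _ ih).mono ?_) (((h2.mul ih).smul e).mono ?_) <;>
      · rw [List.length_cons, add_mul (es.length + 1), one_mul]
        omega
  exact ⟨R0 + R1 + R2, fun lam es => ⟨key lam es, (h0 _ lam _ _ (key lam es)).mono (by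
    rw [add_mul es.length 2, add_mul es.length 1]; omega)⟩⟩

theorem trans_const_mul {γ γ' : ℝ → ℂ} (c : ℂ) (G : (JX k → ℂ) → ℂ) (x : Fin (k + 1) → ℂ) :
    trans γ γ' (fun w => c * G w) x = c * trans γ γ' G x := by
  simp only [trans, mul_assoc]
  exact integral_const_mul _ _

theorem exists_trans_Lfac (k L : ℕ) {m : ℕ} (hm : 0 < m) : ∃ A : ℕ, ∀ (κ : ℂ) (lam : Fin k → ℂ),
    (∀ i, (A : ℝ) ≤ (lam i - κ).re) → ∃ D : LP (Fin (k + 1)),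
      Lead (wt 1 (k + 1)) D (m • rho (k + 1)) (topCoeff m k * ∏ i,
        ((-1) ^ m * (1 / 2) ^ (m + 1) * Complex.betaIntegral ((lam i - κ) / 2) (m + 1))) ∧
      ∀ es : List ℂ, es.length ≤ L → ∀ x ∈ Spr (k + 1),
        trans gS gS' (jF (ker k m κ) (cl (B k) lam (Lfac m lam 0 es (seed m k)) (2 * es.length))) x =
          cl (B (k + 1)) (Fin.snoc (α := fun _ => ℂ) lam κ : Fin (k + 1) → ℂ)
            (Lfac m (Fin.snoc (α := fun _ => ℂ) lam κ) m (es.map fun e => e + κ ^ 2) D)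
            (m + 2 * es.length) x ∧
        sutherland m (trans gS gS' (jF (ker k m κ)
          (cl (B k) lam (Lfac m lam 0 es (seed m k)) (2 * es.length)))) x =
          trans gS gS' (jF (ker k m κ) (cl (B k) lam
            (Lop m lam (2 * es.length) (Lfac m lam 0 es (seed m k))) (2 * es.length + 2))) x -
          κ ^ 2 * trans gS gS' (jF (ker k m κ)
            (cl (B k) lam (Lfac m lam 0 es (seed m k)) (2 * es.length))) x := by
  obtain ⟨R, hR⟩ := exists_intertwine_gS k hm
  obtain ⟨R1, h1⟩ := exists_trans_seed m k
  obtain ⟨R2, h2⟩ := exists_suppLe_Lfac m k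
  refine ⟨R + ((L + 2) * R2 + (2 * L + 2 + 2) * R) + 2 * R + 2 + (R1 + 1), fun κ lam hlam => ?_⟩
  obtain ⟨D, hD, hlD⟩ := h1 κ lam fun i => lt_of_lt_of_le (Nat.cast_lt.2 (by omega)) (hlam i)
  have hA : ∀ l ≤ L, ∀ M ≤ 2 * l + 2, ∀ i,
      ((R + ((l + 2) * R2 + (M + 2) * R) + 2 * R : ℕ) : ℝ) + 2 ≤ (lam i - κ).re := by
    intro l hl M hM i
    refine le_trans ?_ (hlam i)
    have e1 : (l + 2) * R2 ≤ (L + 2) * R2 := by gcongr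
    have e2 : (M + 2) * R ≤ (2 * L + 2 + 2) * R := by gcongr; omega
    norm_cast
    omega
  have hint : ∀ es : List ℂ, es.length ≤ L → _ := fun es hes =>
    (hR κ lam (Lfac m lam 0 es (seed m k)) (2 * es.length) ((es.length + 2) * R2)
      ((h2 lam es).1.mono (by gcongr; omega)) (hA _ hes _ (by omega)))
  refine ⟨D, hlD, fun es => ?_⟩
  induction es with
  | nil => exact fun hes x hx => ⟨hD x hx, (hint [] hes).2 (h2 lam []).2 x hx⟩
  | cons e es ih =>
    intro hes x hx
    refine ⟨?_, (hint _ hes).2 (h2 lam _).2 x hx⟩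
    have hes' : es.length ≤ L := by simp at hes; omega
    have hs := sinhVand_ne_of_spr hx
    set F := Lfac m lam 0 es (seed m k)
    have g1 := (hint es hes').1
    have g2 := (hR κ lam (Lop m lam (2 * es.length) F) (2 * es.length + 2) ((es.length + 2) * R2)
      (h2 lam es).2 (hA _ hes' _ le_rfl)).1
    have e1 : trans gS gS' (jF (ker k m κ) (cl (B k) lam (Lfac m lam 0 (e :: es) (seed m k))
        (2 * (e :: es).length))) x =
        trans gS gS' (jF (ker k m κ) (cl (B k) lam (Lop m lam (2 * es.length) F)
          (2 * es.length + 2))) x +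
        e * trans gS gS' (jF (ker k m κ) (cl (B k) lam F (2 * es.length))) x := by
      rw [trans, trans, trans, ← integral_const_mul, ← integral_add (g2.integrableOn hx)
        ((g1.integrableOn hx).const_mul e)]
      refine setIntegral_congr_fun (measurableSet_box k) fun θ hθ => ?_
      have hz : ev (wj gS x θ ∘ Sum.inr) (B k) ≠ 0 := by
        have := ev_Bz_ne (wj_gS_mem_sep hx hθ)
        rwa [Bz, ev_inr] at this
      simp only [jF]
      rw [Lfac, zero_add, show 2 * (e :: es).length = 2 * es.length + 2 by simp; ring, cl_add, cl_smul,
        cl_mul_pow _ _ _ _ _ _ hz]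
      ring
    have e2 := ih hes' x hx
    have e3 : trans gS gS' (jF (ker k m κ) (cl (B k) lam F (2 * es.length))) =ᶠ[nhds x] _ :=
      Filter.eventuallyEq_of_mem ((isOpen_spr (k + 1)).mem_nhds hx) fun y hy => (ih hes' y hy).1
    have e4 := e2.2
    rw [sutherland_congr e3, sutherland_cl _ _ _ hs, e2.1] at e4
    rw [e1, e2.1, eq_add_of_sub_eq e4.symm, List.map_cons, Lfac, List.length_map,
      show m + 2 * (e :: es).length = m + 2 * es.length + 2 by simp; ring, cl_add, cl_smul,
      cl_mul_pow _ _ _ _ _ _ (by simpa using hs)]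
    ring

/-- The transform of the eigenfunction for `k` particles is a multiple of the one for `k + 1`
particles. -/
theorem exists_trans_eig {m : ℕ} (hm : 0 < m) {T : TrigPoly k} {T' : TrigPoly (k + 1)}
    (hE : ∀ ν, IsEig m (fun i => 2 * ν i) (T.toLP ν) m (-4 * ∑ i, ν i * ν i))
    (hl : ∀ ν, Lead (wt 1 k) (T.toLP ν) (m • rho k)
      (((1 / 2 : ℂ) ^ (prs k).card) ^ m * normC m ν))
    (hE' : ∀ ν, IsEig m (fun i => 2 * ν i) (T'.toLP ν) m (-4 * ∑ i, ν i * ν i))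
    (hl' : ∀ ν, Lead (wt 1 (k + 1)) (T'.toLP ν) (m • rho (k + 1))
      (((1 / 2 : ℂ) ^ (prs (k + 1)).card) ^ m * normC m ν)) :
    ∃ A : ℕ, ∀ (ν : Fin k → ℂ) (a : ℂ), (∀ i, (A : ℝ) ≤ (2 * ν i - 2 * a).re) → Gen ν →
      Gen (Fin.snoc (α := fun _ => ℂ) ν a : Fin (k + 1) → ℂ) →
      (∀ κ : Fin k → ℤ, normC m (fun i => -ν i - κ i / 2) ≠ 0) →
      ∀ x ∈ Spr (k + 1),
        ((1 / 2 : ℂ) ^ (prs k).card * (1 / 2 : ℂ) ^ (prs (k + 1)).card) ^ m *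
        normC m (Fin.snoc (α := fun _ => ℂ) ν a : Fin (k + 1) → ℂ) *
        trans gS gS' (jF (ker k m (2 * a)) (cl (B k) (fun i => 2 * ν i) (T.toLP ν) m)) x =
        normC m ν * (topCoeff m k * ∏ i,
          ((-1) ^ m * (1 / 2) ^ (m + 1) * Complex.betaIntegral (ν i - a) (m + 1))) *
        cl (B (k + 1)) (fun i => 2 * (Fin.snoc (α := fun _ => ℂ) ν a : Fin (k + 1) → ℂ) i)
          (T'.toLP (Fin.snoc (α := fun _ => ℂ) ν a)) m x := by
  obtain ⟨L, hL⟩ := exists_Lfac_seed hE hl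
  obtain ⟨A, hA⟩ := exists_trans_Lfac k L hm
  refine ⟨A, fun ν a ha hg hg' hn x hx => ?_⟩
  obtain ⟨es, rfl, hes, hEig⟩ := hL ν hg hn
  obtain ⟨D₀, hl₀, h₀⟩ := hA (2 * a) (fun i => 2 * ν i) ha
  set ν' : Fin (k + 1) → ℂ := Fin.snoc (α := fun _ => ℂ) ν a with hν'
  set lam : Fin k → ℂ := fun i => 2 * ν i
  have hlam : (Fin.snoc (α := fun _ => ℂ) lam (2 * a) : Fin (k + 1) → ℂ) = fun i => 2 * ν' i := by
    ext i
    refine Fin.lastCases ?_ (fun i => ?_) i <;> simp [hν', lam]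
  have hE2 : -4 * ∑ i, ν' i * ν' i = -4 * (∑ i, ν i * ν i) - (2 * a) ^ 2 := by
    rw [Fin.sum_univ_castSucc]; simp [hν']; ring
  rw [hlam] at h₀
  set lam' : Fin (k + 1) → ℂ := fun i => 2 * ν' i
  set D := Lfac m lam 0 es (seed m k)
  set D₁ := Lfac m lam' m (es.map fun e => e + (2 * a) ^ 2) D₀ with hD₁
  have hJ : ∀ x ∈ Spr (k + 1), trans gS gS' (jF (ker k m (2 * a)) (cl (B k) lam D (2 * es.length))) x =
      cl (B (k + 1)) lam' D₁ (m + 2 * es.length) x := fun x hx => (h₀ es le_rfl x hx).1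
  have hz : ∀ x ∈ Spr (k + 1), ∀ θ ∈ box k, ev (wj gS x θ ∘ Sum.inr) (B k) ≠ 0 := fun x hx θ hθ => by
    have := ev_Bz_ne (wj_gS_mem_sep hx hθ)
    rwa [Bz, ev_inr] at this
  have hEig1 : IsEig m lam' D₁ (m + 2 * es.length) (-4 * ∑ i, ν' i * ν' i) := by
    refine isEig_of_spr fun y hy => ?_
    have e3 : trans gS gS' (jF (ker k m (2 * a)) (cl (B k) lam D (2 * es.length))) =ᶠ[nhds y]
        cl (B (k + 1)) lam' D₁ (m + 2 * es.length) :=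
      Filter.eventuallyEq_of_mem ((isOpen_spr (k + 1)).mem_nhds hy) hJ
    rw [← sutherland_congr e3, (h₀ es le_rfl y hy).2, ← hJ y hy, hE2, sub_mul]
    congr 1
    refine (trans_congr (H := fun w => (-4 * ∑ i, ν i * ν i) * jF (ker k m (2 * a))
      (cl (B k) lam D (2 * es.length)) w) fun θ hθ => ?_).trans (trans_const_mul _ _ _)
    simp only [jF]
    rw [show Lop m lam (2 * es.length) D = _ from hEig, cl_smul, cl_mul_pow _ _ _ _ _ _ (hz y hy θ hθ)]
    ring
  have hB := lead_B (Or.inl rfl) k (ε := 1)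
  have hB' := lead_B (Or.inl rfl) (k + 1) (ε := 1)
  rw [one_smul] at hB hB'
  push_cast at hB hB'
  set b : ℂ := (1 / 2) ^ (prs k).card
  set b' : ℂ := (1 / 2) ^ (prs (k + 1)).card
  have hb : b ≠ 0 := pow_ne_zero _ (by norm_num)
  have hb' : b' ≠ 0 := pow_ne_zero _ (by norm_num)
  have hw := wt_injective one_ne_zero k
  have hw' := wt_injective one_ne_zero (k + 1)
  set p : ℂ := (es.map fun e => e - ∑ i, lam i ^ 2).prod with hp
  have hp0 : p ≠ 0 := by
    refine List.prod_ne_zero fun h => ?_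
    obtain ⟨e, he, h⟩ := List.mem_map.1 h
    exact hes e he h
  have hlist : ∀ (c : ℂ) (f : ℂ → ℂ) (l : List ℂ),
      (l.map fun e => c * f e).prod = c ^ l.length * (l.map f).prod := fun c f l => by
    induction l with
    | nil => simp
    | cons e l ih => simp only [List.map_cons, List.prod_cons, ih, List.length_cons, pow_succ]; ring
  have c1 : D.coeff ((2 * es.length) • rho k) = b ^ (2 * es.length) * p * b ^ m := by
    have := (lead_Lfac (m := m) (M := 0) (lam := lam) hB (lead_seed m k) es).1
    rw [zero_add, hlist, ← pow_mul] at this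
    exact this
  have c2 : D₁.coeff ((m + 2 * es.length) • rho (k + 1)) = b' ^ (2 * es.length) * p *
      (topCoeff m k * ∏ i,
        ((-1) ^ m * (1 / 2) ^ (m + 1) * Complex.betaIntegral (ν i - a) (m + 1))) := by
    have := (lead_Lfac (m := m) (M := m) (lam := lam') hB' hl₀ (es.map fun e => e + (2 * a) ^ 2)).1
    rw [List.length_map, hlist, List.length_map, ← pow_mul, List.map_map] at this
    rw [hD₁, this, hp]
    congr 3
    · congr 1
      funext e
      simp only [Function.comp, lam', lam, Fin.sum_univ_castSucc, hν', Fin.snoc_castSucc,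
        Fin.snoc_last]
      ring
    · funext i
      rw [show (2 * ν i - 2 * a) / 2 = ν i - a by ring]
  have q1 := isEig_proportional hg ((IsEig.of_mul (r := m)).2 hEig)
    (by rw [add_comm]; exact (IsEig.of_mul (r := 2 * es.length)).2 (hE ν))
  have q2 := isEig_proportional hg' hEig1 ((IsEig.of_mul (r := 2 * es.length)).2 (hE' ν'))
  have d1 : (B k ^ m * D).coeff ((2 * es.length + m) • rho k) = b ^ m * (b ^ (2 * es.length) * p * b ^ m) := by
    have := (hB.pow hw m).mul hw (lead_Lfac (m := m) (M := 0) (lam := lam) hB (lead_seed m k) es)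
    rw [zero_add, ← add_smul, add_comm m] at this
    rw [this.1, hlist, ← hp]; ring
  have d2 : (B k ^ (2 * es.length) * T.toLP ν).coeff ((2 * es.length + m) • rho k) =
      b ^ (2 * es.length) * (b ^ m * normC m ν) := by
    have := (hB.pow hw (2 * es.length)).mul hw (hl ν)
    rw [← add_smul] at this
    exact this.1
  have d3 : (B (k + 1) ^ (2 * es.length) * T'.toLP ν').coeff ((m + 2 * es.length) • rho (k + 1)) =
      b' ^ (2 * es.length) * (b' ^ m * normC m ν') := by
    have := (hB'.pow hw' (2 * es.length)).mul hw' (hl' ν')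
    rw [← add_smul, add_comm (2 * es.length)] at this
    exact this.1
  rw [d1, d2] at q1
  rw [c2, d3] at q2
  have r2 := congrArg (fun G => cl (B (k + 1)) lam' G (m + 2 * es.length) x) q2
  simp only [cl_smul] at r2
  rw [cl_mul_pow _ _ _ _ _ _ (by simpa using sinhVand_ne_of_spr hx), ← hJ x hx] at r2
  have r1 : b ^ (2 * es.length) * (b ^ m * normC m ν) *
      trans gS gS' (jF (ker k m (2 * a)) (cl (B k) lam D (2 * es.length))) x =
      b ^ m * (b ^ (2 * es.length) * p * b ^ m) *
      trans gS gS' (jF (ker k m (2 * a)) (cl (B k) lam (T.toLP ν) m)) x := by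
    rw [← trans_const_mul, ← trans_const_mul]
    refine trans_congr fun θ hθ => ?_
    have r3 := congrArg (fun G => cl (B k) lam G (2 * es.length + m) (wj gS x θ ∘ Sum.inr)) q1
    simp only [cl_smul] at r3
    rw [cl_mul_pow _ _ _ _ _ _ (hz x hx θ hθ), add_comm (2 * es.length) m,
      cl_mul_pow _ _ _ _ _ _ (hz x hx θ hθ)] at r3
    simp only [jF]
    linear_combination ker k m (2 * a) (wj gS x θ) * r3
  generalize trans gS gS' (jF (ker k m (2 * a)) (cl (B k) lam D (2 * es.length))) x = J at *
  generalize trans gS gS' (jF (ker k m (2 * a)) (cl (B k) lam (T.toLP ν) m)) x = Y at *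
  generalize cl (B (k + 1)) lam' (T'.toLP ν') m x = Z at *
  have hbl := pow_ne_zero (2 * es.length) hb
  have hbl' := pow_ne_zero (2 * es.length) hb'
  have hbm := pow_ne_zero m hb
  have s1 : normC m ν * J = b ^ m * p * Y := by
    apply mul_left_cancel₀ (mul_ne_zero hbl hbm)
    linear_combination r1
  have s2 : b' ^ m * normC m ν' * J = p * (topCoeff m k * ∏ i, ((-1) ^ m *
      (1 / 2) ^ (m + 1) * Complex.betaIntegral (ν i - a) (m + 1))) * Z := by
    apply mul_left_cancel₀ hbl'
    linear_combination r2
  apply mul_left_cancel₀ hp0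
  rw [mul_pow]
  linear_combination normC m ν * s2 - b' ^ m * normC m ν' * s1

end TrigBA

namespace TrigBA
open LP

/-! ### Recursion for the integrand over the number of levels -/

/-- The integration variables of `n + 1` levels: those of `n` levels and those of the last one. -/
def varEquiv (n : ℕ) : VarIdx n ⊕ Fin (n + 1) ≃ VarIdx (n + 1) :=
  Equiv.ofBijective
    (Sum.elim (fun p => ⟨(p.1.1.castSucc, p.1.2.castSucc), by
        simpa [Fin.le_def] using Fin.le_def.1 p.2⟩)
      (fun i => ⟨(i.castSucc, Fin.last n), by simp [Fin.le_def, Fin.is_le]⟩)) <| by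
    constructor
    · rintro (⟨⟨a, b⟩, h⟩ | a) (⟨⟨c, d⟩, h'⟩ | c) e <;>
        simp only [Sum.elim_inl, Sum.elim_inr, Subtype.mk.injEq, Prod.mk.injEq, Fin.ext_iff,
          Fin.val_castSucc, Fin.val_last] at e
      · simp only [Sum.inl.injEq, Subtype.mk.injEq, Prod.mk.injEq, Fin.ext_iff]; exact e
      · omega
      · omega
      · simp only [Sum.inr.injEq, Fin.ext_iff]; exact e.1
    · rintro ⟨⟨a, b⟩, h⟩
      simp only [Fin.le_def, Fin.val_castSucc] at h
      by_cases hb : (b : ℕ) < n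
      · exact ⟨Sum.inl ⟨(⟨a, by omega⟩, ⟨b, hb⟩), by simpa [Fin.le_def] using h⟩, by
          simp⟩
      · exact ⟨Sum.inr ⟨a, by omega⟩, by
          simp [Subtype.ext_iff, Fin.ext_iff]; omega⟩

@[simp] theorem varEquiv_inl_fst (n : ℕ) (p : VarIdx n) :
    (varEquiv n (Sum.inl p)).1.1 = p.1.1.castSucc := rfl
@[simp] theorem varEquiv_inl_snd (n : ℕ) (p : VarIdx n) :
    (varEquiv n (Sum.inl p)).1.2 = p.1.2.castSucc := rfl
@[simp] theorem varEquiv_inr_fst (n : ℕ) (i : Fin (n + 1)) :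
    (varEquiv n (Sum.inr i)).1.1 = i.castSucc := rfl
@[simp] theorem varEquiv_inr_snd (n : ℕ) (i : Fin (n + 1)) :
    (varEquiv n (Sum.inr i)).1.2 = Fin.last n := rfl

/-- The parameters of `n + 1` levels put together from those of `n` levels and the last one. -/
def glue {n : ℕ} (τ : VarIdx n → ℝ) (σ : Fin (n + 1) → ℝ) : VarIdx (n + 1) → ℝ :=
  fun p => Sum.elim τ σ ((varEquiv n).symm p)

variable {n : ℕ}

@[simp] theorem glue_inl (τ : VarIdx n → ℝ) (σ : Fin (n + 1) → ℝ) (p : VarIdx n) :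
    glue τ σ (varEquiv n (Sum.inl p)) = τ p := by simp [glue]
@[simp] theorem glue_inr (τ : VarIdx n → ℝ) (σ : Fin (n + 1) → ℝ) (i : Fin (n + 1)) :
    glue τ σ (varEquiv n (Sum.inr i)) = σ i := by simp [glue]

@[to_additive]
theorem prod_varIdx_succ {M : Type*} [CommMonoid M] (f : VarIdx (n + 1) → M) :
    ∏ p, f p = (∏ p : VarIdx n, f (varEquiv n (Sum.inl p))) * ∏ i, f (varEquiv n (Sum.inr i)) := by
  rw [← (varEquiv n).prod_comp f, Fintype.prod_sum_type]

theorem contourLog_last (x : Fin (n + 1) → ℂ) (τ : VarIdx n → ℝ) (i : Fin (n + 1)) :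
    contourLog x τ i (Fin.last n) = 2 * x i := by
  simp [contourLog]

/-- The points of level `k` on the rays, in the coordinates `x`. -/
def low {k : ℕ} (x : Fin (k + 1) → ℂ) (σ : Fin k → ℝ) : Fin k → ℂ := wj gS x σ ∘ Sum.inr

theorem low_apply {k : ℕ} (x : Fin (k + 1) → ℂ) (σ : Fin k → ℝ) (i : Fin k) :
    low x σ i = x i.castSucc + gS (σ i) := rfl

theorem contourLog_glue (x : Fin (n + 2) → ℂ) (τ : VarIdx n → ℝ) (σ : Fin (n + 1) → ℝ)
    (i j : Fin (n + 1)) :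
    contourLog x (glue τ σ) i.castSucc j.castSucc = contourLog (low x σ) τ i j := by
  simp only [contourLog, Finset.sum_filter, sum_varIdx_succ, varEquiv_inl_fst, varEquiv_inl_snd,
    varEquiv_inr_fst, varEquiv_inr_snd, glue_inl, glue_inr, low_apply, gS]
  have h1 : ∀ i' : Fin (n + 1), (i' = i ∧ j ≤ Fin.last n) ↔ i' = i := fun i' => by
    simp [Fin.le_last]
  simp only [Fin.castSucc_inj, Fin.castSucc_le_castSucc_iff, h1, Finset.sum_ite_eq',
    Finset.mem_univ, if_true]
  push_cast
  ring

/-- The factor `A_{j,j+1}` for the last two levels. -/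
def crossL {k : ℕ} (t : Fin k → ℂ) (u : Fin (k + 1) → ℂ) : ℂ :=
  ∏ i : Fin k, ∏ l : Fin (k + 1), if i.castSucc ≤ l then t i - u l else u l - t i

theorem alphaStarPullback_glue (m : ℕ) (x ν : Fin (n + 2) → ℂ) (τ : VarIdx n → ℝ)
    (σ : Fin (n + 1) → ℝ) :
    alphaStarPullback m x ν (glue τ σ) =
      alphaStarPullback m (low x σ) (ν ∘ Fin.castSucc) τ *
        (crossL (fun i => Complex.exp (2 * low x σ i)) (fun l => Complex.exp (2 * x l)) ^ m *
          (vand (fun i => Complex.exp (2 * low x σ i)) ^ (2 * m))⁻¹ *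
          ∏ i : Fin (n + 1), (Complex.exp ((ν (Fin.last n).castSucc - ν (Fin.last (n + 1)) - m - 1) *
            (2 * low x σ i)) * Complex.exp (2 * x i.castSucc))) := by
  have hz1 : -(-(m : ℤ) - 1) - 1 = m := by ring
  have hz2 : 2 + 2 * (-(m : ℤ) - 1) = -((2 * m : ℕ) : ℤ) := by push_cast; ring
  have hl : ∀ i : Fin (n + 1), contourLog x (glue τ σ) i.castSucc (Fin.last n).castSucc =
      2 * low x σ i := fun i => by rw [contourLog_glue, contourLog_last]
  have hc : ∀ j : Fin n, crossA (fun i l => Complex.exp (contourLog x (glue τ σ) i l)) j.castSucc =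
      crossA (fun i l => Complex.exp (contourLog (low x σ) τ i l)) j := fun j => by
    simp only [crossA, Fin.succ_castSucc, Fin.prod_Iic_castSucc, contourLog_glue,
      Fin.castSucc_le_castSucc_iff]
  have hc' : crossA (fun i l => Complex.exp (contourLog x (glue τ σ) i l)) (Fin.last n) =
      crossL (fun i => Complex.exp (2 * low x σ i)) (fun l => Complex.exp (2 * x l)) := by
    have h1 : Finset.Iic (Fin.last n) = Finset.univ := by ext; simp [Fin.le_last]
    have h2 : Finset.Iic (Fin.last (n + 1)) = Finset.univ := by ext; simp [Fin.le_last]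
    simp only [crossA, Fin.succ_last, Fin.prod_Iic_castSucc, h1, h2, hl, contourLog_last, crossL]
  have hv : ∀ j : Fin n, levelA (fun i l => Complex.exp (contourLog x (glue τ σ) i l)) j.castSucc =
      levelA (fun i l => Complex.exp (contourLog (low x σ) τ i l)) j := fun j => by
    simp only [levelA, Fin.prod_Iic_castSucc, Fin.prod_Iio_castSucc, contourLog_glue]
  have hv' : levelA (fun i l => Complex.exp (contourLog x (glue τ σ) i l)) (Fin.last n) =
      vand (fun i => Complex.exp (2 * low x σ i)) := by
    have h1 : Finset.Iic (Fin.last n) = Finset.univ := by ext; simp [Fin.le_last]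
    simp only [levelA, Fin.prod_Iic_castSucc, Fin.prod_Iio_castSucc, hl, h1, vand]
    rw [Finset.prod_sigma', Finset.prod_sigma']
    exact Finset.prod_nbij' (fun p => ⟨p.2, p.1⟩) (fun p => ⟨p.2, p.1⟩) (by simp) (by simp)
      (by simp) (by simp) (by simp)
  simp only [alphaStarPullback, alphaStar, omegaStar, hz1, hz2, zpow_neg, zpow_natCast,
    Fin.prod_univ_castSucc (n := n), prod_varIdx_succ, varEquiv_inl_fst, varEquiv_inl_snd,
    varEquiv_inr_fst, varEquiv_inr_snd, hc, hc', hv, hv', Fin.succ_castSucc, contourLog_glue, hl,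
    Fin.succ_last, contourLog_last, Finset.prod_mul_distrib, Function.comp]
  have h3 : ∀ i : Fin (n + 1), Complex.exp ((ν (Fin.last n).castSucc - ν (Fin.last (n + 1)) +
      ((-(m : ℤ) - 1 : ℤ) : ℂ)) * (2 * low x σ i)) = Complex.exp ((ν (Fin.last n).castSucc -
      ν (Fin.last (n + 1)) - m - 1) * (2 * low x σ i)) := fun i => by
    congr 1; push_cast; ring
  simp only [h3]
  ring

end TrigBA

namespace TrigBA
open LP
variable {n k : ℕ}

theorem measurable_alphaStarPullback (m : ℕ) (x ν : Fin (n + 1) → ℂ) :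
    Measurable (alphaStarPullback m x ν) := by
  have hc : ∀ i j, Measurable fun τ => contourLog x τ i j := fun i j => by
    unfold contourLog; fun_prop
  unfold alphaStarPullback alphaStar omegaStar crossA levelA
  have hz1 : -(-(m : ℤ) - 1) - 1 = m := by ring
  have hz2 : 2 + 2 * (-(m : ℤ) - 1) = -((2 * m : ℕ) : ℤ) := by push_cast; ring
  simp only [hz1, hz2, zpow_neg, zpow_natCast]
  have hif : ∀ (j : Fin n) (i l : Fin (n + 1)), Measurable fun τ : VarIdx n → ℝ =>
      if i ≤ l then Complex.exp (contourLog x τ i j.castSucc) - Complex.exp (contourLog x τ l j.succ)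
      else Complex.exp (contourLog x τ l j.succ) - Complex.exp (contourLog x τ i j.castSucc) :=
    fun j i l => by split_ifs <;> fun_prop
  fun_prop

/-- The cube without the faces `σ_i = 0`. -/
def icube (k : ℕ) : Set (Fin k → ℝ) := Set.univ.pi fun _ => Set.Ioc 0 1

theorem icube_ae_eq (k : ℕ) : (box k : Set (Fin k → ℝ)) =ᵐ[volume] icube k :=
  (Measure.univ_pi_Ioo_ae_eq_Icc (μ := fun _ : Fin k => (volume : Measure ℝ))).trans
    (Measure.univ_pi_Ioc_ae_eq_Icc (μ := fun _ : Fin k => (volume : Measure ℝ))).symm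

theorem cube_eq (n : ℕ) : cube n = Set.univ.pi fun _ => Set.Ioc 0 1 := by
  ext; simp [cube]

theorem measurableSet_cube (n : ℕ) : MeasurableSet (cube n) :=
  cube_eq n ▸ MeasurableSet.univ_pi fun _ => measurableSet_Ioc

/-- `glue` as an equivalence. -/
def glueEquiv (n : ℕ) : ((Fin (n + 1) → ℝ) × (VarIdx n → ℝ)) ≃ᵐ (VarIdx (n + 1) → ℝ) :=
  (MeasurableEquiv.prodComm.trans
    (MeasurableEquiv.sumPiEquivProdPi (fun _ : VarIdx n ⊕ Fin (n + 1) => ℝ)).symm).trans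
    (MeasurableEquiv.piCongrLeft (fun _ => ℝ) (varEquiv n))

theorem glueEquiv_apply (q : (Fin (n + 1) → ℝ) × (VarIdx n → ℝ)) :
    glueEquiv n q = glue q.2 q.1 := by
  funext p
  obtain ⟨r, rfl⟩ := (varEquiv n).surjective p
  refine (MeasurableEquiv.piCongrLeft_apply_apply (varEquiv n) (β := fun _ => ℝ)
    (x := fun r => Sum.rec q.2 q.1 r) (i := r)).trans ?_
  rcases r with r | r <;> simp

theorem measurePreserving_glueEquiv (n : ℕ) : MeasurePreserving (glueEquiv n) volume volume :=
  ((volume_measurePreserving_piCongrLeft (fun _ => ℝ) (varEquiv n)).comp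
    (volume_measurePreserving_sumPiEquivProdPi_symm
      (fun _ : VarIdx n ⊕ Fin (n + 1) => ℝ))).comp Measure.measurePreserving_swap

theorem glue_mem_cube {τ : VarIdx n → ℝ} {σ : Fin (n + 1) → ℝ} :
    glue τ σ ∈ cube (n + 1) ↔ σ ∈ icube (n + 1) ∧ τ ∈ cube n := by
  constructor
  · intro h
    exact ⟨fun i _ => by simpa using h (varEquiv n (Sum.inr i)),
      fun p => by simpa using h (varEquiv n (Sum.inl p))⟩
  · rintro ⟨h1, h2⟩ p
    obtain ⟨r, rfl⟩ := (varEquiv n).surjective p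
    rcases r with r | r
    · simpa using h2 r
    · simpa using h1 r (Set.mem_univ _)

theorem setIntegral_cube_succ {f : (VarIdx (n + 1) → ℝ) → ℂ} (hf : IntegrableOn f (cube (n + 1))) :
    ∫ τ in cube (n + 1), f τ = ∫ σ in box (n + 1), ∫ τ in cube n, f (glue τ σ) := by
  have hp : glueEquiv n ⁻¹' cube (n + 1) = icube (n + 1) ×ˢ cube n := by
    ext q; simp only [Set.mem_preimage, glueEquiv_apply, glue_mem_cube, Set.mem_prod]
  have hm := measurePreserving_glueEquiv n
  have he := (glueEquiv n).measurableEmbedding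
  rw [← hm.integrableOn_comp_preimage he, hp] at hf
  rw [← hm.setIntegral_preimage_emb he, hp, Measure.volume_eq_prod, setIntegral_prod (fun q => f (glueEquiv n q)) hf,
    setIntegral_congr_set (icube_ae_eq (n + 1))]
  simp only [glueEquiv_apply]

/-! ### A bound for the integrand -/

theorem spread_le {c : ℝ} (hc : 0 ≤ c) {a b : ℂ} (h : c ≤ |Real.sin (a - b).im|) :
    c * (‖Complex.exp (2 * a)‖ + ‖Complex.exp (2 * b)‖) ≤
      ‖Complex.exp (2 * a) - Complex.exp (2 * b)‖ := by
  have e : Complex.exp (2 * a) - Complex.exp (2 * b) =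
      Complex.exp (a + b) * (2 * Complex.sinh (a - b)) := by
    rw [Complex.two_sinh, mul_sub, ← Complex.exp_add, ← Complex.exp_add]; ring_nf
  have e2 : ‖Complex.exp (2 * a)‖ + ‖Complex.exp (2 * b)‖ =
      ‖Complex.exp (a + b)‖ * (2 * Real.cosh (a - b).re) := by
    rw [Complex.norm_exp, Complex.norm_exp, Complex.norm_exp, Real.cosh_eq]
    rw [mul_div_cancel₀ _ two_ne_zero, mul_add, ← Real.exp_add, ← Real.exp_add]
    simp; ring_nf
  rw [e, e2, norm_mul, norm_mul, Complex.norm_ofNat, mul_left_comm]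
  refine mul_le_mul_of_nonneg_left ?_ (norm_nonneg _)
  rw [mul_left_comm]
  refine mul_le_mul_of_nonneg_left ?_ zero_le_two
  refine le_of_sq_le_sq ?_ (norm_nonneg _)
  rw [norm_sinh_sq, mul_pow, Real.cosh_sq]
  have h1 : c ^ 2 ≤ Real.sin (a - b).im ^ 2 := by
    rw [← sq_abs (Real.sin _)]; exact pow_le_pow_left₀ hc h 2
  nlinarith [Real.sin_sq_le_one (a - b).im, sq_nonneg (Real.sinh (a - b).re)]

theorem prod_erase_eq_prs {N : ℕ} {M : Type*} [CommMonoid M] (f : Fin N → Fin N → M) :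
    ∏ i, ∏ l ∈ Finset.univ.erase i, f i l = ∏ p ∈ prs N, f p.1 p.2 * f p.2 p.1 := by
  have h : ∀ i : Fin N, ∏ l ∈ Finset.univ.erase i, f i l =
      (∏ l ∈ Finset.Ioi i, f i l) * ∏ l ∈ Finset.Iio i, f i l := fun i => by
    rw [← Finset.prod_union (by
      rw [Finset.disjoint_left]; intro a h1 h2; simp at h1 h2; exact lt_asymm h1 h2)]
    congr 1; ext l; simp [lt_or_lt_iff_ne, eq_comm]
  simp only [h]
  rw [Finset.prod_mul_distrib, Finset.prod_mul_distrib, prod_prs, ← prod_prs (fun i l => f l i)]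
  congr 1
  rw [Finset.prod_sigma', Finset.prod_sigma']
  exact Finset.prod_nbij' (fun p => ⟨p.2, p.1⟩) (fun p => ⟨p.2, p.1⟩) (by simp) (by simp)
      (by simp) (by simp) (by simp)

theorem norm_vand {N : ℕ} (u : Fin N → ℂ) : ‖vand u‖ = ∏ p ∈ prs N, ‖u p.1 - u p.2‖ := by
  rw [vand_eq, norm_prod]

theorem norm_crossL_le {c : ℝ} (hc : 0 < c) {t : Fin k → ℂ} {u : Fin (k + 1) → ℂ}
    (hu : ∀ i l, i ≠ l → c * (‖u i‖ + ‖u l‖) ≤ ‖u i - u l‖)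
    (ht : ∀ i : Fin k, ‖t i‖ ≤ ‖u i.castSucc‖) :
    ‖crossL t u‖ ≤ (∏ _i : Fin k, ∏ _l : Fin (k + 1), 2 * c⁻¹) * ‖vand u‖ ^ 2 := by
  have key : ∀ i l, i ≠ l → ‖u i‖ + ‖u l‖ ≤ c⁻¹ * ‖u i - u l‖ := fun i l h => by
    rw [inv_mul_eq_div, le_div_iff₀ hc, mul_comm]; exact hu i l h
  let g : Fin k → Fin (k + 1) → ℝ := fun i l =>
    if l = i.castSucc then ‖u i.castSucc - u (Fin.last k)‖ else ‖u i.castSucc - u l‖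
  have h1 : ∀ i l, ‖(if i.castSucc ≤ l then t i - u l else u l - t i)‖ ≤ 2 * c⁻¹ * g i l := by
    intro i l
    have e : ‖(if i.castSucc ≤ l then t i - u l else u l - t i)‖ = ‖t i - u l‖ := by
      split_ifs
      · rfl
      · exact norm_sub_rev _ _
    rw [e]
    refine (norm_sub_le _ _).trans ((add_le_add_left (ht i) _).trans ?_)
    simp only [g]
    have hl := key _ _ (Fin.castSucc_lt_last i).ne
    split_ifs with h
    · rw [h]; linarith [norm_nonneg (u (Fin.last k))]
    · have := key _ _ (Ne.symm h)
      linarith [norm_nonneg (u i.castSucc), norm_nonneg (u l)]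
  have h2 : ∏ i, ∏ l, g i l = ‖vand u‖ ^ 2 := by
    have h3 : ∀ i : Fin k, ∏ l, g i l = (∏ l ∈ Finset.univ.erase i,
        ‖u i.castSucc - u l.castSucc‖) * ‖u i.castSucc - u (Fin.last k)‖ ^ 2 := fun i => by
      rw [Fin.prod_univ_castSucc, ← Finset.mul_prod_erase _ _ (Finset.mem_univ i)]
      have h4 : ∏ l ∈ Finset.univ.erase i, g i l.castSucc =
          ∏ l ∈ Finset.univ.erase i, ‖u i.castSucc - u l.castSucc‖ :=
        Finset.prod_congr rfl fun l hl => by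
          simp only [g, Fin.castSucc_inj, if_neg (Finset.ne_of_mem_erase hl)]
      rw [h4]
      simp only [g, if_true, if_neg (Fin.castSucc_lt_last i).ne']
      ring
    simp only [h3]
    rw [Finset.prod_mul_distrib, prod_erase_eq_prs, vand_succ, norm_mul, mul_pow, norm_vand,
      norm_prod, Finset.prod_pow, ← Finset.prod_pow (prs k)]
    congr 1
    exact Finset.prod_congr rfl fun p _ => by
      simp only [Function.comp]; rw [norm_sub_rev (u p.2.castSucc), sq]
  rw [crossL, norm_prod, ← h2, ← Finset.prod_mul_distrib]
  refine Finset.prod_le_prod (fun _ _ => norm_nonneg _) fun i _ => ?_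
  rw [norm_prod, ← Finset.prod_mul_distrib]
  exact Finset.prod_le_prod (fun _ _ => norm_nonneg _) fun l _ => h1 i l


/-- The bound for the integrand in terms of `β_i = ν_i + i m`. -/
def alphaBound (m : ℕ) (x β : Fin (n + 1) → ℂ) (τ : VarIdx n → ℝ) : ℝ :=
  ‖vand fun i => Complex.exp (2 * x i)‖ ^ (2 * m) *
    ‖Complex.exp (∑ i, (β i - β (Fin.last n)) * (2 * x i))‖ *
    ∏ p : VarIdx n, τ p ^ ((β p.1.1 - β p.1.2.succ).re - 1)

theorem exp_two_gS {t : ℝ} (ht : 0 < t) (a : ℂ) :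
    ‖Complex.exp (a * (2 * gS t))‖ = t ^ a.re := by
  rw [gS, Complex.norm_exp, Real.rpow_def_of_pos ht]
  congr 1
  have : a * (2 * ((Real.log t / 2 : ℝ) : ℂ)) = a * (Real.log t : ℂ) := by push_cast; ring
  rw [this, Complex.re_mul_ofReal, mul_comm]

theorem low_mem_spread {c : ℝ} {x : Fin (k + 1) → ℂ}
    (hx : ∀ i l, i ≠ l → c ≤ |Real.sin (x i - x l).im|) (σ : Fin k → ℝ) (i l : Fin k) (h : i ≠ l) :
    c ≤ |Real.sin (low x σ i - low x σ l).im| := by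
  have := hx i.castSucc l.castSucc (by simpa using h)
  simpa [low_apply, gS] using this

theorem exists_glue (τ : VarIdx (n + 1) → ℝ) : ∃ τ' σ, τ = glue τ' σ :=
  ⟨fun p => τ (varEquiv n (Sum.inl p)), fun i => τ (varEquiv n (Sum.inr i)), by
    funext p
    obtain ⟨r, rfl⟩ := (varEquiv n).surjective p
    rcases r with r | r <;> simp⟩

theorem alphaBound_glue (m : ℕ) {x ν : Fin (n + 2) → ℂ} {τ : VarIdx n → ℝ}
    {σ : Fin (n + 1) → ℝ} (hσ : ∀ i, 0 < σ i) :
    ‖vand fun i => Complex.exp (2 * x i)‖ ^ (2 * m) *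
      (‖Complex.exp (∑ i, ((ν (Fin.castSucc i) + (i : ℕ) * m) - (ν (Fin.last n).castSucc + n * m)) *
        (2 * low x σ i))‖ *
      ∏ p : VarIdx n, τ p ^ (((ν (Fin.castSucc p.1.1) + (p.1.1 : ℕ) * m) -
        (ν (Fin.castSucc p.1.2.succ) + (p.1.2.succ : ℕ) * m) : ℂ).re - 1)) *
      ‖∏ i : Fin (n + 1), (Complex.exp ((ν (Fin.last n).castSucc - ν (Fin.last (n + 1)) - m - 1) *
            (2 * low x σ i)) * Complex.exp (2 * x i.castSucc))‖ =
    alphaBound m x (fun i => ν i + (i : ℕ) * m) (glue τ σ) := by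
  have h1 : (∑ i : Fin (n + 1), ((ν (Fin.castSucc i) + (i : ℕ) * m) -
      (ν (Fin.last n).castSucc + n * m)) * (2 * low x σ i)) +
      ∑ i : Fin (n + 1), ((ν (Fin.last n).castSucc - ν (Fin.last (n + 1)) - m - 1) *
            (2 * low x σ i) + 2 * x i.castSucc) =
      (∑ i : Fin (n + 2), (ν i + (i : ℕ) * m - (ν (Fin.last (n + 1)) + (n + 1 : ℕ) * m)) * (2 * x i)) +
      ∑ i : Fin (n + 1), ((ν i.castSucc + (i : ℕ) * m -
        (ν (Fin.last (n + 1)) + (n + 1 : ℕ) * m)) - 1) * (2 * gS (σ i)) := by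
    rw [Fin.sum_univ_castSucc (n := n + 1), ← Finset.sum_add_distrib, Fin.val_last, sub_self,
      zero_mul, add_zero, ← Finset.sum_add_distrib]
    refine Finset.sum_congr rfl fun i _ => ?_
    simp only [low_apply, Fin.val_castSucc]
    push_cast
    ring
  have h2 := congrArg (fun z => ‖Complex.exp z‖) h1
  simp only [Complex.exp_add, Complex.exp_sum, norm_mul, norm_prod, exp_two_gS (hσ _)] at h2
  simp only [alphaBound, prod_varIdx_succ, glue_inl, glue_inr, varEquiv_inl_fst, varEquiv_inl_snd,
    varEquiv_inr_fst, varEquiv_inr_snd, Fin.val_castSucc, Fin.succ_castSucc, Fin.succ_last,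
    Complex.exp_sum, norm_mul, norm_prod, Fin.val_last]
  simp only [Complex.sub_re, Complex.one_re] at h2 ⊢
  linear_combination (‖vand fun i => Complex.exp (2 * x i)‖ ^ (2 * m) * ∏ p : VarIdx n,
    τ p ^ ((ν p.1.1.castSucc + (p.1.1 : ℕ) * m).re -
      (ν p.1.2.succ.castSucc + (p.1.2.succ : ℕ) * m).re - 1)) * h2

theorem norm_alphaStarPullback_le (m : ℕ) {c : ℝ} (hc : 0 < c) (n : ℕ) :
    ∃ K : ℝ, ∀ (x ν : Fin (n + 1) → ℂ), (∀ i l, i ≠ l → c ≤ |Real.sin (x i - x l).im|) →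
      ∀ τ ∈ cube n, ‖alphaStarPullback m x ν τ‖ ≤
        K * alphaBound m x (fun i => ν i + (i : ℕ) * m) τ := by
  induction n with
  | zero =>
    refine ⟨1, fun x ν _ τ _ => ?_⟩
    simp [alphaStarPullback, alphaStar, omegaStar, alphaBound, vand]
  | succ n ih =>
    obtain ⟨K, hK⟩ := ih
    refine ⟨K * (∏ _i : Fin (n + 1), ∏ _l : Fin (n + 2), 2 * c⁻¹) ^ m, fun x ν hx τ hτ => ?_⟩
    obtain ⟨τ, σ, rfl⟩ := exists_glue τ
    obtain ⟨hσ, hτ⟩ := glue_mem_cube.1 hτ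
    have hσ' : ∀ i, 0 < σ i := fun i => (hσ i (Set.mem_univ _)).1
    have hlow := low_mem_spread hx σ
    have hu : ∀ i l, i ≠ l → c * (‖Complex.exp (2 * x i)‖ + ‖Complex.exp (2 * x l)‖) ≤
      ‖Complex.exp (2 * x i) - Complex.exp (2 * x l)‖ := fun i l h => spread_le hc.le (hx i l h)
    have ht : ∀ i, ‖Complex.exp (2 * low x σ i)‖ ≤ ‖Complex.exp (2 * x i.castSucc)‖ := fun i => by
      have e := exp_two_gS (hσ' i) 1
      rw [one_mul, Complex.one_re, Real.rpow_one] at e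
      rw [low_apply, mul_add, Complex.exp_add, norm_mul, e]
      exact mul_le_of_le_one_right (norm_nonneg _) (hσ i (Set.mem_univ _)).2
    have hX := norm_crossL_le hc hu ht
    have hv : vand (fun i => Complex.exp (2 * low x σ i)) ≠ 0 := by
      refine vand_ne_zero.2 fun i l hil e => ?_
      have h1 := spread_le hc.le (hlow i l hil.ne)
      rw [e, sub_self, norm_zero] at h1
      have := mul_pos hc (add_pos (norm_pos_iff.2 (Complex.exp_ne_zero (2 * low x σ i)))
        (norm_pos_iff.2 (Complex.exp_ne_zero (2 * low x σ l))))
      rw [e] at this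
      linarith
    rw [alphaStarPullback_glue, norm_mul, norm_mul, norm_mul, norm_pow, norm_inv, norm_pow,
      ← alphaBound_glue m hσ']
    have hA := hK (low x σ) (ν ∘ Fin.castSucc) hlow τ hτ
    have hX' := pow_le_pow_left₀ (norm_nonneg _) hX m
    rw [mul_pow, ← pow_mul] at hX'
    simp only [alphaBound, Function.comp, Fin.val_last] at hA
    have hv' : ‖vand (fun i => Complex.exp (2 * low x σ i))‖ ^ (2 * m) ≠ 0 :=
      pow_ne_zero _ (norm_ne_zero_iff.2 hv)
    refine (mul_le_mul hA (mul_le_mul_of_nonneg_right (mul_le_mul_of_nonneg_right hX'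
      (by positivity)) (norm_nonneg _)) (by positivity)
      ((norm_nonneg _).trans hA)).trans (le_of_eq ?_)
    have aux : ∀ K V E P D W F : ℝ, V ≠ 0 →
        K * (V * E * P) * (D * W * V⁻¹ * F) = K * D * (W * (E * P) * F) := by
      intros; field_simp
    exact aux _ _ _ _ _ _ _ hv'

theorem integrableOn_prod_rpow {b : VarIdx n → ℝ} (hb : ∀ p, 0 < b p) :
    IntegrableOn (fun τ : VarIdx n → ℝ => ∏ p, τ p ^ (b p - 1)) (cube n) := by
  rw [IntegrableOn, cube_eq, volume_pi, Measure.restrict_pi_pi]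
  refine Integrable.fintype_prod (f := fun p t => t ^ (b p - 1)) fun p => ?_
  exact (intervalIntegrable_iff_integrableOn_Ioc_of_le zero_le_one).1
    (intervalIntegral.intervalIntegrable_rpow' (by linarith [hb p]))

theorem sub_re_gt {m : ℕ} {ν : Fin (n + 1) → ℂ}
    (hν : ∀ j : Fin n, (m : ℝ) < (ν j.castSucc - ν j.succ).re) {i j : Fin (n + 1)} (h : i < j) :
    0 < ((ν i + (i : ℕ) * m) - (ν j + (j : ℕ) * m)).re := by
  have : StrictAnti fun i : Fin (n + 1) => (ν i + (i : ℕ) * m).re := by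
    rw [Fin.strictAnti_iff_succ_lt]
    intro i
    have := hν i
    simp at this ⊢
    linarith
  have := this h
  simp only [Complex.sub_re] at this ⊢
  linarith

theorem Spr.exists_spread {N : ℕ} {x : Fin N → ℂ} (hx : x ∈ Spr N) :
    ∃ c : ℝ, 0 < c ∧ ∀ i l, i ≠ l → c ≤ |Real.sin (x i - x l).im| := by
  have h : ∀ᶠ c : ℝ in nhdsWithin 0 (Set.Ioi 0),
      ∀ i l, i ≠ l → c ≤ |Real.sin (x i - x l).im| := by
    simp only [Filter.eventually_all]
    intro i l h
    filter_upwards [Ioo_mem_nhdsGT (abs_pos.2 (hx i l h))] with c hc using hc.2.le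
  obtain ⟨c, h1, h2⟩ := (h.and self_mem_nhdsWithin).exists
  exact ⟨c, h2, h1⟩

theorem integrableOn_alphaStarPullback (m : ℕ) {x ν : Fin (n + 1) → ℂ} (hx : x ∈ Spr (n + 1))
    (hν : ∀ j : Fin n, (m : ℝ) < (ν j.castSucc - ν j.succ).re) :
    IntegrableOn (alphaStarPullback m x ν) (cube n) := by
  obtain ⟨c, hc, hxc⟩ := Spr.exists_spread hx
  obtain ⟨K, hK⟩ := norm_alphaStarPullback_le m hc n
  refine Integrable.mono' (g := fun τ => K * alphaBound m x (fun i => ν i + (i : ℕ) * m) τ)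
    ?_ (measurable_alphaStarPullback m x ν).aestronglyMeasurable
    ((ae_restrict_iff' (measurableSet_cube n)).2 (Filter.Eventually.of_forall fun τ hτ =>
      hK x ν hxc τ hτ))
  refine (Integrable.const_mul ?_ _).const_mul K
  refine integrableOn_prod_rpow fun p => sub_re_gt hν ?_
  have := Fin.le_def.1 p.2
  rw [Fin.lt_def, Fin.val_succ]
  simpa using Nat.lt_succ_of_le this

end TrigBA

namespace TrigBA
open LP
variable {n k : ℕ}

theorem exp_sub_exp (a b : ℂ) : Complex.exp (2 * a) - Complex.exp (2 * b) =
    2 * (Complex.exp a * Complex.exp b) * Complex.sinh (a - b) := by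
  rw [mul_comm (2 : ℂ) (_ * _), mul_assoc, Complex.two_sinh, ← Complex.exp_add, mul_sub,
    ← Complex.exp_add, ← Complex.exp_add]
  ring_nf

theorem vand_exp (x : Fin (n + 1) → ℂ) : vand (fun i => Complex.exp (2 * x i)) =
    2 ^ (prs (n + 1)).card * Complex.exp (∑ i, x i) ^ n * sinhVand x := by
  have h := prod_erase_eq_prs fun i _ : Fin (n + 1) => Complex.exp (x i)
  simp only [Finset.prod_const, Finset.card_erase_of_mem (Finset.mem_univ _), Finset.card_univ,
    Fintype.card_fin, Nat.add_sub_cancel, Finset.prod_pow] at h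
  rw [vand_eq, sinhVand_eq, Complex.exp_sum, h]
  simp only [exp_sub_exp, Finset.prod_mul_distrib, Finset.prod_const]

/-- The sign of `crossL`. -/
def crossSign (k : ℕ) : ℂ :=
  ∏ i : Fin k, ∏ l ∈ Finset.univ.erase i.castSucc, (sg i.castSucc l : ℂ)

theorem crossSign_sq (k : ℕ) : crossSign k * crossSign k = 1 := by
  rw [crossSign, ← Finset.prod_mul_distrib]
  refine Finset.prod_eq_one fun i _ => ?_
  rw [← Finset.prod_mul_distrib]
  refine Finset.prod_eq_one fun l _ => ?_
  simp only [sg]; split_ifs <;> simp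

theorem topCoeff_eq (m k : ℕ) : topCoeff m k * (crossSign k * 2 ^ (k * k)) ^ m = 1 := by
  rw [topCoeff, ← mul_pow]
  have : ∏ i : Fin k, ∏ l ∈ Finset.univ.erase i.castSucc, (sg i.castSucc l : ℂ) / 2 =
      crossSign k * (1 / 2) ^ (k * k) := by
    simp only [div_eq_mul_inv, one_mul, Finset.prod_mul_distrib, Finset.prod_const,
      Finset.card_erase_of_mem (Finset.mem_univ _), Finset.card_univ, Fintype.card_fin,
      Nat.add_sub_cancel, crossSign, pow_mul]
  rw [this, mul_mul_mul_comm, crossSign_sq, ← mul_pow]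
  norm_num

theorem crossL_eq (t : Fin k → ℂ) (u : Fin (k + 1) → ℂ) :
    crossL t u = crossSign k * ∏ i, ∏ l, (t i - u l) := by
  rw [crossL, crossSign, ← Finset.prod_mul_distrib]
  refine Finset.prod_congr rfl fun i _ => ?_
  rw [← Finset.mul_prod_erase _ _ (Finset.mem_univ i.castSucc),
    ← Finset.mul_prod_erase _ (fun l => t i - u l) (Finset.mem_univ i.castSucc), mul_left_comm,
    ← Finset.prod_mul_distrib, if_pos le_rfl]
  congr 1
  refine Finset.prod_congr rfl fun l hl => ?_
  have hl' := Finset.ne_of_mem_erase hl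
  simp only [sg]
  by_cases h : i.castSucc ≤ l
  · rw [if_pos h, if_pos (lt_of_le_of_ne h (Ne.symm hl'))]; simp
  · rw [if_neg h, if_neg fun h' => h h'.le]; push_cast; ring

theorem crossL_exp (z : Fin k → ℂ) (x : Fin (k + 1) → ℂ) :
    crossL (fun i => Complex.exp (2 * z i)) (fun l => Complex.exp (2 * x l)) =
      crossSign k * (2 ^ (k * (k + 1)) * Complex.exp (∑ i, z i) ^ (k + 1) *
        Complex.exp (∑ l, x l) ^ k * ∏ q : Fin k × Fin (k + 1), Complex.sinh (z q.1 - x q.2)) := by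
  rw [crossL_eq, Fintype.prod_prod_type]
  simp only [exp_sub_exp, Finset.prod_mul_distrib, Finset.prod_const, Finset.card_univ,
    Fintype.card_fin, Complex.exp_sum, Finset.prod_pow, pow_mul']
  ring

theorem low_mem_spr {x : Fin (k + 1) → ℂ} (hx : x ∈ Spr (k + 1)) (σ : Fin k → ℝ) :
    low x σ ∈ Spr k := fun i l h => by
  have := hx i.castSucc l.castSucc (by simpa using h)
  simpa [low_apply, gS] using this

theorem integrand_step (m : ℕ) {x : Fin (n + 2) → ℂ} (hx : x ∈ Spr (n + 2)) (a b : ℂ)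
    {σ : Fin (n + 1) → ℝ} (hσ : σ ∈ box (n + 1)) :
    vand (fun i => Complex.exp (2 * low x σ i)) ^ m *
      Complex.exp (-2 * b * ∑ i, low x σ i) *
      (crossL (fun i => Complex.exp (2 * low x σ i)) (fun l => Complex.exp (2 * x l)) ^ m *
          (vand (fun i => Complex.exp (2 * low x σ i)) ^ (2 * m))⁻¹ *
          ∏ i : Fin (n + 1), (Complex.exp ((b - a - m - 1) *
            (2 * low x σ i)) * Complex.exp (2 * x i.castSucc))) =
    (crossSign (n + 1) * 2 ^ ((n + 1) * (n + 2)) *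
      ((1 / 2) ^ (prs (n + 1)).card * (1 / 2) ^ (prs (n + 2)).card)) ^ m * 2 ^ (n + 1) *
      vand (fun i => Complex.exp (2 * x i)) ^ m * Complex.exp (-2 * a * ∑ i, x i) *
      (ker (n + 1) m (2 * a) (wj gS x σ) * ∏ i, gS' (σ i)) := by
  have hσ' := mem_box.1 hσ
  have hz := sinhVand_ne_of_spr (low_mem_spr hx σ)
  have hX := sinhVand_ne_of_spr hx
  have e1 : ∀ i, Complex.exp ((b - a - m - 1) * (2 * low x σ i)) * Complex.exp (2 * x i.castSucc) =
      Complex.exp ((2 * b - 2 * a) * low x σ i) * (Complex.exp (low x σ i) ^ (2 * m))⁻¹ *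
        (2 * gS' (σ i)) := fun i => by
    have h0 : Complex.exp (-(2 * gS (σ i))) = 2 * gS' (σ i) := by
      have h2 : -(2 * gS (σ i)) = ((-Real.log (σ i) : ℝ) : ℂ) := by rw [gS]; push_cast; ring
      rw [h2, ← Complex.ofReal_exp, Real.exp_neg, Real.exp_log (hσ' i).1, gS']
      push_cast
      field_simp
    rw [← h0, ← Complex.exp_nat_mul, ← Complex.exp_neg, ← Complex.exp_add, ← Complex.exp_add,
      ← Complex.exp_add, low_apply]
    congr 1
    push_cast
    ring
  have e2 : ∏ i : Fin (n + 1), (Complex.exp ((b - a - m - 1) *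
      (2 * low x σ i)) * Complex.exp (2 * x i.castSucc)) =
      Complex.exp ((2 * b - 2 * a) * ∑ i, low x σ i) * (Complex.exp (∑ i, low x σ i) ^ (2 * m))⁻¹ *
        (2 ^ (n + 1) * ∏ i, gS' (σ i)) := by
    simp only [e1, Finset.prod_mul_distrib, Finset.prod_const, Finset.card_univ, Fintype.card_fin,
      ← Complex.exp_sum, ← Finset.mul_sum, Finset.prod_inv_distrib, Finset.prod_pow]
  have e3 : Complex.exp (∑ c, -(2 * a) * eps (n + 1) c * wj gS x σ c) =
      Complex.exp (2 * a * ∑ i, x i) * Complex.exp (-2 * a * ∑ i, low x σ i) := by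
    rw [← Complex.exp_add, Fintype.sum_sum_type, Finset.mul_sum, Finset.mul_sum]
    congr 2 <;> refine Finset.sum_congr rfl fun i _ => ?_
    · rw [eps_inl]; simp [wj]
    · rw [eps_inr, mul_one, low]; simp
  have e4 : ev (wj gS x σ) (Bx (n + 1)) = sinhVand x := by rw [ev_Bx, sinhVand_eq]; rfl
  have e5 : ev (wj gS x σ) (Bz (n + 1)) = sinhVand (low x σ) := by rw [ev_Bz, sinhVand_eq]; rfl
  have e6 : ev (wj gS x σ) (LP.X (n + 1)) =
      ∏ q : Fin (n + 1) × Fin (n + 2), Complex.sinh (low x σ q.1 - x q.2) := by rw [ev_X]; rfl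
  have e7 : Complex.exp (-2 * b * ∑ i, low x σ i) * Complex.exp ((2 * b - 2 * a) * ∑ i, low x σ i) =
      Complex.exp (-2 * a * ∑ i, low x σ i) := by rw [← Complex.exp_add]; ring_nf
  have e8 : Complex.exp (-2 * a * ∑ i, x i) * Complex.exp (2 * a * ∑ i, x i) = 1 := by
    rw [← Complex.exp_add, ← Complex.exp_zero]; ring_nf
  have aux : ∀ V C E F G P : ℂ, V ≠ 0 →
      V ^ m * F * (C ^ m * (V ^ (2 * m))⁻¹ * (G * (E ^ (2 * m))⁻¹ * P)) =
      (C * V⁻¹ * (E ^ 2)⁻¹) ^ m * (F * G) * P := fun V C E F G P hV => by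
    rw [mul_pow, mul_pow, inv_pow, inv_pow, ← pow_mul, two_mul m, pow_add V]
    field_simp
  have hV : vand (fun i => Complex.exp (2 * low x σ i)) ≠ 0 := by
    rw [vand_exp]
    exact mul_ne_zero (mul_ne_zero (by simp) (pow_ne_zero _ (Complex.exp_ne_zero _))) hz
  have core : crossL (fun i => Complex.exp (2 * low x σ i)) (fun l => Complex.exp (2 * x l)) *
      (vand (fun i => Complex.exp (2 * low x σ i)))⁻¹ * (Complex.exp (∑ i, low x σ i) ^ 2)⁻¹ =
      crossSign (n + 1) * 2 ^ ((n + 1) * (n + 2)) *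
      ((1 / 2) ^ (prs (n + 1)).card * (1 / 2) ^ (prs (n + 2)).card) *
      vand (fun i => Complex.exp (2 * x i)) *
      ((∏ q : Fin (n + 1) × Fin (n + 2), Complex.sinh (low x σ q.1 - x q.2)) /
        (sinhVand x * sinhVand (low x σ))) := by
    rw [vand_exp, vand_exp, crossL_exp]
    have hE := Complex.exp_ne_zero (∑ i, low x σ i)
    generalize (∏ q : Fin (n + 1) × Fin (n + 2), Complex.sinh (low x σ q.1 - x q.2)) = Y
    generalize Complex.exp (∑ i, low x σ i) = E at hE ⊢
    generalize Complex.exp (∑ i, x i) = F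
    rw [one_div, inv_pow, inv_pow]
    generalize (prs (n + 1)).card = c₁
    generalize (prs (n + 2)).card = c₂
    field_simp
    ring
  rw [e2, ker, e3, e4, e5, e6, zpow_natCast, aux _ _ _ _ _ _ hV, core, e7, mul_pow, mul_pow]
  linear_combination (-((crossSign (n + 1) * 2 ^ ((n + 1) * (n + 2)) *
      ((1 / 2) ^ (prs (n + 1)).card * (1 / 2) ^ (prs (n + 2)).card)) ^ m * 2 ^ (n + 1) *
      vand (fun i => Complex.exp (2 * x i)) ^ m * Complex.exp (-2 * a * ∑ i, low x σ i) *
      ((∏ q : Fin (n + 1) × Fin (n + 2), Complex.sinh (low x σ q.1 - x q.2)) /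
        (sinhVand x * sinhVand (low x σ))) ^ m * ∏ i, gS' (σ i))) * e8

end TrigBA

namespace TrigBA
open LP
variable {n k : ℕ}

/-- The integral formula at `(x, ν)` for the numerator `T`. -/
def SelbergEq (m : ℕ) (T : TrigPoly (n + 1)) (x ν : Fin (n + 1) → ℂ) : Prop :=
  ∫ τ in cube n, alphaStarPullback m x ν τ =
    constC4 m ν * vand (fun i => Complex.exp (2 * x i)) ^ m *
      Complex.exp (-2 * ν (Fin.last n) * ∑ i, x i) * baFun m T x ν

theorem constC4_eq {N : ℕ} (m : ℕ) (ν : Fin N → ℂ) : constC4 m ν =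
    (-1) ^ (m * (prs N).card) * ∏ p ∈ prs N, (Complex.Gamma (m + 1) * Complex.Gamma (ν p.1 - ν p.2) /
        Complex.Gamma (ν p.1 - ν p.2 + m + 1)) := by
  rw [constC4, card_prs, ← prod_prs (fun i j => Complex.Gamma (m + 1) * Complex.Gamma (ν i - ν j) /
        Complex.Gamma (ν i - ν j + m + 1))]

theorem constC4_succ (m : ℕ) (ν : Fin (k + 1) → ℂ) : constC4 m ν =
    constC4 m (ν ∘ Fin.castSucc) * ∏ i : Fin k, ((-1) ^ m * (Complex.Gamma (m + 1) *
      Complex.Gamma (ν i.castSucc - ν (Fin.last k)) /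
        Complex.Gamma (ν i.castSucc - ν (Fin.last k) + m + 1))) := by
  rw [constC4_eq, constC4_eq, prod_prs_succ, card_prs_succ, Finset.prod_mul_distrib,
    Finset.prod_const, Finset.card_univ, Fintype.card_fin, ← pow_mul, mul_add, pow_add]
  simp only [Function.comp]
  ring

theorem sub_re_gt_cast {m : ℕ} {ν : Fin (n + 1) → ℂ}
    (hν : ∀ j : Fin n, (m : ℝ) < (ν j.castSucc - ν j.succ).re) {i j : Fin (n + 1)} (h : i < j) :
    (m : ℝ) < (ν i - ν j).re := by
  have h1 := sub_re_gt hν h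
  have h2 : ((i : ℕ) : ℝ) + 1 ≤ (j : ℕ) := by exact_mod_cast Fin.lt_def.1 h
  simp at h1 ⊢
  nlinarith [Nat.cast_nonneg (α := ℝ) m]

theorem normC_ne_zero {m : ℕ} {ν : Fin (n + 1) → ℂ}
    (hν : ∀ j : Fin n, (m : ℝ) < (ν j.castSucc - ν j.succ).re) : normC m ν ≠ 0 := by
  refine Finset.prod_ne_zero_iff.2 fun k hk => Finset.prod_ne_zero_iff.2 fun i _ =>
    Finset.prod_ne_zero_iff.2 fun j hj h => ?_
  have h1 := sub_re_gt_cast hν (Finset.mem_Ioi.1 hj)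
  have h2 : ((k : ℕ) : ℝ) ≤ m := by exact_mod_cast (Finset.mem_Icc.1 hk).2
  rw [sub_eq_zero.1 h, Complex.natCast_re] at h1
  linarith

theorem betaIntegral_eq {m : ℕ} {d : ℂ} (hd : 0 < d.re) : Complex.betaIntegral d (m + 1) =
    Complex.Gamma (m + 1) * Complex.Gamma d / Complex.Gamma (d + m + 1) := by
  have h1 : 0 < ((m : ℂ) + 1).re := by simp; positivity
  have h := Complex.Gamma_mul_Gamma_eq_betaIntegral hd h1
  have h2 : Complex.Gamma (d + m + 1) ≠ 0 :=
    Complex.Gamma_ne_zero_of_re_pos (by simp; positivity)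
  rw [eq_div_iff h2, mul_comm (Complex.Gamma (m + 1)), h, add_assoc, mul_comm]

theorem combine_factors {C a b S H W U w V E D top P G F : ℂ} (ha : a ≠ 0) (hb : b ≠ 0)
    (h1 : H * b * D = a * (top * (P * w * G)) * F) (h2 : top * S = 1) (h3 : W * U * w = 1) :
    C * a⁻¹ * (S * H * U * W * V * E) * D = C * (P * G) * V * E * (b⁻¹ * F) := by
  field_simp
  linear_combination (C * S * U * W * V * E) * h1 + (C * a * P * G * F * V * E) * h3 +
    (C * a * U * W * V * E * w * P * G * F) * h2

theorem selberg_step_generic {m : ℕ} (hm : 0 < m) {T : TrigPoly (n + 1)} {T' : TrigPoly (n + 2)}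
    (hE : ∀ ν, IsEig m (fun i => 2 * ν i) (T.toLP ν) m (-4 * ∑ i, ν i * ν i))
    (hl : ∀ ν, Lead (wt 1 (n + 1)) (T.toLP ν) (m • rho (n + 1))
      (((1 / 2 : ℂ) ^ (prs (n + 1)).card) ^ m * normC m ν))
    (hE' : ∀ ν, IsEig m (fun i => 2 * ν i) (T'.toLP ν) m (-4 * ∑ i, ν i * ν i))
    (hl' : ∀ ν, Lead (wt 1 (n + 2)) (T'.toLP ν) (m • rho (n + 2))
      (((1 / 2 : ℂ) ^ (prs (n + 2)).card) ^ m * normC m ν))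
    (ih : ∀ x ∈ Spr (n + 1), ∀ ν : Fin (n + 1) → ℂ,
      (∀ j : Fin n, (m : ℝ) < (ν j.castSucc - ν j.succ).re) → SelbergEq m T x ν) :
    ∃ A : ℕ, ∀ ν : Fin (n + 2) → ℂ,
      (∀ j : Fin (n + 1), (m : ℝ) < (ν j.castSucc - ν j.succ).re) →
      (∀ i : Fin (n + 1), (A : ℝ) ≤ (2 * ν i.castSucc - 2 * ν (Fin.last (n + 1))).re) →
      Gen (ν ∘ Fin.castSucc) → Gen ν →
      (∀ κ : Fin (n + 1) → ℤ, normC m (fun i => -ν (Fin.castSucc i) - κ i / 2) ≠ 0) →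
      ∀ x ∈ Spr (n + 2), SelbergEq m T' x ν := by
  obtain ⟨A, hA⟩ := exists_trans_eig hm hE hl hE' hl'
  refine ⟨A, fun ν hν hge hg hg' hn x hx => ?_⟩
  have hsn : (Fin.snoc (α := fun _ => ℂ) (ν ∘ Fin.castSucc) (ν (Fin.last (n + 1))) :
    Fin (n + 2) → ℂ) = ν := Fin.snoc_init_self ν
  have h := hA (ν ∘ Fin.castSucc) (ν (Fin.last (n + 1))) hge hg (hsn.symm ▸ hg') hn x hx
  rw [hsn] at h
  have hν' : ∀ j : Fin n, (m : ℝ) < ((ν ∘ Fin.castSucc) j.castSucc - (ν ∘ Fin.castSucc) j.succ).re :=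
    fun j => by simpa [Function.comp] using hν j.castSucc
  have hd : ∀ i : Fin (n + 1), 0 < (ν i.castSucc - ν (Fin.last (n + 1))).re := fun i =>
    (Nat.cast_nonneg m).trans_lt (sub_re_gt_cast hν (Fin.castSucc_lt_last i))
  obtain ⟨D, hD⟩ : ∃ D, D = trans gS gS' (jF (ker (n + 1) m (2 * ν (Fin.last (n + 1))))
    (cl (B (n + 1)) (fun i => 2 * (ν ∘ Fin.castSucc) i) (T.toLP (ν ∘ Fin.castSucc)) m)) x := ⟨_, rfl⟩
  obtain ⟨c, hc⟩ : ∃ c : ℂ, c = crossSign (n + 1) * 2 ^ ((n + 1) * (n + 2)) *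
      ((1 / 2) ^ (prs (n + 1)).card * (1 / 2) ^ (prs (n + 2)).card) := ⟨_, rfl⟩
  have h1 : ∫ τ in cube (n + 1), alphaStarPullback m x ν τ =
      constC4 m (ν ∘ Fin.castSucc) * (normC m (ν ∘ Fin.castSucc))⁻¹ * (c ^ m * 2 ^ (n + 1) *
      vand (fun i => Complex.exp (2 * x i)) ^ m *
      Complex.exp (-2 * ν (Fin.last (n + 1)) * ∑ i, x i)) * D := by
    rw [setIntegral_cube_succ (integrableOn_alphaStarPullback m hx hν), hD, trans,
      ← integral_const_mul]
    refine setIntegral_congr_fun (measurableSet_box _) fun σ hσ => ?_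
    have h2 := ih (low x σ) (low_mem_spr hx σ) (ν ∘ Fin.castSucc) hν'
    have h3 := integrand_step m hx (ν (Fin.last (n + 1))) (ν (Fin.last n).castSucc) hσ
    rw [← hc] at h3
    simp only [alphaStarPullback_glue, integral_mul_const]
    rw [h2, TrigPoly.baFun_eq, jF]
    simp only [Function.comp] at h3 ⊢
    have aux : ∀ a b e f g r r' s t u v : ℂ, b * e * r = s * (t * u) →
        a * b * e * (f * g) * r = a * f * s * (t * g * u) := by
      intro a b e f g r r' s t u v hh
      linear_combination (a * f * g) * hh
    exact aux _ _ _ _ _ _ 0 _ _ _ 0 h3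
  have hn1 := normC_ne_zero hν'
  have hn2 := normC_ne_zero hν
  rw [SelbergEq, h1, TrigPoly.baFun_eq, constC4_succ m ν]
  rw [← hD] at h
  simp only [Function.comp, betaIntegral_eq (hd _)] at h ⊢
  rw [Finset.prod_mul_distrib, Finset.prod_const, Finset.card_univ, Fintype.card_fin] at h ⊢
  rw [mul_pow ((-1 : ℂ) ^ m) ((1 / 2) ^ (m + 1)) (n + 1)] at h
  have hcm : c ^ m = (crossSign (n + 1) * 2 ^ ((n + 1) * (n + 1))) ^ m *
      ((1 / 2) ^ (prs (n + 1)).card * (1 / 2) ^ (prs (n + 2)).card) ^ m * (2 ^ (n + 1)) ^ m := by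
    rw [hc, ← mul_pow, ← mul_pow]
    congr 1
    rw [show (n + 1) * (n + 2) = (n + 1) * (n + 1) + (n + 1) by ring, pow_add]
    ring
  have htop := topCoeff_eq m (n + 1)
  have hW : (2 : ℂ) ^ (n + 1) * (2 ^ (n + 1)) ^ m * ((1 / 2) ^ (m + 1)) ^ (n + 1) = 1 := by
    rw [← pow_succ', ← pow_mul, ← pow_mul, mul_comm (n + 1), ← mul_pow]; norm_num
  rw [hcm]
  exact combine_factors hn1 hn2 h htop hW

end TrigBA

namespace TrigBA
open LP
variable {n k : ℕ}

/-! ### Analytic continuation in the spectral parameter -/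

theorem differentiableAt_integral_exp {Ω : Type*} [MeasurableSpace Ω] {μ : Measure Ω} {h : Ω → ℂ}
    {l : Ω → ℝ} (hl : Measurable l) {U : Set ℂ} (hU : IsOpen U)
    (hint : ∀ s ∈ U, Integrable (fun ω => h ω * Complex.exp (s * l ω)) μ) {s₀ : ℂ} (hs : s₀ ∈ U) :
    DifferentiableAt ℂ (fun s => ∫ ω, h ω * Complex.exp (s * l ω) ∂μ) s₀ := by
  obtain ⟨r, hr, hrU⟩ := Metric.isOpen_iff.1 hU s₀ hs
  obtain ⟨ε, hε, hεr⟩ : ∃ ε : ℝ, 0 < ε ∧ 2 * ε < r := ⟨r / 4, by linarith, by linarith⟩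
  have hpm : ∀ a : ℝ, |a| ≤ 2 * ε → s₀ + (a : ℂ) ∈ U := fun a ha => hrU <| by
    rw [Metric.mem_ball, dist_eq_norm, add_sub_cancel_left, Complex.norm_real]
    exact ha.trans_lt hεr
  have h1 := hint _ (hpm (2 * ε) (by rw [abs_of_pos (by linarith)]))
  have h2 := hint _ (hpm (-(2 * ε)) (by rw [abs_neg, abs_of_pos (by linarith)]))
  have hnorm : ∀ (s : ℂ) ω, ‖h ω * Complex.exp (s * l ω)‖ = ‖h ω‖ * Real.exp (s.re * l ω) :=
    fun s ω => by rw [norm_mul, Complex.norm_exp, Complex.re_mul_ofReal]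
  have hmeas : ∀ s ∈ U, AEStronglyMeasurable (fun ω => h ω * Complex.exp (s * l ω)) μ :=
    fun s hs => (hint s hs).aestronglyMeasurable
  have hmU : ∀ s ∈ Metric.ball s₀ ε, s ∈ U := fun s hs =>
    hrU (Metric.ball_subset_ball (by linarith) hs)
  refine (hasDerivAt_integral_of_dominated_loc_of_deriv_le (𝕜 := ℂ) (μ := μ) (x₀ := s₀)
    (F := fun s ω => h ω * Complex.exp (s * l ω))
    (F' := fun s ω => h ω * Complex.exp (s * l ω) * l ω)
    (bound := fun ω => ε⁻¹ * (‖h ω * Complex.exp ((s₀ + (2 * ε : ℝ)) * l ω)‖ +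
      ‖h ω * Complex.exp ((s₀ + (-(2 * ε) : ℝ)) * l ω)‖))
    (Metric.ball_mem_nhds s₀ hε) ?_ (hint _ hs) ?_ ?_ ?_ ?_).2.differentiableAt
  · filter_upwards [hU.mem_nhds hs] with s hs using hmeas s hs
  · exact (hmeas s₀ hs).mul (Complex.measurable_ofReal.comp hl).aestronglyMeasurable
  · refine Filter.Eventually.of_forall fun ω s hsb => ?_
    have h3 : |s.re - s₀.re| ≤ ε := by
      rw [← Complex.sub_re]
      exact (Complex.abs_re_le_norm _).trans (mem_ball_iff_norm.1 hsb).le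
    have h3 := abs_le.1 h3
    rw [norm_mul, hnorm, hnorm, hnorm, Complex.norm_real, Real.norm_eq_abs]
    have h5 : |l ω| ≤ ε⁻¹ * Real.exp (ε * |l ω|) := by
      rw [inv_mul_eq_div, le_div_iff₀ hε, mul_comm]
      linarith [Real.add_one_le_exp (ε * |l ω|)]
    have h6 : Real.exp (s.re * l ω) * Real.exp (ε * |l ω|) ≤
        Real.exp ((s₀ + (2 * ε : ℝ)).re * l ω) + Real.exp ((s₀ + (-(2 * ε) : ℝ)).re * l ω) := by
      rw [← Real.exp_add, Complex.add_re, Complex.add_re, Complex.ofReal_re, Complex.ofReal_re]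
      rcases le_total 0 (l ω) with h0 | h0
      · rw [abs_of_nonneg h0]
        refine le_add_of_le_of_nonneg (Real.exp_le_exp.2 ?_) (Real.exp_pos _).le
        nlinarith
      · rw [abs_of_nonpos h0]
        refine le_add_of_nonneg_of_le (Real.exp_pos _).le (Real.exp_le_exp.2 ?_)
        nlinarith
    calc ‖h ω‖ * Real.exp (s.re * l ω) * |l ω|
        ≤ ‖h ω‖ * Real.exp (s.re * l ω) * (ε⁻¹ * Real.exp (ε * |l ω|)) :=
          mul_le_mul_of_nonneg_left h5 (by positivity)
      _ = ε⁻¹ * (‖h ω‖ * (Real.exp (s.re * l ω) * Real.exp (ε * |l ω|))) := by ring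
      _ ≤ ε⁻¹ * (‖h ω‖ * (Real.exp ((s₀ + (2 * ε : ℝ)).re * l ω) +
            Real.exp ((s₀ + (-(2 * ε) : ℝ)).re * l ω))) := by gcongr
      _ = _ := by ring
  · exact (h1.norm.add h2.norm).const_mul _
  · refine Filter.Eventually.of_forall fun ω s _ => ?_
    have := ((hasDerivAt_mul_const (x := s) (l ω : ℂ)).cexp).const_mul (h ω)
    simpa [mul_assoc] using this

/-- A line of spectral parameters. -/
def shiftP (ν : Fin (n + 1) → ℂ) (s : ℂ) (i : Fin (n + 1)) : ℂ := ν i + s * ((tt ^ (i : ℕ) : ℝ) : ℂ)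

theorem shiftP_zero (ν : Fin (n + 1) → ℂ) : shiftP ν 0 = ν := by funext i; simp [shiftP]

theorem differentiable_shiftP (ν : Fin (n + 1) → ℂ) (i : Fin (n + 1)) :
    Differentiable ℂ fun s => shiftP ν s i := by unfold shiftP; fun_prop

theorem differentiable_eval_shiftP (ν : Fin (n + 1) → ℂ) (p : MvPolynomial (Fin (n + 1)) ℂ) :
    Differentiable ℂ fun s => MvPolynomial.eval (shiftP ν s) p := by
  induction p using MvPolynomial.induction_on with
  | C a => simp
  | add p q hp hq => simpa using hp.fun_add hq
  | mul_X p i hp => simpa using hp.fun_mul (differentiable_shiftP ν i)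

/-- The parameters on a line at which the integral converges. -/
def shiftU (m : ℕ) (ν : Fin (n + 1) → ℂ) : Set ℂ :=
  {s | ∀ j : Fin n, (m : ℝ) < (shiftP ν s j.castSucc - shiftP ν s j.succ).re}

theorem shiftP_sub (ν : Fin (n + 1) → ℂ) (s : ℂ) (i j : Fin (n + 1)) :
    (shiftP ν s i - shiftP ν s j).re =
      (ν i - ν j).re + s.re * (tt ^ (i : ℕ) - tt ^ (j : ℕ)) := by
  simp only [shiftP, Complex.sub_re, Complex.add_re, Complex.re_mul_ofReal]; ring

theorem isOpen_shiftU (m : ℕ) (ν : Fin (n + 1) → ℂ) : IsOpen (shiftU m ν) := by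
  simp only [shiftU, shiftP_sub, Set.ofPred_forall]
  exact isOpen_iInter_of_finite fun j => isOpen_lt continuous_const (by fun_prop)

theorem convex_shiftU (m : ℕ) (ν : Fin (n + 1) → ℂ) : Convex ℝ (shiftU m ν) := by
  intro s hs t ht a b ha hb hab j
  have h1 := hs j
  have h2 := ht j
  rw [shiftP_sub] at h1 h2 ⊢
  simp only [Complex.add_re, Complex.real_smul, Complex.re_ofReal_mul]
  have e : (ν j.castSucc - ν j.succ).re +
      (a * s.re + b * t.re) * (tt ^ (j.castSucc : ℕ) - tt ^ (j.succ : ℕ)) =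
      a * ((ν j.castSucc - ν j.succ).re + s.re * (tt ^ (j.castSucc : ℕ) - tt ^ (j.succ : ℕ))) +
      b * ((ν j.castSucc - ν j.succ).re + t.re * (tt ^ (j.castSucc : ℕ) - tt ^ (j.succ : ℕ))) := by
    linear_combination (-(ν j.castSucc - ν j.succ).re) * hab
  rw [e]
  have e2 : (m : ℝ) = a * m + b * m := by rw [← add_mul, hab, one_mul]
  rcases ha.eq_or_lt with rfl | ha
  · rw [zero_add] at hab; subst hab; simpa using h2
  · rw [e2]
    exact add_lt_add_of_lt_of_le (mul_lt_mul_of_pos_left h1 ha) (mul_le_mul_of_nonneg_left h2.le hb)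

theorem alphaStarPullback_shiftP (m : ℕ) (x ν : Fin (n + 1) → ℂ) (s : ℂ) (τ : VarIdx n → ℝ) :
    alphaStarPullback m x (shiftP ν s) τ = Complex.exp (s * ∑ p : VarIdx n,
        ((tt ^ (p.1.2 : ℕ) - tt ^ (p.1.2 + 1 : ℕ) : ℝ) : ℂ) * (2 * x p.1.1)) *
      (alphaStarPullback m x ν τ * Complex.exp (s * ((∑ p : VarIdx n,
        (tt ^ (p.1.2 : ℕ) - tt ^ (p.1.2 + 1 : ℕ)) * ∑ q : VarIdx n with
          q.1.1 = p.1.1 ∧ p.1.2.castSucc ≤ q.1.2.castSucc, Real.log (τ q) : ℝ) : ℂ))) := by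
  have e : ∏ p : VarIdx n, Complex.exp ((shiftP ν s p.1.2.castSucc - shiftP ν s p.1.2.succ +
      ((-(m : ℤ) - 1 : ℤ) : ℂ)) * contourLog x τ p.1.1 p.1.2.castSucc) =
      (∏ p : VarIdx n, Complex.exp ((ν p.1.2.castSucc - ν p.1.2.succ +
      ((-(m : ℤ) - 1 : ℤ) : ℂ)) * contourLog x τ p.1.1 p.1.2.castSucc)) *
      (Complex.exp (s * ∑ p : VarIdx n,
        ((tt ^ (p.1.2 : ℕ) - tt ^ (p.1.2 + 1 : ℕ) : ℝ) : ℂ) * (2 * x p.1.1)) *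
      Complex.exp (s * ((∑ p : VarIdx n,
        (tt ^ (p.1.2 : ℕ) - tt ^ (p.1.2 + 1 : ℕ)) * ∑ q : VarIdx n with
          q.1.1 = p.1.1 ∧ p.1.2.castSucc ≤ q.1.2.castSucc, Real.log (τ q) : ℝ) : ℂ))) := by
    rw [← Complex.exp_add, ← Complex.exp_sum, ← Complex.exp_sum, ← Complex.exp_add]
    congr 1
    rw [Complex.ofReal_sum, Finset.mul_sum, Finset.mul_sum, ← Finset.sum_add_distrib,
      ← Finset.sum_add_distrib]
    refine Finset.sum_congr rfl fun p _ => ?_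
    simp only [shiftP, contourLog, Fin.val_castSucc, Fin.val_succ]
    push_cast
    ring
  simp only [alphaStarPullback, alphaStar, omegaStar]
  rw [e]
  ring

theorem differentiableOn_integral_alpha (m : ℕ) {x : Fin (n + 1) → ℂ} (hx : x ∈ Spr (n + 1))
    (ν : Fin (n + 1) → ℂ) :
    DifferentiableOn ℂ (fun s => ∫ τ in cube n, alphaStarPullback m x (shiftP ν s) τ)
      (shiftU m ν) := by
  simp only [alphaStarPullback_shiftP, integral_const_mul]
  intro s₀ hs₀
  refine (DifferentiableAt.mul (by fun_prop)
    (differentiableAt_integral_exp (by fun_prop) (isOpen_shiftU m ν) (fun s hs => ?_)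
      hs₀)).differentiableWithinAt
  have h := integrableOn_alphaStarPullback m hx hs
  rw [IntegrableOn, show alphaStarPullback m x (shiftP ν s) = _ from
    funext fun τ => alphaStarPullback_shiftP m x ν s τ] at h
  exact (integrable_const_mul_iff (Complex.exp_ne_zero _).isUnit _).1 h

theorem differentiableOn_constC4 (m : ℕ) (ν : Fin (n + 1) → ℂ) :
    DifferentiableOn ℂ (fun s => constC4 m (shiftP ν s)) (shiftU m ν) := by
  intro s hs
  refine DifferentiableAt.differentiableWithinAt ?_
  simp only [constC4_eq]
  refine DifferentiableAt.const_mul (DifferentiableAt.fun_finsetProd fun p hp => ?_) _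
  have h0 : 0 < (shiftP ν s p.1 - shiftP ν s p.2).re :=
    (Nat.cast_nonneg m).trans_lt (sub_re_gt_cast hs (mem_prs.1 hp))
  have h1 : 0 < (shiftP ν s p.1 - shiftP ν s p.2 + m + 1).re := by simp at h0 ⊢; linarith [Nat.cast_nonneg (α := ℝ) m]
  have hG : ∀ z : ℂ, 0 < z.re → DifferentiableAt ℂ Complex.Gamma z := fun z hz =>
    Complex.differentiableAt_Gamma z fun j h => by
      rw [h, Complex.neg_re, Complex.natCast_re] at hz
      linarith [Nat.cast_nonneg (α := ℝ) j]
  have hd : DifferentiableAt ℂ (fun s => shiftP ν s p.1 - shiftP ν s p.2) s :=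
    ((differentiable_shiftP ν p.1).sub (differentiable_shiftP ν p.2)).differentiableAt
  refine DifferentiableAt.fun_div ((differentiableAt_const _).fun_mul ?_) ?_
    (Complex.Gamma_ne_zero_of_re_pos h1)
  · exact DifferentiableAt.fun_comp' s (hG _ h0) hd
  · exact DifferentiableAt.fun_comp' s (hG _ h1) ((hd.add_const _).add_const _)

theorem differentiableOn_baFun (m : ℕ) (T : TrigPoly (n + 1)) {x : Fin (n + 1) → ℂ}
    (hx : x ∈ Spr (n + 1)) (ν : Fin (n + 1) → ℂ) :
    DifferentiableOn ℂ (fun s => baFun m T x (shiftP ν s)) (shiftU m ν) := by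
  intro s hs
  refine DifferentiableAt.differentiableWithinAt ?_
  have hn : DifferentiableAt ℂ (fun s => normC m (shiftP ν s)) s := by
    unfold normC
    refine DifferentiableAt.fun_finsetProd fun k _ => DifferentiableAt.fun_finsetProd fun i _ =>
      DifferentiableAt.fun_finsetProd fun j _ => ?_
    exact (((differentiable_shiftP ν i).sub (differentiable_shiftP ν j)).sub_const _).differentiableAt
  unfold baFun
  refine DifferentiableAt.fun_mul (DifferentiableAt.fun_div ?_ (hn.const_mul _)
    (mul_ne_zero (pow_ne_zero _ (sinhVand_ne_of_spr hx)) (normC_ne_zero hs))) ?_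
  · simp only [TrigPoly.eval, Finsupp.sum]
    exact DifferentiableAt.fun_sum fun μ _ =>
      (differentiable_eval_shiftP ν _).differentiableAt.mul_const _
  · refine (DifferentiableAt.const_mul (DifferentiableAt.fun_sum fun i _ => ?_) _).cexp
    exact (differentiable_shiftP ν i).differentiableAt.mul_const _

end TrigBA

namespace TrigBA
open LP
variable {n k : ℕ}

theorem countable_not_gen_powers {N : ℕ} (ν : Fin N → ℂ) :
    {s : ℂ | ¬ Gen fun i => ν i + s * ((tt ^ (i : ℕ) : ℝ) : ℂ)}.Countable := by
  rcases countable_not_gen (fun i : Fin N => ((tt ^ (i : ℕ) : ℝ) : ℂ)) ν with h | ⟨κ, hκ, h, -⟩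
  · exact h
  · refine absurd (wt_injective one_ne_zero N ?_) hκ
    rw [map_zero]
    have h1 : (∑ i : Fin N, tt ^ (i : ℕ) * (κ i : ℝ)) = 0 := by exact_mod_cast h
    simp only [wt, AddMonoidHom.coe_mk, ZeroHom.coe_mk, Int.cast_one, one_mul]
    rw [← h1]
    exact Finset.sum_congr rfl fun i _ => mul_comm _ _

theorem pow_tt_lt {i j : ℕ} (h : i < j) : tt ^ j < tt ^ i :=
  pow_lt_pow_right_of_lt_one₀ tt_pos tt_lt_one h

theorem countable_normC_zero (m : ℕ) {N : ℕ} (ν : Fin N → ℂ) :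
    {s : ℂ | ∃ κ : Fin N → ℤ,
      normC m (fun i => -(ν i + s * ((tt ^ (i : ℕ) : ℝ) : ℂ)) - κ i / 2) = 0}.Countable := by
  have : {s : ℂ | ∃ κ : Fin N → ℤ,
      normC m (fun i => -(ν i + s * ((tt ^ (i : ℕ) : ℝ) : ℂ)) - κ i / 2) = 0} ⊆
      ⋃ q : (Fin N → ℤ) × ℕ × Fin N × Fin N, {s | q.2.2.1 < q.2.2.2 ∧
        -(ν q.2.2.1 + s * ((tt ^ (q.2.2.1 : ℕ) : ℝ) : ℂ)) - q.1 q.2.2.1 / 2 -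
        (-(ν q.2.2.2 + s * ((tt ^ (q.2.2.2 : ℕ) : ℝ) : ℂ)) - q.1 q.2.2.2 / 2) - q.2.1 = 0} := by
    rintro s ⟨κ, h⟩
    simp only [normC, Finset.prod_eq_zero_iff] at h
    obtain ⟨a, -, i, -, j, hj, h⟩ := h
    exact Set.mem_iUnion.2 ⟨(κ, a, i, j), Finset.mem_Ioi.1 hj, h⟩
  refine (Set.countable_iUnion fun q => Set.Subsingleton.countable ?_).mono this
  rintro s ⟨hq, hs⟩ s' ⟨-, hs'⟩
  have h1 : (s - s') * (((tt ^ (q.2.2.2 : ℕ) : ℝ) : ℂ) - ((tt ^ (q.2.2.1 : ℕ) : ℝ) : ℂ)) = 0 := by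
    linear_combination hs - hs'
  refine sub_eq_zero.1 ((mul_eq_zero.1 h1).resolve_right ?_)
  rw [← Complex.ofReal_sub]
  exact_mod_cast (sub_neg.2 (pow_tt_lt hq)).ne

theorem frequently_of_real {p : ℂ → Prop} {E : Set ℂ} (hE : E.Countable) {a b : ℝ} (hab : a < b)
    (h : ∀ t : ℝ, a ≤ t → (t : ℂ) ∉ E → p t) : ∃ᶠ z in nhdsWithin (b : ℂ) {(b : ℂ)}ᶜ, p z := by
  intro hne
  have h1 : Filter.Tendsto (fun t : ℝ => (t : ℂ)) (nhdsWithin b {b}ᶜ)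
      (nhdsWithin (b : ℂ) {(b : ℂ)}ᶜ) :=
    tendsto_nhdsWithin_iff.2 ⟨(Complex.continuous_ofReal.tendsto b).mono_left nhdsWithin_le_nhds,
      eventually_nhdsWithin_of_forall fun t ht => by simpa using ht⟩
  have h2 : ∀ᶠ t : ℝ in nhdsWithin b {b}ᶜ, (t : ℂ) ∈ E := by
    filter_upwards [h1.eventually hne,
      nhdsWithin_le_nhds (Ioi_mem_nhds hab)] with t ht hta
    by_contra hc
    exact ht (h t (le_of_lt hta) hc)
  have hc : (insert b ((fun t : ℝ => (t : ℂ)) ⁻¹' E)).Countable :=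
    (hE.preimage Complex.ofReal_injective).insert b
  have hd := hc.dense_compl ℝ
  obtain ⟨V, hV, hbV, hVE⟩ := mem_nhdsWithin.1 h2
  obtain ⟨t, ht, ht'⟩ := hd.inter_open_nonempty V hV ⟨b, hbV⟩
  refine ht' (Set.mem_insert_iff.2 ?_)
  by_cases htb : t = b
  · exact Or.inl htb
  · exact Or.inr (hVE ⟨ht, htb⟩)

theorem selberg_step {m : ℕ} (hm : 0 < m) {T : TrigPoly (n + 1)} {T' : TrigPoly (n + 2)}
    (hE : ∀ ν, IsEig m (fun i => 2 * ν i) (T.toLP ν) m (-4 * ∑ i, ν i * ν i))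
    (hl : ∀ ν, Lead (wt 1 (n + 1)) (T.toLP ν) (m • rho (n + 1))
      (((1 / 2 : ℂ) ^ (prs (n + 1)).card) ^ m * normC m ν))
    (hE' : ∀ ν, IsEig m (fun i => 2 * ν i) (T'.toLP ν) m (-4 * ∑ i, ν i * ν i))
    (hl' : ∀ ν, Lead (wt 1 (n + 2)) (T'.toLP ν) (m • rho (n + 2))
      (((1 / 2 : ℂ) ^ (prs (n + 2)).card) ^ m * normC m ν))
    (ih : ∀ x ∈ Spr (n + 1), ∀ ν : Fin (n + 1) → ℂ,
      (∀ j : Fin n, (m : ℝ) < (ν j.castSucc - ν j.succ).re) → SelbergEq m T x ν)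
    {x : Fin (n + 2) → ℂ} (hx : x ∈ Spr (n + 2)) {ν : Fin (n + 2) → ℂ}
    (hν : ∀ j : Fin (n + 1), (m : ℝ) < (ν j.castSucc - ν j.succ).re) : SelbergEq m T' x ν := by
  obtain ⟨A, hA⟩ := selberg_step_generic hm hE hl hE' hl' ih
  have h0U : (0 : ℂ) ∈ shiftU m ν := fun j => by rw [shiftP_zero]; exact hν j
  have hpos : ∀ t : ℝ, 0 ≤ t → (t : ℂ) ∈ shiftU m ν := fun t ht j => by
    rw [shiftP_sub, Complex.ofReal_re]
    have h1 : 0 ≤ t * (tt ^ (j.castSucc : ℕ) - tt ^ (j.succ : ℕ)) :=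
      mul_nonneg ht (sub_nonneg.2 (pow_tt_lt (by simp)).le)
    linarith [hν j]
  obtain ⟨R, hR0, hR⟩ : ∃ R : ℝ, 0 ≤ R ∧ ∀ t : ℝ, R ≤ t → ∀ i : Fin (n + 1),
      (A : ℝ) ≤ (2 * shiftP ν t i.castSucc - 2 * shiftP ν t (Fin.last (n + 1))).re := by
    have h1 : ∀ᶠ t : ℝ in Filter.atTop, 0 ≤ t ∧ ∀ i : Fin (n + 1),
        (A : ℝ) ≤ (2 * shiftP ν t i.castSucc - 2 * shiftP ν t (Fin.last (n + 1))).re := by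
      refine (Filter.eventually_ge_atTop 0).and (Filter.eventually_all.2 fun i => ?_)
      have hc : 0 < tt ^ (i : ℕ) - tt ^ (n + 1) := sub_pos.2 (pow_tt_lt i.2)
      filter_upwards [Filter.eventually_ge_atTop
        (((A : ℝ) - 2 * (ν i.castSucc - ν (Fin.last (n + 1))).re) / (2 * (tt ^ (i : ℕ) - tt ^ (n + 1))))]
        with t ht
      rw [div_le_iff₀ (by linarith)] at ht
      rw [← mul_sub, show (2 : ℂ) = ((2 : ℝ) : ℂ) by norm_num, Complex.re_ofReal_mul, shiftP_sub,
        Complex.ofReal_re, Fin.val_castSucc, Fin.val_last]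
      linarith
    obtain ⟨R, hR⟩ := Filter.eventually_atTop.1 h1
    exact ⟨R, (hR R le_rfl).1, fun t ht => (hR t ht).2⟩
  have hE1 := countable_not_gen_powers ν
  have hE2 := countable_not_gen_powers (ν ∘ Fin.castSucc)
  have hE3 := countable_normC_zero m (ν ∘ Fin.castSucc)
  have hF : AnalyticOnNhd ℂ (fun s => ∫ τ in cube (n + 1), alphaStarPullback m x (shiftP ν s) τ)
      (shiftU m ν) :=
    (differentiableOn_integral_alpha m hx ν).analyticOnNhd (isOpen_shiftU m ν)
  have hG : AnalyticOnNhd ℂ (fun s => constC4 m (shiftP ν s) *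
      vand (fun i => Complex.exp (2 * x i)) ^ m *
      Complex.exp (-2 * shiftP ν s (Fin.last (n + 1)) * ∑ i, x i) * baFun m T' x (shiftP ν s))
      (shiftU m ν) := by
    refine DifferentiableOn.analyticOnNhd ?_ (isOpen_shiftU m ν)
    refine DifferentiableOn.fun_mul (DifferentiableOn.fun_mul
      ((differentiableOn_constC4 m ν).mul_const _) ?_) (differentiableOn_baFun m T' hx ν)
    exact (((differentiable_shiftP ν (Fin.last (n + 1))).const_mul (-2)).mul_const
      (∑ i, x i)).cexp.differentiableOn
  have key := hF.eqOn_of_preconnected_of_frequently_eq hG (convex_shiftU m ν).isPreconnected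
    (hpos (R + 1) (by linarith)) (frequently_of_real ((hE1.union hE2).union hE3)
      (lt_add_one R) fun t ht hts => ?_) h0U
  · rw [SelbergEq]; simpa only [shiftP_zero] using key
  · simp only [Set.mem_union, not_or, Set.mem_ofPred_eq, not_not, not_exists] at hts
    exact hA (shiftP ν t) (hpos t (hR0.trans ht)) (hR t ht) hts.1.2 hts.1.1 hts.2 x hx

theorem selbergEq_zero {m : ℕ} {T : TrigPoly 1} (hT : IsBANumerator m T) (x ν : Fin 1 → ℂ) :
    SelbergEq m T x ν := by
  have hc : ∀ μ, T μ = MvPolynomial.C (MvPolynomial.coeff 0 (T μ)) := fun μ =>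
    MvPolynomial.totalDegree_eq_zero_iff_eq_C.1 (Nat.le_zero.1 (by simpa using hT.degree_le μ))
  have hl := hT.leading x ν
  have hev : T.eval x ν = 1 := by
    have h1 : T.evalHomog (m * (1 * (1 - 1) / 2)) x ν = T.eval x ν := by
      simp only [TrigPoly.evalHomog, TrigPoly.eval]
      refine Finsupp.sum_congr fun μ _ => ?_
      rw [hc μ]
      simp
    rw [← h1, hl]
    simp [sinhVand, vand]
  have hvol : (volume : Measure (VarIdx 0 → ℝ)).real (cube 0) = 1 := by
    have : IsEmpty (VarIdx 0) := ⟨fun p => p.1.2.elim0⟩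
    have hu : cube 0 = Set.univ := by ext; simp [cube]
    rw [hu, Measure.real, volume_pi, Measure.pi_univ]; simp
  have ha : ∀ τ, alphaStarPullback m x ν τ = 1 := fun τ => by
    simp [alphaStarPullback, alphaStar, omegaStar]
  simp only [SelbergEq, ha, baFun, hev]
  rw [setIntegral_const, hvol]
  simp [constC4, vand, sinhVand, normC, ← Complex.exp_add]
  rw [mul_assoc, neg_add_cancel, Complex.exp_zero]

/-- The integral formula for the constructed numerators. -/
theorem selbergEq {m : ℕ} (hm : 0 < m) (n : ℕ) : ∀ {T : TrigPoly (n + 1)}, IsBANumerator m T →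
    ∀ x ∈ Spr (n + 1), ∀ ν : Fin (n + 1) → ℂ,
      (∀ j : Fin n, (m : ℝ) < (ν j.castSucc - ν j.succ).re) → SelbergEq m T x ν := by
  induction n with
  | zero => exact fun hT x _ ν _ => selbergEq_zero hT x ν
  | succ n ih =>
    intro T' hT' x hx ν hν
    obtain ⟨T, hT, hE, hl, -⟩ := exists_trigBA m n
    obtain ⟨S, hS, hE', hl', -⟩ := exists_trigBA m (n + 1)
    obtain rfl := (existsUnique_trigBA m (n + 1)).unique hT' hS
    exact selberg_step hm hE hl hE' hl' (fun x hx ν hν => ih hT x hx ν hν) hx hν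

theorem constC4_ne_zero {m : ℕ} {ν : Fin (n + 1) → ℂ}
    (hν : ∀ j : Fin n, (m : ℝ) < (ν j.castSucc - ν j.succ).re) : constC4 m ν ≠ 0 := by
  rw [constC4_eq]
  refine mul_ne_zero (pow_ne_zero _ (by norm_num)) (Finset.prod_ne_zero_iff.2 fun p hp => ?_)
  have h0 : 0 < (ν p.1 - ν p.2).re :=
    (Nat.cast_nonneg m).trans_lt (sub_re_gt_cast hν (mem_prs.1 hp))
  have h1 : 0 < (m + 1 : ℂ).re := by simp; positivity
  rw [add_assoc]
  exact div_ne_zero (mul_ne_zero (Complex.Gamma_ne_zero_of_re_pos h1)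
    (Complex.Gamma_ne_zero_of_re_pos h0)) (Complex.Gamma_ne_zero_of_re_pos (by
      rw [Complex.add_re]; exact add_pos h0 h1))

theorem mem_spr_of_arg {N : ℕ} {x : Fin N → ℂ}
    (h : ∀ i j, i ≠ j → (Complex.exp (2 * x i)).arg ≠ (Complex.exp (2 * x j)).arg) :
    x ∈ Spr N := by
  intro i j hij hs
  refine h i j hij ?_
  obtain ⟨N, hN⟩ := Real.sin_eq_zero_iff.1 hs
  have e : 2 * x i = 2 * x j + ((2 * (x i - x j).re : ℝ) : ℂ) + N * (2 * Real.pi * Complex.I) := by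
    apply Complex.ext
    · simp; ring
    · rw [Complex.sub_im] at hN
      simp
      linarith
  rw [e, Complex.exp_periodic.int_mul N, Complex.exp_add, ← Complex.ofReal_exp, mul_comm,
    Complex.arg_real_mul _ (Real.exp_pos _)]

end TrigBA

end

theorem mainTheorem8 (n m : ℕ) (hm : 0 < m) :
    (∃! P : TrigBA.TrigPoly (n + 1), TrigBA.IsBANumerator m P) ∧
    ∀ P : TrigBA.TrigPoly (n + 1), TrigBA.IsBANumerator m P →
      ∀ x ν : Fin (n + 1) → ℂ,
        (∀ i j, i ≠ j → (Complex.exp (2 * x i)).arg ≠ (Complex.exp (2 * x j)).arg) →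
        (∀ j : Fin n, (m : ℝ) < (ν j.castSucc - ν j.succ).re) →
        IntegrableOn (TrigBA.alphaStarPullback m x ν) (TrigBA.cube n) ∧
        TrigBA.baFun m P x ν =
          (TrigBA.constC4 m ν)⁻¹ * (∏ i, Complex.exp (2 * ν (Fin.last n) * x i)) *
            (TrigBA.vand (fun i => Complex.exp (2 * x i)) ^ m)⁻¹ *
            ∫ τ in TrigBA.cube n, TrigBA.alphaStarPullback m x ν τ := by
  refine ⟨TrigBA.existsUnique_trigBA m n, fun P hP x ν hx hν => ?_⟩
  have hx := TrigBA.mem_spr_of_arg hx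
  refine ⟨TrigBA.integrableOn_alphaStarPullback m hx hν, ?_⟩
  have h := TrigBA.selbergEq hm n hP x hx ν hν
  have hC := TrigBA.constC4_ne_zero hν
  have hv : TrigBA.vand (fun i => Complex.exp (2 * x i)) ^ m ≠ 0 := by
    rw [TrigBA.vand_exp]
    exact pow_ne_zero _ (mul_ne_zero (mul_ne_zero (by simp) (pow_ne_zero _ (Complex.exp_ne_zero _)))
      (TrigBA.sinhVand_ne_of_spr hx))
  have he : (∏ i, Complex.exp (2 * ν (Fin.last n) * x i)) *
      Complex.exp (-2 * ν (Fin.last n) * ∑ i, x i) = 1 := by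
    rw [← Complex.exp_sum, ← Finset.mul_sum, ← Complex.exp_add, ← Complex.exp_zero]
    ring_nf
  rw [TrigBA.SelbergEq] at h
  have aux : ∀ C V Q E b : ℂ, C ≠ 0 → V ≠ 0 → Q * E = 1 → b = C⁻¹ * Q * V⁻¹ * (C * V * E * b) := by
    intro C V Q E b hC hV hQ
    field_simp
    linear_combination (-b) * hQ
  rw [h]
  exact aux _ _ _ _ _ hC hv he
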